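/- Let $d\ge 2$, $m\ge 2$, and $\lambda_0,\lambda_1>0$. For $n\ge 1$ let $\mathbf A=\{A^{jk}_{\alpha\beta}(y)\}$ ($1\le j,k\le n$; multiindices $|\alpha|=|\beta|=m$) be an array of measurable complex functions on $\mathbb R^d$, 1-periodic in each variable, with $|\mathbf A(y)F|\le\lambda_1|F|$ for a.e. $y$ and all arrays $F=\{F_{k,\beta}\}$, where $(\mathbf AF)_{j,\alpha}=\sum_{k,\beta}A^{jk}_{\alpha\beta}F_{k,\beta}$ and $|F|^2=\sum_{k,\beta}|F_{k,\beta}|^2$, and with $$\mathrm{Re}\,(\nabla^m\varphi,\mathbf A\nabla^m\varphi)\ge\lambda_0\|\nabla^m\varphi\|^2\qquad\text{for all }\varphi\in C_0^\infty(\mathbb R^d;\mathbb C^n).$$ Here $\nabla^m\varphi=\{D^\alpha\varphi_j\}_{j,\,|\alpha|=m}$, and $(F,G)=\sum_{j,\alpha}\int_{\mathbb R^d}\overline{F_{j,\alpha}}\,G_{j,\alpha}\,dx$, with norm $\|\cdot\|$. For $\varepsilon\in(0,1]$ put $L_\varepsilon u=(-1)^m\sum_{|\alpha|=|\beta|=m}D^\alpha\big(A_{\alpha\beta}(x/\varepsilon)D^\beta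 u\big)$, where $A_{\alpha\beta}=\{A^{jk}_{\alpha\beta}\}_{j,k}$. Let $Y=[-1/2,1/2)^d$ and $\langle g\rangle=\int_Y g\,dy$. Let $\mathcal W$ be the space of 1-periodic $\mathbb C^n$-valued functions with zero mean over $Y$ whose weak derivatives of order at most $m$ belong to $L^2(Y)$. For $|\gamma|=m$ and $1\le k\le n$ let $N^k_\gamma\in\mathcal W$ be the solution of the cell problem $$\sum_{|\alpha|=|\beta|=m}D^\alpha(A_{\alpha\beta}D^\beta N^k_\gamma)=-\sum_{|\alpha|=m}D^\alpha(A_{\alpha\gamma}e^k),$$ understood as an integral identity over $Y$ with test functions in $\mathcal W$, where $e^1,\dots,e^n$ is the standard basis of $\mathbb C^n$. Put $\hat A_{\alpha\beta}e^k=\big\langle A_{\alpha\beta}e^k+\sum_{|\gamma|=m}A_{\alpha\gamma}D^\gamma N^k_\beta\big\rangle$ and $\hat L=(-1)^m\sum_{|\alpha|=|\beta|=m}D^\alpha\hat A_{\alpha\beta}D^\beta$. Let $(S^\varepsilon\varphi)(x)=\int_Y\varphi(x-\varepsilon\omega)\,d\omega$, and let $\|v\|_{H^m}^2=\sum_{0\le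 k\le m}\|\nabla^kv\|^2$. Then there is a constant $C>0$, depending only on $d,m,\lambda_0,\lambda_1$, such that for all such $n$, $\mathbf A$ and all $\varepsilon\in(0,1]$ the following holds. (i) Let $f\in L^2(\mathbb R^d;\mathbb C^n)$, and let $u^\varepsilon,u\in H^m(\mathbb R^d;\mathbb C^n)$ be the weak solutions of $L_\varepsilon u^\varepsilon+u^\varepsilon=f$ and $\hat Lu+u=f$. With $w^\varepsilon=S^\varepsilon u$ put $$\tilde u^\varepsilon(x)=w^\varepsilon(x)+\varepsilon^m\sum_{k=1}^n\sum_{|\gamma|=m}N^k_\gamma(x/\varepsilon)\,D^\gamma w^\varepsilon_k(x).$$ Then $\tilde u^\varepsilon\in H^m(\mathbb R^d;\mathbb C^n)$ and $\|u^\varepsilon-\tilde u^\varepsilon\|_{H^m(\mathbb R^d)}\le C\varepsilon\|f\|_{L^2(\mathbb R^d)}$. (ii) The resolvents $(L_\varepsilon+I)^{-1}$ and $(\hat L+I)^{-1}$ exist as bounded operators in $L^2(\mathbb R^d;\mathbb C^n)$ (each of the two equations has, for every $f\in L^2$, exactly one weak solution in $H^m$, and it depends on $f$ linearly and continuously), and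 with $$\mathcal K_\varepsilon f(x)=\sum_{k=1}^n\sum_{|\gamma|=m}N^k_\gamma(x/\varepsilon)\,(S^\varepsilon D^\gamma u_k)(x),\qquad u=(\hat L+I)^{-1}f,$$ one has $$\big\|(L_\varepsilon+I)^{-1}-(\hat L+I)^{-1}-\varepsilon^m\mathcal K_\varepsilon\big\|_{L^2(\mathbb R^d)\to H^m(\mathbb R^d)}\le C\varepsilon.$$ -/

import Mathlib

open MeasureTheory

namespace HighOrderHomogenization

noncomputable section

/-- The space `ℝ^d`. -/
abbrev E (d : ℕ) := EuclideanSpace ℝ (Fin d)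

/-- The space `ℂ^n` of values, with its Hermitian norm. -/
abbrev V (n : ℕ) := EuclideanSpace ℂ (Fin n)

/-- Multiindices `γ = (γ₁, …, γ_d)` of length `|γ| = k`. -/
def MIdx (d k : ℕ) := {γ : Fin d → ℕ // ∑ i, γ i = k}

instance (d k : ℕ) : Fintype (MIdx d k) :=
  Fintype.subtype (Finset.piAntidiag Finset.univ k) (by simp)

instance (d k : ℕ) : DecidableEq (MIdx d k) :=
  inferInstanceAs (DecidableEq {γ : Fin d → ℕ // ∑ i, γ i = k})

section Derivatives

variable {d : ℕ} {F : Type*} [NormedAddCommGroup F] [NormedSpace ℝ F]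

/-- The classical partial derivative `D_i φ`. -/
def pderiv (i : Fin d) (φ : E d → F) : E d → F :=
  fun x => fderiv ℝ φ x (EuclideanSpace.single i 1)

/-- The classical derivative `D^γ φ = D_1^{γ_1} ⋯ D_d^{γ_d} φ`. -/
def multiDeriv (γ : Fin d → ℕ) (φ : E d → F) : E d → F :=
  (List.finRange d).foldr (fun i ψ => (pderiv i)^[γ i] ψ) φ

/-- `w` is the weak derivative `D^γ u` on `ℝ^d`. -/
def HasWeakDeriv (γ : Fin d → ℕ) (u w : E d → F) : Prop :=
  LocallyIntegrable u ∧ LocallyIntegrable w ∧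
    ∀ φ : E d → ℝ, ContDiff ℝ (⊤ : ℕ∞) φ → HasCompactSupport φ →
      ∫ x, multiDeriv γ φ x • u x = (-1 : ℝ) ^ (∑ i, γ i) • ∫ x, φ x • w x

open Classical in
/-- The weak derivative `D^γ u` (a representative; it is unique almost everywhere),
and `0` if there is none. -/
def weakDeriv (γ : Fin d → ℕ) (u : E d → F) : E d → F :=
  if h : ∃ w, HasWeakDeriv γ u w then h.choose else 0

/-- `u ∈ H^m(ℝ^d)`: all weak derivatives of order at most `m` exist and are in `L²(ℝ^d)`. -/
def MemH (m : ℕ) (u : E d → F) : Prop :=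
  ∀ γ : Fin d → ℕ, ∑ i, γ i ≤ m → ∃ w, HasWeakDeriv γ u w ∧ MemLp w 2 volume

/-- The norm of `L²(ℝ^d)`. -/
def l2Norm (u : E d → F) : ℝ := (eLpNorm u 2 volume).toReal

/-- The norm of `H^m(ℝ^d)`: `‖u‖² = ∑_{0 ≤ k ≤ m} ∑_{|γ| = k} ‖D^γ u‖²`. -/
def hNorm (m : ℕ) (u : E d → F) : ℝ :=
  Real.sqrt (∑ k ∈ Finset.range (m + 1), ∑ γ : MIdx d k, l2Norm (weakDeriv γ.1 u) ^ 2)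

/-- The function is 1-periodic in each variable. -/
def IsPeriodic {X : Type*} (u : E d → X) : Prop :=
  ∀ (i : Fin d) (y : E d), u (y + EuclideanSpace.single i 1) = u y

/-- The periodicity cell `Y = [-1/2, 1/2)^d`. -/
def cell (d : ℕ) : Set (E d) := {y | ∀ i, y i ∈ Set.Ico (-(1 / 2) : ℝ) (1 / 2)}

/-- The space `𝒲`, the completion of the smooth 1-periodic functions with zero mean in the norm
`‖∇^m u‖_{L²(Y)}`: it consists of the 1-periodic functions with zero mean all of whose weak
derivatives of order at most `m` are in `L²(Y)`. -/
def MemW (m : ℕ) (u : E d → F) : Prop :=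
  IsPeriodic u ∧ ∫ y in cell d, u y = 0 ∧
    ∀ γ : Fin d → ℕ, ∑ i, γ i ≤ m →
      ∃ w, HasWeakDeriv γ u w ∧ MemLp w 2 (volume.restrict (cell d))

/-- The Steklov smoothing `S^ε φ (x) = ∫_Y φ(x - ε ω) dω`. -/
def steklov (ε : ℝ) (φ : E d → F) : E d → F :=
  fun x => ∫ ω in cell d, φ (x - ε • ω)

end Derivatives

section Operators

variable {d m n : ℕ}

/-- Arrays `{F_{j,α}}` indexed by `|α| = m` and `1 ≤ j ≤ n`. -/
abbrev Arr (d m n : ℕ) := MIdx d m → Fin n → ℂ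

/-- Arrays of coefficients `{A^{jk}_{αβ}}`, the entry being written `a α β j k`. -/
abbrev CArr (d m n : ℕ) := MIdx d m → MIdx d m → Fin n → Fin n → ℂ

/-- `∑_{j,α} |F_{j,α}|²`. -/
def arrNormSq (F : Arr d m n) : ℝ := ∑ α, ∑ j, ‖F α j‖ ^ 2

/-- The product `(𝐀F)_{j,α} = ∑_{k,β} A^{jk}_{αβ} F_{k,β}`. -/
def CArr.mul (a : CArr d m n) (F : Arr d m n) : Arr d m n :=
  fun α j => ∑ β, ∑ k, a α β j k * F β k

/-- The pointwise inner product `∑_{j,α} conj(F_{j,α}) G_{j,α}`. -/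
def arrInner (F G : Arr d m n) : ℂ := ∑ α, ∑ j, (starRingEnd ℂ) (F α j) * G α j

/-- The array `∇^m φ` of classical derivatives. -/
def gradC (m : ℕ) (φ : E d → V n) (x : E d) : Arr d m n := fun α j => multiDeriv α.1 φ x j

/-- The array `∇^m u` of weak derivatives. -/
def grad (m : ℕ) (u : E d → V n) (x : E d) : Arr d m n := fun α j => weakDeriv α.1 u x j

/-- The class of coefficients: measurable, 1-periodic, bounded by `lam1` (in the operator norm of
arrays, almost everywhere), and subject to the strict Gårding inequality on `C_0^∞(ℝ^d)` with the
constant `lam0`. -/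
structure IsAdmissible (lam0 lam1 : ℝ) (A : E d → CArr d m n) : Prop where
  aemeasurable : ∀ α β j k, AEMeasurable (fun y => A y α β j k) volume
  periodic : IsPeriodic A
  bounded : ∀ᵐ y, ∀ F : Arr d m n, arrNormSq ((A y).mul F) ≤ lam1 ^ 2 * arrNormSq F
  garding : ∀ φ : E d → V n, ContDiff ℝ (⊤ : ℕ∞) φ → HasCompactSupport φ →
    lam0 * ∫ x, arrNormSq (gradC m φ x) ≤
      (∫ x, arrInner (gradC m φ x) ((A x).mul (gradC m φ x))).re

/-- The `ε`-periodic coefficients `𝐀^ε(x) = 𝐀(x/ε)`. -/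
def rescale (ε : ℝ) (A : E d → CArr d m n) : E d → CArr d m n := fun x => A (ε⁻¹ • x)

/-- `u ∈ H^m(ℝ^d)` is a weak solution of `L u + u = f`, where
`L = (-1)^m ∑_{|α|=|β|=m} D^α (B_{αβ} D^β)`:
`(∇^m φ, B ∇^m u) + (φ, u) = (φ, f)` for all `φ ∈ H^m(ℝ^d)`. -/
def IsWeakSol (B : E d → CArr d m n) (f u : E d → V n) : Prop :=
  MemH m u ∧ ∀ φ : E d → V n, MemH m φ →
    (∫ x, arrInner (grad m φ x) ((B x).mul (grad m u x))) + ∫ x, inner ℂ (φ x) (u x)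
      = ∫ x, inner ℂ (φ x) (f x)

/-- The family `N γ k = N^k_γ` of solutions of the cell problems: `N^k_γ ∈ 𝒲` and
`∑_{|α|=|β|=m} D^α (A_{αβ} D^β N^k_γ) = - ∑_{|α|=m} D^α (A_{αγ} e^k)`, in the sense of the integral
identity over `Y` with test functions in `𝒲`. -/
def IsCellSolution (A : E d → CArr d m n) (N : MIdx d m → Fin n → E d → V n) : Prop :=
  ∀ (γ : MIdx d m) (k : Fin n), MemW m (N γ k) ∧
    ∀ φ : E d → V n, MemW m φ →
      ∫ y in cell d, arrInner (grad m φ y) ((A y).mul (grad m (N γ k) y))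
        = - ∫ y in cell d, arrInner (grad m φ y) (fun α j => A y α γ j k)

/-- The homogenized coefficients
`Â_{αβ} e^k = ⟨A_{αβ} e^k + ∑_{|γ|=m} A_{αγ} D^γ N^k_β⟩`. -/
def homCoeff (A : E d → CArr d m n) (N : MIdx d m → Fin n → E d → V n) : CArr d m n :=
  fun α β j k => ∫ y in cell d, (A y α β j k + (A y).mul (grad m (N β k) y) α j)

/-- The two-scale approximation
`ũ^ε = w^ε + ε^m ∑_k ∑_{|γ|=m} N^k_γ(x/ε) D^γ w^ε_k` with `w^ε = S^ε u`. -/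
def twoScale (N : MIdx d m → Fin n → E d → V n) (ε : ℝ) (u : E d → V n) : E d → V n :=
  fun x => steklov ε u x +
    (ε ^ m : ℝ) • ∑ k : Fin n, ∑ γ : MIdx d m,
      (weakDeriv γ.1 (steklov ε u) x k) • N γ k (ε⁻¹ • x)

/-- The corrector of the operator estimate, as a function of `u`:
`∑_k ∑_{|γ|=m} N^k_γ(x/ε) S^ε (D^γ u_k)(x)`; then `𝒦_ε f` is its value at `u = (L̂ + I)⁻¹ f`. -/
def corrector (N : MIdx d m → Fin n → E d → V n) (ε : ℝ) (u : E d → V n) : E d → V n :=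
  fun x => ∑ k : Fin n, ∑ γ : MIdx d m,
    (steklov ε (weakDeriv γ.1 u) x k) • N γ k (ε⁻¹ • x)

/-- The bounded operator `R` on `L²(ℝ^d)` is the resolvent `(L + I)⁻¹` of
`L = (-1)^m ∑_{|α|=|β|=m} D^α (B_{αβ} D^β)`: for every `f`, the problem `L u + u = f` has
one and only one weak solution, namely `R f`. -/
def IsResolvent (B : E d → CArr d m n)
    (R : Lp (V n) 2 (volume : Measure (E d)) →L[ℂ] Lp (V n) 2 (volume : Measure (E d))) : Prop :=
  ∀ (f : Lp (V n) 2 (volume : Measure (E d))) (u : E d → V n),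
    IsWeakSol B f u ↔ u =ᵐ[volume] R f

end Operators

end

end HighOrderHomogenization

open HighOrderHomogenization

/-!
# Error estimates for the homogenization of elliptic systems of order `2m`

The difference `z` of the solution `u^ε` and the two-scale approximation
`w = S^ε u + ε^m 𝒩(x/ε) S^ε ∇^m u` satisfies a coercive identity, obtained by testing both equations
with `z`. Hence it suffices to show that `w - u` is `O(ε)` in `L²` and that the form of `L_ε` at
`(φ, w)` differs from the form of the effective operator at `(φ, u)` by `O(ε) ‖φ‖_{H^m}`
(`exists_twoScaleBound`); coercivity on `H^m` is the Gårding inequality together with interpolation of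
intermediate derivatives (`exists_coercive`), and `exists_error_estimate` combines them. All norms of
`u` that occur are dominated by its `H^{2m}` norm, that is, by the norm of `f` (`exists_regularity`).

The Gårding inequality is assumed for test functions on the whole space. Applied to cutoffs of
`ε^m D(x/ε)` with `D` periodic, and averaged over shifts, it yields in the limit `ε → 0` the same
inequality on the cell (`PerElliptic.garding_cell`). Together with the Poincaré inequality it bounds
the solutions of the cell problems, viewed as one operator-valued periodic function `𝒩`
(`exists_perMul_corrector`).

The correctors belong to `L²` of the cell only, so that multiplication by `𝒩(x/ε)` is unbounded; the
Steklov smoothing `S^ε` repairs this. Writing the average over the cell as an integral in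
`x = z + ε ω` shows that `χ ↦ G(x/ε) S^ε χ` is bounded in `L²` as soon as the periodic factor `G` is
square integrable over the cell (`memLp_pmul`). The same change of variables shows that a factor of
zero mean gains `ε` when it is paired with a function with first derivatives in `L²`
(`norm_integral_inner_pmul_le`).

In the difference of the forms three terms appear (`form_ansatz_sub`). The first contains
`S^ε ∇^m u - ∇^m u`, and the last consists of the terms of the Leibniz formula in which derivatives
fall on the smoothed factor; both are `O(ε)` in norm. The middle one is the pairing of `∇^m φ` with
the oscillating flux. The flux has zero mean, and the cell problem says that it is orthogonal to
`∇^m` of all test functions (`Corrector.solenoidal_flux`). Testing this with the product of `φ` and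
the smoothed factor, the pairing is rewritten as a sum of terms with fewer than `m` derivatives on `φ`
(`Solenoidal.sum_eq_zero`). Each of these is `O(ε)` by the zero mean property, so no potential of the
flux has to be constructed (`exists_norm_integral_wgrad_pmul_le`).

The effective coefficients are elliptic because the Gårding inequality for `L_ε` can be tested on the
two-scale approximation of a test function, with `ε → 0` (`Corrector.elliptic`). The resolvents come
from the Lax–Milgram lemma on the closed space of jets in `L²` (`exists_resolvent`). In the operator
estimate `S^ε u` is replaced by `u` at the cost of `O(ε)` in `H^m`, as `u` has `m + 1` derivatives.
-/

namespace HighOrderHomogenization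

set_option linter.unusedSectionVars false

/-! ### Classical derivatives of smooth functions -/

section Classical

variable {d : ℕ} {F F' : Type*} [NormedAddCommGroup F] [NormedSpace ℝ F]
  [NormedAddCommGroup F'] [NormedSpace ℝ F']

/-- Smooth functions on `ℝ^d`. -/
abbrev Smooth (φ : E d → F) : Prop := ContDiff ℝ (⊤ : ℕ∞) φ

theorem Smooth.pderiv {φ : E d → F} (h : Smooth φ) (i : Fin d) : Smooth (pderiv i φ) := by
  have : Smooth (fderiv ℝ φ) := h.fderiv_right (by simp)
  exact this.clm_apply contDiff_const

theorem Smooth.differentiableAt {φ : E d → F} (h : Smooth φ) (x : E d) :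
    DifferentiableAt ℝ φ x :=
  (ContDiff.differentiable h (by simp)) x

theorem hasCompactSupport_pderiv {φ : E d → F} (h : HasCompactSupport φ) (i : Fin d) :
    HasCompactSupport (pderiv i φ) :=
  (h.fderiv (𝕜 := ℝ)).mono (by
    intro x hx hx'
    apply hx
    simp [pderiv, hx'])

theorem pderiv_comm {φ : E d → F} (h : Smooth φ) (i j : Fin d) :
    pderiv i (pderiv j φ) = pderiv j (pderiv i φ) := by
  have h2 : Smooth (fderiv ℝ φ) := h.fderiv_right (by simp)
  have key : ∀ (i j : Fin d) (x : E d), pderiv i (pderiv j φ) x =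
      fderiv ℝ (fderiv ℝ φ) x (EuclideanSpace.single i 1) (EuclideanSpace.single j 1) := by
    intro i j x
    unfold pderiv
    rw [fderiv_clm_apply (h2.differentiableAt x) (differentiableAt_const _)]
    simp
  funext x
  rw [key, key]
  exact (h.contDiffAt.isSymmSndFDerivAt (by
    simp only [minSmoothness_of_isRCLikeNormedField]
    exact WithTop.coe_le_coe.2 (le_top (a := (2 : ℕ∞))))) _ _

theorem Smooth.iterate_pderiv {φ : E d → F} (h : Smooth φ) (i : Fin d) (k : ℕ) :
    Smooth ((HighOrderHomogenization.pderiv i)^[k] φ) := by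
  induction k with
  | zero => exact h
  | succ k ih => rw [Function.iterate_succ_apply']; exact ih.pderiv i

theorem Smooth.foldr {φ : E d → F} (h : Smooth φ) (γ : Fin d → ℕ) (l : List (Fin d)) :
    Smooth (l.foldr (fun i ψ => (HighOrderHomogenization.pderiv i)^[γ i] ψ) φ) := by
  induction l with
  | nil => exact h
  | cons i l ih => exact ih.iterate_pderiv i _

theorem Smooth.multiDeriv {φ : E d → F} (h : Smooth φ) (γ : Fin d → ℕ) :
    Smooth (multiDeriv γ φ) := h.foldr γ _

theorem iterate_pderiv_comm {φ : E d → F} (h : Smooth φ) (i j : Fin d) (k : ℕ) :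
    (pderiv i)^[k] (pderiv j φ) = pderiv j ((pderiv i)^[k] φ) := by
  induction k with
  | zero => rfl
  | succ k ih =>
    rw [Function.iterate_succ_apply', ih, Function.iterate_succ_apply',
      pderiv_comm (h.iterate_pderiv i k)]

theorem iterate_pderiv_comm_iterate {φ : E d → F} (h : Smooth φ) (i j : Fin d) (k k' : ℕ) :
    (pderiv i)^[k] ((pderiv j)^[k'] φ) = (pderiv j)^[k'] ((pderiv i)^[k] φ) := by
  induction k' with
  | zero => rfl
  | succ k' ih =>
    rw [Function.iterate_succ_apply', iterate_pderiv_comm (h.iterate_pderiv j k'), ih,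
      Function.iterate_succ_apply']

theorem foldr_pderiv_comm {φ : E d → F} (h : Smooth φ) (γ : Fin d → ℕ) (l : List (Fin d))
    (j : Fin d) (k : ℕ) :
    l.foldr (fun i ψ => (pderiv i)^[γ i] ψ) ((pderiv j)^[k] φ) =
      (pderiv j)^[k] (l.foldr (fun i ψ => (pderiv i)^[γ i] ψ) φ) := by
  induction l with
  | nil => rfl
  | cons i l ih =>
    simp only [List.foldr_cons]
    rw [ih, iterate_pderiv_comm_iterate (h.foldr γ l)]

theorem foldr_pderiv_add {φ : E d → F} (h : Smooth φ) (μ ν : Fin d → ℕ) (l : List (Fin d)) :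
    l.foldr (fun i ψ => (pderiv i)^[(μ + ν) i] ψ) φ =
      l.foldr (fun i ψ => (pderiv i)^[μ i] ψ) (l.foldr (fun i ψ => (pderiv i)^[ν i] ψ) φ) := by
  induction l with
  | nil => rfl
  | cons i l ih =>
    simp only [List.foldr_cons]
    rw [ih, foldr_pderiv_comm (h.foldr ν l), Pi.add_apply, Function.iterate_add_apply]

theorem multiDeriv_add {φ : E d → F} (h : Smooth φ) (μ ν : Fin d → ℕ) :
    multiDeriv (μ + ν) φ = multiDeriv μ (multiDeriv ν φ) := foldr_pderiv_add h μ ν _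

theorem multiDeriv_zero (φ : E d → F) : multiDeriv 0 φ = φ := by
  unfold multiDeriv
  induction List.finRange d with
  | nil => rfl
  | cons i l _ => simp

/-- The multiindex of the first derivative `D_i`. -/
abbrev unitIdx (i : Fin d) : Fin d → ℕ := Pi.single i 1

theorem sum_unitIdx (i : Fin d) : ∑ j, unitIdx i j = 1 := by
  simp [unitIdx]

theorem multiDeriv_unitIdx (φ : E d → F) (i : Fin d) : multiDeriv (unitIdx i) φ = pderiv i φ := by
  have key : ∀ l : List (Fin d), l.Nodup →
      l.foldr (fun j ψ => (pderiv j)^[unitIdx i j] ψ) φ = if i ∈ l then pderiv i φ else φ := by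
    intro l
    induction l with
    | nil => intro _; simp
    | cons j l ih =>
      intro hl
      rw [List.nodup_cons] at hl
      simp only [List.foldr_cons]
      rw [ih hl.2]
      by_cases hij : i = j
      · subst hij
        simp [hl.1]
      · simp [hij]
  unfold multiDeriv
  rw [key _ (List.nodup_finRange d)]
  simp

theorem multiDeriv_add_unitIdx {φ : E d → F} (h : Smooth φ) (μ : Fin d → ℕ) (i : Fin d) :
    multiDeriv (μ + unitIdx i) φ = pderiv i (multiDeriv μ φ) := by
  rw [add_comm, multiDeriv_add h, multiDeriv_unitIdx]

theorem multiIdx_induction {P : (Fin d → ℕ) → Prop} (h0 : P 0)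
    (hs : ∀ μ i, P μ → P (μ + unitIdx i)) (γ : Fin d → ℕ) : P γ := by
  induction hk : ∑ i, γ i generalizing γ with
  | zero =>
    have : γ = 0 := by
      funext i
      exact (Finset.sum_eq_zero_iff.1 hk) i (Finset.mem_univ i)
    rw [this]; exact h0
  | succ k ih =>
    obtain ⟨i, hi⟩ : ∃ i, γ i ≠ 0 := by
      by_contra! hcon
      simp [hcon] at hk
    have hle : unitIdx i ≤ γ := by
      intro j
      by_cases hj : j = i
      · subst hj; simp; omega
      · simp [Pi.single_eq_of_ne hj]
    have hγ : γ = (γ - unitIdx i) + unitIdx i := (tsub_add_cancel_of_le hle).symm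
    rw [hγ]
    apply hs
    apply ih
    have : ∑ j, γ j = ∑ j, (γ - unitIdx i) j + ∑ j, unitIdx i j := by
      rw [← Finset.sum_add_distrib]
      conv_lhs => rw [hγ]
      rfl
    rw [sum_unitIdx] at this
    omega

theorem hasCompactSupport_multiDeriv {φ : E d → F} (hs : Smooth φ) (h : HasCompactSupport φ)
    (γ : Fin d → ℕ) : HasCompactSupport (multiDeriv γ φ) := by
  induction γ using multiIdx_induction with
  | h0 => rwa [multiDeriv_zero]
  | hs μ i ih => rw [multiDeriv_add_unitIdx hs]; exact hasCompactSupport_pderiv ih i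

theorem multiDeriv_clm_comp (L : F →L[ℝ] F') {φ : E d → F} (hs : Smooth φ) (γ : Fin d → ℕ) :
    multiDeriv γ (fun x => L (φ x)) = fun x => L (multiDeriv γ φ x) := by
  have hL : Smooth (fun x => L (φ x)) := L.contDiff.comp hs
  induction γ using multiIdx_induction with
  | h0 => simp [multiDeriv_zero]
  | hs μ i ih =>
    rw [multiDeriv_add_unitIdx hs, multiDeriv_add_unitIdx hL, ih]
    funext x
    unfold pderiv
    have := (L.hasFDerivAt.comp x ((hs.multiDeriv μ).differentiableAt x).hasFDerivAt).fderiv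
    change fderiv ℝ (L ∘ multiDeriv μ φ) x _ = _
    rw [this]
    rfl

theorem multiDeriv_comp_affine {φ : E d → F} (hs : Smooth φ) (a : ℝ) (b : E d) (γ : Fin d → ℕ) :
    multiDeriv γ (fun x => φ (a • x + b)) =
      fun x => a ^ (∑ i, γ i) • multiDeriv γ φ (a • x + b) := by
  have hA : Smooth (fun x : E d => a • x + b) := (contDiff_id.const_smul a).add contDiff_const
  have hL : Smooth (fun x => φ (a • x + b)) := hs.comp hA
  induction γ using multiIdx_induction with
  | h0 => simp [multiDeriv_zero]
  | hs μ i ih =>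
    rw [multiDeriv_add_unitIdx hs, multiDeriv_add_unitIdx hL, ih]
    funext x
    have h1 : HasFDerivAt (fun x : E d => a • x + b) (a • ContinuousLinearMap.id ℝ (E d)) x :=
      ((hasFDerivAt_id x).const_smul a).add_const b
    have h2 := ((((hs.multiDeriv μ).differentiableAt (a • x + b)).hasFDerivAt.comp x h1).const_smul
      (a ^ ∑ i, μ i)).fderiv
    unfold pderiv
    change fderiv ℝ ((a ^ ∑ i, μ i) • (multiDeriv μ φ ∘ fun x => a • x + b)) x _ = _
    rw [h2]
    have hsum : ∑ j, (μ + unitIdx i) j = (∑ j, μ j) + 1 := by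
      simp only [Pi.add_apply, Finset.sum_add_distrib, sum_unitIdx]
    rw [hsum]
    simp [pow_succ, smul_smul]

theorem multiDeriv_neg_arg {φ : E d → F} (hs : Smooth φ) (b : E d) (γ : Fin d → ℕ) :
    multiDeriv γ (fun x => φ (x - b)) = fun x => multiDeriv γ φ (x - b) := by
  have := multiDeriv_comp_affine hs 1 (-b) γ
  simpa [sub_eq_add_neg] using this

end Classical

/-! ### Weak derivatives -/

section Weak

variable {d : ℕ} {F F' : Type*} [NormedAddCommGroup F] [NormedSpace ℝ F]
  [NormedAddCommGroup F'] [NormedSpace ℝ F']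

theorem integrable_test_smul {φ : E d → ℝ} (hφ : Continuous φ) (hc : HasCompactSupport φ)
    {u : E d → F} (hu : LocallyIntegrable u) : Integrable (fun x => φ x • u x) :=
  hu.integrable_smul_left_of_hasCompactSupport hφ hc

theorem integrable_multiDeriv_smul {φ : E d → ℝ} (hφ : Smooth φ) (hc : HasCompactSupport φ)
    {u : E d → F} (hu : LocallyIntegrable u) (γ : Fin d → ℕ) :
    Integrable (fun x => multiDeriv γ φ x • u x) :=
  integrable_test_smul (hφ.multiDeriv γ).continuous (hasCompactSupport_multiDeriv hφ hc γ) hu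

theorem locallyIntegrable_of_forall_test {u : E d → F}
    (h : ∀ φ : E d → ℝ, Continuous φ → HasCompactSupport φ → Integrable (fun x => φ x • u x)) :
    LocallyIntegrable u := by
  rw [locallyIntegrable_iff]
  intro K hK
  obtain ⟨f, hf1, -, hfc, -⟩ := exists_continuous_one_zero_of_isCompact hK isClosed_empty
    (Set.disjoint_empty K)
  have := (h f f.continuous hfc).integrableOn (s := K)
  refine this.congr_fun (fun x hx => ?_) hK.measurableSet
  simp [hf1 hx]

theorem LocallyIntegrable.clm_comp (L : F →L[ℝ] F') {u : E d → F} (hu : LocallyIntegrable u) :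
    LocallyIntegrable (fun x => L (u x)) := fun x => by
  obtain ⟨s, hs, h⟩ := hu x
  exact ⟨s, hs, L.integrable_comp h⟩

theorem locallyIntegrable_comp_affine {X : Type*} [NormedAddCommGroup X] {u : E d → X}
    (hu : LocallyIntegrable u)
    {a : ℝ} (ha : a ≠ 0) (b : E d) :
    LocallyIntegrable (fun x => u (a • x + b)) := by
  have e1 : LocallyIntegrable (u ∘ fun x => x + b) := by
    rw [← Homeomorph.coe_addRight, ← locallyIntegrable_map_homeomorph, Homeomorph.coe_addRight,
      map_add_right_eq_self]
    exact hu
  have := (locallyIntegrable_map_homeomorph (Homeomorph.smulOfNeZero a ha)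
    (f := u ∘ fun x => x + b) (μ := volume)).1
  apply this
  change LocallyIntegrable _ (Measure.map (fun x => a • x) volume)
  rw [Measure.map_addHaar_smul _ ha]
  intro x
  obtain ⟨s, hs, h⟩ := e1 x
  exact ⟨s, hs, by rw [IntegrableOn, Measure.restrict_smul]; exact h.smul_measure (by simp)⟩

theorem sum_add_idx (μ ν : Fin d → ℕ) : ∑ i, (μ + ν) i = ∑ i, μ i + ∑ i, ν i := by
  simp [Finset.sum_add_distrib]

namespace HasWeakDeriv

variable {γ μ ν : Fin d → ℕ} {u v w z w' : E d → F}

theorem unique [CompleteSpace F] (h : HasWeakDeriv γ u w) (h' : HasWeakDeriv γ u w') :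
    w =ᵐ[volume] w' := by
  apply ae_eq_of_integral_contDiff_smul_eq h.2.1 h'.2.1
  intro g hg hc
  have := (h.2.2 g hg hc).symm.trans (h'.2.2 g hg hc)
  exact smul_right_injective F (pow_ne_zero _ (by norm_num : (-1 : ℝ) ≠ 0)) this

theorem congr (h : HasWeakDeriv γ u w) {u' : E d → F} (hu : u =ᵐ[volume] u')
    (hw : w =ᵐ[volume] w') : HasWeakDeriv γ u' w' := by
  refine ⟨h.1.congr hu, h.2.1.congr hw, fun φ (hφ : Smooth φ) hc => ?_⟩
  rw [integral_congr_ae (g := fun x => multiDeriv γ φ x • u x), h.2.2 φ hφ hc,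
    integral_congr_ae (f := fun x => φ x • w x) (g := fun x => φ x • w' x)]
  · filter_upwards [hw] with x hx; rw [hx]
  · filter_upwards [hu] with x hx; rw [hx]

theorem refl (hu : LocallyIntegrable u) : HasWeakDeriv 0 u u := by
  refine ⟨hu, hu, fun φ _ _ => ?_⟩
  simp [multiDeriv_zero]

theorem fun_add (h : HasWeakDeriv γ u w) (h' : HasWeakDeriv γ v z) :
    HasWeakDeriv γ (fun x => u x + v x) (fun x => w x + z x) := by
  refine ⟨h.1.add h'.1, h.2.1.add h'.2.1, fun φ (hφ : Smooth φ) hc => ?_⟩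
  simp only [smul_add]
  rw [integral_add (integrable_multiDeriv_smul hφ hc h.1 γ)
      (integrable_multiDeriv_smul hφ hc h'.1 γ),
    integral_add (integrable_test_smul hφ.continuous hc h.2.1)
      (integrable_test_smul hφ.continuous hc h'.2.1), smul_add, h.2.2 φ hφ hc, h'.2.2 φ hφ hc]

theorem clm_comp [CompleteSpace F] [CompleteSpace F'] (L : F →L[ℝ] F') (h : HasWeakDeriv γ u w) :
    HasWeakDeriv γ (fun x => L (u x)) (fun x => L (w x)) := by
  refine ⟨LocallyIntegrable.clm_comp L h.1, LocallyIntegrable.clm_comp L h.2.1,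
    fun φ (hφ : Smooth φ) hc => ?_⟩
  have h1 := L.integral_comp_comm (integrable_multiDeriv_smul hφ hc h.1 γ)
  have h2 := L.integral_comp_comm (integrable_test_smul hφ.continuous hc h.2.1)
  simp only [map_smul] at h1 h2
  rw [h1, h2, h.2.2 φ hφ hc, map_smul]

theorem const_smul_real (c : ℝ) (h : HasWeakDeriv γ u w) :
    HasWeakDeriv γ (fun x => c • u x) (fun x => c • w x) := by
  refine ⟨h.1.smul c, h.2.1.smul c, fun φ (hφ : Smooth φ) hc => ?_⟩
  simp only [smul_comm _ c]
  rw [integral_smul, integral_smul, h.2.2 φ hφ hc, smul_comm]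

theorem fun_sub (h : HasWeakDeriv γ u w) (h' : HasWeakDeriv γ v z) :
    HasWeakDeriv γ (fun x => u x - v x) (fun x => w x - z x) := by
  simpa [sub_eq_add_neg] using h.fun_add (h'.const_smul_real (-1))

theorem zero : HasWeakDeriv γ (fun _ : E d => (0 : F)) (fun _ => 0) :=
  ⟨locallyIntegrable_const _, locallyIntegrable_const _, fun φ _ _ => by simp⟩

theorem fun_sum {ι : Type*} (s : Finset ι) {u w : ι → E d → F}
    (h : ∀ i ∈ s, HasWeakDeriv γ (u i) (w i)) :
    HasWeakDeriv γ (fun x => ∑ i ∈ s, u i x) (fun x => ∑ i ∈ s, w i x) := by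
  classical
  induction s using Finset.induction_on with
  | empty => simpa using zero
  | insert i s hi ih =>
    simp only [Finset.sum_insert hi]
    exact (h i (Finset.mem_insert_self i s)).fun_add
      (ih fun j hj => h j (Finset.mem_insert_of_mem hj))

theorem comp (h : HasWeakDeriv μ u w) (h' : HasWeakDeriv ν w z) : HasWeakDeriv (μ + ν) u z := by
  refine ⟨h.1, h'.2.1, fun φ (hφ : Smooth φ) hc => ?_⟩
  rw [multiDeriv_add hφ, h.2.2 _ (hφ.multiDeriv ν) (hasCompactSupport_multiDeriv hφ hc ν),
    h'.2.2 φ hφ hc, smul_smul, sum_add_idx, pow_add]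

theorem of_add (h : HasWeakDeriv μ u w) (h' : HasWeakDeriv (μ + ν) u z) : HasWeakDeriv ν w z := by
  refine ⟨h.2.1, h'.2.1, fun φ (hφ : Smooth φ) hc => ?_⟩
  have h1 := h.2.2 _ (hφ.multiDeriv ν) (hasCompactSupport_multiDeriv hφ hc ν)
  have h2 := h'.2.2 φ hφ hc
  rw [multiDeriv_add hφ, h1, sum_add_idx, pow_add, mul_smul] at h2
  exact smul_right_injective F (pow_ne_zero _ (by norm_num : (-1 : ℝ) ≠ 0)) h2

theorem of_pderiv {φ : E d → F} (hφ : Smooth φ) (i : Fin d) :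
    HasWeakDeriv (unitIdx i) φ (pderiv i φ) := by
  have l1 : LocallyIntegrable φ := hφ.continuous.locallyIntegrable
  have l2 : LocallyIntegrable (pderiv i φ) := (hφ.pderiv i).continuous.locallyIntegrable
  refine ⟨l1, l2, fun ψ (hψ : Smooth ψ) hc => ?_⟩
  have := integral_smul_fderiv_eq_neg_fderiv_smul_of_integrable (μ := volume) (f := ψ) (g := φ)
    (v := EuclideanSpace.single i (1 : ℝ))
    (by
      have := integrable_multiDeriv_smul hψ hc l1 (unitIdx i)
      rw [multiDeriv_unitIdx] at this
      exact this)
    (integrable_test_smul hψ.continuous hc l2) (integrable_test_smul hψ.continuous hc l1)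
    (fun x _ => hψ.differentiableAt x) (fun x _ => hφ.differentiableAt x)
  rw [multiDeriv_unitIdx, sum_unitIdx]
  simp only [pderiv]
  rw [this]
  simp

theorem of_smooth {φ : E d → F} (hφ : Smooth φ) (γ : Fin d → ℕ) :
    HasWeakDeriv γ φ (multiDeriv γ φ) := by
  induction γ using multiIdx_induction with
  | h0 => rw [multiDeriv_zero]; exact refl hφ.continuous.locallyIntegrable
  | hs μ i ih =>
    rw [multiDeriv_add_unitIdx hφ]
    exact ih.comp (of_pderiv (hφ.multiDeriv μ) i)

/-- The distributional identity passes to limits in the sense of distributions. -/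
theorem of_tendsto {u : E d → F} {w : E d → F} {uj wj : ℕ → E d → F}
    (h : ∀ j, HasWeakDeriv γ (uj j) (wj j)) (hu : LocallyIntegrable u) (hw : LocallyIntegrable w)
    (hu' : ∀ φ : E d → ℝ, Continuous φ → HasCompactSupport φ →
      Filter.Tendsto (fun j => ∫ x, φ x • uj j x) Filter.atTop (nhds (∫ x, φ x • u x)))
    (hw' : ∀ φ : E d → ℝ, Continuous φ → HasCompactSupport φ →
      Filter.Tendsto (fun j => ∫ x, φ x • wj j x) Filter.atTop (nhds (∫ x, φ x • w x))) :
    HasWeakDeriv γ u w := by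
  refine ⟨hu, hw, fun φ (hφ : Smooth φ) hc => ?_⟩
  refine tendsto_nhds_unique (hu' _ (hφ.multiDeriv γ).continuous
    (hasCompactSupport_multiDeriv hφ hc γ)) ?_
  simp only [fun j => (h j).2.2 φ hφ hc]
  exact (hw' φ hφ.continuous hc).const_smul _

theorem comp_affine (h : HasWeakDeriv γ u w) {a : ℝ} (ha : a ≠ 0) (b : E d) :
    HasWeakDeriv γ (fun x => u (a • x + b)) (fun x => a ^ (∑ i, γ i) • w (a • x + b)) := by
  refine ⟨locallyIntegrable_comp_affine h.1 ha b,
    (locallyIntegrable_comp_affine h.2.1 ha b).smul _, fun φ (hφ : Smooth φ) hc => ?_⟩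
  -- the change of variables `y = a x + b`
  have cv : ∀ g : E d → F, ∫ x, g (a • x + b) =
      |(a ^ Module.finrank ℝ (E d))⁻¹| • ∫ y, g y := by
    intro g
    rw [Measure.integral_comp_smul volume (fun x => g (x + b)) a,
      integral_add_right_eq_self (fun x => g x) b]
  set ψ : E d → ℝ := fun y => φ (a⁻¹ • y + -(a⁻¹ • b)) with hψdef
  have hinv : ∀ x : E d, a⁻¹ • (a • x + b) + -(a⁻¹ • b) = x := by
    intro x; rw [smul_add, smul_smul, inv_mul_cancel₀ ha, one_smul]; abel
  have hψ : Smooth ψ := hφ.comp ((contDiff_id.const_smul a⁻¹).add contDiff_const)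
  have hψc : HasCompactSupport ψ := by
    have := hc.comp_homeomorph ((Homeomorph.smulOfNeZero a⁻¹ (inv_ne_zero ha)).trans
      (Homeomorph.addRight (-(a⁻¹ • b))))
    exact this
  have hD : ∀ x, multiDeriv γ φ x = a ^ (∑ i, γ i) • multiDeriv γ ψ (a • x + b) := by
    intro x
    rw [hψdef, multiDeriv_comp_affine hφ]
    simp only [hinv]
    rw [smul_smul, inv_pow, mul_inv_cancel₀ (pow_ne_zero _ ha), one_smul]
  have hφψ : ∀ x, φ x = ψ (a • x + b) := by intro x; simp only [hψdef, hinv]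
  have hL := cv (fun y => (a ^ (∑ i, γ i) • multiDeriv γ ψ y) • u y)
  have hR := cv (fun y => ψ y • a ^ (∑ i, γ i) • w y)
  simp only [hD, hφψ]
  rw [hL, hR]
  have := h.2.2 ψ hψ hψc
  simp only [smul_assoc]
  simp only [smul_comm (_ : ℝ) (a ^ (∑ i, γ i))]
  rw [integral_smul, integral_smul, this, smul_comm ((-1 : ℝ) ^ _), smul_comm ((-1 : ℝ) ^ _)]

theorem comp_sub (h : HasWeakDeriv γ u w) (b : E d) :
    HasWeakDeriv γ (fun x => u (x - b)) (fun x => w (x - b)) := by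
  simpa [sub_eq_add_neg] using h.comp_affine one_ne_zero (-b)

theorem real_smul_unitIdx {s : E d → ℝ} (hs : Smooth s) {i : Fin d}
    (h : HasWeakDeriv (unitIdx i) u w) :
    HasWeakDeriv (unitIdx i) (fun x => s x • u x) (fun x => pderiv i s x • u x + s x • w x) := by
  have l0 := h.1.continuous_smul hs.continuous
  have l1 := h.1.continuous_smul (hs.pderiv i).continuous
  have l2 := h.2.1.continuous_smul hs.continuous
  refine ⟨l0, l1.add l2, fun φ (hφ : Smooth φ) hc => ?_⟩
  have hP : Smooth (fun x => φ x * s x) := hφ.mul hs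
  have hPc : HasCompactSupport (fun x => φ x * s x) := hc.mul_right
  have hPd : ∀ x, pderiv i (fun x => φ x * s x) x = φ x * pderiv i s x + s x * pderiv i φ x := by
    intro x
    have := ((hφ.differentiableAt x).hasFDerivAt.mul (hs.differentiableAt x).hasFDerivAt).fderiv
    unfold pderiv
    change fderiv ℝ (φ * s) x _ = _
    rw [this]
    simp
  have key := h.2.2 _ hP hPc
  rw [multiDeriv_unitIdx, sum_unitIdx] at key
  rw [multiDeriv_unitIdx, sum_unitIdx]
  simp only [hPd, add_smul, mul_smul] at key
  have i1 := integrable_test_smul hφ.continuous hc l1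
  have i2 : Integrable (fun x => s x • pderiv i φ x • u x) := by
    have := integrable_test_smul (hφ.pderiv i).continuous (hasCompactSupport_pderiv hc i) l0
    refine this.congr (Filter.Eventually.of_forall fun x => ?_)
    simp only [smul_comm (s x)]
  have i3 := integrable_test_smul hφ.continuous hc l2
  rw [integral_add i1 i2] at key
  simp only [smul_add]
  rw [integral_add i1 i3]
  simp only [smul_comm (pderiv i φ _) (s _)]
  rw [smul_add, ← key]
  simp

end HasWeakDeriv

end Weak

/-! ### The Leibniz formula -/

section Leibniz

variable {d : ℕ}

/-- The binomial coefficient `α! / (μ! (α - μ)!)` of multiindices; it vanishes unless `μ ≤ α`. -/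
noncomputable def binom (α μ : Fin d → ℕ) : ℝ := ∏ i, ((α i).choose (μ i) : ℝ)

theorem binom_self (α : Fin d → ℕ) : binom α α = 1 := by simp [binom]

theorem binom_eq_zero {α μ : Fin d → ℕ} (h : ¬ μ ≤ α) : binom α μ = 0 := by
  rw [Pi.le_def] at h
  push Not at h
  obtain ⟨i, hi⟩ := h
  exact Finset.prod_eq_zero (Finset.mem_univ i) (by rw [Nat.choose_eq_zero_of_lt hi]; simp)

theorem unitIdx_le_iff {i : Fin d} {ν : Fin d → ℕ} : unitIdx i ≤ ν ↔ 1 ≤ ν i := by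
  refine ⟨fun h => by simpa using h i, fun h j => ?_⟩
  by_cases hj : j = i
  · subst hj; simpa using h
  · simp [Pi.single_eq_of_ne hj]

theorem binom_add_unitIdx (α ν : Fin d → ℕ) (i : Fin d) :
    binom (α + unitIdx i) ν =
      binom α ν + if 1 ≤ ν i then binom α (ν - unitIdx i) else 0 := by
  have hrest : ∀ (β κ : Fin d → ℕ), binom β κ =
      ((β i).choose (κ i) : ℝ) * ∏ j ∈ Finset.univ.erase i, ((β j).choose (κ j) : ℝ) := fun β κ =>
    (Finset.mul_prod_erase _ _ (Finset.mem_univ i)).symm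
  have h1 : ∏ j ∈ Finset.univ.erase i, (((α + unitIdx i) j).choose (ν j) : ℝ) =
      ∏ j ∈ Finset.univ.erase i, ((α j).choose (ν j) : ℝ) :=
    Finset.prod_congr rfl fun j hj => by
      rw [Pi.add_apply, unitIdx, Pi.single_eq_of_ne (Finset.ne_of_mem_erase hj), add_zero]
  have h2 : ∏ j ∈ Finset.univ.erase i, ((α j).choose ((ν - unitIdx i) j) : ℝ) =
      ∏ j ∈ Finset.univ.erase i, ((α j).choose (ν j) : ℝ) :=
    Finset.prod_congr rfl fun j hj => by
      rw [Pi.sub_apply, unitIdx, Pi.single_eq_of_ne (Finset.ne_of_mem_erase hj), Nat.sub_zero]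
  rw [hrest (α + unitIdx i), hrest α ν, hrest α (ν - unitIdx i), h1, h2]
  simp only [Pi.add_apply, Pi.sub_apply, unitIdx, Pi.single_eq_same]
  rcases Nat.eq_zero_or_pos (ν i) with h0 | hpos
  · simp [h0]
  · obtain ⟨k, hk⟩ : ∃ k, ν i = k + 1 := ⟨ν i - 1, by omega⟩
    rw [if_pos (show 1 ≤ ν i from hpos), hk, Nat.choose_succ_succ]
    push_cast
    ring

theorem sum_binom_add_unitIdx {X : Type*} [AddCommGroup X] [Module ℝ X] (α : Fin d → ℕ) (i : Fin d)
    (f : (Fin d → ℕ) → X) :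
    ∑ ν ∈ Finset.Iic (α + unitIdx i), binom (α + unitIdx i) ν • f ν =
      ∑ μ ∈ Finset.Iic α, binom α μ • (f μ + f (μ + unitIdx i)) := by
  simp only [binom_add_unitIdx, add_smul, smul_add, Finset.sum_add_distrib]
  congr 1
  · symm
    apply Finset.sum_subset
    · exact Finset.Iic_subset_Iic.2 (le_add_of_nonneg_right zero_le)
    · intro ν _ hν
      rw [binom_eq_zero (by simpa using hν), zero_smul]
  · simp only [ite_smul, zero_smul]
    rw [← Finset.sum_filter]
    refine Finset.sum_nbij' (fun ν => ν - unitIdx i) (fun μ => μ + unitIdx i) ?_ ?_ ?_ ?_ ?_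
    · intro ν hν
      simp only [Finset.mem_filter, Finset.mem_Iic] at hν
      simpa using tsub_le_iff_right.2 hν.1
    · intro μ hμ
      simp only [Finset.mem_filter, Finset.mem_Iic] at hμ ⊢
      exact ⟨by gcongr, by simp⟩
    · intro ν hν
      simp only [Finset.mem_filter] at hν
      exact tsub_add_cancel_of_le (unitIdx_le_iff.2 hν.2)
    · intro μ _
      simp
    · intro ν hν
      simp only [Finset.mem_filter] at hν
      simp only [tsub_add_cancel_of_le (unitIdx_le_iff.2 hν.2)]

variable {F F₁ F₂ F₃ : Type*} [NormedAddCommGroup F] [NormedSpace ℝ F]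
  [NormedAddCommGroup F₁] [NormedSpace ℝ F₁] [NormedAddCommGroup F₂] [NormedSpace ℝ F₂]
  [NormedAddCommGroup F₃] [NormedSpace ℝ F₃]

/-- The Leibniz formula for the product of a smooth real function and a weakly
differentiable one. -/
theorem HasWeakDeriv.real_smul {s : E d → ℝ} (hs : Smooth s) {N : (Fin d → ℕ) → E d → F}
    (α : Fin d → ℕ) (h : ∀ μ ≤ α, HasWeakDeriv μ (N 0) (N μ)) :
    HasWeakDeriv α (fun x => s x • N 0 x)
      (fun x => ∑ μ ∈ Finset.Iic α, binom α μ • (multiDeriv (α - μ) s x • N μ x)) := by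
  induction α using multiIdx_induction with
  | h0 =>
    have h00 := h 0 le_rfl
    have hIic : (Finset.Iic (0 : Fin d → ℕ)) = {0} := by
      ext ν; simp
    simp only [hIic, Finset.sum_singleton, binom_self, one_smul, tsub_zero, multiDeriv_zero]
    exact refl (h00.1.continuous_smul hs.continuous)
  | hs α i ih =>
    have hle : α ≤ α + unitIdx i := le_add_of_nonneg_right zero_le
    refine ((ih fun μ hμ => h μ (hμ.trans hle)).comp (HasWeakDeriv.fun_sum (Finset.Iic α)
      (w := fun μ x => binom α μ • (pderiv i (multiDeriv (α - μ) s) x • N μ x +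
        multiDeriv (α - μ) s x • N (μ + unitIdx i) x)) fun μ hμ => ?_)).congr
      Filter.EventuallyEq.rfl (Filter.Eventually.of_forall fun x => ?_)
    · rw [Finset.mem_Iic] at hμ
      have hd : HasWeakDeriv (unitIdx i) (N μ) (N (μ + unitIdx i)) :=
        (h μ (hμ.trans hle)).of_add (h (μ + unitIdx i) (by gcongr))
      exact (hd.real_smul_unitIdx (hs.multiDeriv (α - μ))).const_smul_real _
    · simp only
      rw [sum_binom_add_unitIdx α i fun ν => multiDeriv (α + unitIdx i - ν) s x • N ν x]
      refine Finset.sum_congr rfl fun μ hμ => ?_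
      rw [Finset.mem_Iic] at hμ
      rw [← multiDeriv_add_unitIdx hs, tsub_add_eq_add_tsub hμ, add_tsub_add_eq_tsub_right]

/-- The Leibniz formula for a bilinear pairing of a weakly differentiable function and a smooth
one. -/
theorem HasWeakDeriv.bilin [CompleteSpace F₁] [CompleteSpace F₃] [FiniteDimensional ℝ F₂]
    (B : F₁ →L[ℝ] F₂ →L[ℝ] F₃) {s : E d → F₂} (hs : Smooth s)
    {N : (Fin d → ℕ) → E d → F₁} (α : Fin d → ℕ) (h : ∀ μ ≤ α, HasWeakDeriv μ (N 0) (N μ)) :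
    HasWeakDeriv α (fun x => B (N 0 x) (s x))
      (fun x => ∑ μ ∈ Finset.Iic α, binom α μ • B (N μ x) (multiDeriv (α - μ) s x)) := by
  let b := Module.finBasis ℝ F₂
  let c : Fin (Module.finrank ℝ F₂) → F₂ →L[ℝ] ℝ := fun j => LinearMap.toContinuousLinearMap (b.coord j)
  have hexp : ∀ (p : F₁) (q : F₂), B p q = ∑ j, c j q • B p (b j) := by
    intro p q
    conv_lhs => rw [← b.sum_repr q, map_sum]
    refine Finset.sum_congr rfl fun j _ => ?_
    rw [map_smul]
    rfl
  have key := HasWeakDeriv.fun_sum (γ := α) Finset.univ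
    (u := fun j x => c j (s x) • B (N 0 x) (b j))
    (w := fun j x => ∑ μ ∈ Finset.Iic α, binom α μ •
      (multiDeriv (α - μ) (fun y => c j (s y)) x • B (N μ x) (b j))) (fun j _ =>
    HasWeakDeriv.real_smul (N := fun μ x => B (N μ x) (b j)) ((c j).contDiff.comp hs) α
      fun μ hμ => (h μ hμ).clm_comp (B.flip (b j)))
  refine key.congr (Filter.Eventually.of_forall fun x => (hexp _ _).symm)
    (Filter.Eventually.of_forall fun x => ?_)
  simp only [multiDeriv_clm_comp (c _) hs]
  rw [Finset.sum_comm]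
  refine Finset.sum_congr rfl fun μ _ => ?_
  rw [hexp, Finset.smul_sum]

end Leibniz

/-! ### Representatives of weak derivatives and the spaces `H^m` -/

section WeakDeriv

variable {d : ℕ} {F F' : Type*} [NormedAddCommGroup F] [NormedSpace ℝ F]
  [NormedAddCommGroup F'] [NormedSpace ℝ F'] {γ μ ν : Fin d → ℕ} {u v w : E d → F} {m : ℕ}

theorem HasWeakDeriv.weakDeriv (h : HasWeakDeriv γ u w) : HasWeakDeriv γ u (weakDeriv γ u) := by
  have hex : ∃ w, HasWeakDeriv γ u w := ⟨w, h⟩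
  rw [HighOrderHomogenization.weakDeriv, dif_pos hex]
  exact hex.choose_spec

theorem HasWeakDeriv.weakDeriv_ae_eq [CompleteSpace F] (h : HasWeakDeriv γ u w) :
    HighOrderHomogenization.weakDeriv γ u =ᵐ[volume] w := h.weakDeriv.unique h

theorem weakDeriv_congr (h : u =ᵐ[volume] v) : weakDeriv γ u = weakDeriv γ v := by
  have key : ∀ P Q : (E d → F) → Prop, P = Q → ∀ hP : ∃ w, P w, ∀ hQ : ∃ w, Q w,
      hP.choose = hQ.choose := by
    rintro P Q rfl _ _
    rfl
  have hPQ : HasWeakDeriv γ u = HasWeakDeriv γ v := by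
    funext w
    exact propext ⟨fun h' => h'.congr h Filter.EventuallyEq.rfl,
      fun h' => h'.congr h.symm Filter.EventuallyEq.rfl⟩
  unfold weakDeriv
  by_cases hu : ∃ w, HasWeakDeriv γ u w
  · have hv : ∃ w, HasWeakDeriv γ v w := hPQ ▸ hu
    rw [dif_pos hu, dif_pos hv]
    exact key _ _ hPQ _ _
  · have hv : ¬ ∃ w, HasWeakDeriv γ v w := hPQ ▸ hu
    rw [dif_neg hu, dif_neg hv]

theorem weakDeriv_zero_ae [CompleteSpace F] (hu : LocallyIntegrable u) :
    weakDeriv 0 u =ᵐ[volume] u := (HasWeakDeriv.refl hu).weakDeriv_ae_eq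

theorem MemH.hasWeakDeriv (h : MemH m u) (hγ : ∑ i, γ i ≤ m) :
    HasWeakDeriv γ u (weakDeriv γ u) := (h γ hγ).choose_spec.1.weakDeriv

theorem MemH.memLp_weakDeriv [CompleteSpace F] (h : MemH m u) (hγ : ∑ i, γ i ≤ m) :
    MemLp (weakDeriv γ u) 2 volume :=
  ((h γ hγ).choose_spec.2).ae_eq (h γ hγ).choose_spec.1.weakDeriv_ae_eq.symm

theorem MemH.locallyIntegrable (h : MemH m u) : LocallyIntegrable u :=
  (h.hasWeakDeriv (γ := 0) (by simp)).1

theorem MemH.memLp [CompleteSpace F] (h : MemH m u) : MemLp u 2 volume :=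
  (h.memLp_weakDeriv (γ := 0) (by simp)).ae_eq (weakDeriv_zero_ae h.locallyIntegrable)

theorem MemH.mono (h : MemH m u) {k : ℕ} (hk : k ≤ m) : MemH k u :=
  fun γ hγ => h γ (hγ.trans hk)

theorem MemH.congr (h : MemH m u) (huv : u =ᵐ[volume] v) : MemH m v := fun γ hγ => by
  obtain ⟨w, hw, hw2⟩ := h γ hγ
  exact ⟨w, hw.congr huv Filter.EventuallyEq.rfl, hw2⟩

theorem MemH.fun_add (h : MemH m u) (h' : MemH m v) : MemH m (fun x => u x + v x) := fun γ hγ => by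
  obtain ⟨w, hw, hw2⟩ := h γ hγ
  obtain ⟨z, hz, hz2⟩ := h' γ hγ
  exact ⟨_, hw.fun_add hz, hw2.add hz2⟩

theorem MemH.fun_sub (h : MemH m u) (h' : MemH m v) : MemH m (fun x => u x - v x) := fun γ hγ => by
  obtain ⟨w, hw, hw2⟩ := h γ hγ
  obtain ⟨z, hz, hz2⟩ := h' γ hγ
  exact ⟨_, hw.fun_sub hz, hw2.sub hz2⟩

theorem MemH.clm_comp [CompleteSpace F] [CompleteSpace F'] (L : F →L[ℝ] F') (h : MemH m u) :
    MemH m (fun x => L (u x)) := fun γ hγ => by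
  obtain ⟨w, hw, hw2⟩ := h γ hγ
  exact ⟨_, hw.clm_comp L, L.comp_memLp' hw2⟩

theorem MemH.weakDeriv [CompleteSpace F] {k : ℕ} (h : MemH (m + k) u) (hγ : ∑ i, γ i ≤ k) :
    MemH m (weakDeriv γ u) := fun μ hμ => by
  have hle : ∑ i, (γ + μ) i ≤ m + k := by rw [sum_add_idx]; omega
  exact ⟨_, (h.hasWeakDeriv (by omega)).of_add (h.hasWeakDeriv hle), h.memLp_weakDeriv hle⟩

theorem MemH.weakDeriv_weakDeriv [CompleteSpace F] (h : MemH m u)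
    (hle : ∑ i, γ i + ∑ i, μ i ≤ m) :
    HighOrderHomogenization.weakDeriv μ (HighOrderHomogenization.weakDeriv γ u) =ᵐ[volume]
      HighOrderHomogenization.weakDeriv (γ + μ) u :=
  ((h.hasWeakDeriv (by omega)).of_add
    (h.hasWeakDeriv (by rw [sum_add_idx]; exact hle))).weakDeriv_ae_eq

theorem weakDeriv_smooth [CompleteSpace F] (h : Smooth u) :
    weakDeriv γ u =ᵐ[volume] multiDeriv γ u := (HasWeakDeriv.of_smooth h γ).weakDeriv_ae_eq

theorem MemH.of_smooth (h : Smooth u) (hc : HasCompactSupport u) : MemH m u := fun γ _ =>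
  ⟨_, HasWeakDeriv.of_smooth h γ, (h.multiDeriv γ).continuous.memLp_of_hasCompactSupport
    (hasCompactSupport_multiDeriv h hc γ)⟩

end WeakDeriv

/-! ### Averaging of translates -/

section Avg

variable {d : ℕ} {F : Type*} [NormedAddCommGroup F] [NormedSpace ℝ F]

/-- The average `∫ u(x - h) dν(h)` of the translates of `u`. Both the Steklov smoothing and the
mollification by a smooth kernel are of this form. -/
noncomputable def avg (ν : Measure (E d)) (u : E d → F) : E d → F := fun x => ∫ h, u (x - h) ∂ν

theorem aestronglyMeasurable_sub_prod {X : Type*} [NormedAddCommGroup X]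
    {u : E d → X} (hu : AEStronglyMeasurable u volume) (ν : Measure (E d)) [SFinite ν] :
    AEStronglyMeasurable (fun p : E d × E d => u (p.1 - p.2)) (volume.prod ν) :=
  hu.comp_quasiMeasurePreserving (quasiMeasurePreserving_sub_of_right_invariant volume ν)

theorem integrable_test_smul_sub_prod {ν : Measure (E d)} [IsFiniteMeasure ν] {R : ℝ}
    (hν : ∀ᵐ h ∂ν, ‖h‖ ≤ R) {u : E d → F} (hu : LocallyIntegrable u) {φ : E d → ℝ}
    (hφ : Continuous φ) (hc : HasCompactSupport φ) :
    Integrable (Function.uncurry fun x h => φ x • u (x - h)) (volume.prod ν) := by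
  have hm : AEStronglyMeasurable (Function.uncurry fun x h => φ x • u (x - h)) (volume.prod ν) :=
    ((hφ.comp continuous_fst).aestronglyMeasurable).smul
      (aestronglyMeasurable_sub_prod hu.aestronglyMeasurable ν)
  refine ⟨hm, ?_⟩
  obtain ⟨C, hC⟩ := hφ.bounded_above_of_compact_support hc
  obtain ⟨r, hr⟩ := hc.isCompact.isBounded.subset_closedBall (0 : E d)
  have hK : IntegrableOn u (Metric.closedBall 0 (r + R)) :=
    hu.integrableOn_isCompact (isCompact_closedBall _ _)
  rw [hasFiniteIntegral_iff_enorm, lintegral_prod_symm _ hm.enorm]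
  have hb : ∀ᵐ h ∂ν, ∫⁻ x, ‖Function.uncurry (fun x h => φ x • u (x - h)) (x, h)‖ₑ ≤
      ENNReal.ofReal C * ∫⁻ y in Metric.closedBall 0 (r + R), ‖u y‖ₑ := by
    filter_upwards [hν] with h hh
    rw [← lintegral_const_mul' _ _ ENNReal.ofReal_ne_top]
    calc ∫⁻ x, ‖Function.uncurry (fun x h => φ x • u (x - h)) (x, h)‖ₑ
        ≤ ∫⁻ x, (Metric.closedBall 0 (r + R)).indicator
            (fun y => ENNReal.ofReal C * ‖u y‖ₑ) (x - h) := by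
          refine lintegral_mono fun x => ?_
          by_cases hx : x ∈ tsupport φ
          · have hmem : x - h ∈ Metric.closedBall (0 : E d) (r + R) := by
              have := hr hx
              rw [mem_closedBall_zero_iff] at this ⊢
              exact (norm_sub_le _ _).trans (add_le_add this hh)
            rw [Set.indicator_of_mem hmem]
            simp only [Function.uncurry, enorm_smul]
            gcongr
            rw [← ofReal_norm]
            exact ENNReal.ofReal_le_ofReal (hC x)
          · simp [Function.uncurry, image_eq_zero_of_notMem_tsupport hx]
      _ = ∫⁻ y, (Metric.closedBall 0 (r + R)).indicator
            (fun y => ENNReal.ofReal C * ‖u y‖ₑ) y :=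
          lintegral_sub_right_eq_self _ h
      _ = _ := lintegral_indicator measurableSet_closedBall _
  refine (lintegral_mono_ae hb).trans_lt ?_
  rw [lintegral_const]
  refine ENNReal.mul_lt_top (ENNReal.mul_lt_top ENNReal.ofReal_lt_top ?_) (measure_lt_top _ _)
  exact hK.2

theorem test_smul_avg (ν : Measure (E d)) (φ : E d → ℝ) (u : E d → F) (x : E d) :
    φ x • avg ν u x = ∫ h, φ x • u (x - h) ∂ν := (integral_smul _ _).symm

theorem locallyIntegrable_avg {ν : Measure (E d)} [IsFiniteMeasure ν] {R : ℝ}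
    (hν : ∀ᵐ h ∂ν, ‖h‖ ≤ R) {u : E d → F} (hu : LocallyIntegrable u) :
    LocallyIntegrable (avg ν u) := by
  refine locallyIntegrable_of_forall_test fun φ hφ hc => ?_
  simp only [test_smul_avg]
  exact (integrable_test_smul_sub_prod hν hu hφ hc).integral_prod_left

theorem HasWeakDeriv.avg {ν : Measure (E d)} [IsFiniteMeasure ν] {R : ℝ}
    (hν : ∀ᵐ h ∂ν, ‖h‖ ≤ R) {γ : Fin d → ℕ} {u w : E d → F} (h : HasWeakDeriv γ u w) :
    HasWeakDeriv γ (avg ν u) (avg ν w) := by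
  refine ⟨locallyIntegrable_avg hν h.1, locallyIntegrable_avg hν h.2.1,
    fun φ (hφ : Smooth φ) hc => ?_⟩
  simp only [test_smul_avg]
  rw [integral_integral_swap (integrable_test_smul_sub_prod hν h.1 (hφ.multiDeriv γ).continuous
      (hasCompactSupport_multiDeriv hφ hc γ)),
    integral_integral_swap (integrable_test_smul_sub_prod hν h.2.1 hφ.continuous hc),
    ← integral_smul]
  refine integral_congr_ae (Filter.Eventually.of_forall fun b => ?_)
  exact (h.comp_sub b).2.2 φ hφ hc

end Avg

/-! ### The norm of `L²` and convergence in `L²` -/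

section L2

variable {Ω X Z : Type*} [MeasurableSpace Ω] {μ : Measure Ω} [NormedAddCommGroup X]
  [NormedAddCommGroup Z] {f g : Ω → X}

/-- The norm of `L²(μ)` as a real number; `l2Norm` is the case of the Lebesgue measure. -/
noncomputable def nrm2 (μ : Measure Ω) (f : Ω → X) : ℝ := (eLpNorm f 2 μ).toReal

theorem l2Norm_eq_nrm2 {d : ℕ} (u : E d → X) : l2Norm u = nrm2 volume u := rfl

theorem nrm2_nonneg : 0 ≤ nrm2 μ f := ENNReal.toReal_nonneg

theorem nrm2_congr (h : f =ᵐ[μ] g) : nrm2 μ f = nrm2 μ g := by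
  rw [nrm2, eLpNorm_congr_ae h, nrm2]

theorem eLpNorm_two_sq (f : Ω → X) : eLpNorm f 2 μ ^ 2 = ∫⁻ x, ‖f x‖ₑ ^ 2 ∂μ := by
  have := eLpNorm_nnreal_pow_eq_lintegral (μ := μ) (f := f) (p := 2) (by norm_num)
  have h2 : ((2 : NNReal) : ℝ) = ((2 : ℕ) : ℝ) := by norm_num
  simp only [h2, ENNReal.rpow_natCast, ENNReal.coe_ofNat] at this
  exact this

theorem nrm2_le_of_lintegral {C : ℝ} (hC : 0 ≤ C)
    (h : ∫⁻ x, ‖f x‖ₑ ^ 2 ∂μ ≤ ENNReal.ofReal (C ^ 2)) : eLpNorm f 2 μ ≤ ENNReal.ofReal C := by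
  rw [← eLpNorm_two_sq, ENNReal.ofReal_pow hC] at h
  exact (ENNReal.pow_le_pow_left_iff two_ne_zero).1 h

theorem nrm2_le_of_eLpNorm {C : ℝ} (hC : 0 ≤ C) (h : eLpNorm f 2 μ ≤ ENNReal.ofReal C) :
    nrm2 μ f ≤ C := ENNReal.toReal_le_of_le_ofReal hC h

theorem ofReal_nrm2 (hf : MemLp f 2 μ) : ENNReal.ofReal (nrm2 μ f) = eLpNorm f 2 μ :=
  ENNReal.ofReal_toReal hf.2.ne

theorem lintegral_eq_nrm2 (hf : MemLp f 2 μ) :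
    ∫⁻ x, ‖f x‖ₑ ^ 2 ∂μ = ENNReal.ofReal (nrm2 μ f ^ 2) := by
  rw [← eLpNorm_two_sq, ENNReal.ofReal_pow nrm2_nonneg, ofReal_nrm2 hf]

theorem integrable_norm_sq (hf : MemLp f 2 μ) : Integrable (fun x => ‖f x‖ ^ 2) μ :=
  hf.integrable_norm_pow (p := 2) two_ne_zero

theorem nrm2_sq (hf : MemLp f 2 μ) : nrm2 μ f ^ 2 = ∫ x, ‖f x‖ ^ 2 ∂μ := by
  rw [integral_eq_lintegral_of_nonneg_ae (Filter.Eventually.of_forall fun x => by positivity)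
    (integrable_norm_sq hf).1, nrm2, ← ENNReal.toReal_pow, eLpNorm_two_sq]
  congr 1
  refine lintegral_congr fun x => ?_
  rw [← ofReal_norm, ENNReal.ofReal_pow (norm_nonneg _)]

theorem nrm2_add_le (hf : MemLp f 2 μ) (hg : MemLp g 2 μ) :
    nrm2 μ (fun x => f x + g x) ≤ nrm2 μ f + nrm2 μ g := by
  rw [nrm2, nrm2, nrm2, ← ENNReal.toReal_add hf.2.ne hg.2.ne]
  exact ENNReal.toReal_mono (ENNReal.add_lt_top.2 ⟨hf.2, hg.2⟩).ne
    (eLpNorm_add_le hf.1 hg.1 one_le_two)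

theorem nrm2_sub_le (hf : MemLp f 2 μ) (hg : MemLp g 2 μ) :
    nrm2 μ (fun x => f x - g x) ≤ nrm2 μ f + nrm2 μ g := by
  rw [nrm2, nrm2, nrm2, ← ENNReal.toReal_add hf.2.ne hg.2.ne]
  exact ENNReal.toReal_mono (ENNReal.add_lt_top.2 ⟨hf.2, hg.2⟩).ne
    (eLpNorm_sub_le hf.1 hg.1 one_le_two)

theorem nrm2_zero : nrm2 μ (fun _ => (0 : X)) = 0 := by
  simp [nrm2]

theorem nrm2_sum_le {ι : Type*} (s : Finset ι) {f : ι → Ω → X} (h : ∀ i ∈ s, MemLp (f i) 2 μ) :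
    nrm2 μ (fun x => ∑ i ∈ s, f i x) ≤ ∑ i ∈ s, nrm2 μ (f i) := by
  classical
  induction s using Finset.induction_on with
  | empty => simp [nrm2_zero]
  | insert i s hi ih =>
    simp only [Finset.sum_insert hi]
    have h' : ∀ j ∈ s, MemLp (f j) 2 μ := fun j hj => h j (Finset.mem_insert_of_mem hj)
    exact (nrm2_add_le (h i (Finset.mem_insert_self i s)) (memLp_finsetSum s h')).trans
      (add_le_add le_rfl (ih h'))

theorem nrm2_smul {𝕜 : Type*} [NormedField 𝕜] [NormedSpace 𝕜 X] (c : 𝕜) (f : Ω → X) :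
    nrm2 μ (fun x => c • f x) = ‖c‖ * nrm2 μ f := by
  have := eLpNorm_const_smul c f 2 μ
  rw [nrm2, nrm2]
  change (eLpNorm (c • f) 2 μ).toReal = _
  rw [this]
  simp

theorem nrm2_mono {f : Ω → X} {g : Ω → Z} (hg : MemLp g 2 μ) (h : ∀ᵐ x ∂μ, ‖f x‖ ≤ ‖g x‖) :
    nrm2 μ f ≤ nrm2 μ g := ENNReal.toReal_mono hg.2.ne (eLpNorm_mono_ae h)

theorem nrm2_le_mul {f : Ω → X} {g : Ω → Z} {c : ℝ} (hc : 0 ≤ c) (hg : MemLp g 2 μ)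
    (h : ∀ᵐ x ∂μ, ‖f x‖ ≤ c * ‖g x‖) : nrm2 μ f ≤ c * nrm2 μ g := by
  have h1 : nrm2 μ f ≤ nrm2 μ (fun x => c • ‖g x‖) := by
    refine nrm2_mono (hg.norm.const_smul c) ?_
    filter_upwards [h] with x hx
    rwa [norm_smul, norm_norm, Real.norm_of_nonneg hc]
  rw [nrm2_smul, Real.norm_of_nonneg hc] at h1
  refine h1.trans (le_of_eq ?_)
  rw [nrm2, eLpNorm_norm, nrm2]

theorem nrm2_eq_zero (hf : MemLp f 2 μ) (h : nrm2 μ f = 0) : f =ᵐ[μ] 0 := by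
  rw [nrm2, ENNReal.toReal_eq_zero_iff] at h
  exact (eLpNorm_eq_zero_iff hf.1 two_ne_zero).1 (h.resolve_right hf.2.ne)

section Inner

variable {W : Type*} [NormedAddCommGroup W] [InnerProductSpace ℂ W] {a b c : Ω → W}

theorem memLp_inner (ha : MemLp a 2 μ) (hb : MemLp b 2 μ) :
    MemLp (fun x => inner ℂ (a x) (b x)) 1 μ := by
  refine ⟨ha.1.inner hb.1, ?_⟩
  refine (eLpNorm_le_eLpNorm_mul_eLpNorm_of_nnnorm ha.1 hb.1 (fun p q => inner ℂ p q) 1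
    (p := 2) (q := 2) (r := 1) (Filter.Eventually.of_forall fun x => ?_)).trans_lt ?_
  · rw [one_mul]; exact nnnorm_inner_le_nnnorm _ _
  · rw [ENNReal.coe_one, one_mul]; exact ENNReal.mul_lt_top ha.2 hb.2

theorem integrable_inner (ha : MemLp a 2 μ) (hb : MemLp b 2 μ) :
    Integrable (fun x => inner ℂ (a x) (b x)) μ := memLp_one_iff_integrable.1 (memLp_inner ha hb)

theorem norm_integral_inner_le (ha : MemLp a 2 μ) (hb : MemLp b 2 μ) :
    ‖∫ x, inner ℂ (a x) (b x) ∂μ‖ ≤ nrm2 μ a * nrm2 μ b := by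
  rw [← toReal_enorm, nrm2, nrm2, ← ENNReal.toReal_mul]
  refine ENNReal.toReal_mono (ENNReal.mul_lt_top ha.2 hb.2).ne ?_
  refine (enorm_integral_le_lintegral_enorm _).trans ?_
  rw [← eLpNorm_one_eq_lintegral_enorm]
  have := eLpNorm_le_eLpNorm_mul_eLpNorm_of_nnnorm (μ := μ) ha.1 hb.1 (fun p q => inner ℂ p q) 1
    (p := 2) (q := 2) (r := 1) (Filter.Eventually.of_forall fun x => ?_)
  · rwa [ENNReal.coe_one, one_mul] at this
  · rw [one_mul]; exact nnnorm_inner_le_nnnorm _ _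

theorem integral_inner_add (ha : MemLp a 2 μ) (hb : MemLp b 2 μ) (hc : MemLp c 2 μ) :
    ∫ x, inner ℂ (a x) (b x + c x) ∂μ = ∫ x, inner ℂ (a x) (b x) ∂μ + ∫ x, inner ℂ (a x) (c x) ∂μ := by
  simp only [inner_add_right]
  exact integral_add (integrable_inner ha hb) (integrable_inner ha hc)

theorem integral_inner_sub (ha : MemLp a 2 μ) (hb : MemLp b 2 μ) (hc : MemLp c 2 μ) :
    ∫ x, inner ℂ (a x) (b x - c x) ∂μ = ∫ x, inner ℂ (a x) (b x) ∂μ - ∫ x, inner ℂ (a x) (c x) ∂μ := by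
  simp only [inner_sub_right]
  exact integral_sub (integrable_inner ha hb) (integrable_inner ha hc)

theorem integral_sub_inner (ha : MemLp a 2 μ) (hb : MemLp b 2 μ) (hc : MemLp c 2 μ) :
    ∫ x, inner ℂ (a x - b x) (c x) ∂μ = ∫ x, inner ℂ (a x) (c x) ∂μ - ∫ x, inner ℂ (b x) (c x) ∂μ := by
  simp only [inner_sub_left]
  exact integral_sub (integrable_inner ha hc) (integrable_inner hb hc)

theorem integral_inner_sum {ι : Type*} (s : Finset ι) {b : ι → Ω → W} (ha : MemLp a 2 μ)
    (hb : ∀ i ∈ s, MemLp (b i) 2 μ) :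
    ∫ x, inner ℂ (a x) (∑ i ∈ s, b i x) ∂μ = ∑ i ∈ s, ∫ x, inner ℂ (a x) (b i x) ∂μ := by
  simp only [inner_sum]
  exact integral_finsetSum _ fun i hi => integrable_inner ha (hb i hi)

theorem integral_inner_self (ha : MemLp a 2 μ) :
    ∫ x, inner ℂ (a x) (a x) ∂μ = ((nrm2 μ a ^ 2 : ℝ) : ℂ) := by
  rw [nrm2_sq ha]
  refine Eq.trans ?_ (integral_ofReal (𝕜 := ℂ))
  refine integral_congr_ae (Filter.Eventually.of_forall fun x => ?_)
  simp [inner_self_eq_norm_sq_to_K]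

theorem integral_inner_conj : ∫ x, inner ℂ (a x) (b x) ∂μ =
    (starRingEnd ℂ) (∫ x, inner ℂ (b x) (a x) ∂μ) := by
  rw [← integral_conj]
  simp only [inner_conj_symm]

end Inner

/-- Convergence in `L²(μ)`. -/
structure L2Tendsto (μ : Measure Ω) (fj : ℕ → Ω → X) (f : Ω → X) : Prop where
  memLp : ∀ j, MemLp (fj j) 2 μ
  memLp_lim : MemLp f 2 μ
  tendsto : Filter.Tendsto (fun j => nrm2 μ fun x => fj j x - f x) Filter.atTop (nhds 0)

namespace L2Tendsto

variable {fj gj : ℕ → Ω → X}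

theorem const (hf : MemLp f 2 μ) : L2Tendsto μ (fun _ => f) f :=
  ⟨fun _ => hf, hf, by simp [nrm2_zero]⟩

theorem congr (h : L2Tendsto μ fj f) (hj : ∀ j, fj j =ᵐ[μ] gj j) (hl : f =ᵐ[μ] g) :
    L2Tendsto μ gj g := by
  refine ⟨fun j => (h.memLp j).ae_eq (hj j), h.memLp_lim.ae_eq hl, ?_⟩
  refine h.tendsto.congr fun j => nrm2_congr ?_
  filter_upwards [hj j, hl] with x h1 h2
  rw [h1, h2]

theorem nrm2_tendsto (h : L2Tendsto μ fj f) :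
    Filter.Tendsto (fun j => nrm2 μ (fj j)) Filter.atTop (nhds (nrm2 μ f)) := by
  rw [tendsto_iff_norm_sub_tendsto_zero]
  refine squeeze_zero (fun _ => norm_nonneg _) (fun j => ?_) h.tendsto
  rw [Real.norm_eq_abs, abs_sub_le_iff]
  constructor
  · have := nrm2_add_le ((h.memLp j).sub h.memLp_lim) h.memLp_lim
    simp only [Pi.sub_apply, sub_add_cancel] at this
    have h2 : nrm2 μ (fj j - f) = nrm2 μ (fun x => fj j x - f x) := rfl
    linarith
  · have := nrm2_sub_le (h.memLp j) ((h.memLp j).sub h.memLp_lim)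
    simp only [Pi.sub_apply, sub_sub_cancel] at this
    have h2 : nrm2 μ (fj j - f) = nrm2 μ (fun x => fj j x - f x) := rfl
    linarith

/-- A Lipschitz map of `L²` preserves convergence. -/
theorem map {Ω' : Type*} [MeasurableSpace Ω'] {μ' : Measure Ω'} (h : L2Tendsto μ fj f)
    (T : (Ω → X) → (Ω' → Z)) (C : ℝ) (hm : ∀ f, MemLp f 2 μ → MemLp (T f) 2 μ')
    (hC : ∀ f g, MemLp f 2 μ → MemLp g 2 μ →
      nrm2 μ' (fun x => T f x - T g x) ≤ C * nrm2 μ (fun x => f x - g x)) :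
    L2Tendsto μ' (fun j => T (fj j)) (T f) := by
  refine ⟨fun j => hm _ (h.memLp j), hm _ h.memLp_lim, ?_⟩
  refine squeeze_zero (fun _ => nrm2_nonneg) (fun j => hC _ _ (h.memLp j) h.memLp_lim) ?_
  simpa using h.tendsto.const_mul C

theorem add (h : L2Tendsto μ fj f) (h' : L2Tendsto μ gj g) :
    L2Tendsto μ (fun j x => fj j x + gj j x) (fun x => f x + g x) := by
  refine ⟨fun j => (h.memLp j).add (h'.memLp j), h.memLp_lim.add h'.memLp_lim, ?_⟩
  refine squeeze_zero (fun _ => nrm2_nonneg) (fun j => ?_) (by simpa using h.tendsto.add h'.tendsto)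
  have := nrm2_add_le ((h.memLp j).sub h.memLp_lim) ((h'.memLp j).sub h'.memLp_lim)
  simp only [Pi.sub_apply] at this
  refine (le_of_eq (congrArg _ ?_)).trans this
  funext x
  abel

theorem sum {ι : Type*} (s : Finset ι) {fj : ι → ℕ → Ω → X} {f : ι → Ω → X}
    (h : ∀ i ∈ s, L2Tendsto μ (fj i) (f i)) :
    L2Tendsto μ (fun j x => ∑ i ∈ s, fj i j x) (fun x => ∑ i ∈ s, f i x) := by
  classical
  induction s using Finset.induction_on with
  | empty =>
    simp only [Finset.sum_empty]
    exact const MemLp.zero'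
  | insert i s hi ih =>
    simp only [Finset.sum_insert hi]
    exact (h i (Finset.mem_insert_self i s)).add
      (ih fun j hj => h j (Finset.mem_insert_of_mem hj))

theorem clm [NormedSpace ℝ X] [NormedSpace ℝ Z] (h : L2Tendsto μ fj f) (L : X →L[ℝ] Z) :
    L2Tendsto μ (fun j x => L (fj j x)) (fun x => L (f x)) := by
  refine h.map (fun f x => L (f x)) ‖L‖ (fun f hf => L.comp_memLp' hf) fun f g hf hg => ?_
  refine nrm2_le_mul (norm_nonneg _) (hf.sub hg) (Filter.Eventually.of_forall fun x => ?_)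
  rw [← map_sub]
  exact L.le_opNorm _

variable {W : Type*} [NormedAddCommGroup W] [InnerProductSpace ℂ W] {aj bj : ℕ → Ω → W}
  {a b : Ω → W}

theorem inner (h : L2Tendsto μ aj a) (h' : L2Tendsto μ bj b) :
    Filter.Tendsto (fun j => ∫ x, Inner.inner ℂ (aj j x) (bj j x) ∂μ) Filter.atTop
      (nhds (∫ x, Inner.inner ℂ (a x) (b x) ∂μ)) := by
  rw [tendsto_iff_norm_sub_tendsto_zero]
  have hlim : Filter.Tendsto (fun j => nrm2 μ (fun x => aj j x - a x) * nrm2 μ (bj j) +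
      nrm2 μ a * nrm2 μ (fun x => bj j x - b x)) Filter.atTop (nhds 0) := by
    simpa using (h.tendsto.mul h'.nrm2_tendsto).add (h'.tendsto.const_mul (nrm2 μ a))
  refine squeeze_zero (fun _ => norm_nonneg _) (fun j => ?_) hlim
  have e : ∫ x, Inner.inner ℂ (aj j x) (bj j x) ∂μ - ∫ x, Inner.inner ℂ (a x) (b x) ∂μ =
      ∫ x, Inner.inner ℂ (aj j x - a x) (bj j x) ∂μ +
        ∫ x, Inner.inner ℂ (a x) (bj j x - b x) ∂μ := by
    rw [integral_sub_inner (h.memLp j) h.memLp_lim (h'.memLp j),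
      integral_inner_sub h.memLp_lim (h'.memLp j) h'.memLp_lim]
    ring
  rw [e]
  exact (norm_add_le _ _).trans (add_le_add
    (norm_integral_inner_le ((h.memLp j).sub h.memLp_lim) (h'.memLp j))
    (norm_integral_inner_le h.memLp_lim ((h'.memLp j).sub h'.memLp_lim)))

end L2Tendsto

/-- `L²` convergence implies convergence in the sense of distributions. -/
theorem L2Tendsto.tendsto_test {d : ℕ} {F : Type*} [NormedAddCommGroup F] [NormedSpace ℝ F]
    {fj : ℕ → E d → F} {f : E d → F} (h : L2Tendsto volume fj f) {φ : E d → ℝ}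
    (hφ : Continuous φ) (hc : HasCompactSupport φ) :
    Filter.Tendsto (fun j => ∫ x, φ x • fj j x) Filter.atTop (nhds (∫ x, φ x • f x)) := by
  have hφ2 : MemLp φ 2 volume := hφ.memLp_of_hasCompactSupport hc
  rw [tendsto_iff_norm_sub_tendsto_zero]
  refine squeeze_zero (fun _ => norm_nonneg _) (fun j => ?_)
    (by simpa using h.tendsto.const_mul (nrm2 volume φ))
  rw [← integral_sub (integrable_test_smul hφ hc ((h.memLp j).locallyIntegrable one_le_two))
    (integrable_test_smul hφ hc (h.memLp_lim.locallyIntegrable one_le_two))]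
  simp only [← smul_sub]
  have hd := (h.memLp j).sub h.memLp_lim
  rw [← toReal_enorm, nrm2, nrm2, ← ENNReal.toReal_mul]
  refine ENNReal.toReal_mono (ENNReal.mul_lt_top hφ2.2 hd.2).ne ?_
  refine (enorm_integral_le_lintegral_enorm _).trans ?_
  rw [← eLpNorm_one_eq_lintegral_enorm]
  have := eLpNorm_le_eLpNorm_mul_eLpNorm_of_nnnorm (μ := volume) hφ2.1 hd.1 (fun p q => p • q) 1
    (p := 2) (q := 2) (r := 1) (Filter.Eventually.of_forall fun x => ?_)
  · rw [ENNReal.coe_one, one_mul] at this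
    exact this
  · rw [one_mul, nnnorm_smul]

theorem HasWeakDeriv.of_L2Tendsto {d : ℕ} {F : Type*} [NormedAddCommGroup F] [NormedSpace ℝ F]
    {γ : Fin d → ℕ} {uj wj : ℕ → E d → F} {u w : E d → F} (h : ∀ j, HasWeakDeriv γ (uj j) (wj j))
    (hu : L2Tendsto volume uj u) (hw : L2Tendsto volume wj w) : HasWeakDeriv γ u w :=
  HasWeakDeriv.of_tendsto h (hu.memLp_lim.locallyIntegrable one_le_two)
    (hw.memLp_lim.locallyIntegrable one_le_two) (fun _ => hu.tendsto_test)
    (fun _ => hw.tendsto_test)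

/-- A Cauchy sequence of `L²` converges. -/
theorem exists_L2Tendsto [CompleteSpace X] {fj : ℕ → Ω → X} (hf : ∀ j, MemLp (fj j) 2 μ)
    (b : ℕ → ℝ) (hb : Filter.Tendsto b Filter.atTop (nhds 0))
    (h : ∀ i j, nrm2 μ (fun x => fj i x - fj j x) ≤ b i + b j) :
    ∃ f, L2Tendsto μ fj f := by
  have hc : CauchySeq fun j => (hf j).toLp (fj j) := by
    rw [Metric.cauchySeq_iff]
    intro ε hε
    obtain ⟨n, hn⟩ := (Metric.tendsto_atTop.1 hb) (ε / 2) (half_pos hε)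
    refine ⟨n, fun i hi j hj => ?_⟩
    rw [dist_eq_norm, ← MemLp.toLp_sub, Lp.norm_toLp]
    have h1 := hn i hi
    have h2 := hn j hj
    rw [Real.dist_eq, sub_zero] at h1 h2
    exact (h i j).trans_lt (by linarith [le_abs_self (b i), le_abs_self (b j)])
  obtain ⟨F, hF⟩ := cauchySeq_tendsto_of_complete hc
  refine ⟨F, hf, Lp.memLp F, ?_⟩
  rw [tendsto_iff_norm_sub_tendsto_zero] at hF
  refine hF.congr fun j => ?_
  rw [Lp.norm_def, nrm2]
  congr 1
  refine eLpNorm_congr_ae ?_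
  filter_upwards [Lp.coeFn_sub ((hf j).toLp (fj j)) F, (hf j).coeFn_toLp] with x h1 h2
  rw [h1, Pi.sub_apply, h2]

end L2

/-! ### Averages in `L²` -/

section AvgL2

variable {d : ℕ} {F : Type*} [NormedAddCommGroup F] [NormedSpace ℝ F]

/-- Jensen's inequality for the square of the norm. -/
theorem enorm_integral_sq_le {H : Type*} [MeasurableSpace H] (ν : Measure H)
    [IsProbabilityMeasure ν] (k : H → F) : ‖∫ h, k h ∂ν‖ₑ ^ 2 ≤ ∫⁻ h, ‖k h‖ₑ ^ 2 ∂ν := by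
  by_cases hk : Integrable k ν
  · have h1 : ‖∫ h, k h ∂ν‖ₑ ≤ eLpNorm k 2 ν := by
      refine (enorm_integral_le_lintegral_enorm _).trans ?_
      rw [← eLpNorm_one_eq_lintegral_enorm]
      exact eLpNorm_le_eLpNorm_of_exponent_le one_le_two hk.1
    rw [← eLpNorm_two_sq]
    gcongr
  · simp [integral_undef hk]

theorem aemeasurable_enorm_sub_prod {X : Type*} [NormedAddCommGroup X] {u : E d → X} (hu : AEStronglyMeasurable u volume)
    (ν : Measure (E d)) [SFinite ν] (S : Set (E d)) :
    AEMeasurable (fun p : E d × E d => ‖u (p.1 - p.2)‖ₑ ^ 2) ((volume.restrict S).prod ν) := by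
  refine ((aestronglyMeasurable_sub_prod hu ν).enorm.pow_const 2).mono_ac ?_
  exact (Measure.restrict_le_self.absolutelyContinuous).prod Measure.AbsolutelyContinuous.rfl

theorem lintegral_avg_sq_le {u : E d → F} (hu : AEStronglyMeasurable u volume)
    (ν : Measure (E d)) [IsProbabilityMeasure ν] (S : Set (E d)) :
    ∫⁻ x in S, ‖avg ν u x‖ₑ ^ 2 ≤ ∫⁻ h, (∫⁻ x in S, ‖u (x - h)‖ₑ ^ 2) ∂ν := by
  refine (lintegral_mono fun x => enorm_integral_sq_le ν _).trans ?_
  rw [lintegral_lintegral_swap (aemeasurable_enorm_sub_prod hu ν S)]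

theorem eLpNorm_avg_le {u : E d → F} (hu : AEStronglyMeasurable u volume)
    (ν : Measure (E d)) [IsProbabilityMeasure ν] :
    eLpNorm (avg ν u) 2 volume ≤ eLpNorm u 2 volume := by
  refine (ENNReal.pow_le_pow_left_iff two_ne_zero).1 ?_
  rw [eLpNorm_two_sq, eLpNorm_two_sq]
  have := lintegral_avg_sq_le hu ν Set.univ
  simp only [Measure.restrict_univ] at this
  refine this.trans ?_
  have h2 : ∀ h : E d, ∫⁻ x, ‖u (x - h)‖ₑ ^ 2 = ∫⁻ x, ‖u x‖ₑ ^ 2 := fun h =>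
    lintegral_sub_right_eq_self (fun x => ‖u x‖ₑ ^ 2) h
  simp only [h2, lintegral_const, measure_univ, mul_one, le_refl]

theorem memLp_avg {ν : Measure (E d)} [IsProbabilityMeasure ν] {R : ℝ}
    (hν : ∀ᵐ h ∂ν, ‖h‖ ≤ R) {u : E d → F} (hu : MemLp u 2 volume) : MemLp (avg ν u) 2 volume :=
  ⟨(locallyIntegrable_avg hν (hu.locallyIntegrable one_le_two)).aestronglyMeasurable,
    (eLpNorm_avg_le hu.1 ν).trans_lt hu.2⟩

theorem nrm2_avg_le {ν : Measure (E d)} [IsProbabilityMeasure ν] {u : E d → F}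
    (hu : MemLp u 2 volume) : nrm2 volume (avg ν u) ≤ nrm2 volume u :=
  ENNReal.toReal_mono hu.2.ne (eLpNorm_avg_le hu.1 ν)

theorem integrable_sub_of_locallyIntegrable {ν : Measure (E d)} [IsFiniteMeasure ν] {R : ℝ}
    (hν : ∀ᵐ h ∂ν, ‖h‖ ≤ R) {u : E d → F} (hu : LocallyIntegrable u) :
    ∀ᵐ x, Integrable (fun h => u (x - h)) ν := by
  have key : ∀ n : ℕ, ∀ᵐ x, x ∈ Metric.closedBall (0 : E d) n →
      Integrable (fun h => u (x - h)) ν := by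
    intro n
    obtain ⟨f, hf1, -, hfc, -⟩ := exists_continuous_one_zero_of_isCompact
      (isCompact_closedBall (0 : E d) n) isClosed_empty (Set.disjoint_empty _)
    filter_upwards [(integrable_test_smul_sub_prod hν hu f.continuous hfc).prod_right_ae] with x hx hxn
    simpa [hf1 hxn] using hx
  filter_upwards [ae_all_iff.2 key] with x hx
  obtain ⟨n, hn⟩ := exists_nat_ge ‖x‖
  exact hx n (by simpa using hn)

/-- If the translates of `u` by vectors from the support of `ν` are close to `u`, so is the
average. -/
theorem nrm2_avg_sub_le {ν : Measure (E d)} [IsProbabilityMeasure ν] {R : ℝ}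
    (hν : ∀ᵐ h ∂ν, ‖h‖ ≤ R) [CompleteSpace F] {u : E d → F} (hu : MemLp u 2 volume) {c : ℝ}
    (hc : 0 ≤ c)
    (h : ∀ᵐ h ∂ν, nrm2 volume (fun x => u (x - h) - u x) ≤ c) :
    nrm2 volume (fun x => avg ν u x - u x) ≤ c := by
  have hl := hu.locallyIntegrable one_le_two
  refine nrm2_le_of_eLpNorm hc (nrm2_le_of_lintegral hc ?_)
  have h1 : ∀ᵐ x, ‖avg ν u x - u x‖ₑ ^ 2 ≤ ∫⁻ h, ‖u (x - h) - u x‖ₑ ^ 2 ∂ν := by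
    filter_upwards [integrable_sub_of_locallyIntegrable hν hl] with x hx
    have : avg ν u x - u x = ∫ h, (u (x - h) - u x) ∂ν := by
      rw [integral_sub hx (integrable_const _)]
      simp [avg]
    rw [this]
    exact enorm_integral_sq_le ν _
  have hm : AEMeasurable (fun p : E d × E d => ‖u (p.1 - p.2) - u p.1‖ₑ ^ 2) (volume.prod ν) :=
    ((aestronglyMeasurable_sub_prod hu.1 ν).sub hu.1.comp_fst).enorm.pow_const 2
  refine (lintegral_mono_ae h1).trans ?_
  rw [lintegral_lintegral_swap hm]
  have h2 : ∀ᵐ h ∂ν, ∫⁻ x, ‖u (x - h) - u x‖ₑ ^ 2 ≤ ENNReal.ofReal (c ^ 2) := by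
    filter_upwards [h] with h hh
    have hmem : MemLp (fun x => u (x - h) - u x) 2 volume :=
      (hu.comp_measurePreserving (measurePreserving_sub_right volume h)).sub hu
    rw [lintegral_eq_nrm2 hmem]
    exact ENNReal.ofReal_le_ofReal (pow_le_pow_left₀ nrm2_nonneg hh 2)
  refine (lintegral_mono_ae h2).trans ?_
  simp

/-- Translations act continuously on `L²`. -/
theorem tendsto_translate {X : Type*} [NormedAddCommGroup X] {u : E d → X} (hu : MemLp u 2 volume) :
    Filter.Tendsto (fun h : E d => nrm2 volume (fun x => u (x - h) - u x)) (nhds 0) (nhds 0) := by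
  let g : E d → C(E d, E d) := fun h => ⟨fun x => x - h, by fun_prop⟩
  have hg : Filter.Tendsto g (nhds 0) (nhds (g 0)) := by
    have : Continuous g := ContinuousMap.continuous_of_continuous_uncurry g (by
      change Continuous fun p : E d × E d => p.2 - p.1
      fun_prop)
    exact this.tendsto 0
  have hgm : ∀ h, MeasurePreserving (g h) (volume : Measure (E d)) volume := fun h =>
    measurePreserving_sub_right volume h
  have key := Filter.Tendsto.compMeasurePreservingLp (l := nhds (0 : E d)) (p := 2)
    (f := fun _ => hu.toLp u) tendsto_const_nhds hg hgm (hgm 0) (by norm_num)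
  rw [tendsto_iff_norm_sub_tendsto_zero] at key
  refine key.congr fun h => ?_
  rw [Lp.norm_def, nrm2]
  congr 1
  refine eLpNorm_congr_ae ?_
  filter_upwards [Lp.coeFn_sub (Lp.compMeasurePreserving (g h) (hgm h) (hu.toLp u))
    (Lp.compMeasurePreserving (g 0) (hgm 0) (hu.toLp u)),
    Lp.coeFn_compMeasurePreserving (hu.toLp u) (hgm h),
    Lp.coeFn_compMeasurePreserving (hu.toLp u) (hgm 0),
    (hgm h).quasiMeasurePreserving.ae_eq_comp hu.coeFn_toLp, hu.coeFn_toLp] with x h1 h2 h3 h4 h5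
  rw [h1, Pi.sub_apply, h2, h3, h4]
  simp only [Function.comp_apply, g, ContinuousMap.coe_mk, sub_zero, h5]

end AvgL2

/-! ### Mollification and density of test functions -/

section Mollify

variable {d : ℕ} {F : Type*} [NormedAddCommGroup F] [NormedSpace ℝ F]

/-- The convolution `∫ k(h) u(x - h) dh` with a scalar kernel. -/
noncomputable def conv (k : E d → ℝ) (u : E d → F) : E d → F :=
  convolution k u (ContinuousLinearMap.lsmul ℝ ℝ) volume

theorem conv_apply (k : E d → ℝ) (u : E d → F) (x : E d) :
    conv k u x = ∫ h, k h • u (x - h) := by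
  simp [conv, convolution_def]

theorem smooth_conv {k : E d → ℝ} (hk : Smooth k) (hc : HasCompactSupport k) {u : E d → F}
    (hu : LocallyIntegrable u) : Smooth (conv k u) :=
  hc.contDiff_convolution_left _ hk hu

theorem pderiv_conv {k : E d → ℝ} (hk : Smooth k) (hc : HasCompactSupport k) {u : E d → F}
    (hu : LocallyIntegrable u) [CompleteSpace F] (i : Fin d) :
    pderiv i (conv k u) = conv (pderiv i k) u := by
  funext x
  have hk1 : ContDiff ℝ 1 k := hk.of_le (by exact_mod_cast le_top)
  have h1 := (hc.hasFDerivAt_convolution_left (ContinuousLinearMap.lsmul ℝ ℝ) hk1 hu x).fderiv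
  have h2 := (hc.fderiv (𝕜 := ℝ)).convolutionExists_left
    (ContinuousLinearMap.precompL (E d) (ContinuousLinearMap.lsmul ℝ ℝ : ℝ →L[ℝ] F →L[ℝ] F))
    (hk1.continuous_fderiv one_ne_zero) hu x
  unfold pderiv
  change fderiv ℝ (convolution k u (ContinuousLinearMap.lsmul ℝ ℝ) volume) x _ = _
  rw [h1, convolution_def, ContinuousLinearMap.integral_apply h2, conv_apply]
  simp [ContinuousLinearMap.precompL_apply]

theorem multiDeriv_conv {k : E d → ℝ} (hk : Smooth k) (hc : HasCompactSupport k) {u : E d → F}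
    (hu : LocallyIntegrable u) [CompleteSpace F] (γ : Fin d → ℕ) :
    multiDeriv γ (conv k u) = conv (multiDeriv γ k) u := by
  induction γ using multiIdx_induction with
  | h0 => simp [multiDeriv_zero]
  | hs μ i ih =>
    rw [multiDeriv_add_unitIdx (smooth_conv hk hc hu), multiDeriv_add_unitIdx hk, ih,
      pderiv_conv (hk.multiDeriv μ) (hasCompactSupport_multiDeriv hk hc μ) hu]

theorem memLp_conv {k : E d → ℝ} (hk : Smooth k) (hc : HasCompactSupport k) {u : E d → F}
    (hu : MemLp u 2 volume) : MemLp (conv k u) 2 volume := by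
  have hl := hu.locallyIntegrable one_le_two
  obtain ⟨C, hC⟩ := hk.continuous.bounded_above_of_compact_support hc
  obtain ⟨r, hr⟩ := hc.isCompact.isBounded.subset_closedBall (0 : E d)
  set R := max r 1
  set B := Metric.closedBall (0 : E d) R
  have hB0 : volume B ≠ 0 :=
    (Metric.measure_closedBall_pos volume 0 (lt_max_of_lt_right one_pos)).ne'
  have hBt : volume B ≠ ⊤ := measure_closedBall_lt_top.ne
  set ν : Measure (E d) := (volume B)⁻¹ • volume.restrict B with hν
  have hprob : IsProbabilityMeasure ν := ⟨by simp [hν, ENNReal.inv_mul_cancel hB0 hBt]⟩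
  have hνb : ∀ᵐ h ∂ν, ‖h‖ ≤ R := by
    apply Measure.ae_smul_measure
    filter_upwards [ae_restrict_mem measurableSet_closedBall] with h hh
    simpa [B] using hh
  have hn : LocallyIntegrable (fun x => ‖u x‖) :=
    hu.norm.locallyIntegrable one_le_two
  refine MemLp.of_le_mul (c := C * (volume B).toReal) (memLp_avg hνb hu.norm)
    (smooth_conv hk hc hl).continuous.aestronglyMeasurable ?_
  filter_upwards [integrable_sub_of_locallyIntegrable hνb hn] with x hx
  have hx' : IntegrableOn (fun h => ‖u (x - h)‖) B := by
    have := (hx.smul_measure hBt)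
    rwa [hν, smul_smul, ENNReal.mul_inv_cancel hB0 hBt, one_smul] at this
  have hav : avg ν (fun x => ‖u x‖) x = (volume B).toReal⁻¹ * ∫ h in B, ‖u (x - h)‖ := by
    simp [avg, hν, integral_smul_measure]
  have hC0 : 0 ≤ C := (norm_nonneg _).trans (hC 0)
  rw [hav, norm_mul, Real.norm_of_nonneg (by positivity),
    Real.norm_of_nonneg (integral_nonneg fun _ => norm_nonneg _), mul_assoc, ← mul_assoc _ _⁻¹,
    mul_inv_cancel₀ (ENNReal.toReal_ne_zero.2 ⟨hB0, hBt⟩), one_mul, ← integral_const_mul,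
    ← integral_indicator measurableSet_closedBall, conv_apply]
  refine norm_integral_le_of_norm_le ((integrable_indicator_iff
    measurableSet_closedBall).2 (hx'.const_mul C)) (Filter.Eventually.of_forall fun h => ?_)
  by_cases hh : h ∈ tsupport k
  · have hb : h ∈ B := Metric.closedBall_subset_closedBall (le_max_left _ _) (hr hh)
    rw [Set.indicator_of_mem hb, norm_smul]
    gcongr
    exact hC h
  · rw [image_eq_zero_of_notMem_tsupport hh, zero_smul, norm_zero]
    exact Set.indicator_nonneg (fun _ _ => by positivity) _

/-- A smooth bump function supported in the ball of radius `1 / (j + 1)`. -/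
noncomputable def mollBump (d j : ℕ) : ContDiffBump (0 : E d) where
  rIn := 1 / (2 * (j + 1))
  rOut := 1 / (j + 1)
  rIn_pos := by positivity
  rIn_lt_rOut := by
    apply one_div_lt_one_div_of_lt <;> first | positivity | linarith [Nat.cast_nonneg (α := ℝ) j]

/-- The mollifying kernel. -/
noncomputable def mollKernel (d j : ℕ) : E d → ℝ := (mollBump d j).normed volume

/-- The probability measure whose density is the mollifying kernel. -/
noncomputable def mollMeasure (d j : ℕ) : Measure (E d) :=
  volume.withDensity fun x => ENNReal.ofReal (mollKernel d j x)

theorem smooth_mollKernel (d j : ℕ) : Smooth (mollKernel d j) := (mollBump d j).contDiff_normed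

theorem hasCompactSupport_mollKernel (d j : ℕ) : HasCompactSupport (mollKernel d j) :=
  (mollBump d j).hasCompactSupport_normed

instance (d j : ℕ) : IsProbabilityMeasure (mollMeasure d j) := by
  constructor
  rw [mollMeasure, withDensity_apply _ MeasurableSet.univ, Measure.restrict_univ,
    ← ofReal_integral_eq_lintegral_ofReal]
  · rw [mollKernel, (mollBump d j).integral_normed, ENNReal.ofReal_one]
  · exact (smooth_mollKernel d j).continuous.integrable_of_hasCompactSupport
      (hasCompactSupport_mollKernel d j)
  · exact Filter.Eventually.of_forall fun x => (mollBump d j).nonneg_normed x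

theorem mollMeasure_support (d j : ℕ) : ∀ᵐ h ∂(mollMeasure d j), ‖h‖ ≤ 1 / (j + 1 : ℝ) := by
  rw [mollMeasure, ae_withDensity_iff
    ((smooth_mollKernel d j).continuous.measurable.ennreal_ofReal)]
  refine Filter.Eventually.of_forall fun x hx => ?_
  have : x ∈ Function.support (mollKernel d j) := by
    intro h0
    simp [h0] at hx
  rw [mollKernel, (mollBump d j).support_normed_eq, mem_ball_zero_iff] at this
  exact this.le

theorem avg_mollMeasure (j : ℕ) (u : E d → F) : avg (mollMeasure d j) u = conv (mollKernel d j) u := by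
  funext x
  rw [avg, mollMeasure, integral_withDensity_eq_integral_toReal_smul
    ((smooth_mollKernel d j).continuous.measurable.ennreal_ofReal)
    (Filter.Eventually.of_forall fun _ => ENNReal.ofReal_lt_top), conv_apply]
  refine integral_congr_ae (Filter.Eventually.of_forall fun h => ?_)
  have h0 : 0 ≤ mollKernel d j h := (mollBump d j).nonneg_normed h
  simp only
  rw [ENNReal.toReal_ofReal h0]

theorem memH_mollify [CompleteSpace F] (j m : ℕ) {u : E d → F} (hu : MemLp u 2 volume) :
    MemH m (avg (mollMeasure d j) u) := by
  intro γ _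
  have hl := hu.locallyIntegrable one_le_two
  have hs := smooth_conv (smooth_mollKernel d j) (hasCompactSupport_mollKernel d j) hl
  refine ⟨multiDeriv γ (conv (mollKernel d j) u), ?_, ?_⟩
  · rw [avg_mollMeasure]
    exact HasWeakDeriv.of_smooth hs γ
  · rw [multiDeriv_conv (smooth_mollKernel d j) (hasCompactSupport_mollKernel d j) hl]
    exact memLp_conv ((smooth_mollKernel d j).multiDeriv γ)
      (hasCompactSupport_multiDeriv (smooth_mollKernel d j) (hasCompactSupport_mollKernel d j) γ) hu

theorem tendsto_mollify [CompleteSpace F] {u : E d → F} (hu : MemLp u 2 volume) :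
    L2Tendsto volume (fun j => avg (mollMeasure d j) u) u := by
  refine ⟨fun j => memLp_avg (mollMeasure_support d j) hu, hu, ?_⟩
  rw [Metric.tendsto_atTop]
  intro ε hε
  obtain ⟨δ, hδ, h⟩ := Metric.tendsto_nhds_nhds.1 (tendsto_translate hu) (ε / 2) (half_pos hε)
  obtain ⟨n, hn⟩ := exists_nat_one_div_lt hδ
  refine ⟨n, fun j hj => ?_⟩
  rw [Real.dist_eq, sub_zero, abs_of_nonneg nrm2_nonneg]
  refine lt_of_le_of_lt (nrm2_avg_sub_le (mollMeasure_support d j) hu (half_pos hε).le ?_)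
    (half_lt_self hε)
  filter_upwards [mollMeasure_support d j] with x hx
  have hx' : dist x 0 < δ := by
    rw [dist_zero_right]
    refine hx.trans_lt (lt_of_le_of_lt ?_ hn)
    exact one_div_le_one_div_of_le (by positivity) (by gcongr)
  have := h hx'
  rw [Real.dist_eq, sub_zero, abs_of_nonneg nrm2_nonneg] at this
  exact this.le

/-- Dominated convergence for products of an `L²` function and bounded factors. -/
theorem L2Tendsto.smul_bounded {g : E d → F} (hg : MemLp g 2 volume) {a : ℕ → E d → ℝ} {c C : ℝ}
    (ha : ∀ j, Continuous (a j)) (hC : ∀ j x, |a j x| ≤ C)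
    (hlim : ∀ x, Filter.Tendsto (fun j => a j x) Filter.atTop (nhds c)) :
    L2Tendsto volume (fun j x => a j x • g x) (fun x => c • g x) := by
  have hm : ∀ j, MemLp (fun x => a j x • g x) 2 volume := fun j =>
    MemLp.of_le_mul (c := C) hg ((ha j).aestronglyMeasurable.smul hg.1)
      (Filter.Eventually.of_forall fun x => by
        rw [norm_smul]; exact mul_le_mul_of_nonneg_right (hC j x) (norm_nonneg _))
  have hm' : MemLp (fun x => c • g x) 2 volume := hg.const_smul c
  refine ⟨hm, hm', ?_⟩
  have hsq : Filter.Tendsto (fun j => ∫ x, ‖a j x • g x - c • g x‖ ^ 2) Filter.atTop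
      (nhds (∫ _ : E d, (0 : ℝ))) := by
    refine tendsto_integral_of_dominated_convergence (fun x => (C + |c|) ^ 2 * ‖g x‖ ^ 2)
      (fun j => (((hm j).sub hm').1.norm.pow 2)) ((integrable_norm_sq hg).const_mul _)
      (fun j => Filter.Eventually.of_forall fun x => ?_)
      (Filter.Eventually.of_forall fun x => ?_)
    · rw [← sub_smul, norm_smul, mul_pow, norm_mul, norm_pow, norm_pow, norm_norm, norm_norm]
      gcongr
      exact (norm_sub_le _ _).trans (add_le_add (hC j x) le_rfl)
    · have h1 : Filter.Tendsto (fun j => a j x • g x - c • g x) Filter.atTop (nhds 0) := by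
        simpa using ((hlim x).smul_const (g x)).sub_const (c • g x)
      simpa using h1.norm.pow 2
  have h2 : Filter.Tendsto (fun j => Real.sqrt (∫ x, ‖a j x • g x - c • g x‖ ^ 2)) Filter.atTop
      (nhds 0) := by
    have := (Real.continuous_sqrt.tendsto _).comp hsq
    simp only [integral_zero, Real.sqrt_zero] at this
    exact this
  refine h2.congr fun j => ?_
  rw [← nrm2_sq (f := fun x => a j x • g x - c • g x) ((hm j).sub hm'),
    Real.sqrt_sq nrm2_nonneg]

/-- The finite set of multiindices of order at most `k`. -/
def idxLE (d k : ℕ) : Finset (Fin d → ℕ) :=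
  (Finset.Iic fun _ => k).filter fun γ => ∑ i, γ i ≤ k

theorem mem_idxLE {k : ℕ} {γ : Fin d → ℕ} : γ ∈ idxLE d k ↔ ∑ i, γ i ≤ k := by
  refine ⟨fun h => (Finset.mem_filter.1 h).2, fun h => Finset.mem_filter.2 ⟨?_, h⟩⟩
  rw [Finset.mem_Iic]
  intro i
  exact (Finset.single_le_sum (fun _ _ => Nat.zero_le _) (Finset.mem_univ i)).trans h

theorem sum_le_of_le {μ γ : Fin d → ℕ} (h : μ ≤ γ) : ∑ i, μ i ≤ ∑ i, γ i :=
  Finset.sum_le_sum fun i _ => h i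

theorem sum_sub_idx {μ γ : Fin d → ℕ} (h : μ ≤ γ) : ∑ i, (γ - μ) i + ∑ i, μ i = ∑ i, γ i := by
  rw [← sum_add_idx, tsub_add_cancel_of_le h]

theorem eq_of_le_of_sum_le {μ γ : Fin d → ℕ} (h : μ ≤ γ) (h' : ∑ i, γ i ≤ ∑ i, μ i) : μ = γ := by
  funext i
  refine (h i).antisymm ?_
  by_contra hcon
  push Not at hcon
  exact absurd (Finset.sum_lt_sum (fun j _ => h j) ⟨i, Finset.mem_univ i, hcon⟩) (by omega)

/-- Smooth functions in `H^k` are approximated by their products with slowly varying cutoffs. -/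
theorem tendsto_cutoff [CompleteSpace F] {k : ℕ} {v : E d → F} (hv : Smooth v)
    (hk : ∀ γ : Fin d → ℕ, ∑ i, γ i ≤ k → MemLp (multiDeriv γ v) 2 volume) :
    ∃ φ : ℕ → E d → F, (∀ j, Smooth (φ j) ∧ HasCompactSupport (φ j)) ∧
      ∀ γ : Fin d → ℕ, ∑ i, γ i ≤ k →
        L2Tendsto volume (fun j => multiDeriv γ (φ j)) (multiDeriv γ v) := by
  let η : ContDiffBump (0 : E d) := ⟨1, 2, one_pos, one_lt_two⟩
  have hη : Smooth (η : E d → ℝ) := η.contDiff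
  have hηc : HasCompactSupport (η : E d → ℝ) := η.hasCompactSupport
  let t : ℕ → ℝ := fun j => 1 / ((j : ℝ) + 1)
  have ht0 : ∀ j, t j ≠ 0 := fun j => by positivity
  let ηj : ℕ → E d → ℝ := fun j x => η (t j • x + 0)
  have hηj : ∀ j, Smooth (ηj j) := fun j =>
    hη.comp ((contDiff_id.const_smul (t j)).add contDiff_const)
  have hηjc : ∀ j, HasCompactSupport (ηj j) := fun j =>
    hηc.comp_homeomorph ((Homeomorph.smulOfNeZero (t j) (ht0 j)).trans (Homeomorph.addRight 0))
  have htlim : Filter.Tendsto t Filter.atTop (nhds 0) := tendsto_one_div_add_atTop_nhds_zero_nat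
  have ht1 : ∀ j, |t j| ≤ 1 := fun j => by
    rw [abs_of_nonneg (by positivity), div_le_one (by positivity)]
    linarith [Nat.cast_nonneg (α := ℝ) j]
  refine ⟨fun j x => ηj j x • v x, fun j => ⟨(hηj j).smul hv, (hηjc j).smul_right⟩,
    fun γ hγ => ?_⟩
  have hL : ∀ j, multiDeriv γ (fun x => ηj j x • v x) =ᵐ[volume] fun x =>
      ∑ μ ∈ Finset.Iic γ, binom γ μ • (multiDeriv (γ - μ) (ηj j) x • multiDeriv μ v x) := by
    intro j
    have h1 : HasWeakDeriv γ (fun x => ηj j x • v x) _ :=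
      HasWeakDeriv.of_smooth ((hηj j).smul hv) γ
    have h2 := HasWeakDeriv.real_smul (hηj j) (N := fun μ => multiDeriv μ v) γ
      (fun μ _ => by
        simp only [multiDeriv_zero]
        exact HasWeakDeriv.of_smooth hv μ)
    simp only [multiDeriv_zero] at h2
    exact h1.unique h2
  -- only the term without derivatives of the cutoff survives in the limit
  have hterm : ∀ μ ∈ Finset.Iic γ, L2Tendsto volume
      (fun j x => binom γ μ • (multiDeriv (γ - μ) (ηj j) x • multiDeriv μ v x))
      (fun x => (if μ = γ then (1 : ℝ) else 0) • multiDeriv μ v x) := by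
    intro μ hμ
    rw [Finset.mem_Iic] at hμ
    have hmem := hk μ ((sum_le_of_le hμ).trans hγ)
    obtain ⟨C, hC⟩ := (hη.multiDeriv (γ - μ)).continuous.bounded_above_of_compact_support
      (hasCompactSupport_multiDeriv hη hηc (γ - μ))
    have hform : ∀ j x, multiDeriv (γ - μ) (ηj j) x =
        t j ^ (∑ i, (γ - μ) i) * multiDeriv (γ - μ) η (t j • x + 0) := fun j x => by
      rw [multiDeriv_comp_affine hη]
      rfl
    have hb : ∀ j x, |multiDeriv (γ - μ) (ηj j) x| ≤ |t j| ^ (∑ i, (γ - μ) i) * C := by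
      intro j x
      rw [hform, abs_mul, abs_pow]
      gcongr
      exact hC _
    have hC0 : 0 ≤ C := (norm_nonneg _).trans (hC 0)
    have hb' : ∀ j x, |binom γ μ * multiDeriv (γ - μ) (ηj j) x| ≤ |binom γ μ| * C := by
      intro j x
      rw [abs_mul]
      gcongr
      exact (hb j x).trans (mul_le_of_le_one_left hC0 (pow_le_one₀ (abs_nonneg _) (ht1 j)))
    have hcont : ∀ j, Continuous fun x => binom γ μ * multiDeriv (γ - μ) (ηj j) x := fun j =>
      continuous_const.mul ((hηj j).multiDeriv _).continuous
    simp only [← mul_smul]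
    refine L2Tendsto.smul_bounded hmem hcont hb' fun x => ?_
    by_cases hμγ : μ = γ
    · subst hμγ
      simp only [if_true, binom_self, one_mul, tsub_self, multiDeriv_zero]
      refine tendsto_const_nhds.congr' ?_
      have : Filter.Tendsto (fun j => t j • x + 0) Filter.atTop (nhds 0) := by
        simpa using htlim.smul_const x
      filter_upwards [this.eventually (Metric.closedBall_mem_nhds (0 : E d) one_pos)] with j hj
      exact (η.one_of_mem_closedBall hj).symm
    · rw [if_neg hμγ]
      have hpos : ∑ i, (γ - μ) i ≠ 0 := by
        intro h0
        have := sum_sub_idx hμ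
        exact hμγ (eq_of_le_of_sum_le hμ (by omega))
      have hz : Filter.Tendsto (fun j => |binom γ μ| * (|t j| ^ (∑ i, (γ - μ) i) * C))
          Filter.atTop (nhds 0) := by
        have := ((htlim.abs.pow (∑ i, (γ - μ) i)).mul_const C).const_mul |binom γ μ|
        simp only [abs_zero, zero_pow hpos, zero_mul, mul_zero] at this
        exact this
      refine squeeze_zero_norm (fun j => ?_) hz
      rw [Real.norm_eq_abs, abs_mul]
      gcongr
      exact hb j x
  refine (L2Tendsto.sum _ hterm).congr (fun j => (hL j).symm)
    (Filter.Eventually.of_forall fun x => ?_)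
  simp only [ite_smul, one_smul, zero_smul]
  rw [Finset.sum_ite_eq' (Finset.Iic γ) γ, if_pos (by simp)]

/-- Test functions are dense in `H^k`. -/
theorem MemH.exists_test_approx [CompleteSpace F] {k : ℕ} {u : E d → F} (hu : MemH k u) :
    ∃ φ : ℕ → E d → F, (∀ j, Smooth (φ j) ∧ HasCompactSupport (φ j)) ∧
      ∀ γ : Fin d → ℕ, ∑ i, γ i ≤ k →
        L2Tendsto volume (fun j => multiDeriv γ (φ j)) (HighOrderHomogenization.weakDeriv γ u) := by
  have hl := hu.locallyIntegrable
  let v : ℕ → E d → F := fun j => avg (mollMeasure d j) u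
  have hvs : ∀ j, Smooth (v j) := fun j => by
    simp only [v, avg_mollMeasure]
    exact smooth_conv (smooth_mollKernel d j) (hasCompactSupport_mollKernel d j) hl
  have hvd : ∀ j (γ : Fin d → ℕ), ∑ i, γ i ≤ k → multiDeriv γ (v j) =ᵐ[volume]
      avg (mollMeasure d j) (HighOrderHomogenization.weakDeriv γ u) := fun j γ hγ =>
    (HasWeakDeriv.of_smooth (hvs j) γ).unique ((hu.hasWeakDeriv hγ).avg (mollMeasure_support d j))
  have hv2 : ∀ (γ : Fin d → ℕ), ∑ i, γ i ≤ k → L2Tendsto volume (fun j => multiDeriv γ (v j))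
      (HighOrderHomogenization.weakDeriv γ u) := fun γ hγ =>
    (tendsto_mollify (hu.memLp_weakDeriv hγ)).congr (fun j => (hvd j γ hγ).symm)
      Filter.EventuallyEq.rfl
  -- cut off the mollification `v j` so far out that the error is at most `1 / (j + 1)`
  have hcut : ∀ j, ∃ φ : E d → F, (Smooth φ ∧ HasCompactSupport φ) ∧ ∀ γ ∈ idxLE d k,
      MemLp (multiDeriv γ φ) 2 volume ∧
      nrm2 volume (fun x => multiDeriv γ φ x - multiDeriv γ (v j) x) ≤ 1 / ((j : ℝ) + 1) := by
    intro j
    obtain ⟨φ, hφ, hφ2⟩ := tendsto_cutoff (k := k) (hvs j) fun γ hγ => (hv2 γ hγ).memLp j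
    have hev : ∀ᶠ i in Filter.atTop, ∀ γ ∈ idxLE d k,
        nrm2 volume (fun x => multiDeriv γ (φ i) x - multiDeriv γ (v j) x) ≤
          1 / ((j : ℝ) + 1) := by
      rw [Filter.eventually_all_finset]
      intro γ hγ
      exact (hφ2 γ (mem_idxLE.1 hγ)).tendsto.eventually (ge_mem_nhds (by positivity))
    obtain ⟨i, hi⟩ := hev.exists
    exact ⟨φ i, hφ i, fun γ hγ => ⟨(hφ2 γ (mem_idxLE.1 hγ)).memLp i, hi γ hγ⟩⟩
  choose φ hφ hφ2 using hcut
  refine ⟨φ, hφ, fun γ hγ => ⟨fun j => (hφ2 j γ (mem_idxLE.2 hγ)).1, hu.memLp_weakDeriv hγ, ?_⟩⟩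
  have hlim := tendsto_one_div_add_atTop_nhds_zero_nat (𝕜 := ℝ).add (hv2 γ hγ).tendsto
  rw [add_zero] at hlim
  refine squeeze_zero (fun _ => nrm2_nonneg) (fun j => ?_) hlim
  obtain ⟨h1, h2⟩ := hφ2 j γ (mem_idxLE.2 hγ)
  have hvm := (hv2 γ hγ).memLp j
  have := nrm2_add_le (h1.sub hvm) (hvm.sub (hu.memLp_weakDeriv hγ))
  simp only [Pi.sub_apply, sub_add_sub_cancel] at this
  exact this.trans (add_le_add h2 le_rfl)

end Mollify

open scoped Pointwise

/-! ### Translations of weakly differentiable functions -/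

section Translate

variable {d : ℕ} {F : Type*} [NormedAddCommGroup F] [NormedSpace ℝ F]

theorem integral_test_smul_avg [CompleteSpace F] {ν : Measure (E d)} [IsFiniteMeasure ν] {R : ℝ}
    (hν : ∀ᵐ h ∂ν, ‖h‖ ≤ R) {u : E d → F} (hu : LocallyIntegrable u) {p : E d → ℝ}
    (hp : Continuous p) (hc : HasCompactSupport p) :
    ∫ x, p x • avg ν u x = ∫ x, (∫ h, p (x + h) ∂ν) • u x := by
  obtain ⟨C, hC⟩ := hp.bounded_above_of_compact_support hc
  obtain ⟨r, hr⟩ := hc.isCompact.isBounded.subset_closedBall (0 : E d)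
  have hK : Integrable ((Metric.closedBall (0 : E d) (r + R)).indicator fun x => C * ‖u x‖) :=
    (integrable_indicator_iff measurableSet_closedBall).2
      ((hu.integrableOn_isCompact (isCompact_closedBall _ _)).norm.const_mul C)
  have hm : AEStronglyMeasurable (Function.uncurry fun (x h : E d) => p (x + h) • u x)
      (volume.prod ν) :=
    (hp.comp (continuous_fst.add continuous_snd)).aestronglyMeasurable.smul
      hu.aestronglyMeasurable.comp_fst
  have hb : ∀ᵐ q : E d × E d ∂(volume.prod ν), ‖q.2‖ ≤ R :=
    Measure.quasiMeasurePreserving_snd.ae hν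
  have hint : Integrable (Function.uncurry fun (x h : E d) => p (x + h) • u x)
      (volume.prod ν) := by
    refine (hK.comp_fst ν).mono' hm ?_
    filter_upwards [hb] with q hq
    simp only [Function.uncurry]
    by_cases hx : q.1 + q.2 ∈ tsupport p
    · have hmem : q.1 ∈ Metric.closedBall (0 : E d) (r + R) := by
        have h1 := hr hx
        rw [mem_closedBall_zero_iff] at h1 ⊢
        calc ‖q.1‖ = ‖(q.1 + q.2) - q.2‖ := by rw [add_sub_cancel_right]
          _ ≤ _ := (norm_sub_le _ _).trans (add_le_add h1 hq)
      rw [Set.indicator_of_mem hmem, norm_smul]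
      gcongr
      exact hC _
    · rw [image_eq_zero_of_notMem_tsupport hx, zero_smul, norm_zero]
      exact Set.indicator_nonneg
        (fun _ _ => mul_nonneg ((norm_nonneg _).trans (hC 0)) (norm_nonneg _)) _
  have hsc : ∀ x, (∫ h, p (x + h) ∂ν) • u x = ∫ h, p (x + h) • u x ∂ν := fun x =>
    (integral_smul_const _ _).symm
  simp only [test_smul_avg, hsc]
  rw [integral_integral_swap (integrable_test_smul_sub_prod hν hu hp hc),
    integral_integral_swap hint]
  refine integral_congr_ae (Filter.Eventually.of_forall fun h => ?_)
  simp only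
  rw [← integral_add_right_eq_self (fun x => p x • u (x - h)) h]
  simp only [add_sub_cancel_right]

/-- The uniform distribution on the segment joining `0` and `h`. -/
noncomputable def segMeasure (h : E d) : Measure (E d) :=
  Measure.map (fun t : ℝ => t • h) (volume.restrict (Set.Icc 0 1))

theorem measurable_seg (h : E d) : Measurable fun t : ℝ => t • h := by fun_prop

instance (h : E d) : IsProbabilityMeasure (segMeasure h) := by
  have : IsProbabilityMeasure (volume.restrict (Set.Icc (0 : ℝ) 1)) := ⟨by simp⟩
  exact Measure.isProbabilityMeasure_map (measurable_seg h).aemeasurable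

theorem segMeasure_support (h : E d) : ∀ᵐ x ∂(segMeasure h), ‖x‖ ≤ ‖h‖ := by
  rw [segMeasure, ae_map_iff (measurable_seg h).aemeasurable
    (measurableSet_le measurable_norm measurable_const)]
  filter_upwards [ae_restrict_mem measurableSet_Icc] with t ht
  rw [norm_smul, Real.norm_of_nonneg ht.1]
  exact mul_le_of_le_one_left (norm_nonneg _) ht.2

theorem fderiv_eq_sum_pderiv (g : E d → ℝ) (x h : E d) :
    fderiv ℝ g x h = ∑ i, h i * pderiv i g x := by
  have : h = ∑ i, h i • EuclideanSpace.single i (1 : ℝ) := by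
    have := (EuclideanSpace.basisFun (Fin d) ℝ).sum_repr h
    simpa using this.symm
  conv_lhs => rw [this, map_sum]
  refine Finset.sum_congr rfl fun i _ => ?_
  rw [map_smul]
  rfl

theorem integral_segMeasure_pderiv {g : E d → ℝ} (hg : Smooth g) (x h : E d) :
    ∫ y, (∑ i, h i * pderiv i g (x + y)) ∂(segMeasure h) = g (x + h) - g x := by
  have hcont : Continuous fun y => ∑ i, h i * pderiv i g (x + y) :=
    continuous_finsetSum _ fun i _ => continuous_const.mul
      ((hg.pderiv i).continuous.comp (continuous_const.add continuous_id))
  rw [segMeasure, integral_map (measurable_seg h).aemeasurable hcont.aestronglyMeasurable,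
    integral_Icc_eq_integral_Ioc, ← intervalIntegral.integral_of_le zero_le_one]
  have hd : ∀ t : ℝ, HasDerivAt (fun t : ℝ => g (x + t • h))
      (∑ i, h i * pderiv i g (x + t • h)) t := by
    intro t
    rw [← fderiv_eq_sum_pderiv]
    have h1 : HasDerivAt (fun t : ℝ => x + t • h) h t := by
      simpa using ((hasDerivAt_id t).smul_const h).const_add x
    exact (hg.differentiableAt (x + t • h)).hasFDerivAt.comp_hasDerivAt t h1
  rw [intervalIntegral.integral_eq_sub_of_hasDerivAt (fun t _ => hd t)]
  · simp
  · exact (hcont.comp (by fun_prop : Continuous fun t : ℝ => t • h)).intervalIntegrable _ _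

/-- The increment of a weakly differentiable function is an average of its gradient. -/
theorem translate_sub_eq [CompleteSpace F] {u : E d → F} {w : Fin d → E d → F}
    (hw : ∀ i, HasWeakDeriv (unitIdx i) u (w i)) (hu : LocallyIntegrable u) (h : E d) :
    ∀ᵐ x, u (x - h) - u x = -∑ i, h i • avg (segMeasure h) (w i) x := by
  have hν := segMeasure_support h
  have hl1 : LocallyIntegrable fun x => u (x - h) := by
    simpa [sub_eq_add_neg] using locallyIntegrable_comp_affine hu one_ne_zero (-h)
  have hl2 : ∀ i, LocallyIntegrable (avg (segMeasure h) (w i)) := fun i =>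
    locallyIntegrable_avg hν (hw i).2.1
  have hl3 : LocallyIntegrable fun x => ∑ i, h i • avg (segMeasure h) (w i) x :=
    locallyIntegrable_finsetSum _ fun i _ => (hl2 i).smul (h i)
  refine ae_eq_of_integral_contDiff_smul_eq (hl1.sub hu) hl3.neg fun g (hg : Smooth g) hc => ?_
  have hgc := hg.continuous
  have hpc : ∀ i, HasCompactSupport (pderiv i g) := fun i => hasCompactSupport_pderiv hc i
  -- the gradient is moved to the test function, where the fundamental theorem applies
  have e1 : ∫ x, g x • ∑ i, h i • avg (segMeasure h) (w i) x =
      -∫ x, (∑ i, h i * pderiv i g x) • avg (segMeasure h) u x := by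
    simp only [Finset.smul_sum, Finset.sum_smul, mul_smul]
    rw [integral_finsetSum, integral_finsetSum, ← Finset.sum_neg_distrib]
    · refine Finset.sum_congr rfl fun i _ => ?_
      have := ((hw i).avg hν).2.2 g hg hc
      rw [multiDeriv_unitIdx, sum_unitIdx, pow_one] at this
      simp only [smul_comm _ (h i)]
      rw [integral_smul, integral_smul, this]
      simp
    · exact fun i _ => (integrable_test_smul (hg.pderiv i).continuous (hpc i)
        (locallyIntegrable_avg hν hu)).smul (h i)
    · exact fun i _ => integrable_test_smul hgc hc ((hl2 i).smul (h i))
  have hPc : Continuous fun x => ∑ i, h i * pderiv i g x :=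
    continuous_finsetSum _ fun i _ => continuous_const.mul (hg.pderiv i).continuous
  have hPs : HasCompactSupport fun x => ∑ i, h i * pderiv i g x := by
    have : (fun x => ∑ i, h i * pderiv i g x) = fun x => fderiv ℝ g x h := by
      funext x
      rw [fderiv_eq_sum_pderiv]
    rw [this]
    exact (hc.fderiv (𝕜 := ℝ)).comp_left (g := fun L : E d →L[ℝ] ℝ => L h) (by simp)
  rw [integral_test_smul_avg hν hu hPc hPs] at e1
  simp only [integral_segMeasure_pderiv hg, sub_smul] at e1
  have hgh : Integrable fun x => g (x + h) • u x := by
    refine integrable_test_smul (hgc.comp (continuous_id.add continuous_const)) ?_ hu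
    exact hc.comp_homeomorph (Homeomorph.addRight h)
  rw [integral_sub hgh (integrable_test_smul hgc hc hu)] at e1
  simp only [smul_neg, integral_neg, e1, neg_neg, smul_sub]
  rw [integral_sub (integrable_test_smul hgc hc hl1) (integrable_test_smul hgc hc hu),
    ← integral_add_right_eq_self (fun x => g x • u (x - h)) h]
  simp only [add_sub_cancel_right]

theorem nrm2_avg_restrict_le {u : E d → F} (hu : AEStronglyMeasurable u volume)
    (ν : Measure (E d)) [IsProbabilityMeasure ν] (S : Set (E d))
    (hS : ∀ h, ∫⁻ x in S, ‖u (x - h)‖ₑ ^ 2 = ∫⁻ x in S, ‖u x‖ₑ ^ 2) :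
    eLpNorm (avg ν u) 2 (volume.restrict S) ≤ eLpNorm u 2 (volume.restrict S) := by
  refine (ENNReal.pow_le_pow_left_iff two_ne_zero).1 ?_
  rw [eLpNorm_two_sq, eLpNorm_two_sq]
  refine (lintegral_avg_sq_le hu ν S).trans ?_
  simp only [hS, lintegral_const, measure_univ, mul_one, le_refl]

/-- Translation estimate on a set `S` over which the integrals of `|D_i u|²` are translation
invariant: the whole space, or the cell if `u` is periodic. -/
theorem nrm2_translate_sub_le [CompleteSpace F] {u : E d → F} {w : Fin d → E d → F}
    (hw : ∀ i, HasWeakDeriv (unitIdx i) u (w i)) (hu : LocallyIntegrable u) (S : Set (E d))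
    (hw2 : ∀ i, MemLp (w i) 2 (volume.restrict S))
    (hS : ∀ i h, ∫⁻ x in S, ‖w i (x - h)‖ₑ ^ 2 = ∫⁻ x in S, ‖w i x‖ₑ ^ 2) (h : E d) :
    MemLp (fun x => u (x - h) - u x) 2 (volume.restrict S) ∧
    nrm2 (volume.restrict S) (fun x => u (x - h) - u x) ≤
      ‖h‖ * ∑ i, nrm2 (volume.restrict S) (w i) := by
  have hν := segMeasure_support h
  have hle : ∀ i, eLpNorm (avg (segMeasure h) (w i)) 2 (volume.restrict S) ≤
      eLpNorm (w i) 2 (volume.restrict S) := fun i =>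
    nrm2_avg_restrict_le (hw i).2.1.aestronglyMeasurable _ S (hS i)
  have hm : ∀ i, MemLp (avg (segMeasure h) (w i)) 2 (volume.restrict S) := fun i =>
    ⟨(locallyIntegrable_avg hν (hw i).2.1).aestronglyMeasurable.restrict,
      (hle i).trans_lt (hw2 i).2⟩
  have hms : ∀ i ∈ Finset.univ, MemLp (fun x => -(h i • avg (segMeasure h) (w i) x)) 2
      (volume.restrict S) := fun i _ => ((hm i).const_smul (h i)).neg
  have hae : (fun x => u (x - h) - u x) =ᵐ[volume.restrict S]
      fun x => ∑ i, -(h i • avg (segMeasure h) (w i) x) := by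
    filter_upwards [ae_restrict_of_ae (translate_sub_eq hw hu h)] with x hx
    rw [hx, Finset.sum_neg_distrib]
  refine ⟨(memLp_finsetSum _ hms).ae_eq hae.symm, ?_⟩
  rw [nrm2_congr hae, Finset.mul_sum]
  refine (nrm2_sum_le _ hms).trans (Finset.sum_le_sum fun i _ => ?_)
  have h1 : nrm2 (volume.restrict S) (fun x => -(h i • avg (segMeasure h) (w i) x)) =
      |h i| * nrm2 (volume.restrict S) (avg (segMeasure h) (w i)) := by
    rw [← Real.norm_eq_abs, ← nrm2_smul, nrm2, nrm2]
    congr 1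
    exact eLpNorm_neg (fun x => h i • avg (segMeasure h) (w i) x) 2 _
  rw [h1]
  exact mul_le_mul (by simpa using PiLp.norm_apply_le h i)
    (ENNReal.toReal_mono (hw2 i).2.ne (hle i)) nrm2_nonneg (norm_nonneg _)

end Translate

/-! ### The periodicity cell -/

section Cell

variable {d : ℕ}

theorem measurableSet_cell : MeasurableSet (cell d) := by
  have : cell d = ⋂ i, (fun y : E d => y i) ⁻¹' Set.Ico (-(1 / 2) : ℝ) (1 / 2) := by
    ext y; simp [cell]
  rw [this]
  exact MeasurableSet.iInter fun i => (by fun_prop : Measurable fun y : E d => y i) measurableSet_Ico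

theorem volume_cell : volume (cell d) = 1 := by
  have h := (EuclideanSpace.volume_preserving_symm_measurableEquiv_toLp (Fin d)).measure_preimage_equiv
    (Set.univ.pi fun _ => Set.Ico (-(1 / 2) : ℝ) (1 / 2))
  have hc : cell d = (MeasurableEquiv.toLp 2 (Fin d → ℝ)).symm ⁻¹'
      (Set.univ.pi fun _ => Set.Ico (-(1 / 2) : ℝ) (1 / 2)) := by
    ext y
    simp [cell]
  rw [hc, h, Real.volume_pi_Ico]
  norm_num

instance : IsProbabilityMeasure (volume.restrict (cell d)) := ⟨by simp [volume_cell]⟩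

theorem norm_le_of_mem_cell {y : E d} (hy : y ∈ cell d) : ‖y‖ ≤ d := by
  have h : y = ∑ i, y i • EuclideanSpace.single i (1 : ℝ) := by
    have := (EuclideanSpace.basisFun (Fin d) ℝ).sum_repr y
    simpa using this.symm
  rw [h]
  refine (norm_sum_le _ _).trans ?_
  calc ∑ i, ‖y i • EuclideanSpace.single i (1 : ℝ)‖ ≤ ∑ _i : Fin d, (1 : ℝ) := by
        refine Finset.sum_le_sum fun i _ => ?_
        have := hy i
        rw [norm_smul, PiLp.norm_single, norm_one, mul_one, Real.norm_eq_abs, abs_le]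
        constructor <;> linarith [this.1, this.2]
    _ = d := by simp

/-- The vector of `ℝ^d` with integer coordinates `k`. -/
noncomputable def zvec (d : ℕ) : (Fin d → ℤ) →+ E d where
  toFun k := WithLp.toLp 2 fun i => (k i : ℝ)
  map_zero' := by ext; simp
  map_add' k l := by ext; simp

theorem zvec_apply (k : Fin d → ℤ) (i : Fin d) : zvec d k i = k i := rfl

theorem zvec_eq_sum (k : Fin d → ℤ) :
    zvec d k = ∑ i, k i • (EuclideanSpace.single i 1 : E d) := by
  have := (EuclideanSpace.basisFun (Fin d) ℝ).sum_repr (zvec d k)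
  simp only [EuclideanSpace.basisFun_repr, EuclideanSpace.basisFun_apply] at this
  rw [← this]
  refine Finset.sum_congr rfl fun i _ => ?_
  rw [zvec_apply, Int.cast_smul_eq_zsmul]

/-- The lattice `ℤ^d`. -/
noncomputable abbrev lattice (d : ℕ) : AddSubgroup (E d) := (zvec d).range

instance : Countable (lattice d) := (Set.countable_range (zvec d)).to_subtype

theorem IsPeriodic.add_lattice {X : Type*} {u : E d → X} (hu : IsPeriodic u) (l : lattice d)
    (y : E d) : u (y + l) = u y := by
  let P : AddSubgroup (E d) :=
    { carrier := {v | ∀ y, u (y + v) = u y}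
      zero_mem' := fun y => by simp
      add_mem' := fun {a b} ha hb y => by rw [← add_assoc, hb, ha]
      neg_mem' := fun {a} ha y => by rw [← ha (y + -a), neg_add_cancel_right] }
  have hP : (l : E d) ∈ P := by
    obtain ⟨k, hk⟩ := l.2
    rw [← hk, zvec_eq_sum]
    exact sum_mem fun i _ => zsmul_mem (show EuclideanSpace.single i 1 ∈ P from fun y => hu i y) _
  exact hP y

/-- The integer vector which has to be subtracted from `y` to get into the cell. -/
noncomputable def cellShift (y : E d) : Fin d → ℤ := fun i => ⌊y i + 1 / 2⌋

theorem sub_cellShift_mem (y : E d) : y - zvec d (cellShift y) ∈ cell d := by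
  intro i
  rw [PiLp.sub_apply, zvec_apply, cellShift]
  have h1 := Int.floor_le (y i + 1 / 2)
  have h2 := Int.lt_floor_add_one (y i + 1 / 2)
  constructor <;> linarith

theorem cellShift_eq {y : E d} {k : Fin d → ℤ} (h : y - zvec d k ∈ cell d) : cellShift y = k := by
  funext i
  have := h i
  rw [PiLp.sub_apply, zvec_apply] at this
  rw [cellShift, Int.floor_eq_iff]
  constructor <;> linarith [this.1, this.2]

theorem isAddFundamentalDomain_cell : IsAddFundamentalDomain (lattice d) (cell d) volume := by
  refine IsAddFundamentalDomain.mk' measurableSet_cell.nullMeasurableSet fun x => ?_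
  refine ⟨⟨-zvec d (cellShift x), neg_mem ⟨_, rfl⟩⟩, ?_, ?_⟩
  · change -zvec d (cellShift x) + x ∈ cell d
    rw [neg_add_eq_sub]
    exact sub_cellShift_mem x
  · rintro ⟨l, hl⟩ hmem
    obtain ⟨k, hk⟩ := neg_mem hl
    have hl' : l = -zvec d k := by rw [hk, neg_neg]
    subst hl'
    change -zvec d k + x ∈ cell d at hmem
    rw [neg_add_eq_sub] at hmem
    simp only [cellShift_eq hmem]

theorem isAddFundamentalDomain_vadd_cell (h : E d) :
    IsAddFundamentalDomain (lattice d) (h +ᵥ cell d) volume :=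
  isAddFundamentalDomain_cell.vadd_of_comm h

theorem preimage_vadd_cell (h : E d) : (fun x => x + h) ⁻¹' (h +ᵥ cell d) = cell d := by
  ext x
  rw [Set.mem_preimage, Set.mem_vadd_set_iff_neg_vadd_mem, vadd_eq_add, add_comm x h,
    neg_add_cancel_left]

theorem lintegral_cell_add {f : E d → ENNReal} (hf : IsPeriodic f) (h : E d) :
    ∫⁻ x in cell d, f (x + h) = ∫⁻ x in cell d, f x := by
  rw [isAddFundamentalDomain_cell.setLIntegral_eq (isAddFundamentalDomain_vadd_cell h) f
    fun g x => by rw [AddSubgroup.vadd_def, vadd_eq_add, add_comm]; exact hf.add_lattice g x]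
  · have := ((measurePreserving_add_right volume h).restrict_preimage_emb
      (measurableEmbedding_addRight h) (h +ᵥ cell d)).lintegral_comp_emb
      (measurableEmbedding_addRight h) f
    rwa [preimage_vadd_cell] at this

theorem integral_cell_add {F : Type*} [NormedAddCommGroup F] [NormedSpace ℝ F] {f : E d → F}
    (hf : IsPeriodic f) (h : E d) : ∫ x in cell d, f (x + h) = ∫ x in cell d, f x := by
  rw [isAddFundamentalDomain_cell.setIntegral_eq (isAddFundamentalDomain_vadd_cell h)
    (f := f) fun g x => by rw [AddSubgroup.vadd_def, vadd_eq_add, add_comm]; exact hf.add_lattice g x]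
  · have := ((measurePreserving_add_right volume h).restrict_preimage_emb
      (measurableEmbedding_addRight h) (h +ᵥ cell d)).integral_comp
      (measurableEmbedding_addRight h) f
    rwa [preimage_vadd_cell] at this

theorem lintegral_cell_sub {f : E d → ENNReal} (hf : IsPeriodic f) (h : E d) :
    ∫⁻ x in cell d, f (x - h) = ∫⁻ x in cell d, f x := by
  simpa [sub_eq_add_neg] using lintegral_cell_add hf (-h)

/-- A function which is almost everywhere invariant under the integer shifts has an exactly
periodic strongly measurable representative. -/
theorem exists_periodic_representative {X : Type*} [TopologicalSpace X]
    [TopologicalSpace.PseudoMetrizableSpace X] {u : E d → X} (hm : AEStronglyMeasurable u volume)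
    (h : ∀ l : lattice d, ∀ᵐ y, u (y + l) = u y) :
    ∃ w : E d → X, StronglyMeasurable w ∧ IsPeriodic w ∧ w =ᵐ[volume] u := by
  -- `p` is the reduction to the cell modulo the lattice; composing with it makes a measurable
  -- version exactly periodic
  let p : E d → E d := fun y => y - zvec d (cellShift y)
  have hp : Measurable p := by
    refine measurable_id.sub ((MeasurableEquiv.toLp 2 (Fin d → ℝ)).measurable.comp
      (measurable_pi_lambda (fun (y : E d) i => ((cellShift y i : ℤ) : ℝ)) fun i => ?_))
    have : Measurable fun y : E d => y i + 1 / 2 := by fun_prop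
    exact measurable_from_top.comp (Int.measurable_floor.comp this)
  have hper : IsPeriodic p := by
    intro i y
    have : zvec d (cellShift y + Pi.single i 1) =
        zvec d (cellShift y) + EuclideanSpace.single i 1 := by
      rw [map_add]
      congr 1
      ext j
      rw [zvec_apply]
      by_cases hj : j = i
      · subst hj; simp
      · simp [hj]
    have h2 : y + EuclideanSpace.single i 1 - zvec d (cellShift y + Pi.single i 1) = p y := by
      rw [this, add_sub_add_right_eq_sub]
    have h3 := cellShift_eq (h2 ▸ sub_cellShift_mem y :
      y + EuclideanSpace.single i 1 - zvec d (cellShift y + Pi.single i 1) ∈ cell d)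
    rw [← h2, ← h3]
  refine ⟨hm.mk u ∘ p, hm.stronglyMeasurable_mk.comp_measurable hp,
    fun i y => congrArg (hm.mk u) (hper i y), ?_⟩
  have hall : ∀ᵐ y, ∀ l : lattice d, hm.mk u (y + l) = u y := by
    rw [ae_all_iff]
    intro l
    have h1 := (measurePreserving_add_right volume (l : E d)).quasiMeasurePreserving.ae_eq_comp
      hm.ae_eq_mk
    filter_upwards [h1, h l] with y hy hy'
    exact hy.symm.trans hy'
  filter_upwards [hall] with y hy
  have := hy ⟨-zvec d (cellShift y), neg_mem ⟨_, rfl⟩⟩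
  rw [← this, Function.comp_apply, ← sub_eq_add_neg]

end Cell

/-! ### Steklov smoothing -/

section Steklov

variable {d : ℕ} {F : Type*} [NormedAddCommGroup F] [NormedSpace ℝ F]

/-- The distribution of `ε ω` for `ω` uniform in the cell. -/
noncomputable def stekMeasure (d : ℕ) (ε : ℝ) : Measure (E d) :=
  Measure.map (fun ω => ε • ω) (volume.restrict (cell d))

instance (ε : ℝ) : IsProbabilityMeasure (stekMeasure d ε) :=
  Measure.isProbabilityMeasure_map (by fun_prop)

theorem stekMeasure_support (ε : ℝ) : ∀ᵐ h ∂(stekMeasure d ε), ‖h‖ ≤ |ε| * d := by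
  rw [stekMeasure, ae_map_iff (by fun_prop) (measurableSet_le measurable_norm measurable_const)]
  filter_upwards [ae_restrict_mem measurableSet_cell] with ω hω
  rw [norm_smul, Real.norm_eq_abs]
  exact mul_le_mul_of_nonneg_left (norm_le_of_mem_cell hω) (abs_nonneg _)

theorem steklov_eq_avg {ε : ℝ} (hε : ε ≠ 0) (φ : E d → F) :
    steklov ε φ = avg (stekMeasure d ε) φ := by
  funext x
  have := (Homeomorph.smulOfNeZero ε hε : E d ≃ₜ E d).measurableEmbedding.integral_map
    (μ := volume.restrict (cell d)) (fun h => φ (x - h))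
  exact this.symm

theorem integrable_steklov {ε : ℝ} (hε : ε ≠ 0) {u : E d → F} (hu : LocallyIntegrable u) :
    ∀ᵐ x, Integrable (fun ω => u (x - ε • ω)) (volume.restrict (cell d)) := by
  filter_upwards [integrable_sub_of_locallyIntegrable (stekMeasure_support ε) hu] with x hx
  exact ((Homeomorph.smulOfNeZero ε hε : E d ≃ₜ E d).measurableEmbedding.integrable_map_iff
    (μ := volume.restrict (cell d)) (g := fun h => u (x - h))).1 hx

theorem HasWeakDeriv.steklov {ε : ℝ} (hε : ε ≠ 0) {γ : Fin d → ℕ} {u w : E d → F}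
    (h : HasWeakDeriv γ u w) : HasWeakDeriv γ (steklov ε u) (steklov ε w) := by
  rw [steklov_eq_avg hε, steklov_eq_avg hε]
  exact h.avg (stekMeasure_support ε)

theorem memLp_steklov {ε : ℝ} (hε : ε ≠ 0) {u : E d → F} (hu : MemLp u 2 volume) :
    MemLp (steklov ε u) 2 volume := by
  rw [steklov_eq_avg hε]
  exact memLp_avg (stekMeasure_support ε) hu

theorem nrm2_steklov_le {ε : ℝ} (hε : ε ≠ 0) {u : E d → F} (hu : MemLp u 2 volume) :
    nrm2 volume (steklov ε u) ≤ nrm2 volume u := by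
  rw [steklov_eq_avg hε]
  exact nrm2_avg_le hu

theorem MemH.steklov [CompleteSpace F] {ε : ℝ} (hε : ε ≠ 0) {m : ℕ} {u : E d → F} (hu : MemH m u) :
    MemH m (steklov ε u) := fun _ hγ =>
  ⟨_, (hu.hasWeakDeriv hγ).steklov hε, memLp_steklov hε (hu.memLp_weakDeriv hγ)⟩

theorem steklov_sub {ε : ℝ} (hε : ε ≠ 0) {u v : E d → F} (hu : LocallyIntegrable u)
    (hv : LocallyIntegrable v) :
    steklov ε (fun x => u x - v x) =ᵐ[volume] fun x => steklov ε u x - steklov ε v x := by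
  filter_upwards [integrable_steklov hε hu, integrable_steklov hε hv] with x h1 h2
  exact integral_sub h1 h2

theorem steklov_congr {ε : ℝ} (hε : ε ≠ 0) {u v : E d → F} (h : u =ᵐ[volume] v) :
    steklov ε u = steklov ε v := by
  funext x
  refine integral_congr_ae (ae_restrict_of_ae ?_)
  have hq : Measure.QuasiMeasurePreserving (fun ω : E d => x - ε • ω) volume volume := by
    have h1 : Measure.QuasiMeasurePreserving (fun ω : E d => ε • ω) volume volume := by
      refine ⟨by fun_prop, ?_⟩
      rw [Measure.map_addHaar_smul _ hε]
      exact Measure.smul_absolutelyContinuous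
    exact (Measure.measurePreserving_sub_left volume x).quasiMeasurePreserving.comp h1
  exact hq.ae_eq_comp h

theorem nrm2_steklov_sub_le [CompleteSpace F] {ε : ℝ} (hε : 0 < ε) {u : E d → F}
    {w : Fin d → E d → F} (hw : ∀ i, HasWeakDeriv (unitIdx i) u (w i)) (hu : MemLp u 2 volume)
    (hw2 : ∀ i, MemLp (w i) 2 volume) :
    nrm2 volume (fun x => steklov ε u x - u x) ≤ ε * d * ∑ i, nrm2 volume (w i) := by
  rw [steklov_eq_avg hε.ne']
  have hs : 0 ≤ ∑ i, nrm2 volume (w i) := Finset.sum_nonneg fun i _ => nrm2_nonneg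
  refine nrm2_avg_sub_le (stekMeasure_support ε) hu (by positivity) ?_
  filter_upwards [stekMeasure_support (d := d) ε] with h hh
  rw [abs_of_pos hε] at hh
  have := (nrm2_translate_sub_le hw (hu.locallyIntegrable one_le_two) Set.univ
    (by simpa using hw2) (fun i h => by
      simpa using lintegral_sub_right_eq_self (fun x => ‖w i x‖ₑ ^ 2) h) h).2
  simp only [Measure.restrict_univ] at this
  exact this.trans (mul_le_mul_of_nonneg_right hh hs)

end Steklov

/-! ### Multiplication by oscillating periodic factors -/

section Multiplier

variable {d : ℕ} {X Z : Type*} [NormedAddCommGroup X] [NormedSpace ℂ X]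
  [NormedAddCommGroup Z] [InnerProductSpace ℂ Z]

/-- Operator-valued periodic functions `G` with `∫_Y |G c|² ≤ K² |c|²` for every vector `c`. -/
structure PerMul (K : ℝ) (G : E d → X →L[ℂ] Z) : Prop where
  nonneg : 0 ≤ K
  meas : StronglyMeasurable G
  per : IsPeriodic G
  bound : ∀ c, ∫⁻ y in cell d, ‖G y c‖ₑ ^ 2 ≤ ENNReal.ofReal (K ^ 2 * ‖c‖ ^ 2)

theorem IsPeriodic.comp_left {S S' : Type*} {u : E d → S} (hu : IsPeriodic u) (f : S → S') :
    IsPeriodic fun y => f (u y) := fun i y => congrArg f (hu i y)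

/-- The measure on `Y × ℝ^d` used to write `∫ … (S^ε χ) …` as a double integral. -/
noncomputable abbrev cellProd (d : ℕ) : Measure (E d × E d) :=
  (volume.restrict (cell d)).prod volume

/-- The shear `(ω, z) ↦ (ω, z + a ω)`. -/
def shear (a : ℝ) : E d × E d → E d × E d := fun p => (p.1, p.2 + a • p.1)

theorem measurePreserving_shear (a : ℝ) :
    MeasurePreserving (shear a) (cellProd d) (cellProd d) := by
  refine MeasurePreserving.skew_product (g := fun ω z => z + a • ω) (MeasurePreserving.id _) ?_ ?_
  · fun_prop
  · exact Filter.Eventually.of_forall fun ω => map_add_right_eq_self volume (a • ω)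

/-- The operator `χ ↦ G(x/ε) (S^ε χ)(x)`. -/
noncomputable def pmul (G : E d → X →L[ℂ] Z) (ε : ℝ) (χ : E d → X) : E d → Z :=
  fun x => G (ε⁻¹ • x) (steklov ε χ x)

/-- The integrand of `G(x/ε) (S^ε χ)(x) = ∫_Y G(x/ε) χ(x - ε ω) dω`. -/
noncomputable def pmulIntegrand (G : E d → X →L[ℂ] Z) (ε : ℝ) (χ : E d → X) : E d × E d → Z :=
  fun p => G (ε⁻¹ • p.2) (χ (p.2 - ε • p.1))

variable {K : ℝ} {G : E d → X →L[ℂ] Z} {ε : ℝ} {χ : E d → X}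

theorem pmulIntegrand_shear (hε : ε ≠ 0) (p : E d × E d) :
    pmulIntegrand G ε χ (shear ε p) = G (p.1 + ε⁻¹ • p.2) (χ p.2) := by
  simp only [pmulIntegrand, shear, add_sub_cancel_right, smul_add, smul_smul, inv_mul_cancel₀ hε,
    one_smul]
  rw [add_comm]

theorem aestronglyMeasurable_clm_apply {Ω : Type*} [MeasurableSpace Ω] {μ : Measure Ω}
    {A : Ω → X →L[ℂ] Z} {f : Ω → X} (hA : AEStronglyMeasurable A μ)
    (hf : AEStronglyMeasurable f μ) : AEStronglyMeasurable (fun x => A x (f x)) μ :=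
  (isBoundedBilinearMap_apply (𝕜 := ℂ) (E := X) (F := Z)).continuous.comp_aestronglyMeasurable
    (hA.prodMk hf)

theorem pmul_sub (hε : ε ≠ 0) {χ' : E d → X} (hχ : LocallyIntegrable χ)
    (hχ' : LocallyIntegrable χ') :
    pmul G ε (fun x => χ x - χ' x) =ᵐ[volume] fun x => pmul G ε χ x - pmul G ε χ' x := by
  filter_upwards [steklov_sub hε hχ hχ'] with x hx
  rw [pmul, hx, map_sub]
  rfl

variable [CompleteSpace X] [CompleteSpace Z]

theorem memLp_pmulIntegrand_shear (hG : PerMul K G) (hε : ε ≠ 0) (hχ : MemLp χ 2 volume) :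
    MemLp (fun p => pmulIntegrand G ε χ (shear ε p)) 2 (cellProd d) ∧
      nrm2 (cellProd d) (fun p => pmulIntegrand G ε χ (shear ε p)) ≤ K * nrm2 volume χ := by
  have hm : AEStronglyMeasurable (fun p => pmulIntegrand G ε χ (shear ε p)) (cellProd d) := by
    simp only [pmulIntegrand_shear hε]
    refine aestronglyMeasurable_clm_apply
      (StronglyMeasurable.aestronglyMeasurable ?_) hχ.1.comp_snd
    exact hG.meas.comp_measurable (by fun_prop)
  have hC : 0 ≤ K * nrm2 volume χ := mul_nonneg hG.nonneg nrm2_nonneg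
  have hle : eLpNorm (fun p => pmulIntegrand G ε χ (shear ε p)) 2 (cellProd d) ≤
      ENNReal.ofReal (K * nrm2 volume χ) := by
    refine nrm2_le_of_lintegral hC ?_
    rw [lintegral_prod_symm _ (hm.enorm.pow_const 2)]
    have h1 : ∀ z : E d, ∫⁻ ω in cell d, ‖pmulIntegrand G ε χ (shear ε (ω, z))‖ₑ ^ 2 ≤
        ENNReal.ofReal (K ^ 2) * ‖χ z‖ₑ ^ 2 := by
      intro z
      simp only [pmulIntegrand_shear hε]
      have hper := hG.per.comp_left fun L => ‖L (χ z)‖ₑ ^ 2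
      rw [lintegral_cell_add hper]
      refine (hG.bound (χ z)).trans (le_of_eq ?_)
      rw [ENNReal.ofReal_mul (by positivity), ENNReal.ofReal_pow (norm_nonneg _), ofReal_norm]
    refine (lintegral_mono h1).trans ?_
    rw [lintegral_const_mul' _ _ ENNReal.ofReal_ne_top, lintegral_eq_nrm2 hχ,
      ← ENNReal.ofReal_mul (by positivity), mul_pow]
  exact ⟨⟨hm, hle.trans_lt ENNReal.ofReal_lt_top⟩, nrm2_le_of_eLpNorm hC hle⟩

theorem memLp_pmulIntegrand (hG : PerMul K G) (hε : ε ≠ 0) (hχ : MemLp χ 2 volume) :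
    MemLp (pmulIntegrand G ε χ) 2 (cellProd d) ∧
      nrm2 (cellProd d) (pmulIntegrand G ε χ) ≤ K * nrm2 volume χ := by
  obtain ⟨h1, h2⟩ := memLp_pmulIntegrand_shear hG hε hχ
  have he : pmulIntegrand G ε χ = (fun p => pmulIntegrand G ε χ (shear ε p)) ∘ shear (-ε) := by
    funext p
    simp [shear]
  have hmp := measurePreserving_shear (d := d) (-ε)
  constructor
  · rw [he]
    exact h1.comp_measurePreserving hmp
  · rw [he, nrm2, eLpNorm_comp_measurePreserving h1.1 hmp]
    exact h2

theorem pmul_eq_integral (hε : ε ≠ 0) (hχ : LocallyIntegrable χ) :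
    ∀ᵐ x, pmul G ε χ x = ∫ ω in cell d, pmulIntegrand G ε χ (ω, x) := by
  filter_upwards [integrable_steklov hε hχ] with x hx
  exact ((G (ε⁻¹ • x)).integral_comp_comm hx).symm

theorem aestronglyMeasurable_pmul (hG : StronglyMeasurable G) (hε : ε ≠ 0)
    (hχ : LocallyIntegrable χ) : AEStronglyMeasurable (pmul G ε χ) volume := by
  refine aestronglyMeasurable_clm_apply
    (hG.comp_measurable (by fun_prop)).aestronglyMeasurable ?_
  rw [steklov_eq_avg hε]
  exact (locallyIntegrable_avg (stekMeasure_support ε) hχ).aestronglyMeasurable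

/-- Multiplication of Steklov means by rapidly oscillating functions which are only square
integrable over the cell is bounded in `L²`. -/
theorem memLp_pmul (hG : PerMul K G) (hε : ε ≠ 0) (hχ : MemLp χ 2 volume) :
    MemLp (pmul G ε χ) 2 volume ∧ nrm2 volume (pmul G ε χ) ≤ K * nrm2 volume χ := by
  obtain ⟨h1, h2⟩ := memLp_pmulIntegrand hG hε hχ
  have hC : 0 ≤ K * nrm2 volume χ := mul_nonneg hG.nonneg nrm2_nonneg
  have hl := hχ.locallyIntegrable one_le_two
  have hle : eLpNorm (pmul G ε χ) 2 volume ≤ ENNReal.ofReal (K * nrm2 volume χ) := by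
    refine nrm2_le_of_lintegral hC ?_
    calc ∫⁻ x, ‖pmul G ε χ x‖ₑ ^ 2
        ≤ ∫⁻ x, (∫⁻ ω in cell d, ‖pmulIntegrand G ε χ (ω, x)‖ₑ ^ 2) := by
          refine lintegral_mono_ae ?_
          filter_upwards [pmul_eq_integral (G := G) hε hl] with x hx
          rw [hx]
          exact enorm_integral_sq_le _ _
      _ = ∫⁻ p, ‖pmulIntegrand G ε χ p‖ₑ ^ 2 ∂(cellProd d) :=
          (lintegral_prod_symm _ (h1.1.enorm.pow_const 2)).symm
      _ = ENNReal.ofReal (nrm2 (cellProd d) (pmulIntegrand G ε χ) ^ 2) := lintegral_eq_nrm2 h1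
      _ ≤ _ := ENNReal.ofReal_le_ofReal (pow_le_pow_left₀ nrm2_nonneg h2 2)
  exact ⟨⟨aestronglyMeasurable_pmul hG.meas hε hl, hle.trans_lt ENNReal.ofReal_lt_top⟩,
    nrm2_le_of_eLpNorm hC hle⟩

theorem L2Tendsto.pmul (hG : PerMul K G) (hε : ε ≠ 0) {χj : ℕ → E d → X}
    (h : L2Tendsto volume χj χ) :
    L2Tendsto volume (fun j => pmul G ε (χj j)) (pmul G ε χ) := by
  refine h.map (fun χ => HighOrderHomogenization.pmul G ε χ) K
    (fun f hf => (memLp_pmul hG hε hf).1) fun f g hf hg => ?_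
  rw [← nrm2_congr (pmul_sub hε (hf.locallyIntegrable one_le_two)
    (hg.locallyIntegrable one_le_two))]
  exact (memLp_pmul hG hε (hf.sub hg)).2

/-- If the periodic factor has zero mean, pairing with a weakly differentiable function gains the
factor `ε`: after unfolding the Steklov mean, the mean value property allows to subtract
`Φ(z)` from `Φ(z + ε ω)`. -/
theorem norm_integral_inner_pmul_le (hG : PerMul K G) (hε : 0 < ε)
    (hmean : ∀ c, ∫ y in cell d, G y c = 0) {Φ : E d → Z} {w : Fin d → E d → Z}
    (hw : ∀ i, HasWeakDeriv (unitIdx i) Φ (w i)) (hΦ : MemLp Φ 2 volume)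
    (hw2 : ∀ i, MemLp (w i) 2 volume) (hχ : MemLp χ 2 volume) :
    ‖∫ x, inner ℂ (Φ x) (pmul G ε χ x)‖ ≤
      (ε * d * ∑ i, nrm2 volume (w i)) * (K * nrm2 volume χ) := by
  have hl := hχ.locallyIntegrable one_le_two
  obtain ⟨q1, -⟩ := memLp_pmulIntegrand hG hε.ne' hχ
  obtain ⟨q2, q3⟩ := memLp_pmulIntegrand_shear hG hε.ne' hχ
  have hs : 0 ≤ ∑ i, nrm2 volume (w i) := Finset.sum_nonneg fun i _ => nrm2_nonneg
  have p1 : MemLp (fun p : E d × E d => Φ p.2) 2 (cellProd d) :=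
    hΦ.comp_measurePreserving measurePreserving_snd
  have hmp := measurePreserving_shear (d := d) ε
  have p2 : MemLp (fun p : E d × E d => Φ (shear ε p).2) 2 (cellProd d) :=
    p1.comp_measurePreserving hmp
  have hi1 := integrable_inner p1 q1
  -- write the Steklov mean as an integral over the cell
  have e1 : ∫ x, inner ℂ (Φ x) (pmul G ε χ x) =
      ∫ p, inner ℂ (Φ p.2) (pmulIntegrand G ε χ p) ∂(cellProd d) := by
    rw [integral_prod_symm _ hi1]
    refine integral_congr_ae ?_
    filter_upwards [pmul_eq_integral (G := G) hε.ne' hl, integrable_steklov hε.ne' hl] with x hx hi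
    rw [hx]
    exact (integral_inner ((G (ε⁻¹ • x)).integrable_comp hi) (Φ x)).symm
  -- the shear `x = z + ε ω` makes the smoothed factor depend on `z` only
  have e2 : ∫ p, inner ℂ (Φ p.2) (pmulIntegrand G ε χ p) ∂(cellProd d) =
      ∫ p, inner ℂ (Φ (shear ε p).2) (pmulIntegrand G ε χ (shear ε p)) ∂(cellProd d) := by
    conv_lhs => rw [← hmp.map_eq]
    rw [integral_map hmp.measurable.aemeasurable]
    rw [hmp.map_eq]
    exact hi1.1
  -- with `Φ(z)` in place of `Φ(z + ε ω)` the integral over `ω` is the mean of `G`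
  have e3 : ∫ p, inner ℂ (Φ p.2) (pmulIntegrand G ε χ (shear ε p)) ∂(cellProd d) = 0 := by
    rw [integral_prod_symm _ (integrable_inner p1 q2)]
    refine integral_eq_zero_of_ae ?_
    have hq : ∀ᵐ z, MemLp (fun ω => pmulIntegrand G ε χ (shear ε (ω, z))) 2
        (volume.restrict (cell d)) := by
      refine Filter.Eventually.of_forall fun z => ?_
      simp only [pmulIntegrand_shear hε.ne']
      refine ⟨aestronglyMeasurable_clm_apply (hG.meas.comp_measurable
        (by fun_prop : Measurable fun ω : E d => ω + ε⁻¹ • z)).aestronglyMeasurable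
          aestronglyMeasurable_const, ?_⟩
      have hper := hG.per.comp_left fun L => ‖L (χ z)‖ₑ ^ 2
      refine (ENNReal.pow_lt_top_iff.1 ?_).resolve_right two_ne_zero
      rw [eLpNorm_two_sq, lintegral_cell_add hper]
      exact (hG.bound _).trans_lt ENNReal.ofReal_lt_top
    filter_upwards [hq] with z hz
    have hper := hG.per.comp_left fun L => L (χ z)
    have := integral_inner (𝕜 := ℂ) (hz.integrable one_le_two) (Φ z)
    simp only [pmulIntegrand_shear hε.ne'] at this
    rw [integral_cell_add hper, hmean, inner_zero_right] at this
    simp only [pmulIntegrand_shear hε.ne', Pi.zero_apply]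
    exact this
  -- what remains are the increments `Φ(z + ε ω) - Φ(z)` over steps of length at most `ε d`
  rw [e1, e2, ← sub_zero (∫ p, _ ∂_), ← e3, ← integral_sub_inner p2 p1 q2]
  refine (norm_integral_inner_le (p2.sub p1) q2).trans ?_
  refine mul_le_mul ?_ q3 nrm2_nonneg (by positivity)
  have hC : 0 ≤ ε * d * ∑ i, nrm2 volume (w i) := by positivity
  refine nrm2_le_of_eLpNorm hC (nrm2_le_of_lintegral hC ?_)
  rw [lintegral_prod _ ((p2.sub p1).1.enorm.pow_const 2)]
  have hω : ∀ᵐ ω ∂(volume.restrict (cell d)),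
      ∫⁻ z, ‖(fun p : E d × E d => Φ (shear ε p).2 - Φ p.2) (ω, z)‖ₑ ^ 2 ≤
        ENNReal.ofReal ((ε * d * ∑ i, nrm2 volume (w i)) ^ 2) := by
    filter_upwards [ae_restrict_mem measurableSet_cell] with ω hω
    obtain ⟨t1, t2⟩ := nrm2_translate_sub_le hw (hΦ.locallyIntegrable one_le_two) Set.univ
      (by simpa using hw2) (fun i h => by
        simpa using lintegral_sub_right_eq_self (fun x => ‖w i x‖ₑ ^ 2) h) (-(ε • ω))
    simp only [Measure.restrict_univ, sub_neg_eq_add, norm_neg] at t1 t2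
    simp only [shear]
    rw [lintegral_eq_nrm2 t1]
    refine ENNReal.ofReal_le_ofReal (pow_le_pow_left₀ nrm2_nonneg (t2.trans ?_) 2)
    refine mul_le_mul_of_nonneg_right ?_ hs
    rw [norm_smul, Real.norm_of_nonneg hε.le]
    exact mul_le_mul_of_nonneg_left (norm_le_of_mem_cell hω) hε.le
  refine (lintegral_mono_ae hω).trans ?_
  simp

end Multiplier

/-! ### Arrays as vectors of a Euclidean space -/

section Pack

variable {ι : Type*} [Fintype ι] [DecidableEq ι] {n : ℕ}

/-- Families `{v_i}` of vectors of `ℂ^n`, as vectors of one Euclidean space. -/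
abbrev Pk (ι : Type*) (n : ℕ) := EuclideanSpace ℂ (ι × Fin n)

/-- The vector with components `v i`. -/
def pack (v : ι → V n) : Pk ι n := WithLp.toLp 2 fun p => v p.1 p.2

/-- The component with index `i`. -/
noncomputable def prj (i : ι) : Pk ι n →L[ℂ] V n :=
  LinearMap.toContinuousLinearMap
    { toFun := fun F => WithLp.toLp 2 fun j => F (i, j)
      map_add' := fun _ _ => rfl
      map_smul' := fun _ _ => rfl }

/-- The vector whose only nonzero component is the one with index `i`. -/
noncomputable def emb (i : ι) : V n →L[ℂ] Pk ι n :=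
  LinearMap.toContinuousLinearMap
    { toFun := fun v => pack (Pi.single i v)
      map_add' := fun v w => by
        ext p
        by_cases h : p.1 = i <;> simp [pack, h, Pi.single_apply]
      map_smul' := fun c v => by
        ext p
        by_cases h : p.1 = i <;> simp [pack, h, Pi.single_apply] }

theorem prj_apply (i : ι) (F : Pk ι n) (j : Fin n) : prj i F j = F (i, j) := rfl

theorem emb_apply (i : ι) (v : V n) : emb i v = pack (Pi.single i v) := rfl

theorem prj_pack (i : ι) (v : ι → V n) : prj i (pack v) = v i := rfl

theorem pack_prj (F : Pk ι n) : pack (fun i => prj i F) = F := rfl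

theorem prj_emb (i : ι) (v : V n) : prj i (emb i v) = v := by
  rw [emb_apply, prj_pack, Pi.single_eq_same]

theorem prj_emb_ne {i j : ι} (h : j ≠ i) (v : V n) : prj j (emb i v) = 0 := by
  rw [emb_apply, prj_pack, Pi.single_eq_of_ne h]

theorem Pk.ext {F G : Pk ι n} (h : ∀ i, prj i F = prj i G) : F = G := by
  rw [← pack_prj F, ← pack_prj G]
  exact congrArg pack (funext h)

theorem pack_eq_sum (v : ι → V n) : pack v = ∑ i, emb i (v i) := by
  refine Pk.ext fun j => ?_
  rw [map_sum, Finset.sum_eq_single j (fun i _ hi => prj_emb_ne hi.symm _) (by simp), prj_emb,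
    prj_pack]

theorem inner_Pk (F G : Pk ι n) : inner ℂ F G = ∑ i, inner ℂ (prj i F) (prj i G) := by
  simp only [PiLp.inner_apply, Fintype.sum_prod_type, prj_apply]

theorem norm_Pk_sq (F : Pk ι n) : ‖F‖ ^ 2 = ∑ i, ‖prj i F‖ ^ 2 := by
  simp only [EuclideanSpace.norm_sq_eq, Fintype.sum_prod_type, prj_apply]

theorem norm_prj_le (i : ι) (F : Pk ι n) : ‖prj i F‖ ≤ ‖F‖ := by
  refine (sq_le_sq₀ (norm_nonneg _) (norm_nonneg _)).1 ?_
  rw [norm_Pk_sq]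
  exact Finset.single_le_sum (f := fun i => ‖prj i F‖ ^ 2) (fun _ _ => sq_nonneg _)
    (Finset.mem_univ i)

theorem norm_emb (i : ι) (v : V n) : ‖(emb i v : Pk ι n)‖ = ‖v‖ := by
  refine (pow_left_inj₀ (norm_nonneg _) (norm_nonneg _) two_ne_zero).1 ?_
  rw [norm_Pk_sq, Finset.sum_eq_single i (fun j _ hj => by rw [prj_emb_ne hj]; simp) (by simp),
    prj_emb]

variable {Ω : Type*} [MeasurableSpace Ω] {μ : Measure Ω} {D : ι → Ω → V n}

theorem memLp_pack (h : ∀ i, MemLp (D i) 2 μ) : MemLp (fun x => pack fun i => D i x) 2 μ := by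
  simp only [pack_eq_sum]
  exact memLp_finsetSum _ fun i _ => (emb i).comp_memLp' (h i)

theorem memLp_prj {u : Ω → Pk ι n} (h : MemLp u 2 μ) (i : ι) : MemLp (fun x => prj i (u x)) 2 μ :=
  (prj i).comp_memLp' h

theorem nrm2_emb (i : ι) (u : Ω → V n) : nrm2 μ (fun x => (emb i (u x) : Pk ι n)) = nrm2 μ u := by
  simp only [nrm2]
  rw [eLpNorm_congr_norm_ae (Filter.Eventually.of_forall fun x => norm_emb i (u x))]

theorem nrm2_pack_le (h : ∀ i, MemLp (D i) 2 μ) :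
    nrm2 μ (fun x => pack fun i => D i x) ≤ ∑ i, nrm2 μ (D i) := by
  simp only [pack_eq_sum]
  refine (nrm2_sum_le _ fun i _ => (emb i).comp_memLp' (h i)).trans_eq ?_
  exact Finset.sum_congr rfl fun i _ => nrm2_emb i _

theorem nrm2_prj_le {u : Ω → Pk ι n} (h : MemLp u 2 μ) (i : ι) :
    nrm2 μ (fun x => prj i (u x)) ≤ nrm2 μ u :=
  nrm2_mono h (Filter.Eventually.of_forall fun _ => norm_prj_le i _)

theorem L2Tendsto.pack {Dj : ι → ℕ → Ω → V n} (h : ∀ i, L2Tendsto μ (Dj i) (D i)) :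
    L2Tendsto μ (fun j x => HighOrderHomogenization.pack fun i => Dj i j x)
      (fun x => HighOrderHomogenization.pack fun i => D i x) := by
  simp only [pack_eq_sum]
  exact L2Tendsto.sum _ fun i _ => (h i).clm ((emb i : V n →L[ℂ] Pk ι n).restrictScalars ℝ)

theorem HasWeakDeriv.pack {d : ℕ} {γ : Fin d → ℕ} {u w : ι → E d → V n}
    (h : ∀ i, HasWeakDeriv γ (u i) (w i)) :
    HasWeakDeriv γ (fun x => HighOrderHomogenization.pack fun i => u i x)
      (fun x => HighOrderHomogenization.pack fun i => w i x) := by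
  simp only [pack_eq_sum]
  exact HasWeakDeriv.fun_sum _ fun i _ =>
    (h i).clm_comp ((emb i : V n →L[ℂ] Pk ι n).restrictScalars ℝ)

end Pack

/-! ### Gradients and coefficient arrays as vectors and operators -/

section Gradient

variable {d m n : ℕ}

/-- The space of arrays `{F_{j,α}}`, `|α| = m`, with its Hermitian structure. -/
abbrev W (d m n : ℕ) := Pk (MIdx d m) n

/-- The array of weak derivatives of order `m`. -/
noncomputable def wgrad (m : ℕ) (u : E d → V n) (x : E d) : W d m n :=
  pack fun α => weakDeriv α.1 u x

/-- An array as a vector. -/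
def toW (F : Arr d m n) : W d m n := WithLp.toLp 2 fun p => F p.1 p.2

theorem toW_grad (u : E d → V n) (x : E d) : toW (grad m u x) = wgrad m u x := rfl

theorem arrNormSq_eq (F : Arr d m n) : arrNormSq F = ‖toW F‖ ^ 2 := by
  rw [EuclideanSpace.norm_sq_eq, Fintype.sum_prod_type]
  rfl

theorem arrInner_eq (F G : Arr d m n) : arrInner F G = inner ℂ (toW F) (toW G) := by
  rw [PiLp.inner_apply, Fintype.sum_prod_type]
  simp only [arrInner, RCLike.inner_apply, mul_comm]
  rfl

/-- An array of coefficients as an operator on arrays. -/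
noncomputable def aop : CArr d m n →ₗ[ℂ] (W d m n →L[ℂ] W d m n) where
  toFun a := LinearMap.toContinuousLinearMap
    { toFun := fun F => toW (a.mul fun β k => F (β, k))
      map_add' := fun F G => by
        ext p
        simp [toW, CArr.mul, mul_add, Finset.sum_add_distrib]
      map_smul' := fun c F => by
        ext p
        simp [toW, CArr.mul, mul_left_comm, Finset.mul_sum] }
  map_add' a b := by
    ext F p
    simp [toW, CArr.mul, add_mul, Finset.sum_add_distrib]
  map_smul' c a := by
    ext F p
    simp [toW, CArr.mul, Finset.mul_sum, mul_assoc]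

theorem aop_toW (a : CArr d m n) (F : Arr d m n) : aop a (toW F) = toW (a.mul F) := rfl

theorem continuous_aop : Continuous (aop : CArr d m n → (W d m n →L[ℂ] W d m n)) :=
  LinearMap.continuous_of_finiteDimensional aop

theorem norm_aop_le {lam1 : ℝ} (h1 : 0 ≤ lam1) {a : CArr d m n}
    (h : ∀ F : Arr d m n, arrNormSq (a.mul F) ≤ lam1 ^ 2 * arrNormSq F) : ‖aop a‖ ≤ lam1 := by
  refine ContinuousLinearMap.opNorm_le_bound _ h1 fun F => ?_
  have := h fun β k => F (β, k)
  rw [arrNormSq_eq, arrNormSq_eq, ← mul_pow] at this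
  exact (sq_le_sq₀ (norm_nonneg _) (by positivity)).1 this

end Gradient

/-! ### The Sobolev norm as a sum over multiindices -/

section SobolevNorm

variable {d m n : ℕ} {F : Type*} [NormedAddCommGroup F] [NormedSpace ℝ F]

/-- The sum of the `L²` norms of the derivatives of order at most `m`; it is equivalent to the
norm of `H^m`. -/
noncomputable def sobNorm (m : ℕ) (u : E d → F) : ℝ :=
  ∑ γ ∈ idxLE d m, nrm2 volume (weakDeriv γ u)

theorem sobNorm_nonneg (m : ℕ) (u : E d → F) : 0 ≤ sobNorm m u :=
  Finset.sum_nonneg fun _ _ => nrm2_nonneg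

theorem sobNorm_congr {u v : E d → F} (h : u =ᵐ[volume] v) : sobNorm m u = sobNorm m v := by
  simp only [sobNorm, weakDeriv_congr h]

theorem nrm2_weakDeriv_le_sobNorm (u : E d → F) {γ : Fin d → ℕ} (h : ∑ i, γ i ≤ m) :
    nrm2 volume (weakDeriv γ u) ≤ sobNorm m u :=
  Finset.single_le_sum (f := fun γ => nrm2 volume (weakDeriv γ u)) (fun _ _ => nrm2_nonneg)
    (mem_idxLE.2 h)

theorem nrm2_le_sobNorm [CompleteSpace F] {u : E d → F} (hu : LocallyIntegrable u) :
    nrm2 volume u ≤ sobNorm m u := by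
  rw [← nrm2_congr (weakDeriv_zero_ae hu)]
  exact nrm2_weakDeriv_le_sobNorm u (by simp)

theorem sobNorm_mono {k : ℕ} (h : k ≤ m) (u : E d → F) : sobNorm k u ≤ sobNorm m u :=
  Finset.sum_le_sum_of_subset_of_nonneg
    (fun _ hγ => mem_idxLE.2 ((mem_idxLE.1 hγ).trans h)) fun _ _ _ => nrm2_nonneg

theorem sobNorm_add_le [CompleteSpace F] {u v : E d → F} (hu : MemH m u) (hv : MemH m v) :
    sobNorm m (fun x => u x + v x) ≤ sobNorm m u + sobNorm m v := by
  simp only [sobNorm]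
  rw [← Finset.sum_add_distrib]
  refine Finset.sum_le_sum fun γ hγ => ?_
  have h := mem_idxLE.1 hγ
  rw [nrm2_congr ((hu.hasWeakDeriv h).fun_add (hv.hasWeakDeriv h)).weakDeriv_ae_eq]
  exact nrm2_add_le (hu.memLp_weakDeriv h) (hv.memLp_weakDeriv h)

theorem sqrt_sum_sq_le {ι : Type*} (s : Finset ι) {a : ι → ℝ} (h : ∀ i ∈ s, 0 ≤ a i) :
    Real.sqrt (∑ i ∈ s, a i ^ 2) ≤ ∑ i ∈ s, a i := by
  rw [Real.sqrt_le_left (Finset.sum_nonneg h)]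
  exact Finset.sum_sq_le_sq_sum_of_nonneg h

theorem sum_idxLE {X : Type*} [AddCommMonoid X] (f : (Fin d → ℕ) → X) :
    ∑ γ ∈ idxLE d m, f γ = ∑ k ∈ Finset.range (m + 1), ∑ γ : MIdx d k, f γ.1 := by
  symm
  rw [Finset.sum_sigma']
  refine Finset.sum_bij (fun p _ => p.2.1) ?_ ?_ ?_ ?_
  · rintro ⟨k, γ, hγ⟩ h
    simp only [Finset.mem_sigma, Finset.mem_range] at h
    exact mem_idxLE.2 (by simp only [hγ]; omega)
  · rintro ⟨k, γ, hγ⟩ - ⟨k', γ', hγ'⟩ - h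
    simp only at h
    subst h
    subst hγ
    subst hγ'
    rfl
  · intro γ hγ
    exact ⟨⟨∑ i, γ i, γ, rfl⟩, Finset.mem_sigma.2 ⟨Finset.mem_range.2
      (Nat.lt_succ_of_le (mem_idxLE.1 hγ)), Finset.mem_univ _⟩, rfl⟩
  · rintro ⟨k, γ, hγ⟩ -
    rfl

theorem hNorm_le_sobNorm (u : E d → F) : hNorm m u ≤ sobNorm m u := by
  simp only [hNorm, l2Norm_eq_nrm2]
  rw [← sum_idxLE fun γ => nrm2 volume (weakDeriv γ u) ^ 2]
  exact sqrt_sum_sq_le _ fun _ _ => nrm2_nonneg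

theorem MemH.memLp_wgrad {k : ℕ} {u : E d → V n} (hu : MemH k u) (h : m ≤ k) :
    MemLp (wgrad m u) 2 volume := memLp_pack fun α => hu.memLp_weakDeriv (by rw [α.2]; exact h)

theorem nrm2_wgrad_le {k : ℕ} {u : E d → V n} (hu : MemH k u) (h : m ≤ k) :
    nrm2 volume (wgrad m u) ≤ ∑ α : MIdx d m, nrm2 volume (weakDeriv α.1 u) :=
  nrm2_pack_le fun α => hu.memLp_weakDeriv (by rw [α.2]; exact h)

theorem sum_nrm2_weakDeriv_le_sobNorm {k : ℕ} (h : m ≤ k) (u : E d → F) :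
    ∑ α : MIdx d m, nrm2 volume (weakDeriv α.1 u) ≤ sobNorm k u := by
  rw [sobNorm, ← Finset.sum_image (f := fun γ => nrm2 volume (weakDeriv γ u))
    (s := Finset.univ) (g := fun α : MIdx d m => α.1) Subtype.val_injective.injOn]
  refine Finset.sum_le_sum_of_subset_of_nonneg ?_ fun _ _ _ => nrm2_nonneg
  intro γ hγ
  obtain ⟨α, -, rfl⟩ := Finset.mem_image.1 hγ
  exact mem_idxLE.2 (by rw [α.2]; exact h)

theorem nrm2_wgrad_le_sobNorm {u : E d → V n} (hu : MemH m u) :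
    nrm2 volume (wgrad m u) ≤ sobNorm m u :=
  (nrm2_wgrad_le hu le_rfl).trans (sum_nrm2_weakDeriv_le_sobNorm le_rfl u)

theorem nrm2_weakDeriv_le_wgrad {u : E d → V n} (hu : MemH m u) (α : MIdx d m) :
    nrm2 volume (weakDeriv α.1 u) ≤ nrm2 volume (wgrad m u) :=
  nrm2_prj_le (hu.memLp_wgrad le_rfl) α

theorem wgrad_congr {u v : E d → V n} (h : u =ᵐ[volume] v) : wgrad m u = wgrad m v := by
  funext x
  simp only [wgrad, weakDeriv_congr h]

theorem wgrad_ae_eq {u : E d → V n} {D : MIdx d m → E d → V n}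
    (h : ∀ α, HasWeakDeriv α.1 u (D α)) : wgrad m u =ᵐ[volume] fun x => pack fun α => D α x := by
  filter_upwards [ae_all_iff.2 fun α => (h α).weakDeriv_ae_eq] with x hx
  simp only [wgrad, hx]

theorem wgrad_sub {u v : E d → V n} (hu : MemH m u) (hv : MemH m v) :
    wgrad m (fun x => u x - v x) =ᵐ[volume] fun x => wgrad m u x - wgrad m v x :=
  wgrad_ae_eq fun α => (hu.hasWeakDeriv α.2.le).fun_sub (hv.hasWeakDeriv α.2.le)

theorem MemH.exists_approx {u : E d → V n} (hu : MemH m u) :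
    ∃ φ : ℕ → E d → V n, (∀ j, Smooth (φ j) ∧ HasCompactSupport (φ j)) ∧
      (∀ γ : Fin d → ℕ, ∑ i, γ i ≤ m →
        L2Tendsto volume (fun j => HighOrderHomogenization.weakDeriv γ (φ j)) (HighOrderHomogenization.weakDeriv γ u)) ∧
      L2Tendsto volume (fun j => wgrad m (φ j)) (wgrad m u) := by
  obtain ⟨φ, h1, h2⟩ := hu.exists_test_approx
  have h3 : ∀ γ : Fin d → ℕ, ∑ i, γ i ≤ m →
      L2Tendsto volume (fun j => HighOrderHomogenization.weakDeriv γ (φ j)) (HighOrderHomogenization.weakDeriv γ u) := fun γ hγ =>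
    (h2 γ hγ).congr (fun j => (weakDeriv_smooth (h1 j).1).symm) Filter.EventuallyEq.rfl
  exact ⟨φ, h1, h3, L2Tendsto.pack fun α => h3 α.1 α.2.le⟩

end SobolevNorm

/-! ### Integration by parts and interpolation of derivatives -/

section Parts

variable {d : ℕ} {Z : Type*} [NormedAddCommGroup Z] [InnerProductSpace ℂ Z]
  [FiniteDimensional ℂ Z] {γ : Fin d → ℕ}

theorem Smooth.memLp {F : Type*} [NormedAddCommGroup F] [NormedSpace ℝ F] {φ : E d → F}
    (hφ : Smooth φ) (hc : HasCompactSupport φ) : MemLp φ 2 volume :=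
  hφ.continuous.memLp_of_hasCompactSupport hc

/-- The definition of weak derivatives extends to vector-valued test functions. -/
theorem HasWeakDeriv.integral_inner {g w : E d → Z} (h : HasWeakDeriv γ g w) {φ : E d → Z}
    (hφ : Smooth φ) (hc : HasCompactSupport φ) :
    ∫ x, inner ℂ (multiDeriv γ φ x) (g x) = (-1) ^ (∑ i, γ i) * ∫ x, inner ℂ (φ x) (w x) := by
  have : FiniteDimensional ℝ Z := FiniteDimensional.complexToReal Z
  have : CompleteSpace Z := FiniteDimensional.complete ℝ Z
  -- expand the first argument of the inner product in a real basis: its coordinates are scalar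
  -- test functions
  let b := Module.finBasis ℝ Z
  let c : Fin (Module.finrank ℝ Z) → Z →L[ℝ] ℝ := fun k => (b.coord k).toContinuousLinearMap
  let l : Fin (Module.finrank ℝ Z) → Z →L[ℝ] ℂ := fun k =>
    (innerSL ℂ (b k)).restrictScalars ℝ
  have key : ∀ v z : Z, inner ℂ v z = ∑ k, c k v • l k z := by
    intro v z
    conv_lhs => rw [← b.sum_repr v, sum_inner]
    refine Finset.sum_congr rfl fun k _ => ?_
    rw [← Complex.coe_smul, inner_smul_left, Complex.conj_ofReal, Complex.real_smul]
    rfl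
  have hs : ∀ k, Smooth fun x => c k (φ x) := fun k => (c k).contDiff.comp hφ
  have hcs : ∀ k, HasCompactSupport fun x => c k (φ x) := fun k =>
    hc.comp_left (g := c k) (map_zero _)
  have hl : ∀ k, HasWeakDeriv γ (fun x => l k (g x)) (fun x => l k (w x)) := fun k =>
    h.clm_comp (l k)
  simp only [key]
  rw [integral_finsetSum, integral_finsetSum, Finset.mul_sum]
  · refine Finset.sum_congr rfl fun k _ => ?_
    have := (hl k).2.2 _ (hs k) (hcs k)
    rw [multiDeriv_clm_comp (c k) hφ] at this
    rw [this]
    simp [Complex.real_smul]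
  · exact fun k _ => integrable_test_smul (hs k).continuous (hcs k) (hl k).2.1
  · intro k _
    have := integrable_multiDeriv_smul (hs k) (hcs k) (hl k).1 γ
    rwa [multiDeriv_clm_comp (c k) hφ] at this

theorem MemH.integral_inner {k : ℕ} {φ g : E d → Z} (hφ : MemH k φ) (hg : MemH k g)
    (hγ : ∑ i, γ i ≤ k) :
    ∫ x, inner ℂ (HighOrderHomogenization.weakDeriv γ φ x) (g x) =
      (-1) ^ (∑ i, γ i) * ∫ x, inner ℂ (φ x) (HighOrderHomogenization.weakDeriv γ g x) := by
  have : FiniteDimensional ℝ Z := FiniteDimensional.complexToReal Z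
  have : CompleteSpace Z := FiniteDimensional.complete ℝ Z
  obtain ⟨ψ, h1, h2⟩ := hφ.exists_test_approx
  have t1 := (h2 γ hγ).inner (L2Tendsto.const hg.memLp)
  have t2 := ((h2 0 (by simp)).congr (fun _ => by rw [multiDeriv_zero])
    (weakDeriv_zero_ae hφ.locallyIntegrable)).inner (L2Tendsto.const (hg.memLp_weakDeriv hγ))
  refine tendsto_nhds_unique t1 ?_
  refine (t2.const_mul ((-1) ^ (∑ i, γ i))).congr fun j => ?_
  exact ((hg.hasWeakDeriv hγ).integral_inner (h1 j).1 (h1 j).2).symm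

/-- A nonnegative sequence which satisfies the convexity condition `a_{i+1}² ≤ c_i a_i a_{i+2}` has
its next to last term controlled by the first and the last one. -/
theorem interpolation_step (c : ℕ → ℝ) (hc : ∀ k, 0 ≤ c k) (k : ℕ) :
    ∃ C, 0 ≤ C ∧ ∀ a : ℕ → ℝ, (∀ i, 0 ≤ a i) →
      (∀ i < k, a (i + 1) ^ 2 ≤ c i * (a i * a (i + 2))) → a k ≤ C * (a 0 + a (k + 1)) := by
  induction k with
  | zero => exact ⟨1, zero_le_one, fun a ha _ => by linarith [ha 1]⟩
  | succ k ih =>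
    obtain ⟨C, hC, h⟩ := ih
    refine ⟨1 + 2 * c k * C, by have := hc k; positivity, fun a ha hk => ?_⟩
    have h1 := h a ha fun i hi => hk i (hi.trans k.lt_succ_self)
    have h2 := hk k k.lt_succ_self
    have hck := hc k
    have p : 0 ≤ 2 * c k * C := by positivity
    rcases le_or_gt (a (k + 1)) (a 0) with h3 | h3
    · nlinarith [ha 0, ha (k + 1 + 1), mul_nonneg p (add_nonneg (ha 0) (ha (k + 1 + 1)))]
    · have h4 : a (k + 1) ^ 2 ≤ c k * ((C * (2 * a (k + 1))) * a (k + 2)) := by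
        refine h2.trans (mul_le_mul_of_nonneg_left (mul_le_mul_of_nonneg_right (h1.trans ?_)
          (ha _)) hck)
        exact mul_le_mul_of_nonneg_left (by linarith) hC
      have h5 : a (k + 1) ≤ 2 * c k * C * a (k + 2) := by
        have h6 : 0 < a (k + 1) := (ha 0).trans_lt h3
        refine le_of_mul_le_mul_right ?_ h6
        calc a (k + 1) * a (k + 1) = a (k + 1) ^ 2 := by ring
          _ ≤ _ := h4
          _ = _ := by ring
      have h7 := mul_nonneg p (ha 0)
      have h8 := ha 0
      have h9 := ha (k + 2)
      calc a (k + 1) ≤ 2 * c k * C * a (k + 2) := h5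
        _ ≤ (1 + 2 * c k * C) * (a 0 + a (k + 1 + 1)) := by
          have : (1 + 2 * c k * C) * (a 0 + a (k + 1 + 1)) =
            a 0 + a (k + 2) + 2 * c k * C * a 0 + 2 * c k * C * a (k + 2) := by ring
          linarith

/-- All terms of a sequence with `a_{i+1}² ≤ c_i a_i a_{i+2}` are controlled by the end terms. -/
theorem interpolation_sequence (c : ℕ → ℝ) (hc : ∀ k, 0 ≤ c k) (M : ℕ) :
    ∃ C, 0 ≤ C ∧ ∀ a : ℕ → ℝ, (∀ i, 0 ≤ a i) →
      (∀ i, i + 2 ≤ M → a (i + 1) ^ 2 ≤ c i * (a i * a (i + 2))) →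
      ∀ k ≤ M, a k ≤ C * (a 0 + a M) := by
  induction M with
  | zero =>
    refine ⟨1, zero_le_one, fun a ha _ k hk => ?_⟩
    obtain rfl : k = 0 := by omega
    linarith [ha 0]
  | succ M ih =>
    obtain ⟨C, hC, h⟩ := ih
    obtain ⟨C', hC', h'⟩ := interpolation_step c hc M
    refine ⟨C * (1 + C') + 1, by positivity, fun a ha hk k hkM => ?_⟩
    have p0 := ha 0
    have p1 := ha (M + 1)
    rcases hkM.eq_or_lt with rfl | hlt
    · have : 0 ≤ C * (1 + C') * (a 0 + a (M + 1)) := by positivity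
      nlinarith
    · have h1 := h a ha (fun i hi => hk i (by omega)) k (by omega)
      have h2 := h' a ha fun i hi => hk i (by omega)
      calc a k ≤ C * (a 0 + a M) := h1
        _ ≤ C * ((a 0 + a (M + 1)) + C' * (a 0 + a (M + 1))) :=
          mul_le_mul_of_nonneg_left (by linarith) hC
        _ ≤ _ := by nlinarith

theorem exists_add_unitIdx {k : ℕ} (γ : MIdx d (k + 1)) :
    ∃ (μ : MIdx d k) (i : Fin d), γ.1 = μ.1 + unitIdx i := by
  have : ∃ i, 1 ≤ γ.1 i := by
    by_contra! h
    have h0 : ∑ i, γ.1 i = 0 := Finset.sum_eq_zero fun i _ => by have := h i; omega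
    rw [γ.2] at h0
    omega
  obtain ⟨i, hi⟩ := this
  have hle := unitIdx_le_iff.2 hi
  have hs := sum_sub_idx hle
  rw [sum_unitIdx, γ.2] at hs
  exact ⟨⟨γ.1 - unitIdx i, by omega⟩, i, (tsub_add_cancel_of_le hle).symm⟩

/-- One integration by parts: `‖∂_i D^μ v‖² ≤ ‖D^μ v‖ ‖∂_i² D^μ v‖`. -/
theorem nrm2_weakDeriv_sq_le {M : ℕ} {v : E d → Z} (hv : MemH M v) {μ : Fin d → ℕ} (i : Fin d)
    (h : ∑ j, μ j + 2 ≤ M) :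
    nrm2 volume (weakDeriv (μ + unitIdx i) v) ^ 2 ≤
      nrm2 volume (weakDeriv μ v) * nrm2 volume (weakDeriv (μ + unitIdx i + unitIdx i) v) := by
  have : FiniteDimensional ℝ Z := FiniteDimensional.complexToReal Z
  have : CompleteSpace Z := FiniteDimensional.complete ℝ Z
  obtain ⟨M', rfl⟩ : ∃ M', M = 1 + M' := ⟨M - 1, by omega⟩
  have s1 := sum_unitIdx i
  have s2 := sum_add_idx μ (unitIdx i)
  have s3 := sum_add_idx (μ + unitIdx i) (unitIdx i)
  have a1 : MemH 1 (weakDeriv μ v) := hv.weakDeriv (by omega)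
  have a2 : MemH 1 (weakDeriv (μ + unitIdx i) v) := hv.weakDeriv (by omega)
  have e1 : weakDeriv (unitIdx i) (weakDeriv μ v) =ᵐ[volume] weakDeriv (μ + unitIdx i) v :=
    hv.weakDeriv_weakDeriv (by omega)
  have e2 : weakDeriv (unitIdx i) (weakDeriv (μ + unitIdx i) v) =ᵐ[volume]
      weakDeriv (μ + unitIdx i + unitIdx i) v := hv.weakDeriv_weakDeriv (by omega)
  have key := a1.integral_inner a2 (γ := unitIdx i) (by omega)
  have l : ∫ x, inner ℂ (weakDeriv (unitIdx i) (weakDeriv μ v) x) (weakDeriv (μ + unitIdx i) v x) =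
      ((nrm2 volume (weakDeriv (μ + unitIdx i) v) ^ 2 : ℝ) : ℂ) := by
    rw [← integral_inner_self a2.memLp]
    refine integral_congr_ae ?_
    filter_upwards [e1] with x hx
    rw [hx]
  rw [l] at key
  have n := congrArg norm key
  rw [Complex.norm_real, Real.norm_of_nonneg (sq_nonneg _), norm_mul, norm_pow, norm_neg, norm_one,
    one_pow, one_mul] at n
  rw [n, ← nrm2_congr e2]
  exact norm_integral_inner_le a1.memLp (a2.memLp_weakDeriv (by omega))

/-- Derivatives of order at most `M` are controlled by the function and its derivatives of order
exactly `M`. -/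
theorem exists_sobNorm_le (d M : ℕ) : ∃ C : ℝ, 0 ≤ C ∧
    ∀ {Z : Type*} [NormedAddCommGroup Z] [InnerProductSpace ℂ Z] [FiniteDimensional ℂ Z]
      {v : E d → Z}, MemH M v →
      sobNorm M v ≤ C * (nrm2 volume v + ∑ α : MIdx d M, nrm2 volume (weakDeriv α.1 v)) := by
  obtain ⟨C, hC, h⟩ := interpolation_sequence (fun k => (Fintype.card (MIdx d (k + 1)) : ℝ) ^ 2)
    (fun k => by positivity) M
  refine ⟨(M + 1) * C, by positivity, ?_⟩
  intro Z _ _ _ v hv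
  have : FiniteDimensional ℝ Z := FiniteDimensional.complexToReal Z
  have : CompleteSpace Z := FiniteDimensional.complete ℝ Z
  set a : ℕ → ℝ := fun k => ∑ γ : MIdx d k, nrm2 volume (weakDeriv γ.1 v) with ha
  have hpos : ∀ k, 0 ≤ a k := fun k => Finset.sum_nonneg fun _ _ => nrm2_nonneg
  have hle : ∀ {k : ℕ} (γ : MIdx d k), nrm2 volume (weakDeriv γ.1 v) ≤ a k := fun {k} γ =>
    Finset.single_le_sum (f := fun γ : MIdx d k => nrm2 volume (weakDeriv γ.1 v))
      (fun _ _ => nrm2_nonneg) (Finset.mem_univ γ)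
  have h0 : a 0 = nrm2 volume v := by
    have : ∀ γ : MIdx d 0, γ.1 = 0 := fun γ => by
      funext i
      exact Finset.sum_eq_zero_iff.1 γ.2 i (Finset.mem_univ i)
    let z : MIdx d 0 := ⟨0, by simp⟩
    have hz : a 0 = nrm2 volume (weakDeriv z.1 v) :=
      Fintype.sum_eq_single z fun γ hγ => absurd (Subtype.ext (this γ)) hγ
    rw [hz]
    exact nrm2_congr (weakDeriv_zero_ae hv.locallyIntegrable)
  have hsq : ∀ i, i + 2 ≤ M →
      a (i + 1) ^ 2 ≤ (Fintype.card (MIdx d (i + 1)) : ℝ) ^ 2 * (a i * a (i + 2)) := by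
    intro i hi
    have hb : ∀ γ : MIdx d (i + 1),
        nrm2 volume (weakDeriv γ.1 v) ≤ Real.sqrt (a i * a (i + 2)) := by
      intro γ
      refine Real.le_sqrt_of_sq_le ?_
      obtain ⟨μ, j, hγ⟩ := exists_add_unitIdx γ
      rw [hγ]
      refine (nrm2_weakDeriv_sq_le hv j (by rw [μ.2]; exact hi)).trans ?_
      have hs : ∑ l, (μ.1 + unitIdx j + unitIdx j) l = i + 2 := by
        rw [sum_add_idx, sum_add_idx, sum_unitIdx, μ.2]
      exact mul_le_mul (hle μ) (hle ⟨_, hs⟩) nrm2_nonneg (hpos _)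
    have : a (i + 1) ≤ Fintype.card (MIdx d (i + 1)) * Real.sqrt (a i * a (i + 2)) := by
      refine (Finset.sum_le_sum fun γ _ => hb γ).trans_eq ?_
      simp
    refine (pow_le_pow_left₀ (hpos _) this 2).trans_eq ?_
    rw [mul_pow, Real.sq_sqrt (mul_nonneg (hpos _) (hpos _))]
  have key := h a hpos hsq
  rw [sobNorm, sum_idxLE]
  refine (Finset.sum_le_sum fun k hk => key k (Nat.lt_succ_iff.1 (Finset.mem_range.1 hk))).trans_eq ?_
  rw [Finset.sum_const, Finset.card_range, nsmul_eq_mul, h0]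
  push_cast
  ring

end Parts

/-! ### Elliptic forms and their resolvents -/

section Multiplication

variable {Ω X Z : Type*} [MeasurableSpace Ω] {μ : Measure Ω} [NormedAddCommGroup X]
  [NormedSpace ℂ X] [NormedAddCommGroup Z] [InnerProductSpace ℂ Z] {B : Ω → X →L[ℂ] Z} {Lam : ℝ}

theorem memLp_clm_apply (hm : AEStronglyMeasurable B μ) (hB : ∀ᵐ x ∂μ, ‖B x‖ ≤ Lam) {f : Ω → X}
    (hf : MemLp f 2 μ) : MemLp (fun x => B x (f x)) 2 μ :=
  hf.of_le_mul (aestronglyMeasurable_clm_apply hm hf.1) (by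
    filter_upwards [hB] with x hx
    exact (B x).le_of_opNorm_le hx (f x))

theorem nrm2_clm_apply_le (hL : 0 ≤ Lam) (hB : ∀ᵐ x ∂μ, ‖B x‖ ≤ Lam)
    {f : Ω → X} (hf : MemLp f 2 μ) : nrm2 μ (fun x => B x (f x)) ≤ Lam * nrm2 μ f :=
  nrm2_le_mul hL hf (by
    filter_upwards [hB] with x hx
    exact (B x).le_of_opNorm_le hx (f x))

theorem L2Tendsto.clm_apply (hL : 0 ≤ Lam) (hm : AEStronglyMeasurable B μ)
    (hB : ∀ᵐ x ∂μ, ‖B x‖ ≤ Lam) {fj : ℕ → Ω → X} {f : Ω → X} (h : L2Tendsto μ fj f) :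
    L2Tendsto μ (fun j x => B x (fj j x)) (fun x => B x (f x)) := by
  refine h.map (fun f x => B x (f x)) Lam (fun f hf => memLp_clm_apply hm hB hf)
    fun f g hf hg => ?_
  simp only [← map_sub]
  exact nrm2_clm_apply_le hL hB (hf.sub hg)

end Multiplication

section Elliptic

variable {d m n : ℕ} {lam Lam : ℝ} {B : E d → W d m n →L[ℂ] W d m n}

/-- Bounded measurable coefficients with the Gårding inequality on test functions. -/
structure Elliptic (lam Lam : ℝ) (B : E d → W d m n →L[ℂ] W d m n) : Prop where
  meas : AEStronglyMeasurable B volume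
  nonneg : 0 ≤ Lam
  bound : ∀ᵐ x, ‖B x‖ ≤ Lam
  garding : ∀ φ : E d → V n, Smooth φ → HasCompactSupport φ →
    lam * nrm2 volume (wgrad m φ) ^ 2 ≤
      (∫ x, inner ℂ (wgrad m φ x) (B x (wgrad m φ x))).re

/-- The sesquilinear form `(∇^m φ, B ∇^m u)`. -/
noncomputable def form (B : E d → W d m n →L[ℂ] W d m n) (φ u : E d → V n) : ℂ :=
  ∫ x, inner ℂ (wgrad m φ x) (B x (wgrad m u x))

namespace Elliptic

theorem memLp (hB : Elliptic lam Lam B) {f : E d → W d m n} (hf : MemLp f 2 volume) :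
    MemLp (fun x => B x (f x)) 2 volume := memLp_clm_apply hB.meas hB.bound hf

theorem nrm2_le (hB : Elliptic lam Lam B) {f : E d → W d m n} (hf : MemLp f 2 volume) :
    nrm2 volume (fun x => B x (f x)) ≤ Lam * nrm2 volume f :=
  nrm2_clm_apply_le hB.nonneg hB.bound hf

theorem garding_memH (hB : Elliptic lam Lam B) {z : E d → V n} (hz : MemH m z) :
    lam * nrm2 volume (wgrad m z) ^ 2 ≤ (form B z z).re := by
  obtain ⟨φ, h1, -, h2⟩ := hz.exists_approx
  have t1 := ((h2.nrm2_tendsto).pow 2).const_mul lam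
  have t2 := (Complex.continuous_re.tendsto _).comp
    (h2.inner (h2.clm_apply hB.nonneg hB.meas hB.bound))
  exact le_of_tendsto_of_tendsto' t1 t2 fun j => hB.garding _ (h1 j).1 (h1 j).2

end Elliptic

/-- The form of an elliptic operator, increased by the inner product of `L²`, is coercive on
`H^m`. -/
theorem exists_coercive (d m : ℕ) {lam : ℝ} (hlam : 0 < lam) : ∃ C : ℝ, 0 < C ∧
    ∀ {n : ℕ} {Lam : ℝ} {B : E d → W d m n →L[ℂ] W d m n}, Elliptic lam Lam B →
      ∀ {z : E d → V n}, MemH m z →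
        sobNorm m z ^ 2 ≤ C * (form B z z + ∫ x, inner ℂ (z x) (z x)).re := by
  obtain ⟨C₁, hC₁, h⟩ := exists_sobNorm_le d m
  set c : ℝ := ((Fintype.card (MIdx d m) : ℕ) : ℝ) with hc
  have hc0 : 0 ≤ c := by positivity
  refine ⟨2 * C₁ ^ 2 * (1 + c ^ 2 / lam) + 1, by positivity, ?_⟩
  intro n Lam B hB z hz
  have h1 := h hz
  set a := nrm2 volume z
  set g := nrm2 volume (wgrad m z)
  have ha : 0 ≤ a := nrm2_nonneg
  have hg0 : 0 ≤ g := nrm2_nonneg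
  have h2 : ∑ α : MIdx d m, nrm2 volume (weakDeriv α.1 z) ≤ c * g := by
    refine (Finset.sum_le_sum fun α _ => nrm2_weakDeriv_le_wgrad hz α).trans_eq ?_
    simp [hc, g]
  -- intermediate derivatives by interpolation, the highest ones by the Gårding inequality
  have h3 : sobNorm m z ≤ C₁ * (a + c * g) :=
    h1.trans (mul_le_mul_of_nonneg_left (by linarith) hC₁)
  have h4 := hB.garding_memH hz
  have h5 : (form B z z + ∫ x, inner ℂ (z x) (z x)).re = (form B z z).re + a ^ 2 := by
    rw [integral_inner_self hz.memLp, Complex.add_re, Complex.ofReal_re]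
  rw [h5]
  have h6 : g ^ 2 ≤ (form B z z).re / lam := by
    rw [le_div_iff₀ hlam]; linarith
  have h7 : 0 ≤ (form B z z).re := le_trans (by positivity) h4
  calc sobNorm m z ^ 2 ≤ (C₁ * (a + c * g)) ^ 2 :=
        pow_le_pow_left₀ (sobNorm_nonneg _ _) h3 2
    _ ≤ 2 * C₁ ^ 2 * (a ^ 2 + c ^ 2 * g ^ 2) := by
        nlinarith [mul_nonneg (sq_nonneg C₁) (sq_nonneg (a - c * g))]
    _ ≤ 2 * C₁ ^ 2 * (a ^ 2 + c ^ 2 * ((form B z z).re / lam)) := by gcongr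
    _ ≤ (2 * C₁ ^ 2 * (1 + c ^ 2 / lam)) * ((form B z z).re + a ^ 2) := by
        have e : (2 * C₁ ^ 2 * (1 + c ^ 2 / lam)) * ((form B z z).re + a ^ 2) =
          2 * C₁ ^ 2 * (a ^ 2 + c ^ 2 * ((form B z z).re / lam)) +
            2 * C₁ ^ 2 * ((form B z z).re + c ^ 2 / lam * a ^ 2) := by ring
        rw [e]
        have : 0 ≤ 2 * C₁ ^ 2 * ((form B z z).re + c ^ 2 / lam * a ^ 2) := by positivity
        linarith
    _ ≤ _ := by nlinarith [sq_nonneg a]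

/-- Weak solutions of `L u + u = f` in terms of the form. -/
structure WeakSol (B : E d → W d m n →L[ℂ] W d m n) (f u : E d → V n) : Prop where
  memH : MemH m u
  eq : ∀ φ : E d → V n, MemH m φ →
    form B φ u + ∫ x, inner ℂ (φ x) (u x) = ∫ x, inner ℂ (φ x) (f x)

theorem isWeakSol_iff {a : E d → CArr d m n} {f u : E d → V n} :
    IsWeakSol a f u ↔ WeakSol (fun x => aop (a x)) f u := by
  simp only [IsWeakSol, arrInner_eq]
  exact ⟨fun h => ⟨h.1, h.2⟩, fun h => ⟨h.1, h.2⟩⟩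

theorem form_congr_coeff {B' : E d → W d m n →L[ℂ] W d m n} (h : B =ᵐ[volume] B')
    (φ u : E d → V n) : form B φ u = form B' φ u := by
  refine integral_congr_ae ?_
  filter_upwards [h] with x hx
  rw [hx]

theorem form_congr {φ u φ' u' : E d → V n} (h : φ =ᵐ[volume] φ') (h' : u =ᵐ[volume] u') :
    form B φ u = form B φ' u' := by
  rw [form, form, wgrad_congr h, wgrad_congr h']

theorem WeakSol.congr_coeff {B' : E d → W d m n →L[ℂ] W d m n} (h : B =ᵐ[volume] B')
    {f u : E d → V n} (hu : WeakSol B f u) : WeakSol B' f u :=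
  ⟨hu.memH, fun φ hφ => by rw [← form_congr_coeff h]; exact hu.eq φ hφ⟩

theorem WeakSol.congr {f u v : E d → V n} (hu : WeakSol B f u) (h : u =ᵐ[volume] v) :
    WeakSol B f v := by
  refine ⟨hu.memH.congr h, fun φ hφ => ?_⟩
  rw [← hu.eq φ hφ, form_congr (Filter.EventuallyEq.refl _ φ) h]
  congr 1
  refine integral_congr_ae ?_
  filter_upwards [h] with x hx
  rw [hx]

theorem form_sub (hB : Elliptic lam Lam B) {φ u v : E d → V n} (hφ : MemH m φ) (hu : MemH m u)
    (hv : MemH m v) : form B φ (fun x => u x - v x) = form B φ u - form B φ v := by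
  rw [form, form, form, ← integral_inner_sub (hφ.memLp_wgrad le_rfl)
    (hB.memLp (hu.memLp_wgrad le_rfl)) (hB.memLp (hv.memLp_wgrad le_rfl))]
  refine integral_congr_ae ?_
  filter_upwards [wgrad_sub hu hv] with x hx
  rw [hx, map_sub]

theorem WeakSol.unique (hlam : 0 < lam) (hB : Elliptic lam Lam B) {f u v : E d → V n}
    (hu : WeakSol B f u) (hv : WeakSol B f v) : u =ᵐ[volume] v := by
  obtain ⟨C, hC, h⟩ := exists_coercive d m hlam
  have hz := hu.memH.fun_sub hv.memH
  have h1 := h hB hz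
  have e : form B (fun x => u x - v x) (fun x => u x - v x) +
      ∫ x, inner ℂ (u x - v x) (u x - v x) = 0 := by
    rw [form_sub hB hz hu.memH hv.memH,
      integral_inner_sub hz.memLp hu.memH.memLp hv.memH.memLp]
    linear_combination hu.eq _ hz - hv.eq _ hz
  rw [e, Complex.zero_re, mul_zero] at h1
  have h2 : sobNorm m (fun x => u x - v x) = 0 := by
    nlinarith [sobNorm_nonneg m (fun x => u x - v x)]
  have h3 : nrm2 volume (fun x => u x - v x) = 0 := le_antisymm
    ((nrm2_le_sobNorm (m := m) hz.locallyIntegrable).trans h2.le) nrm2_nonneg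
  filter_upwards [nrm2_eq_zero hz.memLp h3] with x hx
  exact sub_eq_zero.1 hx

end Elliptic

/-! ### Existence of resolvents -/

section Resolvent

variable {d m n : ℕ} {lam Lam : ℝ} {B : E d → W d m n →L[ℂ] W d m n}

/-- The space of jets of order `m`, i.e. of families indexed by the multiindices of length at
most `m`. -/
abbrev Jet (d m n : ℕ) := Pk (idxLE d m) n

/-- The zero multiindex. -/
def zeroIdx (d m : ℕ) : idxLE d m := ⟨0, mem_idxLE.2 (by simp)⟩

/-- A multiindex of length `m` as a multiindex of length at most `m`. -/
def topIdx (α : MIdx d m) : idxLE d m := ⟨α.1, mem_idxLE.2 α.2.le⟩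

/-- The jet of weak derivatives. -/
noncomputable def jet (m : ℕ) (u : E d → V n) (x : E d) : Jet d m n :=
  pack fun γ => weakDeriv γ.1 u x

theorem MemH.memLp_jet {u : E d → V n} (hu : MemH m u) : MemLp (jet m u) 2 volume :=
  memLp_pack fun γ => hu.memLp_weakDeriv (mem_idxLE.1 γ.2)

theorem nrm2_jet_le {u : E d → V n} (hu : MemH m u) : nrm2 volume (jet m u) ≤ sobNorm m u := by
  refine (nrm2_pack_le fun γ => hu.memLp_weakDeriv (mem_idxLE.1 γ.2)).trans_eq ?_
  exact Finset.sum_coe_sort (idxLE d m) fun γ => nrm2 volume (weakDeriv γ u)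

/-- The derivatives of order `m` in a jet. -/
noncomputable def topPart (d m n : ℕ) : Jet d m n →L[ℂ] W d m n :=
  ∑ α : MIdx d m, (emb α).comp (prj (topIdx α))

theorem topPart_jet (u : E d → V n) (x : E d) : topPart d m n (jet m u x) = wgrad m u x := by
  rw [wgrad, pack_eq_sum]
  simp only [topPart, sum_apply, ContinuousLinearMap.comp_apply]
  rfl

/-- The operators with `⟨jet φ, jetOp (jet u)⟩ = ⟨∇^m φ, B ∇^m u⟩ + ⟨φ, u⟩`. -/
noncomputable def jetOp (b : W d m n →L[ℂ] W d m n) : Jet d m n →L[ℂ] Jet d m n :=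
  (emb (zeroIdx d m)).comp (prj (zeroIdx d m)) +
    (ContinuousLinearMap.adjoint (topPart d m n)).comp (b.comp (topPart d m n))

theorem inner_emb {ι : Type*} [Fintype ι] [DecidableEq ι] (i : ι) (F : Pk ι n) (v : V n) :
    inner ℂ F (emb i v) = inner ℂ (prj i F) v := by
  rw [inner_Pk, Finset.sum_eq_single i (fun j _ hj => by rw [prj_emb_ne hj, inner_zero_right])
    (by simp), prj_emb]

theorem inner_jetOp (b : W d m n →L[ℂ] W d m n) (F G : Jet d m n) :
    inner ℂ F (jetOp b G) = inner ℂ (prj (zeroIdx d m) F) (prj (zeroIdx d m) G) +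
      inner ℂ (topPart d m n F) (b (topPart d m n G)) := by
  simp only [jetOp, add_apply, ContinuousLinearMap.comp_apply, inner_add_right,
    inner_emb, ContinuousLinearMap.adjoint_inner_right]

theorem continuous_jetOp :
    Continuous (jetOp : (W d m n →L[ℂ] W d m n) → (Jet d m n →L[ℂ] Jet d m n)) := by
  unfold jetOp
  fun_prop

theorem norm_jetOp_le (hL : 0 ≤ Lam) : ∃ C, 0 ≤ C ∧
    ∀ b : W d m n →L[ℂ] W d m n, ‖b‖ ≤ Lam → ‖jetOp b‖ ≤ C := by
  refine ⟨‖(emb (zeroIdx d m) : V n →L[ℂ] Jet d m n).comp (prj (zeroIdx d m))‖ +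
    ‖ContinuousLinearMap.adjoint (topPart d m n)‖ * (Lam * ‖topPart d m n‖), by positivity,
    fun b hb => ?_⟩
  refine (norm_add_le _ _).trans (add_le_add_right ((ContinuousLinearMap.opNorm_comp_le _ _).trans
    (mul_le_mul_of_nonneg_left ((ContinuousLinearMap.opNorm_comp_le _ _).trans ?_)
    (norm_nonneg _))) _)
  exact mul_le_mul_of_nonneg_right hb (norm_nonneg _)

variable {X : Type*} [NormedAddCommGroup X] [InnerProductSpace ℂ X]

theorem norm_Lp_eq_nrm2 {Ω : Type*} [MeasurableSpace Ω] {μ : Measure Ω} (U : Lp X 2 μ) :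
    ‖U‖ = nrm2 μ U := Lp.norm_def U

theorem L2Tendsto.of_tendsto {Ω : Type*} [MeasurableSpace Ω] {μ : Measure Ω} {Uj : ℕ → Lp X 2 μ}
    {U : Lp X 2 μ} (h : Filter.Tendsto Uj Filter.atTop (nhds U)) :
    L2Tendsto μ (fun j => Uj j) U := by
  refine ⟨fun j => Lp.memLp _, Lp.memLp _, ?_⟩
  refine (tendsto_iff_norm_sub_tendsto_zero.1 h).congr fun j => ?_
  rw [norm_Lp_eq_nrm2]
  exact nrm2_congr (Lp.coeFn_sub _ _)

/-- Multiplication by a bounded operator-valued function, as an operator in `L²`. -/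
theorem exists_mulL {Ω : Type*} [MeasurableSpace Ω] {μ : Measure Ω} {M : Ω → X →L[ℂ] X} {C : ℝ}
    (hC : 0 ≤ C) (hm : AEStronglyMeasurable M μ) (hM : ∀ᵐ x ∂μ, ‖M x‖ ≤ C) :
    ∃ T : Lp X 2 μ →L[ℂ] Lp X 2 μ, ∀ U, T U =ᵐ[μ] fun x => M x (U x) := by
  have hml := fun U : Lp X 2 μ => memLp_clm_apply hm hM (Lp.memLp U)
  let T : Lp X 2 μ →ₗ[ℂ] Lp X 2 μ :=
    { toFun := fun U => (hml U).toLp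
      map_add' := fun U U' => by
        rw [← MemLp.toLp_add]
        refine MemLp.toLp_congr _ _ ?_
        filter_upwards [Lp.coeFn_add U U'] with x hx
        rw [hx, Pi.add_apply, map_add]
        rfl
      map_smul' := fun c U => by
        rw [RingHom.id_apply, ← MemLp.toLp_const_smul]
        refine MemLp.toLp_congr _ _ ?_
        filter_upwards [Lp.coeFn_smul c U] with x hx
        rw [hx, Pi.smul_apply, map_smul]
        rfl }
  refine ⟨T.mkContinuous C fun U => ?_, fun U => (hml U).coeFn_toLp⟩
  rw [norm_Lp_eq_nrm2, norm_Lp_eq_nrm2]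
  refine (nrm2_congr (hml U).coeFn_toLp).trans_le ?_
  exact nrm2_clm_apply_le hC hM (Lp.memLp U)

/-- The jets of functions of `H^m`, as a subspace of `L²`. -/
def jetSpace (d m n : ℕ) : Submodule ℂ (Lp (Jet d m n) 2 (volume : Measure (E d))) where
  carrier := {U | ∀ γ : idxLE d m,
    HasWeakDeriv γ.1 (fun x => prj (zeroIdx d m) (U x)) fun x => prj γ (U x)}
  add_mem' {U U'} h h' γ := by
    have e := Lp.coeFn_add U U'
    refine ((h γ).fun_add (h' γ)).congr ?_ ?_ <;>
    · filter_upwards [e] with x hx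
      rw [hx, Pi.add_apply, map_add]
  zero_mem' γ := by
    have e := Lp.coeFn_zero (Jet d m n) 2 (volume : Measure (E d))
    refine HasWeakDeriv.zero.congr ?_ ?_ <;>
    · filter_upwards [e] with x hx
      rw [hx, Pi.zero_apply, map_zero]
  smul_mem' c U h γ := by
    have e := Lp.coeFn_smul c U
    refine ((h γ).clm_comp
      ((c • ContinuousLinearMap.id ℂ (V n)).restrictScalars ℝ)).congr ?_ ?_ <;>
    · filter_upwards [e] with x hx
      rw [hx, Pi.smul_apply, map_smul]
      rfl

theorem isClosed_jetSpace : IsClosed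
    (jetSpace d m n : Set (Lp (Jet d m n) 2 (volume : Measure (E d)))) := by
  refine IsSeqClosed.isClosed fun Uj U hU h γ => ?_
  have ht := L2Tendsto.of_tendsto h
  exact HasWeakDeriv.of_L2Tendsto (fun j => hU j γ)
    (ht.clm ((prj (zeroIdx d m)).restrictScalars ℝ)) (ht.clm ((prj γ).restrictScalars ℝ))

theorem memH_of_mem_jetSpace {U : Lp (Jet d m n) 2 (volume : Measure (E d))} (hU : U ∈ jetSpace d m n) :
    MemH m fun x => prj (zeroIdx d m) (U x) := fun γ hγ =>
  ⟨_, hU ⟨γ, mem_idxLE.2 hγ⟩, memLp_prj (Lp.memLp U) _⟩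

theorem ae_eq_jet_of_mem_jetSpace {U : Lp (Jet d m n) 2 (volume : Measure (E d))} (hU : U ∈ jetSpace d m n) :
    U =ᵐ[volume] jet m fun x => prj (zeroIdx d m) (U x) := by
  filter_upwards [ae_all_iff.2 fun γ => (hU γ).weakDeriv_ae_eq] with x hx
  exact Pk.ext fun γ => (hx γ).symm

theorem MemH.toLp_jet_mem {u : E d → V n} (hu : MemH m u) : hu.memLp_jet.toLp ∈ jetSpace d m n := by
  intro γ
  have e := hu.memLp_jet.coeFn_toLp
  refine (hu.hasWeakDeriv (mem_idxLE.1 γ.2)).congr ?_ ?_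
  · filter_upwards [e, weakDeriv_zero_ae hu.locallyIntegrable] with x hx h0
    rw [hx]
    exact h0.symm
  · filter_upwards [e] with x hx
    rw [hx]
    rfl

theorem integral_inner_jetOp (hB : Elliptic lam Lam B) {φ u : E d → V n} (hφ : MemH m φ)
    (hu : MemH m u) : ∫ x, inner ℂ (jet m φ x) (jetOp (B x) (jet m u x)) =
      form B φ u + ∫ x, inner ℂ (φ x) (u x) := by
  rw [form, ← integral_add (integrable_inner (hφ.memLp_wgrad le_rfl)
    (hB.memLp (hu.memLp_wgrad le_rfl))) (integrable_inner hφ.memLp hu.memLp)]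
  refine integral_congr_ae ?_
  filter_upwards [weakDeriv_zero_ae hφ.locallyIntegrable, weakDeriv_zero_ae hu.locallyIntegrable]
    with x h1 h2
  rw [inner_jetOp, topPart_jet, topPart_jet, add_comm]
  simp only [jet, prj_pack]
  rw [show (zeroIdx d m).1 = 0 from rfl, h1, h2]

/-- The Lax–Milgram lemma in operator form. -/
theorem isUnit_of_coercive {H : Type*} [NormedAddCommGroup H] [InnerProductSpace ℂ H]
    [CompleteSpace H] {T : H →L[ℂ] H} {C : ℝ} (hC : 0 < C)
    (h : ∀ U, ‖U‖ ^ 2 ≤ C * (inner ℂ U (T U)).re) : IsUnit T := by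
  refine T.isUnit_of_forall_le_norm_inner_map (c := C⁻¹.toNNReal)
    (Real.toNNReal_pos.2 (inv_pos.2 hC)) fun U => ?_
  rw [← inner_conj_symm, RCLike.norm_conj, Real.coe_toNNReal _ (inv_pos.2 hC).le,
    ← div_eq_mul_inv, div_le_iff₀ hC, mul_comm]
  exact (h U).trans (mul_le_mul_of_nonneg_left (Complex.re_le_norm _) hC.le)

/-- The Lax–Milgram lemma on a closed subspace. -/
theorem exists_solution_operator {H : Type*} [NormedAddCommGroup H] [InnerProductSpace ℂ H]
    [CompleteSpace H] {S : Submodule ℂ H} (hS : IsClosed (S : Set H)) {M : H →L[ℂ] H} {C : ℝ}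
    (hC : 0 < C) (h : ∀ U ∈ S, ‖U‖ ^ 2 ≤ C * (inner ℂ U (M U)).re) :
    ∃ Q : H →L[ℂ] H, ∀ g, Q g ∈ S ∧ ∀ F ∈ S, inner ℂ F (M (Q g)) = inner ℂ F g := by
  have hcl : CompleteSpace S := hS.completeSpace_coe
  have hunit : IsUnit ((ContinuousLinearMap.adjoint S.subtypeL).comp (M.comp S.subtypeL)) := by
    refine isUnit_of_coercive hC fun U => ?_
    rw [ContinuousLinearMap.comp_apply, ContinuousLinearMap.adjoint_inner_right]
    exact h U.1 U.2
  obtain ⟨T', hT'⟩ := hunit.exists_right_inv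
  refine ⟨S.subtypeL.comp (T'.comp (ContinuousLinearMap.adjoint S.subtypeL)),
    fun g => ⟨Subtype.mem _, fun F hF => ?_⟩⟩
  have h2 := congrArg (fun T : S →L[ℂ] S => T (ContinuousLinearMap.adjoint S.subtypeL g)) hT'
  have h3 := congrArg (fun U : S => inner ℂ (⟨F, hF⟩ : S) U) h2
  simp only [mul_apply_eq_comp, one_apply_eq_self,
    ContinuousLinearMap.comp_apply, ContinuousLinearMap.adjoint_inner_right] at h3
  exact h3

/-- Weak solutions as the result of the Lax–Milgram lemma on the space of jets, a closed subspace of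
`L²`; the solution is read off from the component of order zero. -/
theorem exists_jetSpace_solution (hlam : 0 < lam) (hB : Elliptic lam Lam B) :
    ∃ Q : Lp (Jet d m n) 2 (volume : Measure (E d)) →L[ℂ]
        Lp (Jet d m n) 2 (volume : Measure (E d)),
      ∀ g, Q g ∈ jetSpace d m n ∧ ∀ φ : E d → V n, MemH m φ →
        form B φ (fun x => prj (zeroIdx d m) (Q g x)) +
            ∫ x, inner ℂ (φ x) (prj (zeroIdx d m) (Q g x)) =
          ∫ x, inner ℂ (jet m φ x) (g x) := by
  obtain ⟨C, hC, hcoer⟩ := exists_coercive d m hlam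
  obtain ⟨C', hC', hb⟩ := norm_jetOp_le (d := d) (m := m) (n := n) hB.nonneg
  obtain ⟨M, hM⟩ := exists_mulL (M := fun x => jetOp (B x)) hC'
    (continuous_jetOp.comp_aestronglyMeasurable hB.meas) (by
      filter_upwards [hB.bound] with x hx
      exact hb _ hx)
  have hT : ∀ (F U : Lp (Jet d m n) 2 (volume : Measure (E d))) (φ : E d → V n) (hφ : MemH m φ),
      F =ᵐ[volume] jet m φ → U ∈ jetSpace d m n → inner ℂ F (M U) =
      form B φ (fun x => prj (zeroIdx d m) (U x)) +
        ∫ x, inner ℂ (φ x) (prj (zeroIdx d m) (U x)) := by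
    intro F U φ hφ hF hU
    rw [← integral_inner_jetOp hB hφ (memH_of_mem_jetSpace hU)]
    refine (L2.inner_def _ _).trans (integral_congr_ae ?_)
    filter_upwards [hM U, hF, ae_eq_jet_of_mem_jetSpace hU] with x h1 h2 h3
    rw [h1, h2, ← h3]
  obtain ⟨Q, hQ⟩ := exists_solution_operator (M := M) isClosed_jetSpace hC fun U hU => by
    have hu := memH_of_mem_jetSpace hU
    have h1 : ‖U‖ ≤ sobNorm m fun x => prj (zeroIdx d m) (U x) := by
      rw [norm_Lp_eq_nrm2, nrm2_congr (ae_eq_jet_of_mem_jetSpace hU)]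
      exact nrm2_jet_le hu
    rw [hT U U _ hu (ae_eq_jet_of_mem_jetSpace hU) hU]
    exact (pow_le_pow_left₀ (norm_nonneg _) h1 2).trans (hcoer hB hu)
  refine ⟨Q, fun g => ⟨(hQ g).1, fun φ hφ => ?_⟩⟩
  have h1 := (hQ g).2 _ hφ.toLp_jet_mem
  rw [hT _ _ φ hφ hφ.memLp_jet.coeFn_toLp (hQ g).1] at h1
  rw [h1]
  refine (L2.inner_def _ _).trans (integral_congr_ae ?_)
  filter_upwards [hφ.memLp_jet.coeFn_toLp] with x hx
  rw [hx]

/-- The resolvent of an elliptic operator. -/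
theorem exists_resolvent (hlam : 0 < lam) (hB : Elliptic lam Lam B) :
    ∃ R : Lp (V n) 2 (volume : Measure (E d)) →L[ℂ] Lp (V n) 2 (volume : Measure (E d)),
      ∀ (f : Lp (V n) 2 (volume : Measure (E d))) (u : E d → V n),
        WeakSol B f u ↔ u =ᵐ[volume] R f := by
  obtain ⟨Q, hQ⟩ := exists_jetSpace_solution hlam hB
  let P : Lp (Jet d m n) 2 (volume : Measure (E d)) →L[ℂ] Lp (V n) 2 (volume : Measure (E d)) :=
    (prj (zeroIdx d m)).compLpL 2 volume
  let J : Lp (V n) 2 (volume : Measure (E d)) →L[ℂ] Lp (Jet d m n) 2 (volume : Measure (E d)) :=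
    (emb (zeroIdx d m)).compLpL 2 volume
  have hsol : ∀ f : Lp (V n) 2 (volume : Measure (E d)), WeakSol B f (P (Q (J f))) := by
    intro f
    have hR : P (Q (J f)) =ᵐ[volume] fun x => prj (zeroIdx d m) (Q (J f) x) :=
      (prj (zeroIdx d m)).coeFn_compLpL (Q (J f))
    have hJ : J f =ᵐ[volume] fun x => emb (zeroIdx d m) (f x) :=
      (emb (zeroIdx d m) : V n →L[ℂ] Jet d m n).coeFn_compLpL f
    obtain ⟨h1, h2⟩ := hQ (J f)
    refine WeakSol.congr ⟨memH_of_mem_jetSpace h1, fun φ hφ => (h2 φ hφ).trans ?_⟩ hR.symm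
    refine integral_congr_ae ?_
    filter_upwards [hJ, weakDeriv_zero_ae hφ.locallyIntegrable] with x hx h0
    rw [hx, inner_emb, ← h0]
    rfl
  exact ⟨P.comp (Q.comp J), fun f u =>
    ⟨fun h => h.unique hlam hB (hsol f), fun h => (hsol f).congr h.symm⟩⟩

end Resolvent

/-! ### Dilations and periodic coefficients -/

section Coefficients

variable {d m n : ℕ} {lam Lam : ℝ} {B : E d → W d m n →L[ℂ] W d m n}

theorem quasiMeasurePreserving_smul {a : ℝ} (ha : a ≠ 0) :
    Measure.QuasiMeasurePreserving (fun x : E d => a • x) volume volume := by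
  refine ⟨by fun_prop, ?_⟩
  rw [Measure.map_addHaar_smul _ ha]
  exact Measure.smul_absolutelyContinuous

theorem wgrad_comp_smul {φ : E d → V n} (hφ : MemH m φ) {a : ℝ} (ha : a ≠ 0) :
    wgrad m (fun y => φ (a • y)) =ᵐ[volume] fun y => a ^ m • wgrad m φ (a • y) := by
  have h := wgrad_ae_eq (u := fun y => φ (a • y))
    (D := fun α y => a ^ m • weakDeriv α.1 φ (a • y)) fun α => by
      have := (hφ.hasWeakDeriv α.2.le).comp_affine ha 0
      simpa only [add_zero, α.2] using this
  filter_upwards [h] with y hy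
  rw [hy]
  exact Pk.ext fun α => rfl

/-- The Gårding inequality is invariant under dilations. -/
theorem Elliptic.rescale (hB : Elliptic lam Lam B) {ε : ℝ} (hε : 0 < ε) :
    Elliptic lam Lam fun x => B (ε⁻¹ • x) := by
  have hq := quasiMeasurePreserving_smul (d := d) (inv_ne_zero hε.ne')
  refine ⟨hB.meas.comp_quasiMeasurePreserving hq, hB.nonneg, hq.ae hB.bound,
    fun φ hφ hc => ?_⟩
  have hH : MemH m φ := MemH.of_smooth hφ hc
  have hsm : Smooth fun y => φ (ε • y) := hφ.comp (contDiff_const_smul ε)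
  have hcs : HasCompactSupport fun y => φ (ε • y) :=
    hc.comp_homeomorph (Homeomorph.smulOfNeZero ε hε.ne')
  have h := hB.garding _ hsm hcs
  have e := wgrad_comp_smul hH hε.ne'
  -- `∇^m` contributes `ε^m` for each factor, the change of variables `ε^{-d}`
  have e1 : nrm2 volume (wgrad m fun y => φ (ε • y)) ^ 2 =
      (ε ^ m) ^ 2 * (|(ε ^ d)⁻¹| * nrm2 volume (wgrad m φ) ^ 2) := by
    rw [nrm2_sq ((MemH.of_smooth hsm hcs).memLp_wgrad le_rfl), nrm2_sq (hH.memLp_wgrad le_rfl)]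
    have := Measure.integral_comp_smul volume (fun x : E d => ‖wgrad m φ x‖ ^ 2) ε
    rw [finrank_euclideanSpace, Fintype.card_fin, smul_eq_mul] at this
    rw [← this, ← integral_const_mul]
    refine integral_congr_ae ?_
    filter_upwards [e] with y hy
    rw [hy, norm_smul, Real.norm_of_nonneg (by positivity), mul_pow]
  have e2 : ∫ y, inner ℂ (wgrad m (fun y => φ (ε • y)) y) (B y (wgrad m (fun y => φ (ε • y)) y)) =
      (((ε ^ m) ^ 2 * |(ε ^ d)⁻¹| : ℝ) : ℂ) *
        ∫ x, inner ℂ (wgrad m φ x) (B (ε⁻¹ • x) (wgrad m φ x)) := by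
    have := Measure.integral_comp_smul volume
      (fun x : E d => inner ℂ (wgrad m φ x) (B (ε⁻¹ • x) (wgrad m φ x))) ε
    rw [finrank_euclideanSpace, Fintype.card_fin] at this
    rw [Complex.ofReal_mul, mul_assoc, ← Complex.real_smul (x := |(ε ^ d)⁻¹|), ← this,
      ← integral_const_mul]
    refine integral_congr_ae ?_
    filter_upwards [e] with y hy
    rw [hy, smul_smul, inv_mul_cancel₀ hε.ne', one_smul, ← Complex.coe_smul, map_smul,
      inner_smul_left, inner_smul_right, Complex.conj_ofReal]
    push_cast
    ring
  rw [e1, e2, Complex.re_ofReal_mul] at h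
  have hp : 0 < (ε ^ m) ^ 2 * |(ε ^ d)⁻¹| := by positivity
  refine le_of_mul_le_mul_left ?_ hp
  calc _ = lam * ((ε ^ m) ^ 2 * (|(ε ^ d)⁻¹| * nrm2 volume (wgrad m φ) ^ 2)) := by ring
    _ ≤ _ := h

/-- Admissible coefficients with a strongly measurable and exactly periodic representative. -/
structure PerElliptic (lam Lam : ℝ) (B : E d → W d m n →L[ℂ] W d m n) : Prop
    extends Elliptic lam Lam B where
  smeas : StronglyMeasurable B
  per : IsPeriodic B

theorem wgrad_smooth {φ : E d → V n} (hφ : Smooth φ) :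
    wgrad m φ =ᵐ[volume] fun x => toW (gradC m φ x) := by
  refine wgrad_ae_eq (D := fun α => multiDeriv α.1 φ) fun α => HasWeakDeriv.of_smooth hφ α.1

theorem IsAdmissible.exists_perElliptic (h1 : 0 ≤ Lam) {A : E d → CArr d m n}
    (hA : IsAdmissible lam Lam A) :
    ∃ B : E d → W d m n →L[ℂ] W d m n, PerElliptic lam Lam B ∧
      B =ᵐ[volume] fun y => aop (A y) := by
  have hAm : AEMeasurable A volume := by
    refine aemeasurable_pi_iff.2 fun α => aemeasurable_pi_iff.2 fun β =>
      aemeasurable_pi_iff.2 fun j => aemeasurable_pi_iff.2 fun k => hA.aemeasurable α β j k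
  have i1 : OpensMeasurableSpace (MIdx d m → Fin n → Fin n → ℂ) := inferInstance
  have i2 : SecondCountableTopology (MIdx d m → Fin n → Fin n → ℂ) := inferInstance
  have i3 : OpensMeasurableSpace (CArr d m n) := Pi.opensMeasurableSpace
  have i4 : SecondCountableTopology (CArr d m n) := inferInstance
  have hm : AEStronglyMeasurable (fun y => aop (A y)) (volume : Measure (E d)) :=
    continuous_aop.comp_aestronglyMeasurable hAm.aestronglyMeasurable
  obtain ⟨B, hBm, hBp, hBA⟩ := exists_periodic_representative hm fun l =>
    Filter.Eventually.of_forall fun y => by rw [hA.periodic.add_lattice l y]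
  refine ⟨B, ⟨⟨hBm.aestronglyMeasurable, h1, ?_, fun φ hφ hc => ?_⟩, hBm, hBp⟩, hBA⟩
  · filter_upwards [hBA, hA.bounded] with y hy hb
    rw [hy]
    exact norm_aop_le h1 hb
  · have e := wgrad_smooth (m := m) hφ
    have h := hA.garding φ hφ hc
    have e1 : ∫ x, arrNormSq (gradC m φ x) = nrm2 volume (wgrad m φ) ^ 2 := by
      rw [nrm2_sq ((MemH.of_smooth hφ hc).memLp_wgrad le_rfl)]
      refine integral_congr_ae ?_
      filter_upwards [e] with x hx
      rw [hx, arrNormSq_eq]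
    have e2 : ∫ x, arrInner (gradC m φ x) ((A x).mul (gradC m φ x)) =
        ∫ x, inner ℂ (wgrad m φ x) (B x (wgrad m φ x)) := by
      refine integral_congr_ae ?_
      filter_upwards [e, hBA] with x hx hB
      rw [hx, hB, aop_toW, arrInner_eq]
    rwa [e1, e2] at h

end Coefficients

/-! ### Periodic Sobolev functions of zero mean -/

section Periodic

variable {d m : ℕ} {Z : Type*} [NormedAddCommGroup Z] [NormedSpace ℝ Z] [CompleteSpace Z]

/-- The derivatives of order at most `m` of a periodic function with zero mean over the cell,
given by strongly measurable and exactly periodic representatives. -/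
structure PerSob (m : ℕ) (D : (Fin d → ℕ) → E d → Z) : Prop where
  meas : ∀ μ, ∑ i, μ i ≤ m → StronglyMeasurable (D μ)
  per : ∀ μ, ∑ i, μ i ≤ m → IsPeriodic (D μ)
  memLp : ∀ μ, ∑ i, μ i ≤ m → MemLp (D μ) 2 (volume.restrict (cell d))
  deriv : ∀ μ, ∑ i, μ i ≤ m → HasWeakDeriv μ (D 0) (D μ)
  mean : ∫ y in cell d, D 0 y = 0

theorem HasWeakDeriv.exists_periodic {μ : Fin d → ℕ} {u w : E d → Z} (hu : IsPeriodic u)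
    (h : HasWeakDeriv μ u w) : ∃ w', StronglyMeasurable w' ∧ IsPeriodic w' ∧ w' =ᵐ[volume] w := by
  refine exists_periodic_representative h.2.1.aestronglyMeasurable fun l => ?_
  have h1 := h.comp_sub (-l : E d)
  simp only [sub_neg_eq_add, hu.add_lattice l] at h1
  exact h1.unique h

theorem MemW.exists_perSob {u : E d → Z} (hu : MemW m u) :
    ∃ D, PerSob m D ∧ ∀ μ : Fin d → ℕ, ∑ i, μ i ≤ m → weakDeriv μ u =ᵐ[volume] D μ := by
  obtain ⟨hp, hmean, hd⟩ := hu
  have hex : ∀ μ : Fin d → ℕ, ∃ w', ∑ i, μ i ≤ m → StronglyMeasurable w' ∧ IsPeriodic w' ∧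
      MemLp w' 2 (volume.restrict (cell d)) ∧ HasWeakDeriv μ u w' := by
    intro μ
    by_cases hμ : ∑ i, μ i ≤ m
    · obtain ⟨w, hw, hw2⟩ := hd μ hμ
      obtain ⟨w', h1, h2, h3⟩ := hw.exists_periodic hp
      exact ⟨w', fun _ => ⟨h1, h2, hw2.ae_eq (ae_restrict_of_ae h3.symm),
        hw.congr (Filter.EventuallyEq.refl _ _) h3.symm⟩⟩
    · exact ⟨0, fun h => absurd h hμ⟩
  choose D hD using hex
  have h00 : ∑ i, (0 : Fin d → ℕ) i ≤ m := by simp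
  have h0 : D 0 =ᵐ[volume] u :=
    ((hD 0 h00).2.2.2).unique (HasWeakDeriv.refl (hD 0 h00).2.2.2.1)
  refine ⟨D, ⟨fun μ hμ => (hD μ hμ).1, fun μ hμ => (hD μ hμ).2.1, fun μ hμ => (hD μ hμ).2.2.1,
    fun μ hμ => (hD μ hμ).2.2.2.congr h0.symm (Filter.EventuallyEq.refl _ _), ?_⟩,
    fun μ hμ => (hD μ hμ).2.2.2.weakDeriv_ae_eq⟩
  rw [← hmean]
  exact integral_congr_ae (ae_restrict_of_ae h0)

namespace PerSob

variable {D : (Fin d → ℕ) → E d → Z}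

theorem deriv_unitIdx (hD : PerSob m D) {μ : Fin d → ℕ} (hμ : ∑ i, μ i + 1 ≤ m) (i : Fin d) :
    HasWeakDeriv (unitIdx i) (D μ) (D (μ + unitIdx i)) :=
  (hD.deriv μ (by omega)).of_add (hD.deriv _ (by rw [sum_add_idx, sum_unitIdx]; exact hμ))

theorem integral_avg_cell {u : E d → Z} (hm : StronglyMeasurable u) (hp : IsPeriodic u)
    (hu : MemLp u 2 (volume.restrict (cell d))) (ν : Measure (E d)) [IsProbabilityMeasure ν] :
    ∫ x in cell d, avg ν u x = ∫ x in cell d, u x := by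
  have hi : Integrable (fun p : E d × E d => u (p.1 - p.2)) ((volume.restrict (cell d)).prod ν) := by
    have hms : StronglyMeasurable fun p : E d × E d => u (p.1 - p.2) :=
      hm.comp_measurable (by fun_prop)
    refine (integrable_prod_iff' hms.aestronglyMeasurable).2 ⟨?_, ?_⟩
    · refine Filter.Eventually.of_forall fun h => ⟨(hm.comp_measurable
        (by fun_prop)).aestronglyMeasurable, ?_⟩
      have := lintegral_cell_sub (hp.comp_left fun z => ‖z‖ₑ) h
      simp only [HasFiniteIntegral]
      rw [this]
      exact (hu.integrable one_le_two).2
    · have : ∀ h, ∫ x in cell d, ‖u (x - h)‖ = ∫ x in cell d, ‖u x‖ := fun h => by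
        simpa only [sub_eq_add_neg] using integral_cell_add (hp.comp_left fun z => ‖z‖) (-h)
      simp only [this]
      exact integrable_const _
  simp only [avg]
  rw [integral_integral_swap hi]
  have : ∀ h, ∫ x in cell d, u (x - h) = ∫ x in cell d, u x := fun h => by
    simpa only [sub_eq_add_neg] using integral_cell_add hp (-h)
  simp only [this]
  simp

theorem mean_deriv (hD : PerSob m D) {μ : Fin d → ℕ} (hμ : ∑ i, μ i + 1 ≤ m) (i : Fin d) :
    ∫ y in cell d, D (μ + unitIdx i) y = 0 := by
  have hs : ∀ j, ∑ l, (μ + unitIdx j : Fin d → ℕ) l ≤ m := fun j => by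
    rw [sum_add_idx, sum_unitIdx]; exact hμ
  have h1 := translate_sub_eq (fun j => hD.deriv_unitIdx hμ j)
    (hD.deriv μ (by omega)).2.1 (-EuclideanSpace.single i (1 : ℝ))
  rw [← integral_avg_cell (hD.meas _ (hs i)) (hD.per _ (hs i)) (hD.memLp _ (hs i))
    (segMeasure (-EuclideanSpace.single i (1 : ℝ)))]
  refine integral_eq_zero_of_ae (ae_restrict_of_ae ?_)
  filter_upwards [h1] with x hx
  rw [sub_neg_eq_add, hD.per μ (by omega), sub_self, Finset.sum_eq_single i, eq_comm,
    neg_eq_zero] at hx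
  · simpa using hx
  · intro j _ hj
    simp [hj]
  · simp

theorem mean_eq_zero (hD : PerSob m D) {μ : Fin d → ℕ} (hμ : ∑ i, μ i ≤ m) :
    ∫ y in cell d, D μ y = 0 := by
  rcases Nat.eq_zero_or_pos (∑ i, μ i) with h | h
  · have : μ = 0 := funext fun i => Finset.sum_eq_zero_iff.1 h i (Finset.mem_univ i)
    rw [this]
    exact hD.mean
  · obtain ⟨k, hk⟩ : ∃ k, ∑ i, μ i = k + 1 := ⟨_, (Nat.succ_pred_eq_of_pos h).symm⟩
    obtain ⟨ν, i, hν⟩ := exists_add_unitIdx (⟨μ, hk⟩ : MIdx d (k + 1))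
    rw [show μ = ν.1 + unitIdx i from hν]
    exact hD.mean_deriv (by rw [ν.2]; omega) i

/-- The Poincaré inequality on the cell, with one derivative. -/
theorem nrm2_le (hD : PerSob m D) {μ : Fin d → ℕ} (hμ : ∑ i, μ i + 1 ≤ m) :
    nrm2 (volume.restrict (cell d)) (D μ) ≤
      d * ∑ i, nrm2 (volume.restrict (cell d)) (D (μ + unitIdx i)) := by
  have hs : ∀ j, ∑ l, (μ + unitIdx j : Fin d → ℕ) l ≤ m := fun j => by
    rw [sum_add_idx, sum_unitIdx]; exact hμ
  have hμ' : ∑ i, μ i ≤ m := by omega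
  set c := ∑ i, nrm2 (volume.restrict (cell d)) (D (μ + unitIdx i)) with hc
  have hc0 : 0 ≤ c := Finset.sum_nonneg fun _ _ => nrm2_nonneg
  have hC : 0 ≤ d * c := by positivity
  have hmean := hD.mean_eq_zero hμ'
  have htr : ∀ h ∈ cell d, ∫⁻ x in cell d, ‖D μ (x + h) - D μ x‖ₑ ^ 2 ≤
      ENNReal.ofReal ((d * c) ^ 2) := by
    intro h hh
    obtain ⟨h1, h2⟩ := nrm2_translate_sub_le (fun j => hD.deriv_unitIdx hμ j)
      (hD.deriv μ hμ').2.1 (cell d) (fun j => hD.memLp _ (hs j))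
      (fun j h => lintegral_cell_sub ((hD.per _ (hs j)).comp_left fun z => ‖z‖ₑ ^ 2) h) (-h)
    simp only [sub_neg_eq_add, norm_neg] at h1 h2
    rw [lintegral_eq_nrm2 h1]
    refine ENNReal.ofReal_le_ofReal (pow_le_pow_left₀ nrm2_nonneg (h2.trans ?_) 2)
    exact mul_le_mul_of_nonneg_right (norm_le_of_mem_cell hh) hc0
  -- by the zero mean, `D μ x` is minus the average of its increments over the cell
  have hmean' : ∀ x, D μ x = -∫ h in cell d, (D μ (x + h) - D μ x) := by
    intro x
    have hi : Integrable (fun h => D μ (x + h)) (volume.restrict (cell d)) := by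
      refine ⟨((hD.meas μ hμ').comp_measurable
        (by fun_prop : Measurable fun h : E d => x + h)).aestronglyMeasurable, ?_⟩
      have := lintegral_cell_add ((hD.per μ hμ').comp_left fun z => ‖z‖ₑ) x
      simp only [HasFiniteIntegral, add_comm x]
      rw [this]
      exact ((hD.memLp μ hμ').integrable one_le_two).2
    have e : ∫ h in cell d, D μ (x + h) = 0 := by
      simp only [add_comm x]
      rw [integral_cell_add (hD.per μ hμ'), hD.mean_eq_zero hμ']
    rw [integral_sub hi (integrable_const _), e]
    simp
  have hms : Measurable fun p : E d × E d => ‖D μ (p.1 + p.2) - D μ p.1‖ₑ ^ 2 := by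
    have h1 : StronglyMeasurable fun p : E d × E d => D μ (p.1 + p.2) :=
      (hD.meas μ hμ').comp_measurable (by fun_prop)
    have h2 : StronglyMeasurable fun p : E d × E d => D μ p.1 :=
      (hD.meas μ hμ').comp_measurable (by fun_prop)
    exact ((h1.sub h2).enorm).pow_const 2
  refine nrm2_le_of_eLpNorm hC (nrm2_le_of_lintegral hC ?_)
  calc ∫⁻ x in cell d, ‖D μ x‖ₑ ^ 2
      ≤ ∫⁻ x in cell d, (∫⁻ h in cell d, ‖D μ (x + h) - D μ x‖ₑ ^ 2) := by
        refine lintegral_mono fun x => ?_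
        have := enorm_integral_sq_le (volume.restrict (cell d)) fun h => D μ (x + h) - D μ x
        rwa [← enorm_neg, ← hmean' x] at this
    _ = ∫⁻ h in cell d, (∫⁻ x in cell d, ‖D μ (x + h) - D μ x‖ₑ ^ 2) :=
        lintegral_lintegral_swap hms.aemeasurable
    _ ≤ ∫⁻ h in cell d, ENNReal.ofReal ((d * c) ^ 2) := by
        refine lintegral_mono_ae ?_
        filter_upwards [ae_restrict_mem measurableSet_cell] with h hh
        exact htr h hh
    _ = _ := by simp

/-- The Poincaré inequality on the cell. -/
theorem exists_nrm2_le (d m : ℕ) : ∃ C : ℝ, 0 ≤ C ∧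
    ∀ {n : ℕ} {D : (Fin d → ℕ) → E d → V n}, PerSob m D → ∀ μ : Fin d → ℕ, ∑ i, μ i ≤ m →
      nrm2 (volume.restrict (cell d)) (D μ) ≤
        C * ∑ α : MIdx d m, nrm2 (volume.restrict (cell d)) (D α.1) := by
  have key : ∀ j, ∃ C : ℝ, 0 ≤ C ∧
      ∀ {n : ℕ} {D : (Fin d → ℕ) → E d → V n}, PerSob m D → ∀ μ : Fin d → ℕ, ∑ i, μ i + j = m →
      nrm2 (volume.restrict (cell d)) (D μ) ≤
        C * ∑ α : MIdx d m, nrm2 (volume.restrict (cell d)) (D α.1) := by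
    intro j
    induction j with
    | zero =>
      refine ⟨1, zero_le_one, fun {n} {D} hD μ hμ => ?_⟩
      rw [one_mul]
      rw [add_zero] at hμ
      have hle : ∀ γ : MIdx d m, nrm2 (volume.restrict (cell d)) (D γ.1) ≤
          ∑ α : MIdx d m, nrm2 (volume.restrict (cell d)) (D α.1) := fun γ =>
        Finset.single_le_sum (f := fun α : MIdx d m => nrm2 (volume.restrict (cell d)) (D α.1))
          (fun _ _ => nrm2_nonneg) (Finset.mem_univ γ)
      exact hle ⟨μ, hμ⟩
    | succ j ih =>
      obtain ⟨C, hC, h⟩ := ih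
      refine ⟨d * (d * C), by positivity, fun {n} {D} hD μ hμ => ?_⟩
      refine (hD.nrm2_le (by omega)).trans ?_
      rw [mul_assoc]
      refine mul_le_mul_of_nonneg_left ?_ (by positivity)
      refine (Finset.sum_le_sum fun i _ => h hD (μ + unitIdx i) ?_).trans_eq ?_
      · rw [sum_add_idx, sum_unitIdx]; omega
      · simp [mul_assoc]
  choose C hC h using key
  refine ⟨∑ j ∈ Finset.range (m + 1), C j, Finset.sum_nonneg fun j _ => hC j,
    fun {n} {D} hD μ hμ => ?_⟩
  refine (h (m - ∑ i, μ i) hD μ (by omega)).trans (mul_le_mul_of_nonneg_right ?_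
    (Finset.sum_nonneg fun _ _ => nrm2_nonneg))
  exact Finset.single_le_sum (f := C) (fun j _ => hC j) (Finset.mem_range.2 (by omega))

end PerSob

end Periodic

/-! ### The Gårding inequality on the cell -/

section Slices

variable {Ω Ω' X : Type*} [MeasurableSpace Ω] [MeasurableSpace Ω'] {μ : Measure Ω}
  {ν : Measure Ω'} [SFinite μ] [SFinite ν] [NormedAddCommGroup X]

theorem memLp_slice {f : Ω × Ω' → X} (hf : MemLp f 2 (μ.prod ν)) :
    ∀ᵐ x ∂μ, MemLp (fun y => f (x, y)) 2 ν := by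
  filter_upwards [hf.1.prodMk_left, (integrable_norm_sq hf).prod_right_ae] with x h1 h2
  exact (memLp_two_iff_integrable_sq_norm h1).2 h2

end Slices

theorem le_of_forall_le_add_mul {a b K : ℝ} (h : ∀ ε : ℝ, 0 < ε → ε ≤ 1 → a ≤ b + K * ε) :
    a ≤ b := by
  have t : Filter.Tendsto (fun ε : ℝ => b + K * ε) (nhdsWithin 0 (Set.Ioi 0)) (nhds (b + K * 0)) :=
    ((continuous_const.add (continuous_const.mul continuous_id)).tendsto 0).mono_left
      nhdsWithin_le_nhds
  rw [mul_zero, add_zero] at t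
  refine ge_of_tendsto t ?_
  filter_upwards [Ioc_mem_nhdsGT (zero_lt_one' ℝ)] with ε hε
  exact h ε hε.1 hε.2

section ScalarMultiplier

variable {d : ℕ} {Z : Type*} [NormedAddCommGroup Z] [InnerProductSpace ℂ Z] [CompleteSpace Z]

theorem perMul_toSpanSingleton {g : E d → Z} (hm : StronglyMeasurable g) (hp : IsPeriodic g)
    (hg : MemLp g 2 (volume.restrict (cell d))) :
    PerMul (nrm2 (volume.restrict (cell d)) g)
      fun y => ContinuousLinearMap.toSpanSingleton ℂ (g y) := by
  refine ⟨nrm2_nonneg, ?_, hp.comp_left _, fun c => ?_⟩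
  · exact (ContinuousLinearMap.toSpanSingletonCLE (𝕜 := ℂ) (E := Z)).continuous.comp_stronglyMeasurable hm
  · simp only [ContinuousLinearMap.toSpanSingleton_apply, enorm_smul, mul_pow]
    rw [lintegral_const_mul' _ _ (by simp), lintegral_eq_nrm2 hg, mul_comm,
      ENNReal.ofReal_mul (by positivity), ENNReal.ofReal_pow (norm_nonneg c), ofReal_norm]

/-- Unfolding of the double integral: the mean of the periodic factor splits off exactly. -/
theorem integral_cellProd_inner {g h : E d → Z} (hgm : StronglyMeasurable g) (hgp : IsPeriodic g)
    (hg : MemLp g 2 (volume.restrict (cell d))) (hhm : StronglyMeasurable h) (hhp : IsPeriodic h)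
    (hh : MemLp h 2 (volume.restrict (cell d))) {ε : ℝ} (hε : ε ≠ 0) {χ : E d → ℂ}
    (hχ : MemLp χ 2 volume) :
    ∫ p, inner ℂ (pmulIntegrand (fun y => ContinuousLinearMap.toSpanSingleton ℂ (g y)) ε χ p)
      (pmulIntegrand (fun y => ContinuousLinearMap.toSpanSingleton ℂ (h y)) ε χ p) ∂(cellProd d) =
      ((nrm2 volume χ ^ 2 : ℝ) : ℂ) * ∫ y in cell d, inner ℂ (g y) (h y) := by
  have hG := perMul_toSpanSingleton hgm hgp hg
  have hH := perMul_toSpanSingleton hhm hhp hh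
  have hi := integrable_inner (memLp_pmulIntegrand hG hε hχ).1 (memLp_pmulIntegrand hH hε hχ).1
  have hi' := integrable_inner (memLp_pmulIntegrand_shear hG hε hχ).1
    (memLp_pmulIntegrand_shear hH hε hχ).1
  have hmp := measurePreserving_shear (d := d) ε
  rw [← hmp.map_eq, integral_map hmp.measurable.aemeasurable (by rw [hmp.map_eq]; exact hi.1),
    integral_prod_symm _ hi', ← integral_inner_self hχ, ← integral_mul_const]
  refine integral_congr_ae (Filter.Eventually.of_forall fun z => ?_)
  simp only [pmulIntegrand_shear hε, ContinuousLinearMap.toSpanSingleton_apply, inner_smul_left,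
    inner_smul_right]
  rw [integral_const_mul, integral_const_mul]
  have hper : IsPeriodic fun y => inner ℂ (g y) (h y) := fun i y => by
    simp only [hgp i y, hhp i y]
  rw [integral_cell_add hper, ← mul_assoc, RCLike.inner_apply, mul_comm (χ z)]

end ScalarMultiplier

section CellGarding

variable {d m n : ℕ} {lam Lam : ℝ} {B : E d → W d m n →L[ℂ] W d m n}
  {D : (Fin d → ℕ) → E d → V n}

/-- The array of derivatives of order `m` of a periodic function. -/
def cgrad (m : ℕ) (D : (Fin d → ℕ) → E d → V n) (y : E d) : W d m n := pack fun α => D α.1 y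

theorem stronglyMeasurable_pack {Ω : Type*} [MeasurableSpace Ω] {ι : Type*} [Fintype ι]
    [DecidableEq ι] {u : ι → Ω → V n} (h : ∀ i, StronglyMeasurable (u i)) :
    StronglyMeasurable fun x => pack fun i => u i x := by
  simp only [pack_eq_sum]
  exact Finset.stronglyMeasurable_fun_sum _ fun i _ =>
    (emb i).continuous.comp_stronglyMeasurable (h i)

theorem PerSob.stronglyMeasurable_cgrad (hD : PerSob m D) : StronglyMeasurable (cgrad m D) :=
  stronglyMeasurable_pack fun α => hD.meas α.1 α.2.le

theorem PerSob.isPeriodic_cgrad (hD : PerSob m D) : IsPeriodic (cgrad m D) := fun i y =>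
  congrArg pack (funext fun α => hD.per α.1 α.2.le i y)

theorem PerSob.memLp_cgrad (hD : PerSob m D) : MemLp (cgrad m D) 2 (volume.restrict (cell d)) :=
  memLp_pack fun α => hD.memLp α.1 α.2.le

/-- The factors `D^ν χ(x - ε ω)` in the localization of a periodic function. -/
noncomputable def cderiv (χ : E d → ℝ) (ν : Fin d → ℕ) (z : E d) : ℂ :=
  ((multiDeriv ν χ z : ℝ) : ℂ)

/-- One term of the Leibniz formula for the localization `ε^m v(x/ε) χ(x - ε ω)`. -/
noncomputable def locTerm (D : (Fin d → ℕ) → E d → V n) (ε : ℝ) (χ : E d → ℝ)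
    (μ ν : Fin d → ℕ) : E d × E d → V n :=
  pmulIntegrand (fun y => ContinuousLinearMap.toSpanSingleton ℂ (D μ y)) ε (cderiv χ ν)

/-- The derivative `D^γ` in `x` of the localization `ε^m v(x/ε) χ(x - ε ω)`. -/
noncomputable def locDeriv (m : ℕ) (D : (Fin d → ℕ) → E d → V n) (ε : ℝ) (χ : E d → ℝ)
    (γ : Fin d → ℕ) (p : E d × E d) : V n :=
  ∑ μ ∈ Finset.Iic γ, (binom γ μ * ε ^ (m - ∑ i, μ i)) • locTerm D ε χ μ (γ - μ) p

theorem memLp_cderiv {χ : E d → ℝ} (hχ : Smooth χ) (hc : HasCompactSupport χ) (ν : Fin d → ℕ) :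
    MemLp (cderiv χ ν) 2 volume :=
  (Complex.continuous_ofReal.comp (hχ.multiDeriv ν).continuous).memLp_of_hasCompactSupport
    ((hasCompactSupport_multiDeriv hχ hc ν).comp_left Complex.ofReal_zero)

theorem PerSob.memLp_locTerm (hD : PerSob m D) {ε : ℝ} (hε : ε ≠ 0) {χ : E d → ℝ} (hχ : Smooth χ)
    (hc : HasCompactSupport χ) {μ : Fin d → ℕ} (hμ : ∑ i, μ i ≤ m) (ν : Fin d → ℕ) :
    MemLp (locTerm D ε χ μ ν) 2 (cellProd d) ∧ nrm2 (cellProd d) (locTerm D ε χ μ ν) ≤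
      nrm2 (volume.restrict (cell d)) (D μ) * nrm2 volume (cderiv χ ν) :=
  memLp_pmulIntegrand (perMul_toSpanSingleton (hD.meas μ hμ) (hD.per μ hμ) (hD.memLp μ hμ)) hε
    (memLp_cderiv hχ hc ν)

theorem PerSob.memLp_locDeriv (hD : PerSob m D) {ε : ℝ} (hε : ε ≠ 0) {χ : E d → ℝ} (hχ : Smooth χ)
    (hc : HasCompactSupport χ) {γ : Fin d → ℕ} (hγ : ∑ i, γ i ≤ m) :
    MemLp (locDeriv m D ε χ γ) 2 (cellProd d) :=
  memLp_finsetSum _ fun μ hμ => ((hD.memLp_locTerm hε hχ hc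
    ((sum_le_of_le (Finset.mem_Iic.1 hμ)).trans hγ) _).1).const_smul
      (binom γ μ * ε ^ (m - ∑ i, μ i))

theorem PerSob.hasWeakDeriv_loc (hD : PerSob m D) {ε : ℝ} (hε : 0 < ε) {χ : E d → ℝ}
    (hχ : Smooth χ) {γ : Fin d → ℕ} (hγ : ∑ i, γ i ≤ m) (ω : E d) :
    HasWeakDeriv γ (fun x => χ (x - ε • ω) • (ε ^ m • D 0 (ε⁻¹ • x)))
      (fun x => locDeriv m D ε χ γ (ω, x)) := by
  have hs : Smooth fun x => χ (x - ε • ω) := hχ.comp (contDiff_id.sub contDiff_const)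
  have hN : ∀ μ ≤ γ, HasWeakDeriv μ
      ((fun (μ : Fin d → ℕ) x => ε ^ (m - ∑ i, μ i) • D μ (ε⁻¹ • x)) 0)
      ((fun (μ : Fin d → ℕ) x => ε ^ (m - ∑ i, μ i) • D μ (ε⁻¹ • x)) μ) := by
    intro μ hμ
    have hμm := (sum_le_of_le hμ).trans hγ
    have h := ((hD.deriv μ hμm).comp_affine (inv_ne_zero hε.ne') 0).const_smul_real (ε ^ m)
    simp only [add_zero, smul_smul] at h
    have e : ε ^ m * ε⁻¹ ^ (∑ i, μ i) = ε ^ (m - ∑ i, μ i) := by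
      rw [inv_pow, ← div_eq_mul_inv, pow_sub₀ _ hε.ne' hμm, div_eq_mul_inv]
    rw [e] at h
    simpa using h
  refine (HasWeakDeriv.real_smul (N := fun (μ : Fin d → ℕ) x => ε ^ (m - ∑ i, μ i) • D μ (ε⁻¹ • x))
    hs γ hN).congr (Filter.Eventually.of_forall fun x => ?_)
    (Filter.Eventually.of_forall fun x => ?_)
  · simp
  · refine Finset.sum_congr rfl fun μ _ => ?_
    simp only [locTerm, pmulIntegrand, ContinuousLinearMap.toSpanSingleton_apply, cderiv,
      Complex.coe_smul]
    rw [multiDeriv_neg_arg hχ, mul_smul, smul_comm (ε ^ _) _ (D μ _)]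

/-- The array of derivatives of order `m` of the localization. -/
noncomputable def locGrad (m : ℕ) (D : (Fin d → ℕ) → E d → V n) (ε : ℝ) (χ : E d → ℝ)
    (p : E d × E d) : W d m n := pack fun α => locDeriv m D ε χ α.1 p

/-- The Gårding inequality for localizations, averaged over the shift. -/
theorem PerElliptic.garding_loc (hB : PerElliptic lam Lam B) (hD : PerSob m D) {ε : ℝ} (hε : 0 < ε)
    {χ : E d → ℝ} (hχ : Smooth χ) (hc : HasCompactSupport χ) :
    lam * nrm2 (cellProd d) (locGrad m D ε χ) ^ 2 ≤
      (∫ p, inner ℂ (locGrad m D ε χ p) (B (ε⁻¹ • p.2) (locGrad m D ε χ p)) ∂(cellProd d)).re := by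
  have hP : MemLp (locGrad m D ε χ) 2 (cellProd d) :=
    memLp_pack fun α => hD.memLp_locDeriv hε.ne' hχ hc α.2.le
  have hBm : StronglyMeasurable fun p : E d × E d => B (ε⁻¹ • p.2) :=
    hB.smeas.comp_measurable (by fun_prop)
  have hBε := hB.toElliptic.rescale hε
  have hBb : ∀ᵐ p ∂(cellProd d), ‖B (ε⁻¹ • p.2)‖ ≤ Lam :=
    Measure.quasiMeasurePreserving_snd.ae hBε.bound
  have hBP : MemLp (fun p => B (ε⁻¹ • p.2) (locGrad m D ε χ p)) 2 (cellProd d) :=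
    memLp_clm_apply hBm.aestronglyMeasurable hBb hP
  have hi1 := integrable_norm_sq hP
  have hi2 := integrable_inner hP hBP
  rw [nrm2_sq hP, integral_prod _ hi1, integral_prod _ hi2, ← integral_const_mul]
  have hre : (∫ ω in cell d, (∫ x, inner ℂ (locGrad m D ε χ (ω, x))
      (B (ε⁻¹ • x) (locGrad m D ε χ (ω, x))))).re = ∫ ω in cell d, (∫ x,
        inner ℂ (locGrad m D ε χ (ω, x)) (B (ε⁻¹ • x) (locGrad m D ε χ (ω, x)))).re :=
    (integral_re (𝕜 := ℂ) hi2.integral_prod_left).symm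
  rw [hre]
  refine integral_mono_ae (hi1.integral_prod_left.const_mul lam) hi2.integral_prod_left.re ?_
  have hsl : ∀ᵐ ω ∂(volume.restrict (cell d)), ∀ γ : idxLE d m,
      MemLp (fun x => locDeriv m D ε χ γ.1 (ω, x)) 2 volume :=
    ae_all_iff.2 fun γ => memLp_slice (hD.memLp_locDeriv hε.ne' hχ hc (mem_idxLE.1 γ.2))
  filter_upwards [hsl] with ω hω
  have hH : MemH m fun x => χ (x - ε • ω) • (ε ^ m • D 0 (ε⁻¹ • x)) := fun γ hγ =>
    ⟨_, hD.hasWeakDeriv_loc hε hχ hγ ω, hω ⟨γ, mem_idxLE.2 hγ⟩⟩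
  have he := wgrad_ae_eq fun α : MIdx d m => hD.hasWeakDeriv_loc hε hχ α.2.le ω
  have hg := hBε.garding_memH hH
  rw [nrm2_sq (hH.memLp_wgrad le_rfl)] at hg
  have e1 : ∫ x, ‖wgrad m (fun x => χ (x - ε • ω) • (ε ^ m • D 0 (ε⁻¹ • x))) x‖ ^ 2 =
      ∫ x, ‖locGrad m D ε χ (ω, x)‖ ^ 2 := by
    refine integral_congr_ae ?_
    filter_upwards [he] with x hx
    rw [hx]
    rfl
  rw [← e1]
  refine hg.trans_eq (congrArg Complex.re (integral_congr_ae ?_))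
  filter_upwards [he] with x hx
  rw [hx]
  rfl

end CellGarding

/-! ### Passage from the space to the cell -/

section CellGarding

variable {d m n : ℕ} {lam Lam : ℝ} {B : E d → W d m n →L[ℂ] W d m n}
  {D : (Fin d → ℕ) → E d → V n}

/-- A cutoff function with nonzero `L²` norm. -/
theorem exists_test_pos (d : ℕ) : ∃ χ : E d → ℝ, Smooth χ ∧ HasCompactSupport χ ∧
    0 < nrm2 volume (cderiv χ 0) := by
  have hs := smooth_mollKernel d 0
  have hc := hasCompactSupport_mollKernel d 0
  refine ⟨mollKernel d 0, hs, hc, lt_of_le_of_ne nrm2_nonneg fun h => ?_⟩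
  have h1 := nrm2_eq_zero (memLp_cderiv hs hc 0) h.symm
  have h2 : ∫ x, mollKernel d 0 x = 1 := (mollBump d 0).integral_normed
  have h3 : ∫ x, mollKernel d 0 x = 0 := by
    refine integral_eq_zero_of_ae ?_
    filter_upwards [h1] with x hx
    simp only [cderiv, multiDeriv_zero] at hx
    exact Complex.ofReal_eq_zero.1 hx
  exact one_ne_zero (h2.symm.trans h3)

/-- The leading term of the localized gradient. -/
noncomputable def locLead (m : ℕ) (D : (Fin d → ℕ) → E d → V n) (ε : ℝ) (χ : E d → ℝ) :
    E d × E d → W d m n :=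
  pmulIntegrand (fun y => ContinuousLinearMap.toSpanSingleton ℂ (cgrad m D y)) ε (cderiv χ 0)

theorem prj_locLead (ε : ℝ) (χ : E d → ℝ) (p : E d × E d) (α : MIdx d m) :
    prj α (locLead m D ε χ p) = locTerm D ε χ α.1 0 p := by
  simp only [locLead, locTerm, pmulIntegrand, ContinuousLinearMap.toSpanSingleton_apply, map_smul]
  rfl

theorem locDeriv_sub_lead (ε : ℝ) (χ : E d → ℝ) (p : E d × E d) (α : MIdx d m) :
    locDeriv m D ε χ α.1 p - locTerm D ε χ α.1 0 p =
      ∑ μ ∈ (Finset.Iic α.1).erase α.1,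
        (binom α.1 μ * ε ^ (m - ∑ i, μ i)) • locTerm D ε χ μ (α.1 - μ) p := by
  rw [locDeriv, ← Finset.add_sum_erase _ _ (Finset.mem_Iic.2 (le_refl α.1)), binom_self, α.2,
    Nat.sub_self, pow_zero, one_mul, one_smul, tsub_self, add_sub_cancel_left]

theorem sum_lt_of_mem_erase {α μ : Fin d → ℕ} (h : μ ∈ (Finset.Iic α).erase α) :
    ∑ i, μ i < ∑ i, α i := by
  rw [Finset.mem_erase, Finset.mem_Iic] at h
  by_contra! h'
  exact h.1 (eq_of_le_of_sum_le h.2 h')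

theorem binom_nonneg (α μ : Fin d → ℕ) : 0 ≤ binom α μ :=
  Finset.prod_nonneg fun _ _ => Nat.cast_nonneg _

/-- In the Leibniz formula each derivative which falls on the cutoff costs a factor `ε`. -/
theorem PerSob.nrm2_locGrad_sub_le (hD : PerSob m D) {χ : E d → ℝ} (hχ : Smooth χ)
    (hc : HasCompactSupport χ) : ∃ c, 0 ≤ c ∧ ∀ ε : ℝ, 0 < ε → ε ≤ 1 →
      nrm2 (cellProd d) (fun p => locGrad m D ε χ p - locLead m D ε χ p) ≤ c * ε := by
  refine ⟨∑ α : MIdx d m, ∑ μ ∈ (Finset.Iic α.1).erase α.1, binom α.1 μ *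
    (nrm2 (volume.restrict (cell d)) (D μ) * nrm2 volume (cderiv χ (α.1 - μ))),
    Finset.sum_nonneg fun α _ => Finset.sum_nonneg fun μ _ =>
      mul_nonneg (binom_nonneg _ _) (mul_nonneg nrm2_nonneg nrm2_nonneg), fun ε hε hε1 => ?_⟩
  have e : (fun p => locGrad m D ε χ p - locLead m D ε χ p) = fun p => pack fun α : MIdx d m =>
      ∑ μ ∈ (Finset.Iic α.1).erase α.1,
        (binom α.1 μ * ε ^ (m - ∑ i, μ i)) • locTerm D ε χ μ (α.1 - μ) p := by
    funext p
    refine Pk.ext fun α => ?_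
    rw [map_sub, prj_locLead, prj_pack, ← locDeriv_sub_lead]
    rfl
  have hm : ∀ (α : MIdx d m), ∀ μ ∈ (Finset.Iic α.1).erase α.1, ∑ i, μ i < m := fun α μ hμ => by
    have := sum_lt_of_mem_erase hμ
    rwa [α.2] at this
  have hml : ∀ (α : MIdx d m), ∀ μ ∈ (Finset.Iic α.1).erase α.1,
      MemLp (fun p => (binom α.1 μ * ε ^ (m - ∑ i, μ i)) • locTerm D ε χ μ (α.1 - μ) p) 2
        (cellProd d) := fun α μ hμ =>
    ((hD.memLp_locTerm hε.ne' hχ hc (hm α μ hμ).le _).1).const_smul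
      (binom α.1 μ * ε ^ (m - ∑ i, μ i))
  rw [e, Finset.sum_mul]
  refine (nrm2_pack_le fun α => memLp_finsetSum _ (hml α)).trans
    (Finset.sum_le_sum fun α _ => ?_)
  refine (nrm2_sum_le _ (hml α)).trans ?_
  rw [Finset.sum_mul]
  refine Finset.sum_le_sum fun μ hμ => ?_
  rw [nrm2_smul, Real.norm_of_nonneg (mul_nonneg (binom_nonneg _ _) (by positivity)),
    mul_assoc, mul_assoc]
  refine mul_le_mul_of_nonneg_left ?_ (binom_nonneg _ _)
  rw [mul_comm _ ε]
  have h1 : ε ^ (m - ∑ i, μ i) ≤ ε := by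
    have := hm α μ hμ
    calc ε ^ (m - ∑ i, μ i) ≤ ε ^ 1 := pow_le_pow_of_le_one hε.le hε1 (by omega)
      _ = ε := pow_one ε
  exact mul_le_mul h1 (hD.memLp_locTerm hε.ne' hχ hc (hm α μ hμ).le _).2 nrm2_nonneg hε.le

/-- The Gårding inequality for periodic functions, deduced from the one on `ℝ^d` by localization:
the functions `ε^m v(x/ε) χ(x - ε ω)`, `ε → 0`, are admissible in the rescaled inequality. -/
theorem PerElliptic.garding_cell (hlam : 0 < lam) (hB : PerElliptic lam Lam B) (hD : PerSob m D) :
    lam * nrm2 (volume.restrict (cell d)) (cgrad m D) ^ 2 ≤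
      (∫ y in cell d, inner ℂ (cgrad m D y) (B y (cgrad m D y))).re := by
  obtain ⟨χ, hχ, hc, hpos⟩ := exists_test_pos d
  obtain ⟨c, hc0, hr⟩ := hD.nrm2_locGrad_sub_le hχ hc
  have hgm := hD.stronglyMeasurable_cgrad
  have hgp := hD.isPeriodic_cgrad
  have hg := hD.memLp_cgrad
  have hbr : ∀ᵐ y ∂(volume.restrict (cell d)), ‖B y‖ ≤ Lam := ae_restrict_of_ae hB.bound
  have hhm : StronglyMeasurable fun y => B y (cgrad m D y) :=
    (isBoundedBilinearMap_apply (𝕜 := ℂ) (E := W d m n) (F := W d m n)).continuous.comp_stronglyMeasurable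
      (hB.smeas.prodMk hgm)
  have hhp : IsPeriodic fun y => B y (cgrad m D y) := fun i y => by
    simp only [hB.per i y, hgp i y]
  have hh : MemLp (fun y => B y (cgrad m D y)) 2 (volume.restrict (cell d)) :=
    memLp_clm_apply hB.smeas.aestronglyMeasurable hbr hg
  set X := nrm2 volume (cderiv χ 0) with hX
  set g := nrm2 (volume.restrict (cell d)) (cgrad m D) with hgdef
  set I := ∫ y in cell d, inner ℂ (cgrad m D y) (B y (cgrad m D y)) with hI
  have hχ2 := memLp_cderiv hχ hc 0
  -- the localized inequality with leading terms `(X g)²` and `X² I` and errors of size `c ε`, where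
  -- `X` is the norm of the cutoff and `g` that of the gradient on the cell
  have key : ∀ ε : ℝ, 0 < ε → ε ≤ 1 → lam * (X * g) ^ 2 ≤ X ^ 2 * I.re +
      (Lam * (2 * (X * g) * c + c ^ 2) + lam * (2 * (X * g) * c + 3 * c ^ 2)) * ε := by
    intro ε hε hε1
    have hQ : MemLp (locLead m D ε χ) 2 (cellProd d) :=
      (memLp_pmulIntegrand (perMul_toSpanSingleton hgm hgp hg) hε.ne' hχ2).1
    have hP : MemLp (locGrad m D ε χ) 2 (cellProd d) :=
      memLp_pack fun α => hD.memLp_locDeriv hε.ne' hχ hc α.2.le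
    have hR := hP.sub hQ
    have hBm : StronglyMeasurable fun p : E d × E d => B (ε⁻¹ • p.2) :=
      hB.smeas.comp_measurable (by fun_prop)
    have hBb : ∀ᵐ p ∂(cellProd d), ‖B (ε⁻¹ • p.2)‖ ≤ Lam :=
      Measure.quasiMeasurePreserving_snd.ae (hB.toElliptic.rescale hε).bound
    have hmul : ∀ {f : E d × E d → W d m n}, MemLp f 2 (cellProd d) →
        MemLp (fun p => B (ε⁻¹ • p.2) (f p)) 2 (cellProd d) := fun hf =>
      memLp_clm_apply hBm.aestronglyMeasurable hBb hf
    have hmulb : ∀ {f : E d × E d → W d m n}, MemLp f 2 (cellProd d) →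
        nrm2 (cellProd d) (fun p => B (ε⁻¹ • p.2) (f p)) ≤ Lam * nrm2 (cellProd d) f := fun hf =>
      nrm2_clm_apply_le hB.nonneg hBb hf
    have q2 : nrm2 (cellProd d) (locLead m D ε χ) = X * g := by
      have h1 := integral_cellProd_inner hgm hgp hg hgm hgp hg hε.ne' hχ2
      rw [integral_inner_self hg] at h1
      have h2 := (integral_inner_self hQ).symm.trans h1
      rw [← Complex.ofReal_mul, Complex.ofReal_inj, ← mul_pow] at h2
      exact (pow_left_inj₀ nrm2_nonneg (mul_nonneg hpos.le nrm2_nonneg) two_ne_zero).1 h2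
    have hQQ : ∫ p, inner ℂ (locLead m D ε χ p) (B (ε⁻¹ • p.2) (locLead m D ε χ p)) ∂(cellProd d) =
        ((X ^ 2 : ℝ) : ℂ) * I := by
      rw [← integral_cellProd_inner hgm hgp hg hhm hhp hh hε.ne' hχ2]
      refine integral_congr_ae (Filter.Eventually.of_forall fun p => ?_)
      simp only [locLead, pmulIntegrand, ContinuousLinearMap.toSpanSingleton_apply, map_smul]
    set r := nrm2 (cellProd d) (fun p => locGrad m D ε χ p - locLead m D ε χ p) with hrdef
    have hr0 : 0 ≤ r := nrm2_nonneg
    have hrc : r ≤ c * ε := hr ε hε hε1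
    set P := nrm2 (cellProd d) (locGrad m D ε χ) with hPdef
    have hP0 : 0 ≤ P := nrm2_nonneg
    set q := X * g with hq
    have hq0 : 0 ≤ q := mul_nonneg hpos.le nrm2_nonneg
    have hPq : P ≤ q + r := by
      have := nrm2_add_le hQ hR
      simp only [Pi.sub_apply, add_sub_cancel] at this
      rw [q2] at this
      exact this
    have hqP : q ≤ P + r := by
      have := nrm2_sub_le hP hR
      simp only [Pi.sub_apply, sub_sub_cancel] at this
      rw [q2] at this
      exact this
    have hg1 := hB.garding_loc hD hε hχ hc
    have split : ∫ p, inner ℂ (locGrad m D ε χ p) (B (ε⁻¹ • p.2) (locGrad m D ε χ p)) ∂(cellProd d) =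
        ((X ^ 2 : ℝ) : ℂ) * I +
        ∫ p, inner ℂ (locLead m D ε χ p)
          (B (ε⁻¹ • p.2) (locGrad m D ε χ p - locLead m D ε χ p)) ∂(cellProd d) +
        ∫ p, inner ℂ (locGrad m D ε χ p - locLead m D ε χ p)
          (B (ε⁻¹ • p.2) (locGrad m D ε χ p)) ∂(cellProd d) := by
      rw [← hQQ]
      simp only [map_sub]
      rw [integral_inner_sub hQ (hmul hP) (hmul hQ), integral_sub_inner hP hQ (hmul hP)]
      ring
    have b1 : ‖∫ p, inner ℂ (locLead m D ε χ p)
          (B (ε⁻¹ • p.2) (locGrad m D ε χ p - locLead m D ε χ p)) ∂(cellProd d)‖ ≤ q * (Lam * r) := by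
      refine (norm_integral_inner_le hQ (hmul hR)).trans ?_
      rw [q2]
      exact mul_le_mul_of_nonneg_left (hmulb hR) hq0
    have b2 : ‖∫ p, inner ℂ (locGrad m D ε χ p - locLead m D ε χ p)
          (B (ε⁻¹ • p.2) (locGrad m D ε χ p)) ∂(cellProd d)‖ ≤ r * (Lam * P) :=
      (norm_integral_inner_le hR (hmul hP)).trans (mul_le_mul_of_nonneg_left (hmulb hP) hr0)
    rw [split, Complex.add_re, Complex.add_re, Complex.re_ofReal_mul] at hg1
    have c1 := (Complex.re_le_norm _).trans b1
    have c2 := (Complex.re_le_norm _).trans b2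
    have hL := hB.nonneg
    have t1 : lam * q ^ 2 ≤ lam * P ^ 2 + lam * (2 * (q + r) * r + r ^ 2) := by
      have : q ^ 2 ≤ (P + r) ^ 2 := pow_le_pow_left₀ hq0 hqP 2
      have h2 : P * r ≤ (q + r) * r := mul_le_mul_of_nonneg_right hPq hr0
      have h3 : q ^ 2 ≤ P ^ 2 + (2 * (q + r) * r + r ^ 2) := by nlinarith
      nlinarith
    have t2 : r * (Lam * P) ≤ Lam * ((q + r) * r) := by
      have h2 : P * r ≤ (q + r) * r := mul_le_mul_of_nonneg_right hPq hr0
      nlinarith [mul_le_mul_of_nonneg_left h2 hL]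
    have hcε : c * ε ≤ c := mul_le_of_le_one_right hc0 hε1
    have r2 : r ^ 2 ≤ c ^ 2 * ε := by
      calc r ^ 2 = r * r := sq r
        _ ≤ (c * ε) * c := mul_le_mul hrc (hrc.trans hcε) hr0 (by positivity)
        _ = c ^ 2 * ε := by ring
    have rq : q * r ≤ q * c * ε := by
      calc q * r ≤ q * (c * ε) := mul_le_mul_of_nonneg_left hrc hq0
        _ = q * c * ε := by ring
    have s1 : Lam * (2 * (q * r) + r ^ 2) ≤ Lam * (2 * (q * c * ε) + c ^ 2 * ε) :=
      mul_le_mul_of_nonneg_left (by linarith) hL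
    have s2 : lam * (2 * (q * r) + 3 * r ^ 2) ≤ lam * (2 * (q * c * ε) + 3 * (c ^ 2 * ε)) :=
      mul_le_mul_of_nonneg_left (by linarith) hlam.le
    nlinarith
  have h1 := le_of_forall_le_add_mul key
  have hX2 : 0 < X ^ 2 := by positivity
  refine le_of_mul_le_mul_left ?_ hX2
  calc X ^ 2 * (lam * g ^ 2) = lam * (X * g) ^ 2 := by ring
    _ ≤ _ := h1

end CellGarding

/-! ### Correctors, homogenized coefficients and fluxes -/

section Correctors

variable {d m n : ℕ} {lam Lam : ℝ} {B : E d → W d m n →L[ℂ] W d m n}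

/-- A shortcut instance: completeness is needed for weak derivatives and Bochner integrals of
operator-valued functions. -/
instance {X Z : Type*} [NormedAddCommGroup X] [NormedSpace ℂ X] [NormedAddCommGroup Z]
    [NormedSpace ℂ Z] [CompleteSpace Z] : CompleteSpace (X →L[ℂ] Z) := inferInstance

theorem PerSob.sum_clm {ι Z Z' : Type*} [Fintype ι] [NormedAddCommGroup Z] [NormedSpace ℝ Z]
    [CompleteSpace Z] [NormedAddCommGroup Z'] [NormedSpace ℝ Z'] [CompleteSpace Z']
    (L : ι → Z →L[ℝ] Z') {D : ι → (Fin d → ℕ) → E d → Z} (hD : ∀ i, PerSob m (D i)) :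
    PerSob m fun μ y => ∑ i, L i (D i μ y) := by
  refine ⟨fun μ hμ => ?_, fun μ hμ i y => ?_, fun μ hμ => ?_, fun μ hμ => ?_, ?_⟩
  · exact Finset.stronglyMeasurable_fun_sum _ fun i _ =>
      (L i).continuous.comp_stronglyMeasurable ((hD i).meas μ hμ)
  · exact Finset.sum_congr rfl fun j _ => by rw [(hD j).per μ hμ i y]
  · exact memLp_finsetSum _ fun i _ => (L i).comp_memLp' ((hD i).memLp μ hμ)
  · exact HasWeakDeriv.fun_sum _ fun i _ => ((hD i).deriv μ hμ).clm_comp (L i)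
  · have hi : ∀ i, Integrable (D i 0) (volume.restrict (cell d)) := fun i =>
      ((hD i).memLp 0 (by simp)).integrable one_le_two
    rw [integral_finsetSum _ fun i _ => (L i).integrable_comp (hi i)]
    refine Finset.sum_eq_zero fun i _ => ?_
    rw [(L i).integral_comp_comm (hi i), (hD i).mean, map_zero]

theorem PerSob.clm {Z Z' : Type*} [NormedAddCommGroup Z] [NormedSpace ℝ Z]
    [CompleteSpace Z] [NormedAddCommGroup Z'] [NormedSpace ℝ Z'] [CompleteSpace Z']
    (L : Z →L[ℝ] Z') {D : (Fin d → ℕ) → E d → Z} (hD : PerSob m D) :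
    PerSob m fun μ y => L (D μ y) := by
  have := PerSob.sum_clm (fun _ : Unit => L) fun _ => hD
  simpa using this

theorem PerSob.memW {Z : Type*} [NormedAddCommGroup Z] [NormedSpace ℝ Z]
    [CompleteSpace Z] {D : (Fin d → ℕ) → E d → Z} (hD : PerSob m D) : MemW m (D 0) :=
  ⟨hD.per 0 (by simp), hD.mean, fun μ hμ => ⟨_, hD.deriv μ hμ, hD.memLp μ hμ⟩⟩

theorem PerSob.wgrad_ae_eq {D : (Fin d → ℕ) → E d → V n} (hD : PerSob m D) :
    wgrad m (D 0) =ᵐ[volume] cgrad m D :=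
  HighOrderHomogenization.wgrad_ae_eq fun α => hD.deriv α.1 α.2.le

/-- The corrector as an operator-valued function: `F ↦ ∑_{k,γ} F_{k,γ} D^μ N^k_γ(y)`. -/
noncomputable def corrOp (D : MIdx d m → Fin n → (Fin d → ℕ) → E d → V n) (μ : Fin d → ℕ)
    (y : E d) : W d m n →L[ℂ] V n :=
  ∑ p : MIdx d m × Fin n, ContinuousLinearMap.smulRightL ℂ (W d m n) (V n)
    (EuclideanSpace.proj p) (D p.1 p.2 μ y)

theorem corrOp_apply (D : MIdx d m → Fin n → (Fin d → ℕ) → E d → V n) (μ : Fin d → ℕ)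
    (y : E d) (F : W d m n) : corrOp D μ y F = ∑ p : MIdx d m × Fin n, F p • D p.1 p.2 μ y := by
  simp only [corrOp, sum_apply]
  rfl

/-- A family of correctors: periodic functions with zero mean `𝒩_F`, linear in the array `F`, which
solve the cell problems `∫_Y ⟨∇^m φ, B (F + ∇^m 𝒩_F)⟩ = 0`, together with the homogenized operator
`Â`, for which `Â F` is the mean value of `B (F + ∇^m 𝒩_F)`. The argument `𝒩` is the family of
derivatives of the corrector. -/
structure Corrector (B : E d → W d m n →L[ℂ] W d m n)
    (𝒩 : (Fin d → ℕ) → E d → W d m n →L[ℂ] V n) (Ahat : W d m n →L[ℂ] W d m n) : Prop where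
  perSob : PerSob m 𝒩
  cell_eq : ∀ (F : W d m n) (D : (Fin d → ℕ) → E d → V n), PerSob m D →
    ∫ y in cell d, inner ℂ (cgrad m D y) (B y (F + cgrad m (fun μ y => 𝒩 μ y F) y)) = 0
  hom_eq : ∀ F : W d m n,
    Ahat F = ∫ y in cell d, B y (F + cgrad m (fun μ y => 𝒩 μ y F) y)

/-- The operators `F ↦ ∇^m 𝒩_F(y)`. -/
noncomputable def gradOp (𝒩 : (Fin d → ℕ) → E d → W d m n →L[ℂ] V n) (y : E d) :
    W d m n →L[ℂ] W d m n := ∑ α : MIdx d m, (emb α).comp (𝒩 α.1 y)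

theorem gradOp_apply (𝒩 : (Fin d → ℕ) → E d → W d m n →L[ℂ] V n) (y : E d) (F : W d m n) :
    gradOp 𝒩 y F = cgrad m (fun μ y => 𝒩 μ y F) y := by
  simp only [gradOp, sum_apply, ContinuousLinearMap.comp_apply, cgrad, pack_eq_sum]

theorem memLp_B {𝒩 : E d → W d m n} (hB : PerElliptic lam Lam B)
    (h : MemLp 𝒩 2 (volume.restrict (cell d))) :
    MemLp (fun y => B y (𝒩 y)) 2 (volume.restrict (cell d)) :=
  memLp_clm_apply hB.smeas.aestronglyMeasurable (ae_restrict_of_ae hB.bound) h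

theorem nrm2_cell_const {X : Type*} [NormedAddCommGroup X] (F : X) :
    nrm2 (volume.restrict (cell d)) (fun _ => F) = ‖F‖ := by
  rw [nrm2, eLpNorm_const _ two_ne_zero (NeZero.ne _)]
  simp

namespace Corrector

variable {𝒩 : (Fin d → ℕ) → E d → W d m n →L[ℂ] V n} {Ahat : W d m n →L[ℂ] W d m n}

theorem perSob_apply (h : Corrector B 𝒩 Ahat) (F : W d m n) : PerSob m fun μ y => 𝒩 μ y F :=
  h.perSob.clm ((ContinuousLinearMap.apply ℂ (V n) F).restrictScalars ℝ)

theorem nrm2_cgrad_le (hlam : 0 < lam) (hB : PerElliptic lam Lam B) (h : Corrector B 𝒩 Ahat)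
    (F : W d m n) : nrm2 (volume.restrict (cell d)) (cgrad m fun μ y => 𝒩 μ y F) ≤
      Lam / lam * ‖F‖ := by
  have hD := h.perSob_apply F
  have hg := hD.memLp_cgrad
  have h1 := hB.garding_cell hlam hD
  have h2 := h.cell_eq F _ hD
  simp only [map_add] at h2
  have hF : MemLp (fun _ : E d => F) 2 (volume.restrict (cell d)) := memLp_const F
  rw [integral_inner_add hg (memLp_B hB hF) (memLp_B hB hg)] at h2
  rw [eq_neg_of_add_eq_zero_right h2, Complex.neg_re] at h1
  have h3 : -(∫ y in cell d, inner ℂ (cgrad m (fun μ y => 𝒩 μ y F) y) (B y F)).re ≤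
      nrm2 (volume.restrict (cell d)) (cgrad m fun μ y => 𝒩 μ y F) * (Lam * ‖F‖) := by
    refine ((neg_le_abs _).trans (Complex.abs_re_le_norm _)).trans
      ((norm_integral_inner_le hg (memLp_B hB hF)).trans ?_)
    refine mul_le_mul_of_nonneg_left ?_ nrm2_nonneg
    rw [← nrm2_cell_const (d := d) F]
    exact nrm2_clm_apply_le hB.nonneg (ae_restrict_of_ae hB.bound) hF
  have hL := hB.nonneg
  set g := nrm2 (volume.restrict (cell d)) (cgrad m fun μ y => 𝒩 μ y F)
  have hg0 : 0 ≤ g := nrm2_nonneg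
  rcases hg0.eq_or_lt with h0 | h0
  · rw [← h0]; positivity
  · rw [div_mul_eq_mul_div, le_div_iff₀ hlam]
    refine le_of_mul_le_mul_left ?_ h0
    calc g * (g * lam) = lam * g ^ 2 := by ring
      _ ≤ _ := h1.trans h3

end Corrector

/-- The correctors and all their derivatives are bounded in `L²` of the cell, with a constant which
depends only on the ellipticity constants. -/
theorem exists_perMul_corrector (d m : ℕ) {lam Lam : ℝ} (hlam : 0 < lam) (hLam : 0 ≤ Lam) :
    ∃ K : ℝ, ∀ {n : ℕ} {B : E d → W d m n →L[ℂ] W d m n}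
      {𝒩 : (Fin d → ℕ) → E d → W d m n →L[ℂ] V n} {Ahat : W d m n →L[ℂ] W d m n},
      PerElliptic lam Lam B → Corrector B 𝒩 Ahat →
      ∀ μ : Fin d → ℕ, ∑ i, μ i ≤ m → PerMul K (𝒩 μ) := by
  obtain ⟨C, hC, h⟩ := PerSob.exists_nrm2_le d m
  set c : ℝ := ((Fintype.card (MIdx d m) : ℕ) : ℝ) with hc
  refine ⟨C * (c * (Lam / lam)), fun {n} {B} {𝒩} {Ahat} hB h𝒩 μ hμ => ⟨by positivity,
    h𝒩.perSob.meas μ hμ, h𝒩.perSob.per μ hμ, fun F => ?_⟩⟩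
  have hD := h𝒩.perSob_apply F
  rw [lintegral_eq_nrm2 (hD.memLp μ hμ), ← mul_pow]
  refine ENNReal.ofReal_le_ofReal (pow_le_pow_left₀ nrm2_nonneg ?_ 2)
  refine (h hD μ hμ).trans ?_
  rw [mul_assoc, mul_assoc]
  refine mul_le_mul_of_nonneg_left ?_ hC
  refine (Finset.sum_le_sum fun α _ => (nrm2_prj_le hD.memLp_cgrad α).trans
    (h𝒩.nrm2_cgrad_le hlam hB F)).trans_eq ?_
  simp [hc]

/-! ### The flux -/

section Flux

variable {𝒩 : (Fin d → ℕ) → E d → W d m n →L[ℂ] V n} {Ahat : W d m n →L[ℂ] W d m n}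

/-- The flux `Â - B (1 + ∇^m 𝒩)`. -/
noncomputable def flux (B : E d → W d m n →L[ℂ] W d m n)
    (𝒩 : (Fin d → ℕ) → E d → W d m n →L[ℂ] V n) (Ahat : W d m n →L[ℂ] W d m n) (y : E d) :
    W d m n →L[ℂ] W d m n :=
  Ahat - (B y).comp (ContinuousLinearMap.id ℂ _ + gradOp 𝒩 y)

theorem flux_apply (y : E d) (F : W d m n) :
    flux B 𝒩 Ahat y F = Ahat F - B y (F + cgrad m (fun μ y => 𝒩 μ y F) y) := by
  rw [← gradOp_apply]
  rfl

theorem Corrector.stronglyMeasurable_gradOp (h : Corrector B 𝒩 Ahat) :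
    StronglyMeasurable (gradOp 𝒩 : E d → W d m n →L[ℂ] W d m n) := by
  refine Finset.stronglyMeasurable_fun_sum _ fun α _ => ?_
  exact ((ContinuousLinearMap.compL ℂ (W d m n) (V n) (W d m n)
    (emb α)).continuous).comp_stronglyMeasurable (h.perSob.meas α.1 α.2.le)

theorem nrm2_integral_le {X : Type*} [NormedAddCommGroup X] [NormedSpace ℝ X] {f : E d → X}
    (hf : MemLp f 2 (volume.restrict (cell d))) :
    ‖∫ y in cell d, f y‖ ≤ nrm2 (volume.restrict (cell d)) f := by
  have h := enorm_integral_sq_le (volume.restrict (cell d)) f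
  rw [lintegral_eq_nrm2 hf, ← ofReal_norm, ← ENNReal.ofReal_pow (norm_nonneg _)] at h
  exact (sq_le_sq₀ (norm_nonneg _) nrm2_nonneg).1
    ((ENNReal.ofReal_le_ofReal_iff (sq_nonneg _)).1 h)

theorem Corrector.memLp_total (hB : PerElliptic lam Lam B) (h : Corrector B 𝒩 Ahat) (F : W d m n) :
    MemLp (fun y => B y (F + cgrad m (fun μ y => 𝒩 μ y F) y)) 2 (volume.restrict (cell d)) :=
  memLp_B hB ((memLp_const F).add (h.perSob_apply F).memLp_cgrad)

theorem Corrector.nrm2_total_le (hlam : 0 < lam) (hB : PerElliptic lam Lam B)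
    (h : Corrector B 𝒩 Ahat) (F : W d m n) :
    nrm2 (volume.restrict (cell d)) (fun y => B y (F + cgrad m (fun μ y => 𝒩 μ y F) y)) ≤
      Lam * (1 + Lam / lam) * ‖F‖ := by
  have hg := (h.perSob_apply F).memLp_cgrad
  refine (nrm2_clm_apply_le hB.nonneg (ae_restrict_of_ae hB.bound)
    ((memLp_const F).add hg)).trans ?_
  rw [mul_assoc]
  refine mul_le_mul_of_nonneg_left ((nrm2_add_le (memLp_const F) hg).trans ?_) hB.nonneg
  rw [nrm2_cell_const, add_mul, one_mul]
  linarith [h.nrm2_cgrad_le hlam hB F]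

theorem Corrector.norm_hom_le (hlam : 0 < lam) (hB : PerElliptic lam Lam B)
    (h : Corrector B 𝒩 Ahat) : ‖Ahat‖ ≤ Lam * (1 + Lam / lam) := by
  have hL := hB.nonneg
  refine ContinuousLinearMap.opNorm_le_bound _ (by positivity) fun F => ?_
  rw [h.hom_eq]
  exact (nrm2_integral_le (h.memLp_total hB F)).trans (h.nrm2_total_le hlam hB F)

theorem Corrector.perMul_flux (hlam : 0 < lam) (hB : PerElliptic lam Lam B)
    (h : Corrector B 𝒩 Ahat) : PerMul (2 * (Lam * (1 + Lam / lam))) (flux B 𝒩 Ahat) := by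
  have hL := hB.nonneg
  refine ⟨by positivity, ?_, fun i y => ?_, fun F => ?_⟩
  · refine stronglyMeasurable_const.sub ?_
    exact (ContinuousLinearMap.compL ℂ (W d m n) (W d m n)
      (W d m n)).isBoundedBilinearMap.continuous.comp_stronglyMeasurable
      (hB.smeas.prodMk (stronglyMeasurable_const.add h.stronglyMeasurable_gradOp))
  · simp only [flux, gradOp, hB.per i y]
    congr 3
    exact Finset.sum_congr rfl fun α _ => by rw [h.perSob.per α.1 α.2.le i y]
  · have h1 := h.memLp_total hB F
    simp only [flux_apply]
    have h3 : MemLp (fun y => Ahat F - B y (F + cgrad m (fun μ y => 𝒩 μ y F) y)) 2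
        (volume.restrict (cell d)) := (memLp_const _).sub h1
    rw [lintegral_eq_nrm2 h3, ← mul_pow]
    refine ENNReal.ofReal_le_ofReal (pow_le_pow_left₀ nrm2_nonneg ?_ 2)
    refine (nrm2_sub_le (memLp_const _) h1).trans ?_
    rw [nrm2_cell_const]
    have h2 := Ahat.le_of_opNorm_le (h.norm_hom_le hlam hB) F
    linarith [h.nrm2_total_le hlam hB F]

theorem Corrector.integral_flux (hB : PerElliptic lam Lam B) (h : Corrector B 𝒩 Ahat) (F : W d m n) :
    ∫ y in cell d, flux B 𝒩 Ahat y F = 0 := by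
  simp only [flux_apply]
  rw [integral_sub (integrable_const _) ((h.memLp_total hB F).integrable one_le_two),
    ← h.hom_eq]
  simp

/-- The flux is solenoidal on the torus. -/
theorem Corrector.integral_inner_flux (hB : PerElliptic lam Lam B)
    (h : Corrector B 𝒩 Ahat) (F : W d m n) {D : (Fin d → ℕ) → E d → V n} (hD : PerSob m D) :
    ∫ y in cell d, inner ℂ (cgrad m D y) (flux B 𝒩 Ahat y F) = 0 := by
  simp only [flux_apply]
  rw [integral_inner_sub hD.memLp_cgrad (memLp_const _) (h.memLp_total hB F), h.cell_eq F D hD,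
    sub_zero]
  have hi := hD.memLp_cgrad.integrable one_le_two
  have h0 : ∫ y in cell d, cgrad m D y = 0 := by
    refine Pk.ext fun α => ?_
    rw [← (prj α).integral_comp_comm hi, map_zero]
    exact hD.mean_eq_zero α.2.le
  have := integral_inner (𝕜 := ℂ) hi (Ahat F)
  rw [h0, inner_zero_right] at this
  rw [integral_inner_conj, this, map_zero]

end Flux

end Correctors

/-! ### Solutions of the cell problems -/

section CellProblems

variable {d m n : ℕ} {lam Lam : ℝ} {B : E d → W d m n →L[ℂ] W d m n}

theorem toW_column (a : CArr d m n) (p : MIdx d m × Fin n) :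
    toW (fun α j => a α p.1 j p.2) = aop a (EuclideanSpace.single p 1) := by
  ext q
  simp only [aop, LinearMap.coe_mk, AddHom.coe_mk, LinearMap.coe_toContinuousLinearMap', toW,
    CArr.mul]
  rw [← Fintype.sum_prod_type (f := fun r : MIdx d m × Fin n =>
    a q.1 r.1 q.2 r.2 * (EuclideanSpace.single p (1 : ℂ) : W d m n) r), Fintype.sum_eq_single p]
  · simp
  · intro r hr
    simp [hr]

theorem aop_apply (a : CArr d m n) (F : W d m n) (q : MIdx d m × Fin n) :
    aop a F q = ∑ p : MIdx d m × Fin n, F p * a q.1 p.1 q.2 p.2 := by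
  simp only [aop, LinearMap.coe_mk, AddHom.coe_mk, LinearMap.coe_toContinuousLinearMap', toW,
    CArr.mul, Fintype.sum_prod_type, mul_comm]

/-- The solutions of the cell problems form a corrector. -/
theorem IsCellSolution.exists_corrector {A : E d → CArr d m n}
    {N : MIdx d m → Fin n → E d → V n} (hB : PerElliptic lam Lam B)
    (hBA : B =ᵐ[volume] fun y => aop (A y)) (hN : IsCellSolution A N) :
    ∃ 𝒩 : (Fin d → ℕ) → E d → W d m n →L[ℂ] V n, Corrector B 𝒩 (aop (homCoeff A N)) ∧
      ∀ᵐ y, ∀ F : W d m n, 𝒩 0 y F = ∑ k : Fin n, ∑ γ : MIdx d m, F (γ, k) • N γ k y := by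
  choose D hD hDN using fun γ k => (hN γ k).1.exists_perSob
  let e : MIdx d m × Fin n → W d m n := fun p => EuclideanSpace.single p 1
  let T : MIdx d m × Fin n → E d → W d m n := fun p y => B y (e p + cgrad m (D p.1 p.2) y)
  have hT : ∀ p, MemLp (T p) 2 (volume.restrict (cell d)) := fun p =>
    memLp_B hB ((memLp_const (e p)).add (hD p.1 p.2).memLp_cgrad)
  have hF : ∀ F : W d m n, F = ∑ p, F p • e p := fun F => by
    ext q
    simp [e, Finset.sum_apply, Pi.single_apply]
  have hcg : ∀ (F : W d m n) (y : E d), cgrad m (fun μ y => corrOp D μ y F) y =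
      ∑ p : MIdx d m × Fin n, F p • cgrad m (D p.1 p.2) y := fun F y => by
    refine Pk.ext fun α => ?_
    rw [map_sum, cgrad, prj_pack, corrOp_apply]
    rfl
  have htot : ∀ (F : W d m n) (y : E d), B y (F + cgrad m (fun μ y => corrOp D μ y F) y) =
      ∑ p, F p • T p y := fun F y => by
    have h : F + ∑ p : MIdx d m × Fin n, F p • cgrad m (D p.1 p.2) y =
        ∑ p : MIdx d m × Fin n, F p • (e p + cgrad m (D p.1 p.2) y) := by
      simp only [smul_add, Finset.sum_add_distrib]
      rw [← hF F]
    rw [hcg, h, map_sum]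
    simp only [map_smul, T]
  have hcell : ∀ (p : MIdx d m × Fin n) (D' : (Fin d → ℕ) → E d → V n), PerSob m D' →
      ∫ y in cell d, inner ℂ (cgrad m D' y) (T p y) = 0 := by
    intro p D' hD'
    have h := (hN p.1 p.2).2 _ hD'.memW
    have hg := hD'.memLp_cgrad
    have h1 := memLp_B hB (memLp_const (μ := volume.restrict (cell d)) (p := 2) (e p))
    have h2 := memLp_B hB (hD p.1 p.2).memLp_cgrad
    have hw : wgrad m (N p.1 p.2) =ᵐ[volume] cgrad m (D p.1 p.2) := by
      filter_upwards [ae_all_iff.2 fun α : MIdx d m => hDN p.1 p.2 α.1 α.2.le] with y hy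
      exact congrArg pack (funext hy)
    have e1 : ∫ y in cell d, arrInner (grad m (D' 0) y) ((A y).mul (grad m (N p.1 p.2) y)) =
        ∫ y in cell d, inner ℂ (cgrad m D' y) (B y (cgrad m (D p.1 p.2) y)) := by
      refine integral_congr_ae (ae_restrict_of_ae ?_)
      filter_upwards [hD'.wgrad_ae_eq, hw, hBA] with y a1 a2 a3
      rw [arrInner_eq, ← aop_toW, toW_grad, toW_grad, a1, a2, a3]
    have e2 : ∫ y in cell d, arrInner (grad m (D' 0) y) (fun α j => A y α p.1 j p.2) =
        ∫ y in cell d, inner ℂ (cgrad m D' y) (B y (e p)) := by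
      refine integral_congr_ae (ae_restrict_of_ae ?_)
      filter_upwards [hD'.wgrad_ae_eq, hBA] with y a1 a3
      rw [arrInner_eq, toW_grad, toW_column, a1, a3]
    rw [e1, e2] at h
    simp only [T, map_add]
    rw [integral_inner_add hg h1 h2, h, add_neg_cancel]
  refine ⟨corrOp D, ⟨?_, fun F D' hD' => ?_, fun F => ?_⟩, ?_⟩
  · exact PerSob.sum_clm (fun p : MIdx d m × Fin n => (ContinuousLinearMap.smulRightL ℂ (W d m n)
      (V n) (EuclideanSpace.proj p)).restrictScalars ℝ) (D := fun p => D p.1 p.2)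
      fun p => hD p.1 p.2
  · simp only [htot]
    rw [integral_inner_sum (b := fun p y => F p • T p y) _ hD'.memLp_cgrad
      fun p _ => (hT p).const_smul (F p)]
    refine Finset.sum_eq_zero fun p _ => ?_
    simp only [inner_smul_right]
    rw [integral_const_mul, hcell p D' hD', mul_zero]
  · simp only [htot]
    have hi : ∀ p, Integrable (fun y => F p • T p y) (volume.restrict (cell d)) := fun p =>
      ((hT p).integrable one_le_two).smul (F p)
    rw [integral_finsetSum _ fun p _ => hi p]
    ext q
    rw [aop_apply, WithLp.ofLp_sum, Finset.sum_apply]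
    refine Finset.sum_congr rfl fun p _ => ?_
    rw [integral_smul, PiLp.smul_apply, smul_eq_mul]
    congr 1
    have h1 := (EuclideanSpace.proj q : W d m n →L[ℂ] ℂ).integral_comp_comm
      ((hT p).integrable one_le_two)
    refine Eq.trans (integral_congr_ae (ae_restrict_of_ae ?_)) h1
    filter_upwards [hBA, ae_all_iff.2 fun α : MIdx d m => hDN p.1 p.2 α.1 α.2.le] with y a1 a2
    have a3 : cgrad m (D p.1 p.2) y = toW (grad m (N p.1 p.2) y) :=
      (congrArg pack (funext a2)).symm
    simp only [T, e]
    rw [a1, a3, map_add, ← toW_column, aop_toW]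
    rfl
  · filter_upwards [ae_all_iff.2 fun γ : MIdx d m => ae_all_iff.2 fun k : Fin n =>
      (hDN γ k 0 (by simp)).symm.trans (weakDeriv_zero_ae ((hN γ k).1.2.2 0 (by simp)).choose_spec.1.1)]
      with y hy F
    rw [corrOp_apply, Fintype.sum_prod_type_right]
    simp only [hy]

end CellProblems

/-! ### Periodization -/

section Periodization

variable {d m n : ℕ} {Z : Type*} [NormedAddCommGroup Z] [NormedSpace ℝ Z]

/-- The periodization `∑_l f(y + l)` over the lattice `ℤ^d`. -/
noncomputable def periodize (f : E d → Z) (y : E d) : Z := ∑' l : lattice d, f (y + l)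

open Classical in
/-- A finite set of lattice points which contains those of norm at most `N`. -/
noncomputable def latBox (d N : ℕ) : Finset (lattice d) :=
  (Fintype.piFinset fun _ : Fin d => Finset.Icc (-(N : ℤ)) N).image fun k => ⟨zvec d k, k, rfl⟩

theorem mem_latBox {N : ℕ} {l : lattice d} (h : ‖(l : E d)‖ ≤ N) : l ∈ latBox d N := by
  obtain ⟨_, k, rfl⟩ := l
  refine Finset.mem_image.2 ⟨k, Fintype.mem_piFinset.2 fun i => ?_, rfl⟩
  have h1 : |(k i : ℝ)| ≤ N := by
    have := PiLp.norm_apply_le (zvec d k) i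
    rw [zvec_apply, Real.norm_eq_abs] at this
    exact this.trans h
  rw [Finset.mem_Icc, ← abs_le]
  exact_mod_cast h1

theorem exists_forall_notMem_latBox {f : E d → Z} (hc : HasCompactSupport f) (R : ℝ) :
    ∃ N : ℕ, ∀ y : E d, ‖y‖ ≤ R → ∀ l ∉ latBox d N, f (y + l) = 0 := by
  obtain ⟨R', hR'⟩ := hc.isCompact.isBounded.exists_norm_le
  refine ⟨⌈R' + R⌉₊, fun y hy l hl => ?_⟩
  by_contra h
  refine hl (mem_latBox (le_trans ?_ (Nat.le_ceil _)))
  have h1 := hR' _ (subset_tsupport f h)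
  calc ‖(l : E d)‖ = ‖(y + l) - y‖ := by rw [add_sub_cancel_left]
    _ ≤ ‖y + l‖ + ‖y‖ := norm_sub_le _ _
    _ ≤ _ := add_le_add h1 hy

theorem periodize_eq_sum {f : E d → Z} {y : E d} {s : Finset (lattice d)}
    (h : ∀ l ∉ s, f (y + l) = 0) : periodize f y = ∑ l ∈ s, f (y + l) := tsum_eq_sum h

theorem isPeriodic_periodize (f : E d → Z) : IsPeriodic (periodize f) := by
  intro i y
  have hz : zvec d (Pi.single i 1) = EuclideanSpace.single i 1 := by
    ext j
    by_cases h : j = i <;> simp [zvec_apply, h]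
  let l₀ : lattice d := ⟨EuclideanSpace.single i 1, Pi.single i 1, hz⟩
  refine Eq.trans ?_ ((Equiv.addLeft l₀).tsum_eq fun l : lattice d => f (y + l))
  refine tsum_congr fun l => ?_
  simp [l₀, add_assoc]

theorem continuous_periodize {f : E d → Z} (hf : Continuous f) (hc : HasCompactSupport f) :
    Continuous (periodize f) := by
  refine continuous_iff_continuousAt.2 fun y => ?_
  obtain ⟨N, hN⟩ := exists_forall_notMem_latBox hc (‖y‖ + 1)
  have h : (fun z => ∑ l ∈ latBox d N, f (z + l)) =ᶠ[nhds y] periodize f := by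
    filter_upwards [Metric.ball_mem_nhds y one_pos] with z hz
    refine (periodize_eq_sum (hN z ?_)).symm
    have := norm_sub_norm_le z y
    rw [Metric.mem_ball, dist_eq_norm] at hz
    linarith
  refine ContinuousAt.congr ?_ h
  exact (continuous_finsetSum _ fun l _ => hf.comp (continuous_id.add continuous_const)).continuousAt

theorem memLp_periodize {f : E d → Z} (hf : Continuous f) (hc : HasCompactSupport f) :
    MemLp (periodize f) 2 (volume.restrict (cell d)) := by
  have h1 := continuous_periodize hf hc
  obtain ⟨C, hC⟩ := (isCompact_closedBall (0 : E d) d).exists_bound_of_continuousOn h1.continuousOn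
  refine MemLp.of_bound h1.aestronglyMeasurable C ?_
  filter_upwards [ae_restrict_mem measurableSet_cell] with y hy
  exact hC y (by simpa using norm_le_of_mem_cell hy)

theorem hasWeakDeriv_periodize [CompleteSpace Z] {f : E d → Z} (hf : Smooth f) (hc : HasCompactSupport f)
    (μ : Fin d → ℕ) : HasWeakDeriv μ (periodize f) (periodize (multiDeriv μ f)) := by
  have hc' := hasCompactSupport_multiDeriv hf hc μ
  refine ⟨(continuous_periodize hf.continuous hc).locallyIntegrable,
    (continuous_periodize (hf.multiDeriv μ).continuous hc').locallyIntegrable,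
    fun φ (hφ : Smooth φ) hφc => ?_⟩
  have hφc' := hasCompactSupport_multiDeriv hφ hφc μ
  obtain ⟨R, hR⟩ := hφc.isCompact.isBounded.exists_norm_le
  obtain ⟨R', hR'⟩ := hφc'.isCompact.isBounded.exists_norm_le
  obtain ⟨N, hN⟩ := exists_forall_notMem_latBox hc R'
  obtain ⟨N', hN'⟩ := exists_forall_notMem_latBox hc' R
  classical
  let s := latBox d N ∪ latBox d N'
  have h : HasWeakDeriv μ (fun y => ∑ l ∈ s, f (y + l)) fun y => ∑ l ∈ s, multiDeriv μ f (y + l) :=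
    HasWeakDeriv.fun_sum _ fun l _ => by
      simpa only [sub_neg_eq_add] using (HasWeakDeriv.of_smooth hf μ).comp_sub (-(l : E d))
  have e1 : ∀ y, multiDeriv μ φ y • periodize f y =
      multiDeriv μ φ y • ∑ l ∈ s, f (y + l) := by
    intro y
    by_cases hy : multiDeriv μ φ y = 0
    · simp [hy]
    · rw [periodize_eq_sum fun l hl => hN y (hR' y (subset_tsupport _ hy)) l
        fun h => hl (Finset.mem_union_left _ h)]
  have e2 : ∀ y, φ y • periodize (multiDeriv μ f) y =
      φ y • ∑ l ∈ s, multiDeriv μ f (y + l) := by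
    intro y
    by_cases hy : φ y = 0
    · simp [hy]
    · rw [periodize_eq_sum fun l hl => hN' y (hR y (subset_tsupport _ hy)) l
        fun h => hl (Finset.mem_union_right _ h)]
  simp only [e1, e2]
  exact h.2.2 φ hφ hφc

theorem multiDeriv_const (c : Z) (μ : Fin d → ℕ) :
    multiDeriv μ (fun _ : E d => c) = fun _ => if μ = 0 then c else 0 := by
  induction μ using multiIdx_induction with
  | h0 => simp [multiDeriv_zero]
  | hs μ i ih =>
    have hne : μ + unitIdx i ≠ 0 := fun h => by
      have := congrFun h i
      simp at this
    rw [multiDeriv_add_unitIdx contDiff_const, ih, if_neg hne]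
    funext x
    simp [pderiv]

/-- The periodization of a test function, made orthogonal to the constants. -/
theorem perSob_periodize [CompleteSpace Z] {f : E d → Z} (hf : Smooth f)
    (hc : HasCompactSupport f) :
    PerSob m fun μ y => periodize (multiDeriv μ f) y -
      if μ = 0 then ∫ z in cell d, periodize f z else 0 := by
  have h1 := fun μ => continuous_periodize (hf.multiDeriv μ).continuous
    (hasCompactSupport_multiDeriv hf hc μ)
  have h2 := fun μ => memLp_periodize (hf.multiDeriv μ).continuous
    (hasCompactSupport_multiDeriv hf hc μ)
  refine ⟨fun μ _ => (h1 μ).stronglyMeasurable.sub stronglyMeasurable_const,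
    fun μ _ i y => by simp only [isPeriodic_periodize _ i y],
    fun μ _ => (h2 μ).sub (memLp_const _), fun μ _ => ?_, ?_⟩
  · have h := (hasWeakDeriv_periodize hf hc μ).fun_sub
      (HasWeakDeriv.of_smooth (contDiff_const (c := ∫ z in cell d, periodize f z)) μ)
    rw [multiDeriv_const] at h
    simpa only [multiDeriv_zero, if_pos] using h
  · have hi := (h2 0).integrable one_le_two
    simp only [multiDeriv_zero, if_pos] at hi ⊢
    rw [integral_sub hi (integrable_const _)]
    simp

theorem inner_vadd_lattice {X : Type*} [NormedAddCommGroup X] [InnerProductSpace ℂ X]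
    (g : E d → X) {H : E d → X} (hp : IsPeriodic H) (l : lattice d) (x : E d) :
    inner ℂ (g (l +ᵥ x)) (H (l +ᵥ x)) = inner ℂ (g (x + l)) (H x) := by
  rw [AddSubgroup.vadd_def, vadd_eq_add, add_comm, hp.add_lattice]

theorem memLp_comp_add_lattice {X : Type*} [NormedAddCommGroup X] {g : E d → X}
    (hg : Continuous g) (hc : HasCompactSupport g) (l : lattice d) :
    MemLp (fun y => g (y + l)) 2 (volume.restrict (cell d)) :=
  ((hg.comp (continuous_id.add continuous_const)).memLp_of_hasCompactSupport
    (hc.comp_homeomorph (Homeomorph.addRight (l : E d)))).restrict _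

theorem integrable_inner_periodic {X : Type*} [NormedAddCommGroup X] [InnerProductSpace ℂ X]
    {g H : E d → X} (hg : Continuous g) (hc : HasCompactSupport g) (hm : StronglyMeasurable H)
    (hp : IsPeriodic H) (hH : MemLp H 2 (volume.restrict (cell d))) :
    Integrable (fun x => inner ℂ (g x) (H x)) := by
  obtain ⟨N, hN⟩ := exists_forall_notMem_latBox (Z := X) hc d
  refine ⟨hg.aestronglyMeasurable.inner hm.aestronglyMeasurable, ?_⟩
  rw [HasFiniteIntegral, isAddFundamentalDomain_cell.lintegral_eq_tsum'',
    tsum_eq_sum (s := latBox d N)]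
  · refine ENNReal.sum_lt_top.2 fun l _ => ?_
    simp only [inner_vadd_lattice g hp]
    exact (integrable_inner (memLp_comp_add_lattice hg hc l) hH).2
  · intro l hl
    refine setLIntegral_eq_zero measurableSet_cell fun x hx => ?_
    simp only [inner_vadd_lattice g hp]
    rw [hN x (norm_le_of_mem_cell hx) l hl]
    simp

/-- Unfolding of integrals against periodic functions. -/
theorem integral_inner_periodize {X : Type*} [NormedAddCommGroup X] [InnerProductSpace ℂ X]
    {g H : E d → X} (hg : Continuous g) (hc : HasCompactSupport g) (hm : StronglyMeasurable H)
    (hp : IsPeriodic H) (hH : MemLp H 2 (volume.restrict (cell d))) :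
    ∫ x, inner ℂ (g x) (H x) = ∫ y in cell d, inner ℂ (periodize g y) (H y) := by
  obtain ⟨N, hN⟩ := exists_forall_notMem_latBox (Z := X) hc d
  rw [isAddFundamentalDomain_cell.integral_eq_tsum'' _ (integrable_inner_periodic hg hc hm hp hH),
    tsum_eq_sum (s := latBox d N)]
  · simp only [inner_vadd_lattice g hp]
    rw [← integral_finsetSum _ fun l _ => integrable_inner (memLp_comp_add_lattice hg hc l) hH]
    refine setIntegral_congr_fun measurableSet_cell fun y hy => ?_
    rw [periodize_eq_sum (hN y (norm_le_of_mem_cell hy)), sum_inner]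
  · intro l hl
    refine setIntegral_eq_zero_of_forall_eq_zero fun x hx => ?_
    rw [inner_vadd_lattice g hp, hN x (norm_le_of_mem_cell hx) l hl, inner_zero_left]

theorem map_periodize {Z' : Type*} [NormedAddCommGroup Z'] [NormedSpace ℝ Z'] (L : Z →L[ℝ] Z')
    {f : E d → Z} (hc : HasCompactSupport f) (y : E d) :
    L (periodize f y) = periodize (fun x => L (f x)) y := by
  obtain ⟨N, hN⟩ := exists_forall_notMem_latBox hc ‖y‖
  rw [periodize_eq_sum (hN y le_rfl), periodize_eq_sum (s := latBox d N), map_sum]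
  intro l hl
  rw [hN y le_rfl l hl, map_zero]

end Periodization

/-! ### Pairing of gradients with oscillating fluxes -/

section FluxPairing

variable {d m n : ℕ} {lam Lam : ℝ} {B : E d → W d m n →L[ℂ] W d m n}
  {𝒩 : (Fin d → ℕ) → E d → W d m n →L[ℂ] V n} {Ahat : W d m n →L[ℂ] W d m n}

/-- The array of classical derivatives of order `m`. -/
noncomputable def sgrad (m : ℕ) (φ : E d → V n) (x : E d) : W d m n :=
  pack fun α => multiDeriv α.1 φ x

theorem wgrad_ae_eq_sgrad {φ : E d → V n} (hφ : Smooth φ) :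
    wgrad m φ =ᵐ[volume] sgrad m φ :=
  wgrad_ae_eq (D := fun α => multiDeriv α.1 φ) fun α => HasWeakDeriv.of_smooth hφ α.1

theorem continuous_pack {ι X : Type*} [Fintype ι] [DecidableEq ι] [TopologicalSpace X]
    {u : ι → X → V n} (h : ∀ i, Continuous (u i)) : Continuous fun x => pack fun i => u i x := by
  simp only [pack_eq_sum]
  exact continuous_finsetSum _ fun i _ => (emb i).continuous.comp (h i)

theorem continuous_sgrad {φ : E d → V n} (hφ : Smooth φ) : Continuous (sgrad m φ) :=
  continuous_pack fun α => (hφ.multiDeriv α.1).continuous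

theorem hasCompactSupport_sgrad {φ : E d → V n} (hφ : Smooth φ) (hc : HasCompactSupport φ) :
    HasCompactSupport (sgrad m φ) := by
  have e : sgrad m φ = fun x => ∑ α, emb α (multiDeriv (F := V n) α.1 φ x) :=
    funext fun x => pack_eq_sum _
  rw [e]
  have h : ∀ s : Finset (MIdx d m), HasCompactSupport fun x =>
      ∑ α ∈ s, (emb α (multiDeriv α.1 φ x) : W d m n) := by
    intro s
    induction s using Finset.induction_on with
    | empty =>
      simp only [Finset.sum_empty]
      exact HasCompactSupport.zero
    | insert α s hα ih =>
      simp only [Finset.sum_insert hα]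
      exact ((hasCompactSupport_multiDeriv hφ hc α.1).comp_left (map_zero (emb α))).add ih
  exact h _

theorem PerMul.memLp_apply {X Z : Type*} [NormedAddCommGroup X] [NormedSpace ℂ X]
    [NormedAddCommGroup Z] [InnerProductSpace ℂ Z] {K : ℝ} {G : E d → X →L[ℂ] Z} (hG : PerMul K G)
    (c : X) : StronglyMeasurable (fun y => G y c) ∧ IsPeriodic (fun y => G y c) ∧
      MemLp (fun y => G y c) 2 (volume.restrict (cell d)) := by
  have hm : StronglyMeasurable fun y => G y c :=
    (ContinuousLinearMap.apply ℂ Z c).continuous.comp_stronglyMeasurable hG.meas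
  refine ⟨hm, hG.per.comp_left fun L => L c, hm.aestronglyMeasurable, ?_⟩
  refine (ENNReal.pow_lt_top_iff.1 ?_).resolve_right two_ne_zero
  rw [eLpNorm_two_sq]
  exact (hG.bound c).trans_lt ENNReal.ofReal_lt_top

/-- Solenoidal oscillating fields: `∫ ⟨∇^m Φ, G(x/ε) F⟩ = 0` for all test functions. -/
def Solenoidal (G : E d → W d m n →L[ℂ] W d m n) : Prop :=
  ∀ Φ : E d → V n, Smooth Φ → HasCompactSupport Φ → ∀ F : W d m n,
    Integrable (fun x => inner ℂ (sgrad m Φ x) (G x F)) ∧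
      ∫ x, inner ℂ (sgrad m Φ x) (G x F) = 0

/-- A test function on the whole space, periodized and stripped of its mean, is admissible in the cell
problem; since `m > 0`, the mean does not affect `∇^m`. -/
theorem Corrector.solenoidal_flux (hm : 0 < m) (hlam : 0 < lam) (hB : PerElliptic lam Lam B)
    (h : Corrector B 𝒩 Ahat) : Solenoidal (flux B 𝒩 Ahat) := by
  intro Φ hΦ hc F
  obtain ⟨h1, h2, h3⟩ := (h.perMul_flux hlam hB).memLp_apply F
  have hgc := continuous_sgrad (m := m) hΦ
  have hgs := hasCompactSupport_sgrad (m := m) hΦ hc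
  refine ⟨integrable_inner_periodic hgc hgs h1 h2 h3, ?_⟩
  rw [integral_inner_periodize hgc hgs h1 h2 h3, ← h.integral_inner_flux hB F
    (perSob_periodize (m := m) hΦ hc)]
  refine integral_congr_ae (Filter.Eventually.of_forall fun y => ?_)
  have e : periodize (sgrad m Φ) y = cgrad m (fun μ y => periodize (multiDeriv μ Φ) y -
      if μ = 0 then ∫ z in cell d, periodize Φ z else 0) y := by
    refine Pk.ext fun α => ?_
    have hα : α.1 ≠ 0 := fun h0 => by
      have := α.2
      rw [h0] at this
      simp at this
      omega
    rw [cgrad, prj_pack, if_neg hα, sub_zero]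
    exact map_periodize ((prj α).restrictScalars ℝ) hgs y
  simp only [e]

theorem Solenoidal.rescale {G : E d → W d m n →L[ℂ] W d m n} (hG : Solenoidal G) {ε : ℝ}
    (hε : 0 < ε) : Solenoidal fun x => G (ε⁻¹ • x) := by
  intro Φ hΦ hc F
  have hsm : Smooth fun y => Φ (ε • y) := hΦ.comp (contDiff_const_smul ε)
  have hcs : HasCompactSupport fun y => Φ (ε • y) :=
    hc.comp_homeomorph (Homeomorph.smulOfNeZero ε hε.ne')
  obtain ⟨h1, h2⟩ := hG _ hsm hcs F
  have e : ∀ y, inner ℂ (sgrad m (fun y => Φ (ε • y)) y) (G y F) =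
      ((ε ^ m : ℝ) : ℂ) * inner ℂ (sgrad m Φ (ε • y)) (G (ε⁻¹ • ε • y) F) := by
    intro y
    have : sgrad m (fun y => Φ (ε • y)) y = ((ε ^ m : ℝ) : ℂ) • sgrad m Φ (ε • y) := by
      refine Pk.ext fun α => ?_
      have h := congrFun (multiDeriv_comp_affine hΦ ε 0 α.1) y
      simp only [add_zero, α.2] at h
      rw [map_smul, sgrad, prj_pack, h, sgrad, prj_pack, Complex.coe_smul]
    rw [this, inner_smul_left, Complex.conj_ofReal, smul_smul, inv_mul_cancel₀ hε.ne', one_smul]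
  have hne : ((ε ^ m : ℝ) : ℂ) ≠ 0 := Complex.ofReal_ne_zero.2 (pow_ne_zero _ hε.ne')
  simp only [e] at h1 h2
  constructor
  · exact (integrable_comp_smul_iff volume
      (fun x : E d => inner ℂ (sgrad m Φ x) (G (ε⁻¹ • x) F)) hε.ne').1
      ((integrable_const_mul_iff hne.isUnit _).1 h1)
  · rw [integral_const_mul, Measure.integral_comp_smul volume
      (fun x : E d => inner ℂ (sgrad m Φ x) (G (ε⁻¹ • x) F))] at h2
    have h3 := (mul_eq_zero.1 h2).resolve_left hne
    refine (smul_eq_zero.1 h3).resolve_left ?_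
    positivity

theorem smooth_avg {F : Type*} [NormedAddCommGroup F] [NormedSpace ℝ F] (ν : Measure (E d))
    [IsFiniteMeasure ν] {φ : E d → F} (hφ : Smooth φ) (hc : HasCompactSupport φ) :
    Smooth (avg ν φ) := by
  have h := hc.contDiff_convolution_right (ContinuousLinearMap.lsmul ℝ ℝ) (μ := ν)
    (f := fun _ => (1 : ℝ)) (integrable_const (1 : ℝ)).locallyIntegrable hφ
  have e : avg ν φ = convolution (fun _ => (1 : ℝ)) φ (ContinuousLinearMap.lsmul ℝ ℝ) ν :=
    funext fun x => by simp [avg, convolution]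
  rw [e]
  exact h

theorem multiDeriv_steklov {F : Type*} [NormedAddCommGroup F] [NormedSpace ℝ F] [CompleteSpace F]
    {ε : ℝ} (hε : ε ≠ 0) {φ : E d → F} (hφ : Smooth φ) (hc : HasCompactSupport φ)
    (γ : Fin d → ℕ) :
    multiDeriv γ (steklov ε φ) =ᵐ[volume] steklov ε (multiDeriv γ φ) := by
  have hs : Smooth (steklov ε φ) := by
    rw [steklov_eq_avg hε]
    exact smooth_avg _ hφ hc
  exact (HasWeakDeriv.of_smooth hs γ).unique ((HasWeakDeriv.of_smooth hφ γ).steklov hε)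

variable {K : ℝ} {G : E d → W d m n →L[ℂ] W d m n} {ε : ℝ}

end FluxPairing

/-! ### The Leibniz formula for solenoidal fields -/

section FluxPairing

variable {d m n : ℕ} {K : ℝ} {G : E d → W d m n →L[ℂ] W d m n} {ε : ℝ}

/-- The complex conjugate of a coordinate, as a real-linear map. -/
noncomputable def conjCoord (p : MIdx d m × Fin n) : W d m n →L[ℝ] ℂ :=
  (Complex.conjCLE : ℂ →L[ℝ] ℂ).comp ((EuclideanSpace.proj p : W d m n →L[ℂ] ℂ).restrictScalars ℝ)

theorem conjCoord_apply (p : MIdx d m × Fin n) (F : W d m n) :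
    conjCoord p F = (starRingEnd ℂ) (F p) := rfl

theorem multiDeriv_conjCoord_smul (p : MIdx d m × Fin n) {s : E d → W d m n} (hs : Smooth s)
    {φ : E d → V n} (hφ : Smooth φ) (γ : Fin d → ℕ) :
    multiDeriv γ (fun x => conjCoord p (s x) • φ x) =ᵐ[volume] fun x =>
      ∑ μ ∈ Finset.Iic γ, binom γ μ •
        (conjCoord p (multiDeriv (γ - μ) s x) • multiDeriv μ φ x) := by
  have hσ : Smooth fun x => conjCoord p (s x) := (conjCoord p).contDiff.comp hs
  have h := HasWeakDeriv.bilin (ContinuousLinearMap.lsmul ℝ ℂ).flip hσ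
    (N := fun μ => multiDeriv μ φ) γ fun μ _ => by
      simpa only [multiDeriv_zero] using HasWeakDeriv.of_smooth hφ μ
  simp only [multiDeriv_zero, ContinuousLinearMap.flip_apply, ContinuousLinearMap.lsmul_apply,
    multiDeriv_clm_comp (conjCoord p) hs] at h
  exact (HasWeakDeriv.of_smooth (hσ.smul hφ) γ).unique h

theorem eq_sum_coord (F : W d m n) :
    F = ∑ p, F p • (EuclideanSpace.single p 1 : W d m n) := by
  ext q
  simp [Pi.single_apply]

theorem inner_emb_left {ι : Type*} [Fintype ι] [DecidableEq ι] (i : ι) (v : V n) (F : Pk ι n) :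
    inner ℂ (emb i v) F = inner ℂ v (prj i F) := by
  rw [← inner_conj_symm, inner_emb, inner_conj_symm]

/-- The Leibniz formula for `⟨∇^m (conj (s_p) φ), L e_p⟩`, summed over the coordinates `p`. -/
theorem sum_inner_sgrad {s : E d → W d m n} (hs : Smooth s) {φ : E d → V n} (hφ : Smooth φ)
    (L : E d → W d m n →L[ℂ] W d m n) :
    ∀ᵐ x, ∑ p, inner ℂ (sgrad m (fun x => conjCoord p (s x) • φ x) x)
        (L x (EuclideanSpace.single p 1)) =
      ∑ α : MIdx d m, ∑ μ ∈ Finset.Iic α.1, (binom α.1 μ : ℂ) *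
        inner ℂ (emb α (multiDeriv μ φ x)) (L x (multiDeriv (α.1 - μ) s x)) := by
  filter_upwards [ae_all_iff.2 fun p => ae_all_iff.2 fun α : MIdx d m =>
    multiDeriv_conjCoord_smul p hs hφ α.1] with x hx
  have e1 : ∀ p, inner ℂ (sgrad m (fun x => conjCoord p (s x) • φ x) x)
      (L x (EuclideanSpace.single p 1)) = ∑ α : MIdx d m, ∑ μ ∈ Finset.Iic α.1,
        (binom α.1 μ : ℂ) * (multiDeriv (α.1 - μ) s x p *
          inner ℂ (multiDeriv μ φ x) (prj α (L x (EuclideanSpace.single p 1)))) := by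
    intro p
    rw [inner_Pk]
    refine Finset.sum_congr rfl fun α _ => ?_
    rw [sgrad, prj_pack, hx p α, sum_inner]
    refine Finset.sum_congr rfl fun μ _ => ?_
    rw [conjCoord_apply, ← Complex.coe_smul, inner_smul_left, inner_smul_left,
      Complex.conj_ofReal, Complex.conj_conj]
  rw [Finset.sum_congr rfl fun p _ => e1 p, Finset.sum_comm]
  refine Finset.sum_congr rfl fun α _ => ?_
  rw [Finset.sum_comm]
  refine Finset.sum_congr rfl fun μ _ => ?_
  rw [← Finset.mul_sum, inner_emb_left]
  congr 1
  conv_rhs => rw [eq_sum_coord (multiDeriv (α.1 - μ) s x)]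
  simp only [map_sum, map_smul, inner_sum, inner_smul_right]

/-- Integration by parts against a solenoidal field: the sum over all terms of the Leibniz formula
vanishes. -/
theorem Solenoidal.sum_eq_zero (hG : PerMul K G) (hε : 0 < ε)
    (hsol : Solenoidal fun x => G (ε⁻¹ • x)) {φ : E d → V n} (hφ : Smooth φ)
    (hc : HasCompactSupport φ) {ψ : E d → W d m n} (hψ : Smooth ψ) (hψc : HasCompactSupport ψ) :
    ∑ α : MIdx d m, ∑ μ ∈ Finset.Iic α.1, (binom α.1 μ : ℂ) *
      ∫ x, inner ℂ (emb α (multiDeriv μ φ x)) (pmul G ε (multiDeriv (α.1 - μ) ψ) x) = 0 := by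
  have hs : Smooth (steklov ε ψ) := by
    rw [steklov_eq_avg hε.ne']
    exact smooth_avg _ hψ hψc
  have hΦ : ∀ p, Smooth fun x => conjCoord p (steklov ε ψ x) • φ x := fun p =>
    ((conjCoord p).contDiff.comp hs).smul hφ
  have hΦc : ∀ p, HasCompactSupport fun x => conjCoord p (steklov ε ψ x) • φ x := fun p =>
    hc.mono fun x hx => right_ne_zero_of_smul hx
  have hst : ∀ α : MIdx d m, ∀ᵐ x, ∀ μ ∈ Finset.Iic α.1,
      multiDeriv (α.1 - μ) (steklov ε ψ) x = steklov ε (multiDeriv (α.1 - μ) ψ) x := fun α =>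
    (Filter.eventually_all_finset _).2 fun μ _ => multiDeriv_steklov hε.ne' hψ hψc _
  have hL2 : ∀ (α : MIdx d m) (μ : Fin d → ℕ), Integrable fun x => (binom α.1 μ : ℂ) *
      inner ℂ (emb α (multiDeriv μ φ x)) (pmul G ε (multiDeriv (α.1 - μ) ψ) x) := fun α μ =>
    (integrable_inner ((emb α).comp_memLp'
      ((hφ.multiDeriv μ).memLp (hasCompactSupport_multiDeriv hφ hc μ)))
      (memLp_pmul hG hε.ne' ((hψ.multiDeriv _).memLp
        (hasCompactSupport_multiDeriv hψ hψc _))).1).const_mul _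
  have hzero : ∑ p, ∫ x, inner ℂ (sgrad m (fun x => conjCoord p (steklov ε ψ x) • φ x) x)
      (G (ε⁻¹ • x) (EuclideanSpace.single p 1)) = 0 :=
    Finset.sum_eq_zero fun p _ => (hsol _ (hΦ p) (hΦc p) _).2
  rw [← integral_finsetSum _ fun p _ => (hsol _ (hΦ p) (hΦc p) _).1] at hzero
  rw [← hzero]
  have e : ∀ α : MIdx d m, ∑ μ ∈ Finset.Iic α.1, (binom α.1 μ : ℂ) *
      ∫ x, inner ℂ (emb α (multiDeriv μ φ x)) (pmul G ε (multiDeriv (α.1 - μ) ψ) x) =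
      ∫ x, ∑ μ ∈ Finset.Iic α.1, (binom α.1 μ : ℂ) *
      inner ℂ (emb α (multiDeriv μ φ x)) (pmul G ε (multiDeriv (α.1 - μ) ψ) x) := fun α => by
    rw [integral_finsetSum _ fun μ _ => hL2 α μ]
    exact Finset.sum_congr rfl fun μ _ => (integral_const_mul _ _).symm
  rw [Finset.sum_congr rfl fun α _ => e α,
    ← integral_finsetSum _ fun α _ => integrable_finsetSum _ fun μ _ => hL2 α μ]
  refine integral_congr_ae ?_
  filter_upwards [sum_inner_sgrad hs hφ fun x => G (ε⁻¹ • x), ae_all_iff.2 hst] with x hx hx'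
  rw [hx]
  refine Finset.sum_congr rfl fun α _ => Finset.sum_congr rfl fun μ hμ => ?_
  rw [hx' α μ hμ, pmul]

end FluxPairing

/-! ### Oscillating solenoidal fields are small in the weak sense -/

section FluxEstimate

variable {d m n : ℕ} {K : ℝ} {G : E d → W d m n →L[ℂ] W d m n} {ε : ℝ}

theorem Smooth.nrm2_multiDeriv_le_sobNorm {F : Type*} [NormedAddCommGroup F] [NormedSpace ℝ F]
    [CompleteSpace F] {φ : E d → F} (hφ : Smooth φ) {γ : Fin d → ℕ} (h : ∑ i, γ i ≤ m) :
    nrm2 volume (HighOrderHomogenization.multiDeriv γ φ) ≤ sobNorm m φ := by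
  rw [← nrm2_congr (weakDeriv_smooth hφ)]
  exact nrm2_weakDeriv_le_sobNorm φ h

/-- The terms of the Leibniz formula with less than `m` derivatives on `φ` are `O(ε)`: one more
derivative of `φ` is still controlled by the norm of `H^m`. -/
theorem norm_integral_inner_emb_pmul_le (hG : PerMul K G) (hmean : ∀ c, ∫ y in cell d, G y c = 0)
    (hε : 0 < ε) {φ : E d → V n} (hφ : Smooth φ) (hc : HasCompactSupport φ) {ψ : E d → W d m n}
    (hψ : Smooth ψ) (hψc : HasCompactSupport ψ) (α : MIdx d m) {μ : Fin d → ℕ}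
    (hμ : μ ∈ (Finset.Iic α.1).erase α.1) :
    ‖∫ x, inner ℂ (emb α (multiDeriv μ φ x)) (pmul G ε (multiDeriv (α.1 - μ) ψ) x)‖ ≤
      d * d * (K * ε * sobNorm m φ * sobNorm m ψ) := by
  have hlt := sum_lt_of_mem_erase hμ
  rw [α.2] at hlt
  have hle : μ ≤ α.1 := Finset.mem_Iic.1 (Finset.mem_of_mem_erase hμ)
  have hψm := (hψ.multiDeriv (α.1 - μ)).memLp (hasCompactSupport_multiDeriv hψ hψc _)
  have hd : ∀ i, HasWeakDeriv (unitIdx i) (multiDeriv μ φ) (multiDeriv (μ + unitIdx i) φ) :=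
    fun i => (HasWeakDeriv.of_smooth hφ μ).of_add (HasWeakDeriv.of_smooth hφ (μ + unitIdx i))
  have hm : ∀ ν, MemLp (multiDeriv ν φ) 2 volume := fun ν =>
    (hφ.multiDeriv ν).memLp (hasCompactSupport_multiDeriv hφ hc ν)
  have h := norm_integral_inner_pmul_le hG hε hmean
    (fun i => (hd i).clm_comp ((emb α : V n →L[ℂ] W d m n).restrictScalars ℝ))
    ((emb α : V n →L[ℂ] W d m n).comp_memLp' (hm μ))
    (fun i => (emb α : V n →L[ℂ] W d m n).comp_memLp' (hm _)) hψm
  refine h.trans ?_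
  have h1 : ∑ i, nrm2 volume (fun x => ((emb α : V n →L[ℂ] W d m n).restrictScalars ℝ)
      (multiDeriv (μ + unitIdx i) φ x)) ≤ d * sobNorm m φ := by
    refine (Finset.sum_le_card_nsmul _ _ (sobNorm m φ) fun i _ => ?_).trans_eq (by simp)
    refine (nrm2_emb α _).trans_le (hφ.nrm2_multiDeriv_le_sobNorm ?_)
    rw [sum_add_idx, sum_unitIdx]
    omega
  have h2 : nrm2 volume (multiDeriv (α.1 - μ) ψ) ≤ sobNorm m ψ := by
    refine hψ.nrm2_multiDeriv_le_sobNorm ?_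
    have := sum_sub_idx hle
    rw [α.2] at this
    omega
  have hK := hG.nonneg
  have hn := sobNorm_nonneg m φ
  have hd0 : (0 : ℝ) ≤ d := Nat.cast_nonneg d
  have hεd : 0 ≤ ε * d := mul_nonneg hε.le hd0
  refine (mul_le_mul (mul_le_mul_of_nonneg_left h1 hεd) (mul_le_mul_of_nonneg_left h2 hK)
    (mul_nonneg hK nrm2_nonneg) (mul_nonneg hεd (mul_nonneg hd0 hn))).trans_eq ?_
  ring

/-- The leading term of the Leibniz formula is minus the sum of the lower ones. -/
theorem Solenoidal.norm_integral_sgrad_le (hG : PerMul K G)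
    (hmean : ∀ c, ∫ y in cell d, G y c = 0) (hε : 0 < ε)
    (hsol : Solenoidal fun x => G (ε⁻¹ • x)) {φ : E d → V n} (hφ : Smooth φ)
    (hc : HasCompactSupport φ) {ψ : E d → W d m n} (hψ : Smooth ψ) (hψc : HasCompactSupport ψ) :
    ‖∫ x, inner ℂ (sgrad m φ x) (pmul G ε ψ x)‖ ≤
      (∑ α : MIdx d m, ∑ μ ∈ (Finset.Iic α.1).erase α.1, binom α.1 μ * (d * d)) *
        (K * ε * sobNorm m φ * sobNorm m ψ) := by
  have h0 := hsol.sum_eq_zero hG hε hφ hc hψ hψc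
  have hmem : ∀ α : MIdx d m, α.1 ∈ Finset.Iic α.1 := fun α => Finset.mem_Iic.2 le_rfl
  have e : ∫ x, inner ℂ (sgrad m φ x) (pmul G ε ψ x) =
      ∑ α : MIdx d m, ∫ x, inner ℂ (emb α (multiDeriv α.1 φ x)) (pmul G ε ψ x) := by
    rw [← integral_finsetSum]
    · refine integral_congr_ae (Filter.Eventually.of_forall fun x => ?_)
      simp only [inner_emb_left]
      rw [inner_Pk]
      rfl
    · exact fun α _ => integrable_inner ((emb α : V n →L[ℂ] W d m n).comp_memLp'
        ((hφ.multiDeriv α.1).memLp (hasCompactSupport_multiDeriv hφ hc α.1)))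
        (memLp_pmul hG hε.ne' (hψ.memLp hψc)).1
  have e' : ∫ x, inner ℂ (sgrad m φ x) (pmul G ε ψ x) =
      -∑ α : MIdx d m, ∑ μ ∈ (Finset.Iic α.1).erase α.1, (binom α.1 μ : ℂ) *
        ∫ x, inner ℂ (emb α (multiDeriv μ φ x)) (pmul G ε (multiDeriv (α.1 - μ) ψ) x) := by
    rw [e, eq_neg_iff_add_eq_zero, ← Finset.sum_add_distrib, ← h0]
    refine Finset.sum_congr rfl fun α _ => ?_
    rw [← Finset.add_sum_erase _ _ (hmem α), binom_self, tsub_self, multiDeriv_zero,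
      Complex.ofReal_one, one_mul]
  rw [e', norm_neg, Finset.sum_mul]
  refine (norm_sum_le _ _).trans (Finset.sum_le_sum fun α _ => ?_)
  rw [Finset.sum_mul]
  refine (norm_sum_le _ _).trans (Finset.sum_le_sum fun μ hμ => ?_)
  rw [norm_mul, Complex.norm_real, Real.norm_of_nonneg (binom_nonneg _ _), mul_assoc]
  exact mul_le_mul_of_nonneg_left
    (norm_integral_inner_emb_pmul_le hG hmean hε hφ hc hψ hψc α hμ) (binom_nonneg _ _)

theorem tendsto_sobNorm {F : Type*} [NormedAddCommGroup F] [NormedSpace ℝ F]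
    {φ : ℕ → E d → F} {u : E d → F} (h : ∀ γ : Fin d → ℕ, ∑ i, γ i ≤ m →
      L2Tendsto volume (fun j => weakDeriv γ (φ j)) (weakDeriv γ u)) :
    Filter.Tendsto (fun j => sobNorm m (φ j)) Filter.atTop (nhds (sobNorm m u)) :=
  tendsto_finsetSum _ fun γ hγ => (h γ (mem_idxLE.1 hγ)).nrm2_tendsto

theorem MemH.exists_sobolev_approx {F : Type*} [NormedAddCommGroup F] [NormedSpace ℝ F]
    [CompleteSpace F] {u : E d → F} (hu : MemH m u) :
    ∃ φ : ℕ → E d → F, (∀ j, Smooth (φ j) ∧ HasCompactSupport (φ j)) ∧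
      ∀ γ : Fin d → ℕ, ∑ i, γ i ≤ m → L2Tendsto volume
        (fun j => HighOrderHomogenization.weakDeriv γ (φ j))
        (HighOrderHomogenization.weakDeriv γ u) := by
  obtain ⟨φ, h1, h2⟩ := hu.exists_test_approx
  exact ⟨φ, h1, fun γ hγ =>
    (h2 γ hγ).congr (fun j => (weakDeriv_smooth (h1 j).1).symm) (ae_eq_refl _)⟩

theorem L2Tendsto.of_weakDeriv_zero {F : Type*} [NormedAddCommGroup F] [NormedSpace ℝ F]
    [CompleteSpace F] {φ : ℕ → E d → F} {u : E d → F} (hφ : ∀ j, LocallyIntegrable (φ j))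
    (hu : LocallyIntegrable u)
    (h : L2Tendsto volume (fun j => weakDeriv 0 (φ j)) (weakDeriv 0 u)) :
    L2Tendsto volume φ u :=
  h.congr (fun j => weakDeriv_zero_ae (hφ j)) (weakDeriv_zero_ae hu)

/-- The weak form of `‖div^m (G(x/ε) S^ε ψ)‖_{H^{-m}} = O(ε)` for a solenoidal periodic field `G`
of zero mean. -/
theorem exists_norm_integral_wgrad_pmul_le (d m : ℕ) : ∃ C : ℝ, 0 ≤ C ∧
    ∀ {n : ℕ} {K : ℝ} {G : E d → W d m n →L[ℂ] W d m n}, PerMul K G →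
      (∀ c, ∫ y in cell d, G y c = 0) → Solenoidal G → ∀ {ε : ℝ}, 0 < ε →
      ∀ {φ : E d → V n} {ψ : E d → W d m n}, MemH m φ → MemH m ψ →
        ‖∫ x, inner ℂ (wgrad m φ x) (pmul G ε ψ x)‖ ≤
          C * (K * ε * sobNorm m φ * sobNorm m ψ) := by
  refine ⟨∑ α : MIdx d m, ∑ μ ∈ (Finset.Iic α.1).erase α.1, binom α.1 μ * (d * d),
    Finset.sum_nonneg fun α _ => Finset.sum_nonneg fun μ _ =>
      mul_nonneg (binom_nonneg _ _) (by positivity), ?_⟩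
  intro n K G hG hmean hsol ε hε φ ψ hφ hψ
  obtain ⟨φj, h1, h2, h3⟩ := hφ.exists_approx
  obtain ⟨ψj, k1, k2⟩ := hψ.exists_sobolev_approx
  have k3 : L2Tendsto volume ψj ψ := L2Tendsto.of_weakDeriv_zero
    (fun j => (k1 j).1.continuous.locallyIntegrable) hψ.locallyIntegrable (k2 0 (by simp))
  refine le_of_tendsto_of_tendsto' (h3.inner (k3.pmul hG hε.ne')).norm
    (((tendsto_const_nhds.mul (tendsto_sobNorm h2)).mul (tendsto_sobNorm k2)).const_mul _)
    fun j => ?_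
  have e : ∫ x, inner ℂ (wgrad m (φj j) x) (pmul G ε (ψj j) x) =
      ∫ x, inner ℂ (sgrad m (φj j) x) (pmul G ε (ψj j) x) := by
    refine integral_congr_ae ?_
    filter_upwards [wgrad_ae_eq_sgrad (h1 j).1] with x hx
    rw [hx]
  rw [e]
  exact (hsol.rescale hε).norm_integral_sgrad_le hG hmean hε (h1 j).1 (h1 j).2 (k1 j).1 (k1 j).2

end FluxEstimate

/-! ### Weak derivatives of the corrector term -/

section CorrectorTerm

variable {d m n : ℕ} {K ε : ℝ} {𝒩 : (Fin d → ℕ) → E d → W d m n →L[ℂ] V n} {χ : E d → W d m n}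

/-- Part of the Leibniz formula for `D^γ (ε^m 𝒩(x/ε) S^ε χ)`: the terms with `μ ∈ s`
derivatives on the periodic factor. -/
noncomputable def corrSum (𝒩 : (Fin d → ℕ) → E d → W d m n →L[ℂ] V n) (ε : ℝ) (χ : E d → W d m n)
    (s : Finset (Fin d → ℕ)) (γ : Fin d → ℕ) (x : E d) : V n :=
  ∑ μ ∈ s, (binom γ μ * ε ^ (m - ∑ i, μ i)) • pmul (𝒩 μ) ε (weakDeriv (γ - μ) χ) x

/-- The Leibniz formula for the corrector term. A derivative of order `|μ|` of `𝒩(x/ε)` produces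
`ε^{-|μ|}`, which the factor `ε^m` absorbs. -/
theorem hasWeakDeriv_corr_of_smooth (hN : PerSob m 𝒩) (hε : 0 < ε) {ψ : E d → W d m n}
    (hψ : Smooth ψ) (hc : HasCompactSupport ψ) {γ : Fin d → ℕ} (hγ : ∑ i, γ i ≤ m) :
    HasWeakDeriv γ (fun x => ε ^ m • pmul (𝒩 0) ε ψ x) (corrSum 𝒩 ε ψ (Finset.Iic γ) γ) := by
  have hs : Smooth (steklov ε ψ) := by
    rw [steklov_eq_avg hε.ne']
    exact smooth_avg _ hψ hc
  have hμm : ∀ μ ≤ γ, ∑ i, μ i ≤ m := fun μ hμ => (sum_le_of_le hμ).trans hγ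
  have hN' : ∀ μ ≤ γ, HasWeakDeriv μ (fun x => ε ^ (m - ∑ i, (0 : Fin d → ℕ) i) • 𝒩 0 (ε⁻¹ • x))
      (fun x => ε ^ (m - ∑ i, μ i) • 𝒩 μ (ε⁻¹ • x)) := by
    intro μ hμ
    have h := (((hN.deriv μ (hμm μ hμ)).comp_affine (inv_ne_zero hε.ne') 0).const_smul_real (ε ^ m))
    simp only [add_zero] at h
    refine h.congr (Filter.Eventually.of_forall fun x => by simp)
      (Filter.Eventually.of_forall fun x => ?_)
    simp only [smul_smul]
    congr 1
    rw [inv_pow, ← pow_sub₀ _ hε.ne' (hμm μ hμ)]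
  have h := HasWeakDeriv.bilin (ContinuousLinearMap.restrictScalarsL ℂ (W d m n) (V n) ℝ ℝ) hs
    (N := fun μ x => ε ^ (m - ∑ i, μ i) • 𝒩 μ (ε⁻¹ • x)) γ hN'
  refine h.congr (Filter.Eventually.of_forall fun x => by simp [pmul]) ?_
  filter_upwards [(Filter.eventually_all_finset (Finset.Iic γ)).2 fun μ _ =>
    multiDeriv_steklov hε.ne' hψ hc (γ - μ)] with x hx
  refine Finset.sum_congr rfl fun μ hμ => ?_
  rw [hx μ hμ, pmul, steklov_congr hε.ne' (weakDeriv_smooth hψ), mul_smul]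
  rfl

theorem L2Tendsto.corrSum (hK : ∀ μ : Fin d → ℕ, ∑ i, μ i ≤ m → PerMul K (𝒩 μ)) (hε : 0 < ε)
    {ψ : ℕ → E d → W d m n} (h : ∀ γ : Fin d → ℕ, ∑ i, γ i ≤ m →
      L2Tendsto volume (fun j => weakDeriv γ (ψ j)) (weakDeriv γ χ)) {γ : Fin d → ℕ}
    (hγ : ∑ i, γ i ≤ m) {s : Finset (Fin d → ℕ)} (hs : s ⊆ Finset.Iic γ) :
    L2Tendsto volume (fun j => HighOrderHomogenization.corrSum 𝒩 ε (ψ j) s γ)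
      (HighOrderHomogenization.corrSum 𝒩 ε χ s γ) := by
  refine L2Tendsto.sum s fun μ hμ => ?_
  have hμ' : μ ≤ γ := Finset.mem_Iic.1 (hs hμ)
  have h1 := sum_sub_idx hμ'
  exact ((h (γ - μ) (by omega)).pmul (hK μ ((sum_le_of_le hμ').trans hγ)) hε.ne').clm
    ((binom γ μ * ε ^ (m - ∑ i, μ i)) • ContinuousLinearMap.id ℝ (V n))

theorem memLp_corrSum (hK : ∀ μ : Fin d → ℕ, ∑ i, μ i ≤ m → PerMul K (𝒩 μ)) (hε : 0 < ε)
    (hχ : MemH m χ) {γ : Fin d → ℕ}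
    (hγ : ∑ i, γ i ≤ m) {s : Finset (Fin d → ℕ)} (hs : s ⊆ Finset.Iic γ) :
    MemLp (corrSum 𝒩 ε χ s γ) 2 volume :=
  (L2Tendsto.corrSum (ψ := fun _ => χ) hK hε
    (fun _ h => L2Tendsto.const (hχ.memLp_weakDeriv h)) hγ hs).memLp_lim

theorem hasWeakDeriv_corr (hN : PerSob m 𝒩)
    (hK : ∀ μ : Fin d → ℕ, ∑ i, μ i ≤ m → PerMul K (𝒩 μ)) (hε : 0 < ε) (hχ : MemH m χ)
    {γ : Fin d → ℕ} (hγ : ∑ i, γ i ≤ m) :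
    HasWeakDeriv γ (fun x => ε ^ m • pmul (𝒩 0) ε χ x) (corrSum 𝒩 ε χ (Finset.Iic γ) γ) := by
  obtain ⟨ψ, k1, k2⟩ := hχ.exists_sobolev_approx
  have k3 : L2Tendsto volume ψ χ := L2Tendsto.of_weakDeriv_zero
    (fun j => (k1 j).1.continuous.locallyIntegrable) hχ.locallyIntegrable (k2 0 (by simp))
  exact HasWeakDeriv.of_L2Tendsto
    (fun j => hasWeakDeriv_corr_of_smooth hN hε (k1 j).1 (k1 j).2 hγ)
    ((k3.pmul (hK 0 (by simp)) hε.ne').clm (ε ^ m • ContinuousLinearMap.id ℝ (V n)))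
    (L2Tendsto.corrSum hK hε k2 hγ le_rfl)

/-- The sum of all Leibniz coefficients of order at most `m`. -/
noncomputable def leibnizConst (d m : ℕ) : ℝ :=
  ∑ γ ∈ idxLE d m, ∑ μ ∈ Finset.Iic γ, binom γ μ

theorem leibnizConst_nonneg (d m : ℕ) : 0 ≤ leibnizConst d m :=
  Finset.sum_nonneg fun _ _ => Finset.sum_nonneg fun _ _ => binom_nonneg _ _

/-- The Leibniz terms carry the factor `ε^a` if at most `m - a` derivatives fall on the
periodic factor. -/
theorem nrm2_corrSum_le (hK : ∀ μ : Fin d → ℕ, ∑ i, μ i ≤ m → PerMul K (𝒩 μ)) (hε : 0 < ε)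
    (hε1 : ε ≤ 1) (hχ : MemH m χ) {γ : Fin d → ℕ} (hγ : ∑ i, γ i ≤ m) {s : Finset (Fin d → ℕ)}
    (hs : s ⊆ Finset.Iic γ) {a : ℕ} (ha : ∀ μ ∈ s, ∑ i, μ i + a ≤ m) :
    nrm2 volume (corrSum 𝒩 ε χ s γ) ≤ leibnizConst d m * (K * ε ^ a * sobNorm m χ) := by
  have hK0 := (hK 0 (by simp)).nonneg
  have hX : 0 ≤ K * ε ^ a * sobNorm m χ :=
    mul_nonneg (mul_nonneg hK0 (pow_nonneg hε.le a)) (sobNorm_nonneg m χ)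
  have hsub : ∀ μ ∈ s, ∑ i, (γ - μ) i ≤ m := fun μ hμ => by
    have h1 := sum_sub_idx (Finset.mem_Iic.1 (hs hμ))
    omega
  have hp := fun μ hμ => memLp_pmul (hK μ ((sum_le_of_le (Finset.mem_Iic.1 (hs hμ))).trans hγ))
    hε.ne' (hχ.memLp_weakDeriv (hsub μ hμ))
  have h1 : nrm2 volume (corrSum 𝒩 ε χ s γ) ≤ ∑ μ ∈ s, binom γ μ * (K * ε ^ a * sobNorm m χ) := by
    refine (nrm2_sum_le s fun μ hμ => (hp μ hμ).1.const_smul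
      (binom γ μ * ε ^ (m - ∑ i, μ i))).trans (Finset.sum_le_sum fun μ hμ => ?_)
    refine (nrm2_smul (binom γ μ * ε ^ (m - ∑ i, μ i)) _).trans_le ?_
    rw [Real.norm_of_nonneg (mul_nonneg (binom_nonneg _ _) (pow_nonneg hε.le _)),
      mul_assoc]
    refine mul_le_mul_of_nonneg_left ?_ (binom_nonneg _ _)
    have h2 : ε ^ (m - ∑ i, μ i) ≤ ε ^ a := by
      have := ha μ hμ
      exact pow_le_pow_of_le_one hε.le hε1 (by omega)
    refine (mul_le_mul h2 ((hp μ hμ).2.trans (mul_le_mul_of_nonneg_left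
      (nrm2_weakDeriv_le_sobNorm χ (hsub μ hμ)) hK0)) nrm2_nonneg
      (pow_nonneg hε.le a)).trans_eq ?_
    ring
  refine h1.trans ?_
  rw [← Finset.sum_mul]
  refine mul_le_mul_of_nonneg_right ?_ hX
  refine (Finset.sum_le_sum_of_subset_of_nonneg hs fun _ _ _ => binom_nonneg _ _).trans ?_
  exact Finset.single_le_sum (f := fun γ => ∑ μ ∈ Finset.Iic γ, binom γ μ)
    (fun _ _ => Finset.sum_nonneg fun _ _ => binom_nonneg _ _) (mem_idxLE.2 hγ)

theorem corrSum_top (hε : 0 < ε) (hχ : LocallyIntegrable χ) (α : MIdx d m) (x : E d) :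
    corrSum 𝒩 ε χ (Finset.Iic α.1) α.1 x = pmul (𝒩 α.1) ε χ x +
      corrSum 𝒩 ε χ ((Finset.Iic α.1).erase α.1) α.1 x := by
  rw [corrSum, ← Finset.add_sum_erase _ _ (Finset.mem_Iic.2 (le_refl α.1)), α.2, tsub_self,
    tsub_self, pow_zero, binom_self, mul_one, one_smul, pmul, pmul,
    steklov_congr hε.ne' (weakDeriv_zero_ae hχ)]
  rfl

theorem wgrad_hasWeakDeriv {k : ℕ} {u : E d → V n} (hu : MemH (m + k) u) {γ : Fin d → ℕ}
    (hγ : ∑ i, γ i ≤ k) :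
    HasWeakDeriv γ (wgrad m u) fun x => pack fun α => weakDeriv (α.1 + γ) u x := by
  refine HasWeakDeriv.pack fun α => ?_
  refine (hu.hasWeakDeriv (by rw [α.2]; omega)).of_add (hu.hasWeakDeriv ?_)
  rw [sum_add_idx, α.2]
  omega

theorem MemH.wgrad {k : ℕ} {u : E d → V n} (hu : MemH (m + k) u) :
    MemH k (HighOrderHomogenization.wgrad m u) := fun γ hγ =>
  ⟨_, wgrad_hasWeakDeriv hu hγ, memLp_pack fun α => hu.memLp_weakDeriv (by
    rw [sum_add_idx, α.2]; omega)⟩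

theorem sobNorm_wgrad_le {k : ℕ} {u : E d → V n} (hu : MemH (m + k) u) :
    sobNorm k (wgrad m u) ≤
      ((idxLE d k).card * Fintype.card (MIdx d m) : ℝ) * sobNorm (m + k) u := by
  rw [mul_assoc, ← nsmul_eq_mul]
  refine Finset.sum_le_card_nsmul _ _ _ fun γ hγ => ?_
  have hγ' := mem_idxLE.1 hγ
  have hs : ∀ α : MIdx d m, ∑ i, (α.1 + γ) i ≤ m + k := fun α => by
    rw [sum_add_idx, α.2]; omega
  rw [nrm2_congr (wgrad_hasWeakDeriv hu hγ').weakDeriv_ae_eq]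
  refine (nrm2_pack_le fun α => hu.memLp_weakDeriv (hs α)).trans ?_
  refine (Finset.sum_le_card_nsmul _ _ (sobNorm (m + k) u) fun α _ =>
    nrm2_weakDeriv_le_sobNorm u (hs α)).trans_eq ?_
  rw [nsmul_eq_mul, Finset.card_univ]

end CorrectorTerm

/-! ### The two-scale approximation -/

section SteklovSobolev

variable {d m : ℕ} {F F' : Type*} [NormedAddCommGroup F] [NormedSpace ℝ F] [CompleteSpace F]
  [NormedAddCommGroup F'] [NormedSpace ℝ F'] [CompleteSpace F'] {ε : ℝ} {u : E d → F}

theorem steklov_clm (L : F →L[ℝ] F') (hε : ε ≠ 0) (hu : LocallyIntegrable u) :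
    (fun x => L (steklov ε u x)) =ᵐ[volume] steklov ε fun x => L (u x) := by
  filter_upwards [integrable_steklov hε hu] with x hx
  exact (L.integral_comp_comm hx).symm

theorem MemH.nrm2_steklov_weakDeriv_sub_le (hε : 0 < ε) (hu : MemH (m + 1) u) {γ : Fin d → ℕ}
    (hγ : ∑ i, γ i ≤ m) :
    nrm2 volume (fun x => HighOrderHomogenization.steklov ε
      (HighOrderHomogenization.weakDeriv γ u) x - HighOrderHomogenization.weakDeriv γ u x) ≤
      d * d * (ε * sobNorm (m + 1) u) := by
  have hs : ∀ i : Fin d, ∑ j, (γ + unitIdx i : Fin d → ℕ) j ≤ m + 1 := fun i => by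
    rw [sum_add_idx, sum_unitIdx]; omega
  refine (nrm2_steklov_sub_le hε (fun i => (hu.hasWeakDeriv (hγ.trans (Nat.le_succ m))).of_add
    (hu.hasWeakDeriv (hs i))) (hu.memLp_weakDeriv (hγ.trans (Nat.le_succ m)))
    fun i => hu.memLp_weakDeriv (hs i)).trans ?_
  have h : ∑ i, nrm2 volume (HighOrderHomogenization.weakDeriv (γ + unitIdx i) u) ≤
      d * sobNorm (m + 1) u :=
    (Finset.sum_le_card_nsmul _ _ (sobNorm (m + 1) u) fun i _ =>
      nrm2_weakDeriv_le_sobNorm u (hs i)).trans_eq (by simp)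
  refine (mul_le_mul_of_nonneg_left h (mul_nonneg hε.le (Nat.cast_nonneg d))).trans_eq ?_
  ring

theorem MemH.weakDeriv_steklov (hε : ε ≠ 0) (hu : MemH m u) {γ : Fin d → ℕ}
    (hγ : ∑ i, γ i ≤ m) :
    HighOrderHomogenization.weakDeriv γ (HighOrderHomogenization.steklov ε u) =ᵐ[volume]
      HighOrderHomogenization.steklov ε (HighOrderHomogenization.weakDeriv γ u) :=
  ((hu.hasWeakDeriv hγ).steklov hε).weakDeriv_ae_eq

theorem MemH.sobNorm_steklov_le (hε : ε ≠ 0) (hu : MemH m u) :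
    sobNorm m (HighOrderHomogenization.steklov ε u) ≤ sobNorm m u := by
  refine Finset.sum_le_sum fun γ hγ => ?_
  rw [nrm2_congr (hu.weakDeriv_steklov hε (mem_idxLE.1 hγ))]
  exact nrm2_steklov_le hε (hu.memLp_weakDeriv (mem_idxLE.1 hγ))

theorem MemH.sobNorm_steklov_sub_le (hε : 0 < ε) (hu : MemH (m + 1) u) :
    sobNorm m (fun x => HighOrderHomogenization.steklov ε u x - u x) ≤
      (idxLE d m).card * (d * d * (ε * sobNorm (m + 1) u)) := by
  rw [← nsmul_eq_mul]
  refine Finset.sum_le_card_nsmul _ _ _ fun γ hγ => ?_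
  have hγ' := mem_idxLE.1 hγ
  have h := hu.hasWeakDeriv (γ := γ) (hγ'.trans (Nat.le_succ m))
  rw [nrm2_congr ((h.steklov hε.ne').fun_sub h).weakDeriv_ae_eq]
  exact hu.nrm2_steklov_weakDeriv_sub_le hε hγ'

theorem MemH.nrm2_steklov_sub_le_sobNorm (hε : 0 < ε) (hm : 0 < m) (hu : MemH m u) :
    nrm2 volume (fun x => HighOrderHomogenization.steklov ε u x - u x) ≤
      d * d * (ε * sobNorm m u) := by
  obtain ⟨k, rfl⟩ := Nat.exists_eq_succ_of_ne_zero hm.ne'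
  have h := hu.nrm2_steklov_weakDeriv_sub_le (γ := 0) hε (by simp)
  have h0 := weakDeriv_zero_ae hu.locallyIntegrable
  rw [steklov_congr hε.ne' h0] at h
  refine (nrm2_congr ?_).trans_le h
  filter_upwards [h0] with x hx
  rw [hx]

end SteklovSobolev

section Ansatz

variable {d m n : ℕ} {lam Lam K ε : ℝ} {B : E d → W d m n →L[ℂ] W d m n}
  {𝒩 : (Fin d → ℕ) → E d → W d m n →L[ℂ] V n} {Ahat : W d m n →L[ℂ] W d m n} {u : E d → V n}

/-- The two-scale approximation `S^ε u + ε^m 𝒩(x/ε) S^ε ∇^m u`. -/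
noncomputable def ansatz (𝒩 : (Fin d → ℕ) → E d → W d m n →L[ℂ] V n) (ε : ℝ) (u : E d → V n)
    (x : E d) : V n :=
  steklov ε u x + ε ^ m • pmul (𝒩 0) ε (wgrad m u) x

/-- The part of `∇^m` of the two-scale approximation that is of order `ε`. -/
noncomputable def ansatzRem (𝒩 : (Fin d → ℕ) → E d → W d m n →L[ℂ] V n) (ε : ℝ)
    (u : E d → V n) (x : E d) : W d m n :=
  pack fun α => corrSum 𝒩 ε (wgrad m u) ((Finset.Iic α.1).erase α.1) α.1 x

theorem memH_ansatz (hN : PerSob m 𝒩)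
    (hK : ∀ μ : Fin d → ℕ, ∑ i, μ i ≤ m → PerMul K (𝒩 μ)) (hε : 0 < ε) (hu : MemH (m + m) u) :
    MemH m (ansatz 𝒩 ε u) :=
  ((hu.mono (Nat.le_add_left m m)).steklov hε.ne').fun_add fun _ hγ =>
    ⟨_, hasWeakDeriv_corr hN hK hε hu.wgrad hγ, memLp_corrSum hK hε hu.wgrad hγ le_rfl⟩

theorem sobNorm_corr_le (hN : PerSob m 𝒩)
    (hK : ∀ μ : Fin d → ℕ, ∑ i, μ i ≤ m → PerMul K (𝒩 μ)) (hε : 0 < ε) (hε1 : ε ≤ 1)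
    (hu : MemH (m + m) u) :
    sobNorm m (fun x => ε ^ m • pmul (𝒩 0) ε (wgrad m u) x) ≤
      (idxLE d m).card * (leibnizConst d m * (K * sobNorm m (wgrad m u))) := by
  rw [← nsmul_eq_mul]
  refine Finset.sum_le_card_nsmul _ _ _ fun γ hγ => ?_
  have hγ' := mem_idxLE.1 hγ
  rw [nrm2_congr (hasWeakDeriv_corr hN hK hε hu.wgrad hγ').weakDeriv_ae_eq]
  refine (nrm2_corrSum_le hK hε hε1 hu.wgrad hγ' le_rfl (a := 0) fun μ hμ =>
    (sum_le_of_le (Finset.mem_Iic.1 hμ)).trans hγ').trans_eq ?_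
  rw [pow_zero, mul_one]

/-- In `L²` the corrector term is even `O(ε^m)`; only `O(ε)` is used. -/
theorem nrm2_corr_le (hm : 0 < m)
    (hK : ∀ μ : Fin d → ℕ, ∑ i, μ i ≤ m → PerMul K (𝒩 μ)) (hε : 0 < ε) (hε1 : ε ≤ 1)
    (hu : MemH (m + m) u) :
    nrm2 volume (fun x => ε ^ m • pmul (𝒩 0) ε (wgrad m u) x) ≤
      K * (ε * sobNorm m (wgrad m u)) := by
  have h0 := hK 0 (by simp)
  refine (nrm2_smul (ε ^ m) _).trans_le ?_
  rw [Real.norm_of_nonneg (pow_nonneg hε.le m)]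
  have h1 := (memLp_pmul h0 hε.ne' hu.wgrad.memLp).2
  have h2 : nrm2 volume (wgrad m u) ≤ sobNorm m (wgrad m u) :=
    nrm2_le_sobNorm hu.wgrad.locallyIntegrable
  have h3 : ε ^ m ≤ ε := by
    simpa using pow_le_pow_of_le_one hε.le hε1 (Nat.succ_le_of_lt hm)
  refine (mul_le_mul h3 (h1.trans (mul_le_mul_of_nonneg_left h2 h0.nonneg)) nrm2_nonneg
    hε.le).trans_eq ?_
  ring

theorem memLp_ansatzRem (hK : ∀ μ : Fin d → ℕ, ∑ i, μ i ≤ m → PerMul K (𝒩 μ)) (hε : 0 < ε)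
    (hu : MemH (m + m) u) : MemLp (ansatzRem 𝒩 ε u) 2 volume :=
  memLp_pack fun α => memLp_corrSum hK hε hu.wgrad α.2.le (Finset.erase_subset _ _)

theorem nrm2_ansatzRem_le (hK : ∀ μ : Fin d → ℕ, ∑ i, μ i ≤ m → PerMul K (𝒩 μ)) (hε : 0 < ε)
    (hε1 : ε ≤ 1) (hu : MemH (m + m) u) : nrm2 volume (ansatzRem 𝒩 ε u) ≤
      Fintype.card (MIdx d m) * (leibnizConst d m * (K * ε * sobNorm m (wgrad m u))) := by
  refine (nrm2_pack_le fun α =>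
    memLp_corrSum hK hε hu.wgrad α.2.le (Finset.erase_subset _ _)).trans ?_
  rw [← nsmul_eq_mul, ← Finset.card_univ]
  refine Finset.sum_le_card_nsmul _ _ _ fun α _ => ?_
  refine (nrm2_corrSum_le hK hε hε1 hu.wgrad α.2.le (Finset.erase_subset _ _) (a := 1)
    fun μ hμ => ?_).trans_eq (by rw [pow_one])
  have := sum_lt_of_mem_erase hμ
  rw [α.2] at this
  omega

theorem wgrad_ansatz (hN : PerSob m 𝒩)
    (hK : ∀ μ : Fin d → ℕ, ∑ i, μ i ≤ m → PerMul K (𝒩 μ)) (hε : 0 < ε) (hu : MemH (m + m) u) :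
    wgrad m (ansatz 𝒩 ε u) =ᵐ[volume] fun x =>
      (steklov ε (wgrad m u) x + gradOp 𝒩 (ε⁻¹ • x) (steklov ε (wgrad m u) x)) +
        ansatzRem 𝒩 ε u x := by
  have hum := hu.mono (Nat.le_add_left m m)
  have hl := hu.wgrad.locallyIntegrable
  have hp : ∀ᵐ x, ∀ α : MIdx d m, prj α (steklov ε (wgrad m u) x) =
      steklov ε (weakDeriv α.1 u) x := ae_all_iff.2 fun α =>
    steklov_clm ((prj α : W d m n →L[ℂ] V n).restrictScalars ℝ) hε.ne' hl
  refine (wgrad_ae_eq fun α => ((hum.hasWeakDeriv α.2.le).steklov hε.ne').fun_add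
    (hasWeakDeriv_corr hN hK hε hu.wgrad α.2.le)).trans ?_
  filter_upwards [hp] with x hx
  refine Pk.ext fun α => ?_
  rw [map_add, map_add, prj_pack, ansatzRem, prj_pack, hx, gradOp_apply, cgrad, prj_pack,
    corrSum_top hε hl, add_assoc]
  rfl

/-- The three sources of error in the form: smoothing of `∇^m u`, the oscillating flux, and the
derivatives which fall on the smoothed factor of the corrector. -/
theorem form_ansatz_sub (hlam : 0 < lam) (hB : PerElliptic lam Lam B) (h : Corrector B 𝒩 Ahat)
    (hK : ∀ μ : Fin d → ℕ, ∑ i, μ i ≤ m → PerMul K (𝒩 μ)) (hε : 0 < ε) (hu : MemH (m + m) u)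
    {φ : E d → V n} (hφ : MemH m φ) :
    form (fun x => B (ε⁻¹ • x)) φ (ansatz 𝒩 ε u) - form (fun _ => Ahat) φ u =
      (∫ x, inner ℂ (wgrad m φ x) (Ahat (steklov ε (wgrad m u) x - wgrad m u x))) -
      (∫ x, inner ℂ (wgrad m φ x) (pmul (flux B 𝒩 Ahat) ε (wgrad m u) x)) +
      ∫ x, inner ℂ (wgrad m φ x) (B (ε⁻¹ • x) (ansatzRem 𝒩 ε u x)) := by
  have hBε := hB.toElliptic.rescale hε
  have hg := hφ.memLp_wgrad le_rfl
  have hχ := hu.wgrad.memLp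
  have hA : ∀ {f : E d → W d m n}, MemLp f 2 volume → MemLp (fun x => Ahat (f x)) 2 volume :=
    fun hf => Ahat.comp_memLp' hf
  have h1 : MemLp (fun x => Ahat (steklov ε (wgrad m u) x - wgrad m u x)) 2 volume :=
    hA ((memLp_steklov hε.ne' hχ).sub hχ)
  have h2 := (memLp_pmul (h.perMul_flux hlam hB) hε.ne' hχ).1
  have h3 := hBε.memLp (memLp_ansatzRem hK hε hu)
  have h4 := hBε.memLp ((memH_ansatz h.perSob hK hε hu).memLp_wgrad le_rfl)
  rw [form, form, ← integral_inner_sub hg h4 (hA hχ), ← integral_inner_sub hg h1 h2,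
    ← integral_inner_add (b := fun x => Ahat (steklov ε (wgrad m u) x - wgrad m u x) -
      pmul (flux B 𝒩 Ahat) ε (wgrad m u) x) hg (h1.sub h2) h3]
  refine integral_congr_ae ?_
  filter_upwards [wgrad_ansatz h.perSob hK hε hu] with x hx
  congr 1
  rw [hx, map_add, pmul, flux_apply, ← gradOp_apply, map_sub]
  abel

end Ansatz

/-! ### Estimates for the two-scale approximation -/

/-- The properties of the two-scale approximation `w` of `u` with error constant `C`: it is
bounded in `H^m`, it is `O(ε)`-close to `u` in `L²` and so are the forms. -/
structure TwoScaleBound {d m n : ℕ} (C ε : ℝ) (Bε : E d → W d m n →L[ℂ] W d m n)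
    (Ahat : W d m n →L[ℂ] W d m n) (u w : E d → V n) : Prop where
  memH : MemH m w
  sobNorm_le : sobNorm m w ≤ C * sobNorm (m + m) u
  nrm2_sub_le : nrm2 volume (fun x => w x - u x) ≤ C * ε * sobNorm (m + m) u
  form_sub_le : ∀ φ : E d → V n, MemH m φ →
    ‖form Bε φ w - form (fun _ => Ahat) φ u‖ ≤ C * ε * sobNorm m φ * sobNorm (m + m) u

/-- The two-scale bounds hold for every `u ∈ H^{2m}`, with a constant depending only on `d`, `m` and
the ellipticity constants. -/
theorem exists_twoScaleBound (d m : ℕ) (hm : 0 < m) {lam Lam : ℝ} (hlam : 0 < lam)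
    (hLam : 0 ≤ Lam) : ∃ C : ℝ, 0 ≤ C ∧ ∀ {n : ℕ} {B : E d → W d m n →L[ℂ] W d m n}
      {𝒩 : (Fin d → ℕ) → E d → W d m n →L[ℂ] V n} {Ahat : W d m n →L[ℂ] W d m n},
      PerElliptic lam Lam B → Corrector B 𝒩 Ahat → ∀ {ε : ℝ}, 0 < ε → ε ≤ 1 →
      ∀ {u : E d → V n}, MemH (m + m) u →
        TwoScaleBound C ε (fun x => B (ε⁻¹ • x)) Ahat u (ansatz 𝒩 ε u) := by
  obtain ⟨K₁, hK₁⟩ := exists_perMul_corrector d m hlam hLam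
  obtain ⟨Cf, hCf, hflux⟩ := exists_norm_integral_wgrad_pmul_le d m
  -- `K` bounds the correctors; the maximum secures its sign
  obtain ⟨K, hKdef⟩ : ∃ K, K = max K₁ 0 := ⟨_, rfl⟩
  have hK0 : 0 ≤ K := hKdef ▸ le_max_right _ _
  obtain ⟨c, hc⟩ : ∃ c : ℝ, c = ((idxLE d m).card * Fintype.card (MIdx d m) : ℝ) := ⟨_, rfl⟩
  have hc0 : 0 ≤ c := hc ▸ by positivity
  obtain ⟨L, hL⟩ : ∃ L, L = leibnizConst d m := ⟨_, rfl⟩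
  have hL0 : 0 ≤ L := hL ▸ leibnizConst_nonneg d m
  -- the bound of the homogenized coefficients
  obtain ⟨H, hH⟩ : ∃ H, H = Lam * (1 + Lam / lam) := ⟨_, rfl⟩
  have hH0 : 0 ≤ H := hH ▸ by positivity
  obtain ⟨I, hI⟩ : ∃ I : ℝ, I = (idxLE d m).card := ⟨_, rfl⟩
  have hI0 : 0 ≤ I := hI ▸ Nat.cast_nonneg _
  obtain ⟨M, hM⟩ : ∃ M : ℝ, M = Fintype.card (MIdx d m) := ⟨_, rfl⟩
  have hM0 : 0 ≤ M := hM ▸ Nat.cast_nonneg _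
  obtain ⟨q, hq⟩ : ∃ q : ℝ, q = d * d := ⟨_, rfl⟩
  have hq0 : 0 ≤ q := hq ▸ by positivity
  have hC1 : 0 ≤ 1 + I * (L * (K * c)) := by positivity
  have hC2 : 0 ≤ q + K * c := by positivity
  have hC3 : 0 ≤ (H * q + Cf * (2 * H) + Lam * (M * (L * K))) * c := by positivity
  refine ⟨(1 + I * (L * (K * c))) + (q + K * c) +
    (H * q + Cf * (2 * H) + Lam * (M * (L * K))) * c, by positivity, ?_⟩
  intro n B 𝒩 Ahat hB h ε hε hε1 u hu
  have hK : ∀ μ : Fin d → ℕ, ∑ i, μ i ≤ m → PerMul K (𝒩 μ) := fun μ hμ => by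
    have := hK₁ hB h μ hμ
    rwa [hKdef, max_eq_left this.nonneg]
  have hum := hu.mono (Nat.le_add_left m m)
  have hu1 : sobNorm m u ≤ sobNorm (m + m) u := sobNorm_mono (Nat.le_add_left m m) u
  have hχ1 : sobNorm m (wgrad m u) ≤ c * sobNorm (m + m) u := hc ▸ sobNorm_wgrad_le hu
  have hχs := sobNorm_nonneg m (wgrad m u)
  obtain ⟨X, hX⟩ : ∃ X, X = sobNorm m (wgrad m u) := ⟨_, rfl⟩
  obtain ⟨U, hU⟩ : ∃ U, U = sobNorm (m + m) u := ⟨_, rfl⟩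
  have hU0 : 0 ≤ U := hU ▸ sobNorm_nonneg _ _
  rw [← hU] at hu1 hχ1
  rw [← hX] at hχ1 hχs
  have hw := memH_ansatz h.perSob hK hε hu
  have hS := hum.steklov hε.ne'
  have hcorr : MemH m fun x => ε ^ m • pmul (𝒩 0) ε (wgrad m u) x := fun γ hγ =>
    ⟨_, hasWeakDeriv_corr h.perSob hK hε hu.wgrad hγ, memLp_corrSum hK hε hu.wgrad hγ le_rfl⟩
  refine ⟨hw, ?_, ?_, fun φ hφ => ?_⟩
  · have e1 := sobNorm_corr_le h.perSob hK hε hε1 hu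
    have e2 := hum.sobNorm_steklov_le hε.ne'
    have e3 : sobNorm m (ansatz 𝒩 ε u) ≤ _ := sobNorm_add_le hS hcorr
    rw [← hX, ← hI, ← hL] at e1
    have e4 : I * (L * (K * X)) ≤ I * (L * (K * (c * U))) := by gcongr
    rw [← hU]
    calc sobNorm m (ansatz 𝒩 ε u) ≤ U + I * (L * (K * (c * U))) := by linarith
      _ = (1 + I * (L * (K * c))) * U := by ring
      _ ≤ _ := mul_le_mul_of_nonneg_right (by linarith) hU0
  · have e1 := nrm2_corr_le hm hK hε hε1 hu
    have e2 := hum.nrm2_steklov_sub_le_sobNorm hε hm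
    have e3 := nrm2_add_le (hS.memLp.sub hum.memLp) hcorr.memLp
    have e4 : nrm2 volume (fun x => ansatz 𝒩 ε u x - u x) =
        nrm2 volume (fun x => (steklov ε u - u) x + ε ^ m • pmul (𝒩 0) ε (wgrad m u) x) := by
      congr 1
      funext x
      rw [ansatz, Pi.sub_apply]
      abel
    rw [← hX] at e1
    rw [← hq] at e2
    rw [← hU, e4]
    have e5 : q * (ε * sobNorm m u) ≤ q * (ε * U) := by
      exact mul_le_mul_of_nonneg_left (mul_le_mul_of_nonneg_left hu1 hε.le) hq0
    have e6 : K * (ε * X) ≤ K * (ε * (c * U)) := by gcongr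
    calc _ ≤ q * (ε * U) + K * (ε * (c * U)) := by
          refine e3.trans (add_le_add (e2.trans e5) (e1.trans e6))
      _ = (q + K * c) * ε * U := by ring
      _ ≤ _ := mul_le_mul_of_nonneg_right (mul_le_mul_of_nonneg_right (by linarith) hε.le) hU0
  · obtain ⟨P, hP⟩ : ∃ P, P = sobNorm m φ := ⟨_, rfl⟩
    have hP0 : 0 ≤ P := hP ▸ sobNorm_nonneg _ _
    have hBε := hB.toElliptic.rescale hε
    have hg := hφ.memLp_wgrad le_rfl
    have hgP : nrm2 volume (wgrad m φ) ≤ P := hP ▸ nrm2_wgrad_le_sobNorm hφ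
    have hχL := hu.wgrad.memLp
    have hsub : MemLp (fun x => steklov ε (wgrad m u) x - wgrad m u x) 2 volume :=
      (memLp_steklov hε.ne' hχL).sub hχL
    -- the three errors: smoothing, flux, and derivatives on the smoothed factor
    have t1 : ‖∫ x, inner ℂ (wgrad m φ x) (Ahat (steklov ε (wgrad m u) x - wgrad m u x))‖ ≤
        P * (H * (q * (ε * X))) := by
      refine (norm_integral_inner_le hg (Ahat.comp_memLp' hsub)).trans
        (mul_le_mul hgP ?_ nrm2_nonneg hP0)
      refine (nrm2_clm_apply_le hH0 (Filter.Eventually.of_forall fun _ =>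
        hH ▸ h.norm_hom_le hlam hB) hsub).trans (mul_le_mul_of_nonneg_left ?_ hH0)
      rw [hX, hq]
      exact hu.wgrad.nrm2_steklov_sub_le_sobNorm hε hm
    have t2 : ‖∫ x, inner ℂ (wgrad m φ x) (pmul (flux B 𝒩 Ahat) ε (wgrad m u) x)‖ ≤
        Cf * (2 * H * ε * P * X) := by
      rw [hH, hP, hX]
      exact hflux (h.perMul_flux hlam hB) (h.integral_flux hB) (h.solenoidal_flux hm hlam hB)
        hε hφ hu.wgrad
    have t3 : ‖∫ x, inner ℂ (wgrad m φ x) (B (ε⁻¹ • x) (ansatzRem 𝒩 ε u x))‖ ≤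
        P * (Lam * (M * (L * (K * ε * X)))) := by
      have hr := memLp_ansatzRem hK hε hu
      refine (norm_integral_inner_le hg (hBε.memLp hr)).trans
        (mul_le_mul hgP ((hBε.nrm2_le hr).trans (mul_le_mul_of_nonneg_left ?_ hLam))
          nrm2_nonneg hP0)
      rw [hX, hL, hM]
      exact nrm2_ansatzRem_le hK hε hε1 hu
    rw [form_ansatz_sub hlam hB h hK hε hu hφ, ← hU, ← hP]
    calc _ ≤ P * (H * (q * (ε * X))) + Cf * (2 * H * ε * P * X) +
          P * (Lam * (M * (L * (K * ε * X)))) :=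
          (norm_add_le _ _).trans (add_le_add ((norm_sub_le _ _).trans (add_le_add t1 t2)) t3)
      _ = (H * q + Cf * (2 * H) + Lam * (M * (L * K))) * ε * P * X := by ring
      _ ≤ (H * q + Cf * (2 * H) + Lam * (M * (L * K))) * ε * P * (c * U) :=
          mul_le_mul_of_nonneg_left hχ1 (by positivity)
      _ = (H * q + Cf * (2 * H) + Lam * (M * (L * K))) * c * ε * P * U := by ring
      _ ≤ _ := by
          refine mul_le_mul_of_nonneg_right (mul_le_mul_of_nonneg_right
            (mul_le_mul_of_nonneg_right (by linarith) hε.le) hP0) hU0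

/-! ### Ellipticity of the homogenized operator -/

section Homogenized

variable {d m n : ℕ} {lam Lam : ℝ} {B : E d → W d m n →L[ℂ] W d m n}
  {𝒩 : (Fin d → ℕ) → E d → W d m n →L[ℂ] V n} {Ahat : W d m n →L[ℂ] W d m n}

theorem norm_neg_one_pow_mul (k : ℕ) (z : ℂ) : ‖(-1) ^ k * z‖ = ‖z‖ := by
  rw [norm_mul, norm_pow, norm_neg, norm_one, one_pow, one_mul]

/-- Integration by parts: `⟨∇^m z, g⟩` is controlled by the `L²` norm of `z`. -/
theorem norm_integral_wgrad_le {z : E d → V n} (hz : MemH m z) {g : E d → W d m n}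
    (hg : MemH m g) : ‖∫ x, inner ℂ (wgrad m z x) (g x)‖ ≤
      nrm2 volume z * (Fintype.card (MIdx d m) * sobNorm m g) := by
  have hgα : ∀ α : MIdx d m, MemH m fun x => prj α (g x) := fun α =>
    hg.clm_comp ((prj α : W d m n →L[ℂ] V n).restrictScalars ℝ)
  have e : ∫ x, inner ℂ (wgrad m z x) (g x) =
      ∑ α : MIdx d m, ∫ x, inner ℂ (weakDeriv α.1 z x) (prj α (g x)) := by
    rw [← integral_finsetSum _ fun α _ =>
      integrable_inner (hz.memLp_weakDeriv α.2.le) (hgα α).memLp]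
    exact integral_congr_ae (Filter.Eventually.of_forall fun x => inner_Pk _ _)
  rw [e]
  have h : ∀ α : MIdx d m, ‖∫ x, inner ℂ (weakDeriv α.1 z x) (prj α (g x))‖ ≤
      nrm2 volume z * sobNorm m g := by
    intro α
    rw [hz.integral_inner (hgα α) α.2.le, norm_neg_one_pow_mul]
    refine (norm_integral_inner_le hz.memLp ((hgα α).memLp_weakDeriv α.2.le)).trans
      (mul_le_mul_of_nonneg_left ?_ nrm2_nonneg)
    have h1 := (hg.hasWeakDeriv α.2.le).clm_comp ((prj α : W d m n →L[ℂ] V n).restrictScalars ℝ)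
    refine (nrm2_congr h1.weakDeriv_ae_eq).trans_le ?_
    exact (nrm2_prj_le (hg.memLp_weakDeriv α.2.le) α).trans
      (nrm2_weakDeriv_le_sobNorm g α.2.le)
  refine (norm_sum_le _ _).trans ((Finset.sum_le_card_nsmul _ _ _ fun α _ => h α).trans_eq ?_)
  rw [nsmul_eq_mul, Finset.card_univ]
  ring

/-- Weak lower semicontinuity of the norm, in quantitative form. -/
theorem two_re_inner_sub_le {g h : E d → W d m n} (hg : MemLp g 2 volume)
    (hh : MemLp h 2 volume) :
    2 * (∫ x, inner ℂ (h x) (g x)).re - nrm2 volume g ^ 2 ≤ nrm2 volume h ^ 2 := by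
  have h1 : (∫ x, inner ℂ (h x) (g x)).re ≤ nrm2 volume h * nrm2 volume g :=
    (Complex.re_le_norm _).trans (norm_integral_inner_le hh hg)
  nlinarith [sq_nonneg (nrm2 volume h - nrm2 volume g)]

/-- The homogenized coefficients inherit the Gårding inequality: it is tested on the two-scale
approximation of `φ`, whose energy converges to the homogenized energy of `φ`. -/
theorem Corrector.elliptic (hm : 0 < m) (hlam : 0 < lam) (hB : PerElliptic lam Lam B)
    (h : Corrector B 𝒩 Ahat) : Elliptic lam (Lam * (1 + Lam / lam)) fun _ : E d => Ahat := by
  have hLam := hB.nonneg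
  refine ⟨aestronglyMeasurable_const, by positivity,
    Filter.Eventually.of_forall fun _ => h.norm_hom_le hlam hB, fun φ hφ hc => ?_⟩
  obtain ⟨C, hC, hts⟩ := exists_twoScaleBound d m hm hlam hLam
  have hu : MemH (m + m) φ := MemH.of_smooth hφ hc
  have hum : MemH m φ := MemH.of_smooth hφ hc
  have hA : MemH m fun x => Ahat (wgrad m φ x) := hu.wgrad.clm_comp (Ahat.restrictScalars ℝ)
  obtain ⟨U, hU⟩ : ∃ U, U = sobNorm (m + m) φ := ⟨_, rfl⟩
  have hU0 : 0 ≤ U := hU ▸ sobNorm_nonneg _ _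
  obtain ⟨S₁, hS₁⟩ : ∃ S : ℝ, S = Fintype.card (MIdx d m) *
    sobNorm m fun x => Ahat (wgrad m φ x) := ⟨_, rfl⟩
  have hS₁0 : 0 ≤ S₁ := hS₁ ▸ mul_nonneg (Nat.cast_nonneg _) (sobNorm_nonneg _ _)
  obtain ⟨S₂, hS₂⟩ : ∃ S : ℝ, S = Fintype.card (MIdx d m) * sobNorm m (wgrad m φ) := ⟨_, rfl⟩
  have hS₂0 : 0 ≤ S₂ := hS₂ ▸ mul_nonneg (Nat.cast_nonneg _) (sobNorm_nonneg _ _)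
  refine le_of_forall_le_add_mul
    (K := C * U * S₁ + C * (C * U) * U + 2 * lam * (C * U * S₂)) fun ε hε hε1 => ?_
  have hw := hts hB h hε hε1 hu
  obtain ⟨w, hwdef⟩ : ∃ w, w = ansatz 𝒩 ε φ := ⟨_, rfl⟩
  rw [← hwdef] at hw
  have hz := hw.memH.fun_sub hum
  have hgw := hw.memH.memLp_wgrad le_rfl
  have hgφ := hum.memLp_wgrad le_rfl
  have hsub : nrm2 volume (fun x => w x - φ x) ≤ C * ε * U := hU ▸ hw.nrm2_sub_le
  -- gradients of `w - φ` are small in the weak sense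
  have hweak : ∀ {g : E d → W d m n}, MemH m g →
      ‖(∫ x, inner ℂ (wgrad m w x) (g x)) - ∫ x, inner ℂ (wgrad m φ x) (g x)‖ ≤
        C * ε * U * (Fintype.card (MIdx d m) * sobNorm m g) := by
    intro g hg
    have e : (∫ x, inner ℂ (wgrad m w x) (g x)) - ∫ x, inner ℂ (wgrad m φ x) (g x) =
        ∫ x, inner ℂ (wgrad m (fun x => w x - φ x) x) (g x) := by
      rw [← integral_sub_inner hgw hgφ hg.memLp]
      refine integral_congr_ae ?_
      filter_upwards [wgrad_sub hw.memH hum] with x hx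
      rw [hx]
    rw [e]
    exact (norm_integral_wgrad_le hz hg).trans (mul_le_mul_of_nonneg_right hsub
      (mul_nonneg (Nat.cast_nonneg _) (sobNorm_nonneg _ _)))
  have h1 := (hB.toElliptic.rescale hε).garding_memH hw.memH
  have h2 := hw.form_sub_le w hw.memH
  have h3 := hw.sobNorm_le
  have h4 := hweak hA
  have h5 := hweak hu.wgrad
  rw [← hU] at h2 h3
  rw [← hS₁] at h4
  rw [← hS₂] at h5
  have h6 := two_re_inner_sub_le hgφ hgw
  have h7 : ∫ x, inner ℂ (wgrad m φ x) (wgrad m φ x) = ((nrm2 volume (wgrad m φ) ^ 2 : ℝ) : ℂ) :=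
    integral_inner_self hgφ
  rw [h7] at h5
  have h2' := (Complex.abs_re_le_norm _).trans h2
  have h4' := (Complex.abs_re_le_norm _).trans h4
  have h5' := (Complex.abs_re_le_norm _).trans h5
  rw [Complex.sub_re, abs_le] at h2' h4' h5'
  rw [Complex.ofReal_re] at h5'
  have h8 : C * ε * sobNorm m w * U ≤ C * ε * (C * U) * U :=
    mul_le_mul_of_nonneg_right (mul_le_mul_of_nonneg_left h3 (mul_nonneg hC hε.le)) hU0
  have h9 := mul_le_mul_of_nonneg_left h6 hlam.le
  have h10 := mul_le_mul_of_nonneg_left h5'.1 hlam.le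
  have h11 : form (fun _ => Ahat) w φ = ∫ x, inner ℂ (wgrad m w x) (Ahat (wgrad m φ x)) := rfl
  rw [h11] at h2'
  nlinarith [h1, h2'.2, h4'.2, h8, h9, h10]

end Homogenized

/-! ### Regularity for constant coefficients -/

section Regularity

variable {d m n : ℕ} {lam Lam : ℝ} {Ahat : W d m n →L[ℂ] W d m n}

theorem MemH.wgrad_weakDeriv {k : ℕ} {z : E d → V n} (hz : MemH (m + k) z) {μ : Fin d → ℕ}
    (hμ : ∑ i, μ i ≤ k) :
    HighOrderHomogenization.wgrad m (HighOrderHomogenization.weakDeriv μ z) =ᵐ[volume]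
      HighOrderHomogenization.weakDeriv μ (HighOrderHomogenization.wgrad m z) := by
  have h : ∀ᵐ x, ∀ α : MIdx d m, HighOrderHomogenization.weakDeriv α.1
      (HighOrderHomogenization.weakDeriv μ z) x =
        HighOrderHomogenization.weakDeriv (α.1 + μ) z x := by
    refine ae_all_iff.2 fun α => ?_
    have := hz.weakDeriv_weakDeriv (γ := μ) (μ := α.1) (by rw [α.2]; omega)
    rwa [add_comm μ] at this
  filter_upwards [h, (wgrad_hasWeakDeriv hz hμ).weakDeriv_ae_eq] with x hx hx'
  rw [hx']
  refine Pk.ext fun α => ?_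
  rw [prj_pack]
  exact hx α

theorem exists_le_sum_eq {γ : Fin d → ℕ} (h : m ≤ ∑ i, γ i) : ∃ μ ≤ γ, ∑ i, μ i = m := by
  induction γ using multiIdx_induction with
  | h0 => exact ⟨0, le_rfl, by simp at h ⊢; omega⟩
  | hs γ i ih =>
    rcases Nat.lt_or_ge (∑ i, γ i) m with h' | h'
    · refine ⟨γ + unitIdx i, le_rfl, ?_⟩
      rw [sum_add_idx, sum_unitIdx] at h ⊢
      omega
    · obtain ⟨μ, h1, h2⟩ := ih h'
      exact ⟨μ, h1.trans le_self_add, h2⟩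

theorem le_of_sq_le_mul {a b : ℝ} (hb : 0 ≤ b) (h : a ^ 2 ≤ b * a) : a ≤ b := by
  by_contra! hlt
  nlinarith

/-- Differentiating the equation: `(-1)^m ⟨D^{2μ} v, g⟩` is the energy of `D^μ v`. -/
theorem WeakSol.energy_weakDeriv {v g : E d → V n} (h : WeakSol (fun _ => Ahat) g v)
    (hv : MemH (m + (m + m)) v) (μ : MIdx d m) :
    (∫ x, inner ℂ (weakDeriv μ.1 (weakDeriv μ.1 v) x) (g x)) =
      (-1) ^ m * (form (fun _ => Ahat) (weakDeriv μ.1 v) (weakDeriv μ.1 v) +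
        ∫ x, inner ℂ (weakDeriv μ.1 v x) (weakDeriv μ.1 v x)) := by
  have hμ : ∑ i, μ.1 i ≤ m := μ.2.le
  have hv2 : MemH (m + m) v := hv.mono (by omega)
  have hz : MemH (m + m) (weakDeriv μ.1 v) :=
    MemH.weakDeriv (k := m) (hv.mono (by omega)) hμ
  have hφ : MemH m (weakDeriv μ.1 (weakDeriv μ.1 v)) := MemH.weakDeriv hz hμ
  have h1 := (hz.mono (Nat.le_add_left m m)).integral_inner (hv2.mono (Nat.le_add_left m m)) hμ
  have h2 := hz.wgrad.integral_inner (hv2.wgrad.clm_comp (Ahat.restrictScalars ℝ)) hμ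
  have h3 : weakDeriv μ.1 (fun x => Ahat (wgrad m v x)) =ᵐ[volume] fun x =>
      Ahat (wgrad m (weakDeriv μ.1 v) x) := by
    refine ((hv2.wgrad.hasWeakDeriv hμ).clm_comp
      (Ahat.restrictScalars ℝ)).weakDeriv_ae_eq.trans ?_
    filter_upwards [hv2.wgrad_weakDeriv hμ] with x hx
    rw [hx]
    rfl
  have h4 : form (fun _ => Ahat) (weakDeriv μ.1 (weakDeriv μ.1 v)) v =
      (-1) ^ m * form (fun _ => Ahat) (weakDeriv μ.1 v) (weakDeriv μ.1 v) := by
    rw [μ.2] at h2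
    have e1 : form (fun _ => Ahat) (weakDeriv μ.1 (weakDeriv μ.1 v)) v =
        ∫ x, inner ℂ (weakDeriv μ.1 (wgrad m (weakDeriv μ.1 v)) x) (Ahat (wgrad m v x)) := by
      refine integral_congr_ae ?_
      filter_upwards [hz.wgrad_weakDeriv hμ] with x hx
      rw [hx]
    rw [e1]
    refine h2.trans ?_
    congr 1
    refine integral_congr_ae ?_
    filter_upwards [h3] with x hx
    exact congrArg _ hx
  rw [← h.eq _ hφ, h4, h1, μ.2, mul_add]

/-- The a priori estimate in `H^{2m}` for regular solutions with constant coefficients. -/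
theorem exists_sobNorm_le_of_weakSol (d m : ℕ) {lam : ℝ} (hlam : 0 < lam) :
    ∃ C : ℝ, 0 ≤ C ∧ ∀ {n : ℕ} {Lam : ℝ} {Ahat : W d m n →L[ℂ] W d m n},
      Elliptic lam Lam (fun _ : E d => Ahat) → ∀ {v g : E d → V n}, MemH (m + (m + m)) v →
        MemLp g 2 volume → WeakSol (fun _ => Ahat) g v →
        sobNorm (m + m) v ≤ C * nrm2 volume g := by
  obtain ⟨c, hc, hco⟩ := exists_coercive d m hlam
  refine ⟨(idxLE d (m + m)).card * c, by positivity, ?_⟩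
  intro n Lam Ahat hA v g hv hg h
  have hv2 : MemH (m + m) v := hv.mono (by omega)
  -- coercivity turns an energy identity with right-hand side `⟨φ, g⟩` into a bound by `‖g‖`
  have key : ∀ {z φ : E d → V n}, MemH m z → MemLp φ 2 volume →
      nrm2 volume φ ≤ sobNorm m z →
      (form (fun _ => Ahat) z z + ∫ x, inner ℂ (z x) (z x)).re ≤ ‖∫ x, inner ℂ (φ x) (g x)‖ →
      sobNorm m z ≤ c * nrm2 volume g := by
    intro z φ hz hφ h1 h2
    refine le_of_sq_le_mul (mul_nonneg hc.le nrm2_nonneg) ((hco hA hz).trans ?_)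
    rw [mul_assoc]
    refine mul_le_mul_of_nonneg_left (h2.trans ((norm_integral_inner_le hφ hg).trans ?_)) hc.le
    rw [mul_comm]
    exact mul_le_mul_of_nonneg_left h1 nrm2_nonneg
  have hlow : sobNorm m v ≤ c * nrm2 volume g := by
    refine key h.memH h.memH.memLp (nrm2_le_sobNorm h.memH.locallyIntegrable) ?_
    rw [h.eq v h.memH]
    exact Complex.re_le_norm _
  have htop : ∀ μ : MIdx d m, sobNorm m (weakDeriv μ.1 v) ≤ c * nrm2 volume g := by
    intro μ
    have hz : MemH m (weakDeriv μ.1 v) := MemH.weakDeriv hv2 μ.2.le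
    refine key hz (hz.memLp_weakDeriv μ.2.le) (nrm2_weakDeriv_le_sobNorm _ μ.2.le) ?_
    rw [h.energy_weakDeriv hv μ, norm_neg_one_pow_mul]
    exact Complex.re_le_norm _
  rw [mul_assoc, ← nsmul_eq_mul]
  refine Finset.sum_le_card_nsmul _ _ _ fun γ hγ => ?_
  have hγ' := mem_idxLE.1 hγ
  -- a derivative of order at least `m` is a derivative of some `D^μ v` with `|μ| = m`
  rcases Nat.lt_or_ge (∑ i, γ i) m with hlt | hge
  · exact (nrm2_weakDeriv_le_sobNorm v hlt.le).trans hlow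
  · obtain ⟨μ, hμ, hs⟩ := exists_le_sum_eq hge
    have h1 := sum_sub_idx hμ
    have h2 := hv2.weakDeriv_weakDeriv (γ := μ) (μ := γ - μ) (by omega)
    rw [add_tsub_cancel_of_le hμ] at h2
    rw [← nrm2_congr h2]
    exact (nrm2_weakDeriv_le_sobNorm _ (by omega)).trans (htop ⟨μ, hs⟩)

end Regularity

/-! ### Averages of solutions over translations -/

section Averaging

variable {d : ℕ} {ν : Measure (E d)} [IsProbabilityMeasure ν] {R : ℝ}

theorem memLp_sub_prod {X : Type*} [NormedAddCommGroup X] {g : E d → X} (hg : MemLp g 2 volume) :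
    MemLp (fun p : E d × E d => g (p.1 - p.2)) 2 (volume.prod ν) := by
  have hm := aestronglyMeasurable_sub_prod hg.1 ν
  refine ⟨hm, (ENNReal.pow_lt_top_iff.1 ?_).resolve_right two_ne_zero⟩
  rw [eLpNorm_two_sq, lintegral_prod_symm _ (hm.enorm.pow_const 2)]
  have h : ∀ h : E d, ∫⁻ x, ‖g (x - h)‖ₑ ^ 2 = ∫⁻ x, ‖g x‖ₑ ^ 2 := fun h =>
    lintegral_sub_right_eq_self (fun x => ‖g x‖ₑ ^ 2) h
  simp only [h, lintegral_const, measure_univ, mul_one]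
  rw [lintegral_eq_nrm2 hg]
  exact ENNReal.ofReal_lt_top

variable {X : Type*} [NormedAddCommGroup X] [InnerProductSpace ℂ X] [CompleteSpace X]

theorem integral_inner_avg (hν : ∀ᵐ h ∂ν, ‖h‖ ≤ R) {φ g : E d → X} (hφ : MemLp φ 2 volume)
    (hg : MemLp g 2 volume) :
    Integrable (fun h => ∫ x, inner ℂ (φ x) (g (x - h))) ν ∧
      ∫ x, inner ℂ (φ x) (avg ν g x) = ∫ h, (∫ x, inner ℂ (φ x) (g (x - h))) ∂ν := by
  have hi : Integrable (fun p : E d × E d => inner ℂ (φ p.1) (g (p.1 - p.2))) (volume.prod ν) :=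
    integrable_inner (hφ.comp_fst ν) (memLp_sub_prod hg)
  refine ⟨hi.integral_prod_right, ?_⟩
  rw [← integral_integral_swap hi]
  refine integral_congr_ae ?_
  filter_upwards [integrable_sub_of_locallyIntegrable hν (hg.locallyIntegrable one_le_two)]
    with x hx
  exact (integral_inner hx (φ x)).symm

theorem avg_clm {F F' : Type*} [NormedAddCommGroup F] [NormedSpace ℝ F] [CompleteSpace F]
    [NormedAddCommGroup F'] [NormedSpace ℝ F'] [CompleteSpace F'] (L : F →L[ℝ] F')
    (hν : ∀ᵐ h ∂ν, ‖h‖ ≤ R) {u : E d → F} (hu : LocallyIntegrable u) :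
    (fun x => L (avg ν u x)) =ᵐ[volume] avg ν fun x => L (u x) := by
  filter_upwards [integrable_sub_of_locallyIntegrable hν hu] with x hx
  exact (L.integral_comp_comm hx).symm

end Averaging

/-! ### Regularity by mollification -/

section Mollification

variable {d m n : ℕ} {lam Lam : ℝ} {Ahat : W d m n →L[ℂ] W d m n}

theorem MemH.comp_sub {F : Type*} [NormedAddCommGroup F] [NormedSpace ℝ F] {φ : E d → F}
    (hφ : MemH m φ) (h : E d) : MemH m fun x => φ (x - h) := fun γ hγ =>
  let ⟨_, h1, h2⟩ := hφ γ hγ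
  ⟨_, h1.comp_sub h, h2.comp_measurePreserving (measurePreserving_sub_right volume h)⟩

theorem MemH.wgrad_comp_sub {φ : E d → V n} (hφ : MemH m φ) (h : E d) :
    HighOrderHomogenization.wgrad m (fun x => φ (x - h)) =ᵐ[volume] fun x =>
      HighOrderHomogenization.wgrad m φ (x - h) :=
  wgrad_ae_eq fun α => (hφ.hasWeakDeriv α.2.le).comp_sub h

/-- Averages over translations of a solution with constant coefficients solve the equation with
the averaged right-hand side. -/
theorem WeakSol.avg (hA : Elliptic lam Lam fun _ : E d => Ahat) {ν : Measure (E d)}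
    [IsProbabilityMeasure ν] {R : ℝ} (hν : ∀ᵐ h ∂ν, ‖h‖ ≤ R) {u f : E d → V n}
    (hf : MemLp f 2 volume) (h : WeakSol (fun _ => Ahat) f u) :
    WeakSol (fun _ => Ahat) (HighOrderHomogenization.avg ν f)
      (HighOrderHomogenization.avg ν u) := by
  have hu := h.memH
  have hg := hu.memLp_wgrad le_rfl
  have hAg : MemLp (fun x => Ahat (wgrad m u x)) 2 volume := hA.memLp hg
  have hmem : MemH m (HighOrderHomogenization.avg ν u) := fun γ hγ =>
    ⟨_, (hu.hasWeakDeriv hγ).avg hν, memLp_avg hν (hu.memLp_weakDeriv hγ)⟩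
  refine ⟨hmem, fun φ hφ => ?_⟩
  have hgφ := hφ.memLp_wgrad le_rfl
  have hw : (fun x => Ahat (wgrad m (HighOrderHomogenization.avg ν u) x)) =ᵐ[volume]
      HighOrderHomogenization.avg ν fun x => Ahat (wgrad m u x) := by
    have h1 : wgrad m (HighOrderHomogenization.avg ν u) =ᵐ[volume]
        HighOrderHomogenization.avg ν (wgrad m u) := by
      have h2 : ∀ᵐ x, ∀ α : MIdx d m, prj α (HighOrderHomogenization.avg ν (wgrad m u) x) =
          HighOrderHomogenization.avg ν (weakDeriv α.1 u) x := ae_all_iff.2 fun α =>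
        avg_clm ((prj α : W d m n →L[ℂ] V n).restrictScalars ℝ) hν
          (hg.locallyIntegrable one_le_two)
      refine (wgrad_ae_eq fun α => (hu.hasWeakDeriv α.2.le).avg hν).trans ?_
      filter_upwards [h2] with x hx
      exact Pk.ext fun α => (hx α).symm
    refine Filter.EventuallyEq.trans ?_
      (avg_clm (Ahat.restrictScalars ℝ) hν (hg.locallyIntegrable one_le_two))
    filter_upwards [h1] with x hx
    rw [hx]
    rfl
  have e : form (fun _ => Ahat) φ (HighOrderHomogenization.avg ν u) =
      ∫ x, inner ℂ (wgrad m φ x)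
        (HighOrderHomogenization.avg ν (fun x => Ahat (wgrad m u x)) x) := by
    refine integral_congr_ae ?_
    filter_upwards [hw] with x hx
    exact congrArg _ hx
  obtain ⟨i1, e1⟩ := integral_inner_avg hν hgφ hAg
  obtain ⟨i2, e2⟩ := integral_inner_avg hν hφ.memLp hu.memLp
  obtain ⟨i3, e3⟩ := integral_inner_avg hν hφ.memLp hf
  rw [e, e1, e2, e3, ← integral_add i1 i2]
  refine integral_congr_ae (Filter.Eventually.of_forall fun t => ?_)
  have ht := h.eq _ (hφ.comp_sub (-t))
  have e4 : ∀ {X : Type} [NormedAddCommGroup X] [InnerProductSpace ℂ X] (a b : E d → X),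
      ∫ x, inner ℂ (a x) (b (x - t)) = ∫ x, inner ℂ (a (x - -t)) (b x) := by
    intro X _ _ a b
    rw [← integral_sub_right_eq_self (fun x => inner ℂ (a (x - -t)) (b x)) t]
    refine integral_congr_ae (Filter.Eventually.of_forall fun x => ?_)
    simp only [sub_neg_eq_add, sub_add_cancel]
  have e5 : form (fun _ => Ahat) (fun x => φ (x - -t)) u =
      ∫ x, inner ℂ (wgrad m φ (x - -t)) (Ahat (wgrad m u x)) := by
    refine integral_congr_ae ?_
    filter_upwards [hφ.wgrad_comp_sub (-t)] with x hx
    rw [hx]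
  rw [e5] at ht
  simp only [e4]
  rw [e4 (wgrad m φ) fun x => Ahat (wgrad m u x)]
  exact ht

theorem WeakSol.sub (hA : Elliptic lam Lam fun _ : E d => Ahat) {u v f g : E d → V n}
    (hf : MemLp f 2 volume) (hg : MemLp g 2 volume) (hu : WeakSol (fun _ => Ahat) f u)
    (hv : WeakSol (fun _ => Ahat) g v) :
    WeakSol (fun _ => Ahat) (fun x => f x - g x) fun x => u x - v x := by
  refine ⟨hu.memH.fun_sub hv.memH, fun φ hφ => ?_⟩
  rw [form_sub hA hφ hu.memH hv.memH, integral_inner_sub hφ.memLp hu.memH.memLp hv.memH.memLp,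
    integral_inner_sub hφ.memLp hf hg, ← hu.eq φ hφ, ← hv.eq φ hφ]
  ring

/-- Weak solutions with constant coefficients and right-hand side in `L²` belong to `H^{2m}`. -/
theorem exists_regularity (d m : ℕ) {lam : ℝ} (hlam : 0 < lam) :
    ∃ C : ℝ, 0 ≤ C ∧ ∀ {n : ℕ} {Lam : ℝ} {Ahat : W d m n →L[ℂ] W d m n},
      Elliptic lam Lam (fun _ : E d => Ahat) → ∀ {u f : E d → V n}, MemLp f 2 volume →
        WeakSol (fun _ => Ahat) f u →
        MemH (m + m) u ∧ sobNorm (m + m) u ≤ C * nrm2 volume f := by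
  obtain ⟨C, hC, hap⟩ := exists_sobNorm_le_of_weakSol d m hlam
  refine ⟨C, hC, ?_⟩
  intro n Lam Ahat hA u f hf h
  have huL := h.memH.memLp
  obtain ⟨uj, huj⟩ : ∃ uj : ℕ → E d → V n, uj = fun j => avg (mollMeasure d j) u := ⟨_, rfl⟩
  obtain ⟨fj, hfj⟩ : ∃ fj : ℕ → E d → V n, fj = fun j => avg (mollMeasure d j) f := ⟨_, rfl⟩
  have hsol : ∀ j, WeakSol (fun _ => Ahat) (fj j) (uj j) := fun j => by
    rw [huj, hfj]
    exact h.avg hA (mollMeasure_support d j) hf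
  have hH : ∀ j k, MemH k (uj j) := fun j k => by
    rw [huj]
    exact memH_mollify j k huL
  have hut : L2Tendsto volume uj u := huj ▸ tendsto_mollify huL
  have hft : L2Tendsto volume fj f := hfj ▸ tendsto_mollify hf
  -- by the a priori estimate for differences the mollified solutions are Cauchy in `H^{2m}`
  have hlim : ∀ γ : Fin d → ℕ, ∑ i, γ i ≤ m + m →
      ∃ w, L2Tendsto volume (fun j => weakDeriv γ (uj j)) w := by
    intro γ hγ
    refine exists_L2Tendsto (fun j => (hH j _).memLp_weakDeriv hγ)
      (fun j => C * nrm2 volume fun x => fj j x - f x) ?_ fun i j => ?_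
    · simpa using hft.tendsto.const_mul C
    · have hd := ((hH i (m + m)).hasWeakDeriv hγ).fun_sub ((hH j (m + m)).hasWeakDeriv hγ)
      rw [← nrm2_congr hd.weakDeriv_ae_eq, ← mul_add]
      refine (nrm2_weakDeriv_le_sobNorm _ hγ).trans ((hap hA ((hH i _).fun_sub (hH j _))
        ((hft.memLp i).sub (hft.memLp j))
        ((hsol i).sub hA (hft.memLp i) (hft.memLp j) (hsol j))).trans ?_)
      refine mul_le_mul_of_nonneg_left ?_ hC
      refine le_trans (le_of_eq ?_) (nrm2_sub_le ((hft.memLp i).sub hf) ((hft.memLp j).sub hf))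
      congr 1
      funext x
      simp only [Pi.sub_apply, sub_sub_sub_cancel_right]
  have hmem : MemH (m + m) u := fun γ hγ => by
    obtain ⟨w, hw⟩ := hlim γ hγ
    exact ⟨w, HasWeakDeriv.of_L2Tendsto (fun j => (hH j (m + m)).hasWeakDeriv hγ) hut hw,
      hw.memLp_lim⟩
  refine ⟨hmem, ?_⟩
  have hconv : ∀ γ : Fin d → ℕ, ∑ i, γ i ≤ m + m →
      L2Tendsto volume (fun j => weakDeriv γ (uj j)) (weakDeriv γ u) := by
    intro γ hγ
    obtain ⟨w, hw⟩ := hlim γ hγ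
    have := HasWeakDeriv.of_L2Tendsto (fun j => (hH j (m + m)).hasWeakDeriv hγ) hut hw
    exact hw.congr (fun _ => ae_eq_refl _) this.weakDeriv_ae_eq.symm
  exact le_of_tendsto_of_tendsto' (tendsto_sobNorm hconv) (hft.nrm2_tendsto.const_mul C)
    fun j => hap hA (hH j _) (hft.memLp j) (hsol j)

end Mollification

/-! ### The error estimates -/

section Main

variable {d m n : ℕ} {lam Lam ε : ℝ}

/-- The error estimate for a fixed corrector: the difference `z` of the solution and its two-scale
approximation satisfies a coercive identity whose right-hand side is `O(ε)`. -/
theorem exists_error_estimate (d m : ℕ) (hm : 0 < m) {lam Lam : ℝ} (hlam : 0 < lam)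
    (hLam : 0 ≤ Lam) : ∃ C : ℝ, 0 ≤ C ∧ ∀ {n : ℕ} {B : E d → W d m n →L[ℂ] W d m n}
      {𝒩 : (Fin d → ℕ) → E d → W d m n →L[ℂ] V n} {Ahat : W d m n →L[ℂ] W d m n},
      PerElliptic lam Lam B → Corrector B 𝒩 Ahat → ∀ {ε : ℝ}, 0 < ε → ε ≤ 1 →
      ∀ {f uε u : E d → V n}, MemLp f 2 volume → WeakSol (fun x => B (ε⁻¹ • x)) f uε →
        WeakSol (fun _ => Ahat) f u →
        MemH (m + m) u ∧ sobNorm (m + m) u ≤ C * nrm2 volume f ∧ MemH m (ansatz 𝒩 ε u) ∧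
          sobNorm m (fun x => uε x - ansatz 𝒩 ε u x) ≤ C * ε * nrm2 volume f := by
  obtain ⟨c, hc, hco⟩ := exists_coercive d m hlam
  obtain ⟨T, hT, hts⟩ := exists_twoScaleBound d m hm hlam hLam
  obtain ⟨R, hR, hreg⟩ := exists_regularity d m hlam
  refine ⟨R + c * (2 * T) * R, by positivity, ?_⟩
  intro n B 𝒩 Ahat hB h ε hε hε1 f uε u hf huε hu
  obtain ⟨hu2, hur⟩ := hreg (h.elliptic hm hlam hB) hf hu
  have hw := hts hB h hε hε1 hu2
  obtain ⟨w, hwdef⟩ : ∃ w, w = ansatz 𝒩 ε u := ⟨_, rfl⟩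
  rw [← hwdef] at hw ⊢
  have hnf : 0 ≤ nrm2 volume f := nrm2_nonneg
  refine ⟨hu2, hur.trans (mul_le_mul_of_nonneg_right (le_add_of_nonneg_right (by positivity)) hnf),
    hw.memH, ?_⟩
  obtain ⟨z, hzdef⟩ : ∃ z, z = fun x => uε x - w x := ⟨_, rfl⟩
  have hz : MemH m z := hzdef ▸ huε.memH.fun_sub hw.memH
  rw [← hzdef]
  have hBε := hB.toElliptic.rescale hε
  have hzL := hz.memLp
  have hwL := hw.memH.memLp
  obtain ⟨U, hU⟩ : ∃ U, U = sobNorm (m + m) u := ⟨_, rfl⟩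
  have hU0 : 0 ≤ U := hU ▸ sobNorm_nonneg _ _
  obtain ⟨Z, hZ⟩ : ∃ Z, Z = sobNorm m z := ⟨_, rfl⟩
  have hZ0 : 0 ≤ Z := hZ ▸ sobNorm_nonneg _ _
  -- subtract the two equations tested with `z`
  have hid : form (fun x => B (ε⁻¹ • x)) z z + ∫ x, inner ℂ (z x) (z x) =
      -(form (fun x => B (ε⁻¹ • x)) z w - form (fun _ => Ahat) z u) -
        ∫ x, inner ℂ (z x) (w x - u x) := by
    have e1 : form (fun x => B (ε⁻¹ • x)) z z =
        form (fun x => B (ε⁻¹ • x)) z uε - form (fun x => B (ε⁻¹ • x)) z w := by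
      conv_lhs => rw [hzdef]
      rw [← hzdef]
      refine Eq.trans ?_ (form_sub hBε hz huε.memH hw.memH)
      rw [← hzdef]
    have e2 : ∫ x, inner ℂ (z x) (z x) =
        (∫ x, inner ℂ (z x) (uε x)) - ∫ x, inner ℂ (z x) (w x) := by
      rw [← integral_inner_sub hzL huε.memH.memLp hwL]
      refine integral_congr_ae (Filter.Eventually.of_forall fun x => ?_)
      exact congrArg (inner ℂ (z x)) (congrFun hzdef x)
    have e3 := integral_inner_sub hzL hwL hu.memH.memLp
    have e4 := huε.eq z hz
    have e5 := hu.eq z hz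
    rw [e1, e2, e3]
    linear_combination e4 - e5
  have b1 := hw.form_sub_le z hz
  have b2 : ‖∫ x, inner ℂ (z x) (w x - u x)‖ ≤ Z * (T * ε * U) := by
    refine (norm_integral_inner_le hzL (hwL.sub hu.memH.memLp)).trans ?_
    rw [hZ, hU]
    exact mul_le_mul (nrm2_le_sobNorm hz.locallyIntegrable) hw.nrm2_sub_le nrm2_nonneg
      (sobNorm_nonneg _ _)
  rw [← hU, ← hZ] at b1
  have b3 : (form (fun x => B (ε⁻¹ • x)) z z + ∫ x, inner ℂ (z x) (z x)).re ≤
      T * ε * Z * U + Z * (T * ε * U) := by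
    rw [hid]
    refine (Complex.re_le_norm _).trans ((norm_sub_le _ _).trans (add_le_add ?_ b2))
    rwa [norm_neg]
  have b4 : Z ^ 2 ≤ (c * (2 * T) * ε * U) * Z := by
    rw [hZ]
    refine (hco hBε hz).trans ((mul_le_mul_of_nonneg_left b3 hc.le).trans_eq ?_)
    rw [hZ]
    ring
  have b5 : Z ≤ c * (2 * T) * ε * U := le_of_sq_le_mul (by positivity) b4
  rw [← hU] at hur
  rw [← hZ]
  calc Z ≤ c * (2 * T) * ε * (R * nrm2 volume f) :=
        b5.trans (mul_le_mul_of_nonneg_left hur (by positivity))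
    _ = (c * (2 * T) * R) * ε * nrm2 volume f := by ring
    _ ≤ _ := mul_le_mul_of_nonneg_right
        (mul_le_mul_of_nonneg_right (le_add_of_nonneg_left hR) hε.le) hnf

variable {A : E d → CArr d m n} {N : MIdx d m → Fin n → E d → V n}
  {𝒩 : (Fin d → ℕ) → E d → W d m n →L[ℂ] V n} {u : E d → V n}

/-- The corrector term is multiplication of `S^ε ∇^m u` by the rescaled operator-valued corrector. -/
theorem corrector_ae_eq
    (hN : ∀ᵐ y, ∀ F : W d m n, 𝒩 0 y F = ∑ k : Fin n, ∑ γ : MIdx d m, F (γ, k) • N γ k y)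
    (hε : ε ≠ 0) (hu : MemH m u) : corrector N ε u =ᵐ[volume] pmul (𝒩 0) ε (wgrad m u) := by
  have h1 := (quasiMeasurePreserving_smul (d := d) (inv_ne_zero hε)).ae hN
  have h2 : ∀ᵐ x, ∀ α : MIdx d m, prj α (steklov ε (wgrad m u) x) =
      steklov ε (weakDeriv α.1 u) x := ae_all_iff.2 fun α =>
    steklov_clm ((prj α : W d m n →L[ℂ] V n).restrictScalars ℝ) hε
      ((hu.memLp_wgrad le_rfl).locallyIntegrable one_le_two)
  filter_upwards [h1, h2] with x hx hx'
  rw [pmul, hx, corrector]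
  refine Finset.sum_congr rfl fun k _ => Finset.sum_congr rfl fun γ _ => ?_
  rw [← hx' γ]
  rfl

theorem twoScale_eq (N : MIdx d m → Fin n → E d → V n) (hε : ε ≠ 0) (hu : MemH m u) :
    twoScale N ε u =ᵐ[volume] fun x => steklov ε u x + (ε ^ m : ℝ) • corrector N ε u x := by
  have h : ∀ᵐ x, ∀ α : MIdx d m, weakDeriv α.1 (steklov ε u) x =
      steklov ε (weakDeriv α.1 u) x := ae_all_iff.2 fun α => hu.weakDeriv_steklov hε α.2.le
  filter_upwards [h] with x hx
  simp only [twoScale, corrector, hx]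

theorem twoScale_ae_eq
    (hN : ∀ᵐ y, ∀ F : W d m n, 𝒩 0 y F = ∑ k : Fin n, ∑ γ : MIdx d m, F (γ, k) • N γ k y)
    (hε : ε ≠ 0) (hu : MemH m u) : twoScale N ε u =ᵐ[volume] ansatz 𝒩 ε u := by
  filter_upwards [twoScale_eq N hε hu, corrector_ae_eq hN hε hu] with x hx hx'
  rw [hx, hx', ansatz]

theorem hNorm_le_of_ae_eq {v w : E d → V n} (h : v =ᵐ[volume] w) : hNorm m v ≤ sobNorm m w :=
  (hNorm_le_sobNorm v).trans_eq (sobNorm_congr h)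

end Main

end HighOrderHomogenization

open HighOrderHomogenization
theorem lemma4p1 (d m : ℕ) (hd : 2 ≤ d) (hm : 2 ≤ m) (lam0 lam1 : ℝ) (h0 : 0 < lam0)
    (h1 : 0 < lam1) :
    ∃ C : ℝ, 0 < C ∧
      ∀ (n : ℕ) (A : E d → CArr d m n) (N : MIdx d m → Fin n → E d → V n),
        IsAdmissible lam0 lam1 A → IsCellSolution A N →
        ∀ ε : ℝ, 0 < ε → ε ≤ 1 →
          (∀ f uε u : E d → V n, MemLp f 2 volume →
            IsWeakSol (rescale ε A) f uε →
            IsWeakSol (fun _ => homCoeff A N) f u →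
            MemH m (twoScale N ε u) ∧
            hNorm m (fun x => uε x - twoScale N ε u x) ≤ C * ε * l2Norm f) ∧
          (∃ Rε Rhat :
              Lp (V n) 2 (volume : Measure (E d)) →L[ℂ] Lp (V n) 2 (volume : Measure (E d)),
            IsResolvent (rescale ε A) Rε ∧
            IsResolvent (fun _ => homCoeff A N) Rhat ∧
            ∀ f : Lp (V n) 2 (volume : Measure (E d)),
              MemH m (fun x => Rε f x - Rhat f x - (ε ^ m : ℝ) • corrector N ε (Rhat f) x) ∧
              hNorm m (fun x => Rε f x - Rhat f x - (ε ^ m : ℝ) • corrector N ε (Rhat f) x)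
                ≤ C * ε * ‖f‖) := by
  have hm0 : 0 < m := by omega
  obtain ⟨C, hC, hest⟩ := exists_error_estimate d m hm0 h0 h1.le
  obtain ⟨q, hq⟩ : ∃ q : ℝ, q = (idxLE d m).card * (d * d) := ⟨_, rfl⟩
  have hq0 : 0 ≤ q := hq ▸ by positivity
  refine ⟨C + q * C + 1, by positivity, ?_⟩
  intro n A N hA hN ε hε hε1
  -- pass to an exactly periodic representative of the coefficients
  obtain ⟨B, hB, hBA⟩ := hA.exists_perElliptic h1.le
  obtain ⟨𝒩, hcor, h𝒩⟩ := hN.exists_corrector hB hBA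
  have hcoef : (fun x => aop (rescale ε A x)) =ᵐ[volume] fun x => B (ε⁻¹ • x) :=
    ((quasiMeasurePreserving_smul (d := d) (inv_ne_zero hε.ne')).ae_eq_comp hBA).symm
  have hsol : ∀ f v : E d → V n,
      IsWeakSol (rescale ε A) f v ↔ WeakSol (fun x => B (ε⁻¹ • x)) f v := fun f v =>
    isWeakSol_iff.trans ⟨fun h => h.congr_coeff hcoef, fun h => h.congr_coeff hcoef.symm⟩
  have hmain : ∀ f uε u : E d → V n, MemLp f 2 volume →
      IsWeakSol (rescale ε A) f uε → IsWeakSol (fun _ => homCoeff A N) f u →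
      MemH (m + m) u ∧ sobNorm (m + m) u ≤ C * nrm2 volume f ∧ MemH m (ansatz 𝒩 ε u) ∧
        sobNorm m (fun x => uε x - ansatz 𝒩 ε u x) ≤ C * ε * nrm2 volume f :=
    fun f uε u hf h h' => hest hB hcor hε hε1 hf ((hsol f uε).1 h) (isWeakSol_iff.1 h')
  refine ⟨fun f uε u hf huε hu => ?_, ?_⟩
  · obtain ⟨-, -, e3, e4⟩ := hmain f uε u hf huε hu
    have hts := twoScale_ae_eq h𝒩 hε.ne' hu.1
    have hf0 : 0 ≤ nrm2 volume f := nrm2_nonneg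
    refine ⟨e3.congr hts.symm, (hNorm_le_of_ae_eq ?_).trans (e4.trans ?_)⟩
    · filter_upwards [hts] with x hx
      rw [hx]
    · rw [l2Norm_eq_nrm2]
      exact mul_le_mul_of_nonneg_right (mul_le_mul_of_nonneg_right
        (by nlinarith [mul_nonneg hq0 hC]) hε.le) hf0
  · obtain ⟨Rε, hRε⟩ := exists_resolvent h0 (hB.toElliptic.rescale hε)
    obtain ⟨Rhat, hRhat⟩ := exists_resolvent h0 (hcor.elliptic hm0 h0 hB)
    have hres : IsResolvent (rescale ε A) Rε := fun f v => (hsol f v).trans (hRε f v)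
    have hres' : IsResolvent (fun _ => homCoeff A N) Rhat := fun f v =>
      isWeakSol_iff.trans (hRhat f v)
    refine ⟨Rε, Rhat, hres, hres', fun f => ?_⟩
    have hf := Lp.memLp f
    have hu := (hres' f (Rhat f)).2 (ae_eq_refl _)
    obtain ⟨e1, e2, e3, e4⟩ := hmain f (Rε f) (Rhat f) hf ((hres f _).2 (ae_eq_refl _)) hu
    have huε := ((hres f (Rε f)).2 (ae_eq_refl _)).1
    have hu1 : MemH (m + 1) (Rhat f) := e1.mono (by omega)
    have hS := (hu.1.steklov hε.ne').fun_sub hu.1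
    have hz := huε.fun_sub e3
    -- the approximation of the second part uses `u` where that of the first part uses `S^ε u`
    have hae : (fun x => Rε f x - Rhat f x - (ε ^ m : ℝ) • corrector N ε (Rhat f) x) =ᵐ[volume]
        fun x => (Rε f x - ansatz 𝒩 ε (Rhat f) x) + (steklov ε (Rhat f) x - Rhat f x) := by
      filter_upwards [corrector_ae_eq h𝒩 hε.ne' hu.1] with x hx
      rw [hx, ansatz]
      abel
    refine ⟨(hz.fun_add hS).congr hae.symm, (hNorm_le_of_ae_eq hae).trans
      ((sobNorm_add_le hz hS).trans ?_)⟩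
    rw [norm_Lp_eq_nrm2]
    have hf0 : 0 ≤ nrm2 volume f := nrm2_nonneg
    have e5 := hu1.sobNorm_steklov_sub_le hε
    have e6 : sobNorm (m + 1) (Rhat f) ≤ C * nrm2 volume f :=
      (sobNorm_mono (by omega) _).trans e2
    have e7 : ((idxLE d m).card : ℝ) * (d * d * (ε * sobNorm (m + 1) (Rhat f))) ≤
        q * (ε * (C * nrm2 volume f)) := by
      rw [hq, mul_assoc ((idxLE d m).card : ℝ)]
      exact mul_le_mul_of_nonneg_left (mul_le_mul_of_nonneg_left
        (mul_le_mul_of_nonneg_left e6 hε.le) (by positivity)) (by positivity)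
    calc _ ≤ C * ε * nrm2 volume f + q * (ε * (C * nrm2 volume f)) :=
          add_le_add e4 (e5.trans e7)
      _ = (C + q * C) * ε * nrm2 volume f := by ring
      _ ≤ _ := mul_le_mul_of_nonneg_right
          (mul_le_mul_of_nonneg_right (by linarith) hε.le) hf0
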